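/- **Proposition 2.2 (A priori estimate).** Let $a,R,c_v,k,p_\infty>0$ and $s_\infty\in\mathbb R$ be constants. Put $\rho(p,s)=k\,p^{\frac{c_v}{c_v+R}}e^{-\frac{s}{c_v+R}}$, $\rho_\infty=\rho(p_\infty,s_\infty)$, $$\kappa_1=\sqrt{\frac{c_v}{(R+c_v)\rho_\infty p_\infty}},\qquad \kappa_2=\sqrt{\frac{(R+c_v)p_\infty}{c_v\rho_\infty}},$$ and consider on $\mathbb R^3$, for scalar $p,s$ and an $\mathbb R^3$-valued $u$, the initial value problem $$\partial_t p+\kappa_2\nabla\cdot u=F,\qquad \partial_t u+\kappa_2\nabla p+au=G,\qquad \partial_t s+\kappa_1(u\cdot\nabla)s=0,\qquad (p,u,s)|_{t=0}=(p_0,u_0,s_0),\tag{2.1}$$ $$F=-\tfrac{(R+c_v)\kappa_1}{c_v}\,p\,\nabla\cdot u-\kappa_1u\cdot\nabla p,\qquad G=-\kappa_1(u\cdot\nabla)u-\tfrac1{\kappa_1}\Big(\tfrac1{\rho(p+p_\infty,\,s+s_\infty)}-\tfrac1{\rho_\infty}\Big)\nabla p.$$ Write $\|\cdot\|_m$ for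 the norm of $H^m(\mathbb R^3)$ and $\|\cdot\|$ for that of $L^2(\mathbb R^3)$. For $0<T<\infty$ let $X(0,T)$ be the set of $(p,u,s)$ with $p,u,s\in C^0([0,T];H^3)\cap C^1([0,T];H^2)$, $\nabla p\in L^2(0,T;H^2)$ and $u\in L^2(0,T;H^3)$. There exist constants $\epsilon>0$ and $C_2>0$ and a nondecreasing function $C_3:\mathbb R\to\mathbb R$, depending only on $a,R,c_v,k,p_\infty,s_\infty$ (in particular not on $T$), such that the following holds. Let $T>0$, let $(p_0,u_0,s_0)\in H^3(\mathbb R^3)$ with $(p_0,u_0)\in L^1(\mathbb R^3)$, put $K_0=\|(p_0,u_0)\|_{L^1}+\|(p_0,u_0)\|_3$, and let $(p,u,s)\in X(0,T)$ be a solution of (2.1) on $[0,T]$ with $$\sup_{0\le t\le T}\|(p,u,s)(t)\|_3\le\epsilon.\tag{2.2}$$ Then for every $t\in[0,T]$ $$\|(p,u)(t)\|_3^2+\int_0^t\big(\|\nabla p(\tau)\|_2^2+\|u(\tau)\|_3^2\big)\,d\tau\le C_2\|(p_0,u_0)\|_3^2,\tag{2.3}$$ $$\|s(t)\|_3\le C_2\|(p_0,u_0,s_0)\|_3\,e^{C_2K_0},\tag{2.4}$$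 $$\|p(t)\|\le C_3(K_0)(1+t)^{-\frac34},\tag{2.6}$$ $$\|\nabla p(t)\|_2+\|u(t)\|_3\le C_3(K_0)(1+t)^{-\frac54},\tag{2.7}$$ $$\|\partial_t(p,u,s)(t)\|\le C_3(K_0)(1+t)^{-\frac54}.\tag{2.8}$$ -/

import Mathlib

open MeasureTheory Set
open scoped ContDiff

noncomputable section

/-- Physical space `ℝ³` with its Euclidean norm and Lebesgue measure. -/
abbrev E3 : Type := EuclideanSpace ℝ (Fin 3)

/-- Real-valued `L²(ℝ³)`. -/
abbrev L2R3 : Type := Lp ℝ 2 (volume : Measure E3)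

/-- The classical partial derivative `∂_i φ`. -/
def partialDeriv (i : Fin 3) (φ : E3 → ℝ) (x : E3) : ℝ :=
  fderiv ℝ φ x (EuclideanSpace.single i (1 : ℝ))

/-- `g` is the weak partial derivative `∂_i f`, tested against all of `C_c^∞(ℝ³)`. -/
def IsWeakPartial (i : Fin 3) (f g : L2R3) : Prop :=
  ∀ φ : E3 → ℝ, ContDiff ℝ ∞ φ → HasCompactSupport φ →
    ∫ x, f x * partialDeriv i φ x = -∫ x, g x * φ x

theorem integrable_L2_mul (f : L2R3) {φ : E3 → ℝ} (hc : Continuous φ)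
    (hs : HasCompactSupport φ) : Integrable (fun x => f x * φ x) volume :=
  (Lp.memLp f).integrable_mul (q := 2) (hc.memLp_of_hasCompactSupport hs)

theorem continuous_partialDeriv (i : Fin 3) {φ : E3 → ℝ} (h : ContDiff ℝ ∞ φ) :
    Continuous (partialDeriv i φ) :=
  (h.continuous_fderiv (by simp)).clm_apply continuous_const

theorem hasCompactSupport_partialDeriv (i : Fin 3) {φ : E3 → ℝ} (h : HasCompactSupport φ) :
    HasCompactSupport (partialDeriv i φ) :=
  h.fderiv_apply (𝕜 := ℝ) (EuclideanSpace.single i (1 : ℝ))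

theorem IsWeakPartial.zero (i : Fin 3) : IsWeakPartial i 0 0 := by
  intro φ _ _
  have h0 := Lp.coeFn_zero ℝ 2 (volume : Measure E3)
  have h1 : ∫ x, (0 : L2R3) x * partialDeriv i φ x = 0 := by
    rw [← integral_zero E3 ℝ]
    refine integral_congr_ae ?_
    filter_upwards [h0] with x hx
    rw [hx]
    simp
  have h2 : ∫ x, (0 : L2R3) x * φ x = 0 := by
    rw [← integral_zero E3 ℝ]
    refine integral_congr_ae ?_
    filter_upwards [h0] with x hx
    rw [hx]
    simp
  rw [h1, h2, neg_zero]

theorem integral_L2_add_mul (f f' : L2R3) {φ : E3 → ℝ} (hc : Continuous φ)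
    (hs : HasCompactSupport φ) :
    ∫ x, (f + f') x * φ x = (∫ x, f x * φ x) + ∫ x, f' x * φ x := by
  rw [← integral_add (integrable_L2_mul f hc hs) (integrable_L2_mul f' hc hs)]
  refine integral_congr_ae ?_
  filter_upwards [Lp.coeFn_add f f'] with x hx
  rw [hx, Pi.add_apply, add_mul]

theorem integral_L2_smul_mul (c : ℝ) (f : L2R3) (φ : E3 → ℝ) :
    ∫ x, (c • f) x * φ x = c * ∫ x, f x * φ x := by
  rw [← integral_const_mul]
  refine integral_congr_ae ?_
  filter_upwards [Lp.coeFn_smul c f] with x hx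
  simp [hx, mul_assoc]

theorem IsWeakPartial.add {i : Fin 3} {f g f' g' : L2R3} (h : IsWeakPartial i f g)
    (h' : IsWeakPartial i f' g') : IsWeakPartial i (f + f') (g + g') := by
  intro φ hφ hs
  rw [integral_L2_add_mul f f' (continuous_partialDeriv i hφ)
      (hasCompactSupport_partialDeriv i hs), integral_L2_add_mul g g' hφ.continuous hs,
    h φ hφ hs, h' φ hφ hs]
  ring

theorem IsWeakPartial.smul {i : Fin 3} {f g : L2R3} (c : ℝ) (h : IsWeakPartial i f g) :
    IsWeakPartial i (c • f) (c • g) := by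
  intro φ hφ hs
  rw [integral_L2_smul_mul, integral_L2_smul_mul, h φ hφ hs]
  ring

/-- The multi-indices `α` with `|α| ≤ m`. -/
def multiIndices (m : ℕ) : Finset (Fin 3 → ℕ) :=
  (Fintype.piFinset fun _ => Finset.range (m + 1)).filter fun α => ∑ i, α i ≤ m

theorem mem_multiIndices {m : ℕ} {α : Fin 3 → ℕ} : α ∈ multiIndices m ↔ ∑ i, α i ≤ m := by
  simp only [multiIndices, Finset.mem_filter, Fintype.mem_piFinset, Finset.mem_range,
    and_iff_right_iff_imp]
  intro h i
  have := Finset.single_le_sum (f := α) (fun _ _ => Nat.zero_le _) (Finset.mem_univ i)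
  omega

/-- The families `(f_α)_{|α| ≤ m}` in `L²` that consist of a function `f = f_0` and its weak
derivatives `f_α = ∂^α f`; the ambient norm is `(∑_{|α| ≤ m} ‖∂^α f‖²)^{1/2}`. -/
def sobolevSubmodule (m : ℕ) :
    Submodule ℝ (PiLp 2 fun _ : multiIndices m => L2R3) where
  carrier := {f | ∀ (α β : multiIndices m) (i : Fin 3),
    (β : Fin 3 → ℕ) = (α : Fin 3 → ℕ) + Pi.single i 1 → IsWeakPartial i (f α) (f β)}
  add_mem' := fun hf hg α β i h => (hf α β i h).add (hg α β i h)
  zero_mem' := fun _ _ i _ => IsWeakPartial.zero i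
  smul_mem' := fun c _ hf α β i h => (hf α β i h).smul c

/-- The Sobolev space `H^m(ℝ³)`. An element is a function together with its (uniquely
determined) weak derivatives up to order `m`; `‖f‖` is the `H^m` norm. -/
abbrev Hm (m : ℕ) : Type := sobolevSubmodule m

/-- The function in `L²(ℝ³)` underlying an element of `H^m(ℝ³)`. -/
def Hm.fn {m : ℕ} (f : Hm m) : L2R3 :=
  f.1 ⟨0, mem_multiIndices.2 (by simp)⟩

/-- The embedding `H^{m+1}(ℝ³) ⊆ H^m(ℝ³)`. -/
def Hm.incl {m : ℕ} (f : Hm (m + 1)) : Hm m :=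
  ⟨WithLp.toLp 2 fun α => f.1 ⟨α.1, mem_multiIndices.2
      ((mem_multiIndices.1 α.2).trans (Nat.le_succ m))⟩,
    fun _ _ i h => f.2 _ _ i h⟩

/-- The partial derivative `∂_i : H^{m+1}(ℝ³) → H^m(ℝ³)`, `(∂_i f)_α = ∂^{α + e_i} f`. -/
def Hm.deriv {m : ℕ} (i : Fin 3) (f : Hm (m + 1)) : Hm m :=
  ⟨WithLp.toLp 2 fun α => f.1 ⟨α.1 + Pi.single i 1, mem_multiIndices.2 (by
      have := mem_multiIndices.1 α.2
      simp only [Pi.add_apply, Finset.sum_add_distrib, Finset.sum_pi_single',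
        Finset.mem_univ, if_true]
      omega)⟩,
    fun α β j h => f.2 _ _ j (by
      show (β : Fin 3 → ℕ) + Pi.single i 1 = (α : Fin 3 → ℕ) + Pi.single i 1 + Pi.single j 1
      rw [h, add_right_comm])⟩

/-- Vector fields of class `H^m(ℝ³)`, with the norm `(∑ i, ‖v_i‖²)^{1/2}`. -/
abbrev HmVec (m : ℕ) : Type := PiLp 2 fun _ : Fin 3 => Hm m

/-- The gradient `∇ : H^{m+1}(ℝ³) → H^m(ℝ³)³`. -/
def Hm.grad {m : ℕ} (f : Hm (m + 1)) : HmVec m :=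
  WithLp.toLp 2 fun i => f.deriv i

/-- The embedding `H^{m+1}(ℝ³)³ ⊆ H^m(ℝ³)³`. -/
def HmVec.incl {m : ℕ} (v : HmVec (m + 1)) : HmVec m :=
  WithLp.toLp 2 fun i => (v i).incl

/-- The physical constants: friction `a`, gas constant `R`, specific heat `cv`, the factor `k`
in the equation of state, and the equilibrium pressure and entropy. -/
structure FlowConstants where
  a : ℝ
  R : ℝ
  cv : ℝ
  k : ℝ
  pInf : ℝ
  sInf : ℝ
  a_pos : 0 < a
  R_pos : 0 < R
  cv_pos : 0 < cv
  k_pos : 0 < k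
  pInf_pos : 0 < pInf

namespace FlowConstants

variable (P : FlowConstants)

/-- The equation of state `ρ(p, s) = k p^{cv/(cv+R)} e^{-s/(cv+R)}`. -/
def rho (p s : ℝ) : ℝ :=
  P.k * p ^ (P.cv / (P.cv + P.R)) * Real.exp (-s / (P.cv + P.R))

def rhoInf : ℝ := P.rho P.pInf P.sInf

def kappa₁ : ℝ := Real.sqrt (P.cv / ((P.R + P.cv) * P.rhoInf * P.pInf))

def kappa₂ : ℝ := Real.sqrt ((P.R + P.cv) * P.pInf / (P.cv * P.rhoInf))

/-- The function `F(p, u, s) = -((R + cv) κ₁ / cv) p ∇·u - κ₁ u·∇p`, where `p, u, s` are the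
perturbation of the pressure, the rescaled velocity and the perturbation of the entropy. -/
def F (p : Hm 3) (u : HmVec 3) (x : E3) : ℝ :=
  -((P.R + P.cv) * P.kappa₁ / P.cv) * (p.fn x * ∑ j, ((u j).deriv j).fn x)
    - P.kappa₁ * ∑ j, (u j).fn x * (p.deriv j).fn x

/-- The `i`-th component of `G(p, u, s) = -κ₁ (u·∇)u - (1/κ₁) (1/ρ - 1/ρ_∞) ∇p`; here `ρ` is the
density at the full pressure `p + p_∞` and the full entropy `s + s_∞`. -/
def G (p : Hm 3) (u : HmVec 3) (s : Hm 3) (i : Fin 3) (x : E3) : ℝ :=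
  -P.kappa₁ * (∑ j, (u j).fn x * ((u i).deriv j).fn x)
    - 1 / P.kappa₁ * (1 / P.rho (p.fn x + P.pInf) (s.fn x + P.sInf) - 1 / P.rhoInf)
      * (p.deriv i).fn x

end FlowConstants

/-- The solution space `X(0,T)`: `p, u, s ∈ C⁰([0,T]; H³) ∩ C¹([0,T]; H²)`,
`∇p ∈ L²(0,T; H²)` and `u ∈ L²(0,T; H³)`. -/
structure InX (T : ℝ) (p : ℝ → Hm 3) (u : ℝ → HmVec 3) (s : ℝ → Hm 3) : Prop where
  p_cont : ContinuousOn p (Icc 0 T)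
  u_cont : ContinuousOn u (Icc 0 T)
  s_cont : ContinuousOn s (Icc 0 T)
  p_C1 : ContDiffOn ℝ 1 (fun t => (p t).incl) (Icc 0 T)
  u_C1 : ContDiffOn ℝ 1 (fun t => HmVec.incl (u t)) (Icc 0 T)
  s_C1 : ContDiffOn ℝ 1 (fun t => (s t).incl) (Icc 0 T)
  grad_p_L2 : MemLp (fun t => (p t).grad) 2 (volume.restrict (Icc 0 T))
  u_L2 : MemLp u 2 (volume.restrict (Icc 0 T))

/-- The time derivative `∂_t f(t) ∈ H²` on `[0,T]` (one-sided at the end points). -/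
def dt (T : ℝ) (f : ℝ → Hm 3) (t : ℝ) : Hm 2 :=
  derivWithin (fun τ => (f τ).incl) (Icc 0 T) t

/-- The time derivative `∂_t v(t) ∈ (H²)³` on `[0,T]` (one-sided at the end points). -/
def dtVec (T : ℝ) (v : ℝ → HmVec 3) (t : ℝ) : HmVec 2 :=
  derivWithin (fun τ => HmVec.incl (v τ)) (Icc 0 T) t

/-- `(p, u, s)` solves on `[0,T]` the initial value problem
`∂_t p + κ₂ ∇·u = F`, `∂_t u + κ₂ ∇p + a u = G`, `∂_t s + κ₁ (u·∇)s = 0`,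
`(p, u, s)|_{t=0} = (p₀, u₀, s₀)`. -/
structure SolvesIVP (P : FlowConstants) (T : ℝ) (p₀ : Hm 3) (u₀ : HmVec 3) (s₀ : Hm 3)
    (p : ℝ → Hm 3) (u : ℝ → HmVec 3) (s : ℝ → Hm 3) : Prop where
  pressure : ∀ t ∈ Icc 0 T, ∀ᵐ x,
    (dt T p t).fn x + P.kappa₂ * ∑ j, ((u t j).deriv j).fn x = P.F (p t) (u t) x
  velocity : ∀ t ∈ Icc 0 T, ∀ i, ∀ᵐ x,
    (dtVec T u t i).fn x + P.kappa₂ * ((p t).deriv i).fn x + P.a * (u t i).fn x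
      = P.G (p t) (u t) (s t) i x
  entropy : ∀ t ∈ Icc 0 T, ∀ᵐ x,
    (dt T s t).fn x + P.kappa₁ * ∑ j, (u t j).fn x * ((s t).deriv j).fn x = 0
  initial_p : p 0 = p₀
  initial_u : u 0 = u₀
  initial_s : s 0 = s₀

/-- `‖(p, u)‖_m`. -/
def normPU {m : ℕ} (p : Hm m) (u : HmVec m) : ℝ := Real.sqrt (‖p‖ ^ 2 + ‖u‖ ^ 2)

/-- `‖(p, u, s)‖_m`. -/
def normPUS {m : ℕ} (p : Hm m) (u : HmVec m) (s : Hm m) : ℝ :=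
  Real.sqrt (‖p‖ ^ 2 + ‖u‖ ^ 2 + ‖s‖ ^ 2)

/-- The `L²` norm of `(p, u, s)`. -/
def l2NormPUS {m : ℕ} (p : Hm m) (u : HmVec m) (s : Hm m) : ℝ :=
  Real.sqrt (‖p.fn‖ ^ 2 + ∑ i, ‖(u i).fn‖ ^ 2 + ‖s.fn‖ ^ 2)

/-- `K₀ = ‖(p₀, u₀)‖_{L¹ ∩ H³}`, the sum of the `L¹` norm and the `H³` norm. -/
def dataNorm (p₀ : Hm 3) (u₀ : HmVec 3) : ℝ :=
  (∫ x, |p₀.fn x|) + (∑ i, ∫ x, |(u₀ i).fn x|) + normPU p₀ u₀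

end

/-! Linearised at the rest state the system is a damped wave equation: friction acts on `u` alone,
and `p` loses energy only through its coupling with `u`. At low frequency the slow mode behaves like
the heat flow e^{-c|ξ|²t}. Data in L¹ have bounded Fourier transform, so `p` decays like
(1+t)^{-3/4}, and ∇p, hence also `u` (to leading order a multiple of ∇p), like (1+t)^{-5/4}. The
entropy is transported and need not decay, but its growth rate is the size of `u`, which is
integrable in time. The time derivatives inherit the rate of ∇p and `u` through the equations.

Energy. Multiplying the pressure equation by the symmetrizer 1+ψ makes the quasilinear coupling
symmetric (`symmetrizer_mul`), so in the energies of order zero and three no term loses a derivative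
(`energy_zero_le`, `energy_three_le`). The functional ∑⟨u_k, ∂_k p⟩, added with a small factor δ,
yields the missing dissipation of ∇p (`interaction_le`). Every error is at most a constant times
ε·`dissip`², where `dissip` is ‖∇p‖₂+‖u‖₃, and is absorbed for small ε (`exists_energy_estimate`).

Regularity. The time derivatives lie only in H², so third derivatives of the equations are not
available. The top order estimate is made for third difference quotients of step h, with commutator
bounds uniform in h (`Coef.commutator`), integrated in time, and only then is h sent to zero
(`energy_three`). Pure differences suffice, since on the Fourier side all mixed derivatives are
dominated by pure ones.

Decay. A second functional, built from the top order energy and ‖u‖² without ‖p‖², satisfies H' ≤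
-cH + C·(low frequency part of ‖∇p‖²) (`exists_damped_functional`). For the low frequencies, the
solution at time τ is multiplied by the truncated heat symbol e^{c(τ-t)|2πξ|²}; a Lyapunov
functional of the result grows only through the nonlinear terms (`lyapunov_deriv_le`). These are
bounded in L¹ by ε·`dissip`, and a convolution estimate gives a low frequency bound of the form
(K+εN)(1+t)^{-5/4} for ∇p, where N is the maximum of (1+τ)^{5/4}·`dissip` (`exists_low_decay`).
Feeding this into the damped functional gives N ≤ Q(K+εN), which closes for small ε with a constant
independent of T (`exists_decay`). Grönwall's inequality then bounds the entropy
(`exists_entropy_bound`). -/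

noncomputable section

/-! ### The Fourier transform on L²: Plancherel and L¹–L^∞ bounds -/

open scoped FourierTransform SchwartzMap
open Filter Topology

/-- Complex-valued `L²(ℝ³)`. -/
abbrev L2C : Type := Lp ℂ 2 (volume : Measure E3)

/-- The Fourier transform of a real-valued square integrable function. -/
def hat : L2R3 →L[ℝ] L2C :=
  ((Lp.fourierTransformₗᵢ E3 ℂ).toContinuousLinearEquiv.toContinuousLinearMap.restrictScalars ℝ).comp
    (Complex.ofRealCLM.compLpL 2 volume)

theorem hat_eq (f : L2R3) : hat f = 𝓕 (Complex.ofRealCLM.compLp f : L2C) := rfl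

theorem norm_compLp_ofReal (f : L2R3) : ‖(Complex.ofRealCLM.compLp f : L2C)‖ = ‖f‖ := by
  rw [Lp.norm_def, Lp.norm_def]
  congr 1
  refine eLpNorm_congr_norm_ae ?_
  filter_upwards [Complex.ofRealCLM.coeFn_compLp f] with x hx
  rw [hx]; simp

theorem norm_hat (f : L2R3) : ‖hat f‖ = ‖f‖ := by
  rw [hat_eq, Lp.norm_fourier_eq, norm_compLp_ofReal]

/-- The L² transform agrees with that of tempered distributions. This multiplication formula is what
allows identities for `hat` to be verified against test functions. -/
theorem integral_smul_fourier_eq (f : L2C) (ψ : 𝓢(E3, ℂ)) :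
    ∫ ξ, ψ ξ • (𝓕 f : L2C) ξ = ∫ x, (𝓕 ψ) x • f x := by
  have h := congrArg (fun T => T ψ) (Lp.fourier_toTemperedDistribution_eq f)
  simp only [TemperedDistribution.fourier_apply, Lp.toTemperedDistribution_apply] at h
  exact h.symm

theorem integral_smul_fourierInv_eq (f : L2C) (ψ : 𝓢(E3, ℂ)) :
    ∫ ξ, ψ ξ • (𝓕⁻ f : L2C) ξ = ∫ x, (𝓕⁻ ψ) x • f x := by
  have h := congrArg (fun T => T ψ) (Lp.fourierInv_toTemperedDistribution_eq f)
  simp only [TemperedDistribution.fourierInv_apply, Lp.toTemperedDistribution_apply] at h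
  exact h.symm

/-- A real test function as a complex Schwartz function. -/
def testC {φ : E3 → ℝ} (h1 : ContDiff ℝ ∞ φ) (h2 : HasCompactSupport φ) : 𝓢(E3, ℂ) :=
  (h2.comp_left (g := Complex.ofRealCLM) rfl).toSchwartzMap
    (Complex.ofRealCLM.contDiff.comp h1)

@[simp] theorem testC_apply {φ : E3 → ℝ} (h1 : ContDiff ℝ ∞ φ) (h2 : HasCompactSupport φ) (x : E3) :
    testC h1 h2 x = (φ x : ℂ) := rfl

/-- The L² transform is not defined by an integral. For integrable `f` it has the same pairings with
test functions as the Fourier integral, by Fubini, hence equals it almost everywhere and inherits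
its trivial bound. This carries the L¹ hypothesis on the data to the frequency side. -/
theorem norm_fourier_le_of_integrable (f : L2C) (hf : Integrable f) :
    ∀ᵐ ξ, ‖(𝓕 f : L2C) ξ‖ ≤ ∫ x, ‖f x‖ := by
  have hL : Continuous fun p : E3 × E3 => (innerₗ E3 p.1) p.2 := continuous_inner
  have hcont : Continuous (𝓕 (f : E3 → ℂ)) :=
    VectorFourier.fourierIntegral_continuous Real.continuous_fourierChar hL hf
  have key : ∀ᵐ ξ, (𝓕 f : L2C) ξ = 𝓕 (f : E3 → ℂ) ξ := by
    refine ae_eq_of_integral_contDiff_smul_eq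
      ((Lp.memLp _).locallyIntegrable (by norm_num)) hcont.locallyIntegrable ?_
    intro g g1 g2
    have h := integral_smul_fourier_eq f (testC g1 g2)
    have h2 := VectorFourier.integral_fourierIntegral_smul_eq_flip (L := innerₗ E3) (e := Real.fourierChar)
      (μ := volume) (ν := volume) Real.continuous_fourierChar hL (testC g1 g2).integrable hf
    simp only [flip_innerₗ] at h2
    have h3 : ∫ x, (𝓕 (testC g1 g2)) x • f x = ∫ x, (testC g1 g2) x • 𝓕 (f : E3 → ℂ) x := h2
    rw [h3] at h
    simpa using h
  filter_upwards [key] with ξ hξ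
  rw [hξ]
  exact VectorFourier.norm_fourierIntegral_le_integral_norm _ _ _ _ _

/-- The same comparison for the inverse transform; it is the source of the Sobolev embedding into
bounded functions. -/
theorem norm_fourierInv_le_of_integrable (f : L2C) (hf : Integrable f) :
    ∀ᵐ ξ, ‖(𝓕⁻ f : L2C) ξ‖ ≤ ∫ x, ‖f x‖ := by
  have hL : Continuous fun p : E3 × E3 => (-innerₗ E3) p.1 p.2 := by
    have h : Continuous fun p : E3 × E3 => inner ℝ p.1 p.2 := continuous_inner
    exact h.neg
  have hcont : Continuous (𝓕⁻ (f : E3 → ℂ)) :=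
    VectorFourier.fourierIntegral_continuous Real.continuous_fourierChar hL hf
  have key : ∀ᵐ ξ, (𝓕⁻ f : L2C) ξ = 𝓕⁻ (f : E3 → ℂ) ξ := by
    refine ae_eq_of_integral_contDiff_smul_eq
      ((Lp.memLp _).locallyIntegrable (by norm_num)) hcont.locallyIntegrable ?_
    intro g g1 g2
    have h := integral_smul_fourierInv_eq f (testC g1 g2)
    have h2 := VectorFourier.integral_fourierIntegral_smul_eq_flip (L := -innerₗ E3) (e := Real.fourierChar)
      (μ := volume) (ν := volume) Real.continuous_fourierChar hL (testC g1 g2).integrable hf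
    have hfl : (-innerₗ E3).flip = -innerₗ E3 := by
      ext x y; simp [real_inner_comm]
    rw [hfl] at h2
    have h3 : ∫ x, (𝓕⁻ (testC g1 g2)) x • f x = ∫ x, (testC g1 g2) x • 𝓕⁻ (f : E3 → ℂ) x := by
      rw [SchwartzMap.fourierInv_coe]; exact h2
    rw [h3] at h
    simpa using h
  filter_upwards [key] with ξ hξ
  rw [hξ]
  exact VectorFourier.norm_fourierIntegral_le_integral_norm _ _ _ _ _

theorem norm_hat_le_of_integrable (f : L2R3) (hf : Integrable f) :
    ∀ᵐ ξ, ‖hat f ξ‖ ≤ ∫ x, |f x| := by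
  have hc := Complex.ofRealCLM.coeFn_compLp f
  have h1 : Integrable (Complex.ofRealCLM.compLp f : L2C) := by
    refine (integrable_congr (f := fun x => Complex.ofRealCLM (f x)) ?_).1 ?_
    · exact (Complex.ofRealCLM.coeFn_compLp' f).symm
    · exact Complex.ofRealCLM.integrable_comp hf
  have h2 := norm_fourier_le_of_integrable _ h1
  have h3 : ∫ x, ‖(Complex.ofRealCLM.compLp f : L2C) x‖ = ∫ x, |f x| := by
    refine integral_congr_ae ?_
    filter_upwards [hc] with x hx
    rw [hx]; simp
  rw [h3] at h2
  exact h2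

theorem abs_le_of_integrable_hat (f : L2R3) (hf : Integrable (hat f)) :
    ∀ᵐ x, |f x| ≤ ∫ ξ, ‖hat f ξ‖ := by
  have h := norm_fourierInv_le_of_integrable (hat f) hf
  have h1 : (𝓕⁻ (hat f) : L2C) = Complex.ofRealCLM.compLp f := by
    rw [hat_eq]; exact FourierTransform.fourierInv_fourier_eq _
  rw [h1] at h
  filter_upwards [h, Complex.ofRealCLM.coeFn_compLp f] with x hx hx2
  rw [hx2] at hx
  simpa using hx

theorem norm_sq_L2C (f : L2C) : ‖f‖ ^ 2 = ∫ ξ, ‖f ξ‖ ^ 2 := by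
  have h2 : ∀ ξ, inner ℂ (f ξ) (f ξ) = ((‖f ξ‖ ^ 2 : ℝ) : ℂ) := by
    intro ξ; rw [inner_self_eq_norm_sq_to_K]; norm_cast
  have h3 := L2.inner_def (𝕜 := ℂ) f f
  rw [inner_self_eq_norm_sq_to_K] at h3
  simp_rw [h2] at h3
  rw [integral_complex_ofReal] at h3
  exact Complex.ofReal_injective ((Complex.ofReal_pow _ _).trans h3)

theorem norm_sq_L2 (f : L2R3) : ‖f‖ ^ 2 = ∫ x, f x ^ 2 := by
  have h3 := L2.inner_def (𝕜 := ℝ) f f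
  rw [real_inner_self_eq_norm_sq] at h3
  rw [h3]
  refine integral_congr_ae (Eventually.of_forall fun x => ?_)
  simp [pow_two]

theorem integrable_norm_sq_L2C (f : L2C) : Integrable fun ξ => ‖f ξ‖ ^ 2 :=
  (Lp.memLp f).integrable_norm_pow (by norm_num)

theorem norm_sq_hat (f : L2R3) : ‖f‖ ^ 2 = ∫ ξ, ‖hat f ξ‖ ^ 2 := by
  rw [← norm_hat, norm_sq_L2C]

end


/-! ### Weak derivatives as Fourier multipliers -/

noncomputable section

open scoped FourierTransform SchwartzMap
open Filter Topology

/-- The unit coordinate vector `e_i`. -/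
def ev (i : Fin 3) : E3 := EuclideanSpace.single i (1 : ℝ)

theorem norm_ev (i : Fin 3) : ‖ev i‖ = 1 := by simp [ev]

theorem inner_ev (x : E3) (i : Fin 3) : inner ℝ x (ev i) = x i := by
  simp [ev, EuclideanSpace.inner_single_right]

/-- The weak derivative may be tested against smooth functions that are square integrable
together with their derivative. -/
theorem IsWeakPartial.integral_eq {i : Fin 3} {f g : L2R3} (h : IsWeakPartial i f g)
    {η : E3 → ℝ} (hη : ContDiff ℝ ∞ η) (h0 : MemLp η 2 volume)
    (h1 : MemLp (partialDeriv i η) 2 volume) :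
    ∫ x, f x * partialDeriv i η x = -∫ x, g x * η x := by
  -- The rescaled cutoffs χ(x/(n+1)) tend to 1 pointwise, while their derivatives are O(1/n). The
  -- identity for the compactly supported product therefore passes to the limit by dominated
  -- convergence.
  let χ : ContDiffBump (0 : E3) := ⟨1, 2, by norm_num, by norm_num⟩
  have hχ : ContDiff ℝ ∞ χ := χ.contDiff
  have hχs : HasCompactSupport χ := χ.hasCompactSupport
  obtain ⟨C, hC⟩ : ∃ C, ∀ x, ‖fderiv ℝ χ x‖ ≤ C :=
    (hχs.fderiv (𝕜 := ℝ)).exists_bound_of_continuous (hχ.continuous_fderiv (by simp))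
  have hC0 : 0 ≤ C := (norm_nonneg _).trans (hC 0)
  let r : ℕ → ℝ := fun n => ((n : ℝ) + 1)⁻¹
  have hr0 : ∀ n, 0 < r n := fun n => by positivity
  have hr1 : ∀ n, r n ≤ 1 := fun n => by
    apply inv_le_one_of_one_le₀; linarith [(Nat.cast_nonneg n : (0 : ℝ) ≤ n)]
  have hrt : Tendsto r atTop (𝓝 0) := tendsto_inv_atTop_zero.comp
    (tendsto_atTop_add_const_right _ _ tendsto_natCast_atTop_atTop)
  let X : ℕ → E3 → ℝ := fun n x => χ (r n • x)
  have hX : ∀ n, ContDiff ℝ ∞ (X n) := fun n => hχ.comp (contDiff_const_smul _)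
  have hXs : ∀ n, HasCompactSupport (X n) := fun n =>
    hχs.comp_homeomorph (Homeomorph.smulOfNeZero (r n) (hr0 n).ne')
  have hXb : ∀ n x, |X n x| ≤ 1 := fun n x => by
    rw [abs_of_nonneg χ.nonneg]; exact χ.le_one
  have hX1 : ∀ x, Tendsto (fun n => X n x) atTop (𝓝 1) := fun x => by
    have : Tendsto (fun n => X n x) atTop (𝓝 (χ ((0 : ℝ) • x))) :=
      (hχ.continuous.tendsto _).comp (hrt.smul_const x)
    rw [zero_smul] at this
    rwa [χ.one_of_mem_closedBall (by simp [χ.rIn_pos.le])] at this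
  have hXd : ∀ n x, |partialDeriv i (X n) x| ≤ r n * C := fun n x => by
    have h1 : fderiv ℝ (X n) x = r n • fderiv ℝ χ (r n • x) := by
      exact fderiv_comp_smul (f := χ) (x := x) (r n)
    rw [partialDeriv, h1, smul_apply, smul_eq_mul, abs_mul,
      abs_of_pos (hr0 n)]
    refine mul_le_mul_of_nonneg_left ?_ (hr0 n).le
    refine ((fderiv ℝ χ (r n • x)).le_opNorm _).trans ?_
    rw [show ‖(EuclideanSpace.single i (1 : ℝ) : E3)‖ = 1 from norm_ev i, mul_one]
    exact hC _
  have hpd : ∀ n x, partialDeriv i (fun y => X n y * η y) x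
      = X n x * partialDeriv i η x + partialDeriv i (X n) x * η x := fun n x => by
    have := fderiv_fun_mul ((hX n).differentiable (by simp) x) (hη.differentiable (by simp) x)
    simp only [partialDeriv, this]
    simp [mul_comm]
  have key : ∀ n, ∫ x, f x * (X n x * partialDeriv i η x + partialDeriv i (X n) x * η x)
      = -∫ x, g x * (X n x * η x) := fun n => by
    have := h (fun y => X n y * η y) ((hX n).mul hη) (hXs n).mul_right
    simpa only [hpd] using this
  have i1 : Integrable (fun x => f x * partialDeriv i η x) volume :=
    (Lp.memLp f).integrable_mul (q := 2) h1
  have i2 : Integrable (fun x => f x * η x) volume := (Lp.memLp f).integrable_mul (q := 2) h0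
  have i3 : Integrable (fun x => g x * η x) volume := (Lp.memLp g).integrable_mul (q := 2) h0
  have mf := (Lp.memLp f).1
  have mg := (Lp.memLp g).1
  have t1 : Tendsto (fun n => ∫ x, f x * (X n x * partialDeriv i η x + partialDeriv i (X n) x * η x))
      atTop (𝓝 (∫ x, f x * partialDeriv i η x)) := by
    refine tendsto_integral_of_dominated_convergence
      (fun x => |f x * partialDeriv i η x| + C * |f x * η x|) (fun n => ?_)
      (i1.abs.add (i2.abs.const_mul C)) (fun n => ?_) ?_
    · exact mf.mul (((hX n).continuous.aestronglyMeasurable.mul h1.1).add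
        ((continuous_partialDeriv i (hX n)).aestronglyMeasurable.mul h0.1))
    · refine Eventually.of_forall fun x => ?_
      rw [mul_add, Real.norm_eq_abs]
      refine (abs_add_le _ _).trans (add_le_add ?_ ?_)
      · rw [mul_left_comm, abs_mul]
        exact mul_le_of_le_one_left (abs_nonneg _) (hXb n x)
      · rw [mul_left_comm, abs_mul]
        refine mul_le_mul_of_nonneg_right ((hXd n x).trans ?_) (abs_nonneg _)
        exact mul_le_of_le_one_left hC0 (hr1 n)
    · refine Eventually.of_forall fun x => ?_
      have hd : Tendsto (fun n => partialDeriv i (X n) x) atTop (𝓝 0) := by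
        refine squeeze_zero_norm (hXd · x) ?_
        simpa using hrt.mul_const C
      have := (((hX1 x).mul_const (partialDeriv i η x)).add (hd.mul_const (η x))).const_mul (f x)
      simpa using this
  have t2 : Tendsto (fun n => -∫ x, g x * (X n x * η x)) atTop (𝓝 (-∫ x, g x * η x)) := by
    refine Tendsto.neg (tendsto_integral_of_dominated_convergence
      (fun x => |g x * η x|) (fun n => ?_) i3.abs (fun n => ?_) ?_)
    · exact mg.mul ((hX n).continuous.aestronglyMeasurable.mul h0.1)
    · refine Eventually.of_forall fun x => ?_
      rw [Real.norm_eq_abs, mul_left_comm, abs_mul]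
      exact mul_le_of_le_one_left (abs_nonneg _) (hXb n x)
    · refine Eventually.of_forall fun x => ?_
      simpa using ((hX1 x).mul_const (η x)).const_mul (g x)
  simp only [key] at t1
  exact tendsto_nhds_unique t1 t2

/-- The transform of a test function is a complex Schwartz function without compact support. Real
and imaginary parts are tested separately because weak derivatives are defined with real test
functions. -/
theorem IsWeakPartial.integral_schwartz_eq {i : Fin 3} {f g : L2R3} (h : IsWeakPartial i f g)
    (η : 𝓢(E3, ℂ)) :
    ∫ x, (LineDeriv.lineDerivOp (ev i) η) x * (f x : ℂ) = -∫ x, η x * (g x : ℂ) := by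
  have hη : ContDiff ℝ ∞ η := η.smooth ⊤
  have hd : ∀ x, (LineDeriv.lineDerivOp (ev i) η) x = fderiv ℝ η x (ev i) := fun x =>
    SchwartzMap.lineDerivOp_apply_eq_fderiv _ _ _
  have part : ∀ L : ℂ →L[ℝ] ℝ, ∫ x, f x * L (LineDeriv.lineDerivOp (ev i) η x)
      = -∫ x, g x * L (η x) := fun L => by
    have hp : ∀ x, partialDeriv i (fun y => L (η y)) x
        = L (LineDeriv.lineDerivOp (ev i) η x) := fun x => by
      have h1 : fderiv ℝ (fun y => L (η y)) x = L.comp (fderiv ℝ η x) :=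
        (L.hasFDerivAt.comp x (hη.differentiable (by simp) x).hasFDerivAt).fderiv
      rw [partialDeriv, h1, hd]; rfl
    have := h.integral_eq (η := fun y => L (η y)) (L.contDiff.comp hη)
      (L.comp_memLp' (η.memLp 2 volume)) (by
        have := L.comp_memLp' ((LineDeriv.lineDerivOp (ev i) η).memLp 2 volume)
        refine this.ae_eq (Eventually.of_forall fun x => ?_)
        simp only [hp]; rfl)
    simpa only [hp] using this
  have i1 : Integrable (fun x => (LineDeriv.lineDerivOp (ev i) η) x * (f x : ℂ)) :=
    ((LineDeriv.lineDerivOp (ev i) η).memLp 2 volume).integrable_mul (q := 2)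
      (Complex.ofRealCLM.comp_memLp' (Lp.memLp f))
  have i2 : Integrable (fun x => η x * (g x : ℂ)) :=
    (η.memLp 2 volume).integrable_mul (q := 2) (Complex.ofRealCLM.comp_memLp' (Lp.memLp g))
  apply Complex.ext
  · have := part Complex.reCLM
    rw [Complex.neg_re]
    have e1 := Complex.reCLM.integral_comp_comm i1
    have e2 := Complex.reCLM.integral_comp_comm i2
    simp only [Complex.reCLM_apply, Complex.re_mul_ofReal] at e1 e2 this
    rw [← e1, ← e2]
    simpa only [mul_comm] using this
  · have := part Complex.imCLM
    rw [Complex.neg_im]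
    have e1 := Complex.imCLM.integral_comp_comm i1
    have e2 := Complex.imCLM.integral_comp_comm i2
    simp only [Complex.imCLM_apply, Complex.im_mul_ofReal] at e1 e2 this
    rw [← e1, ← e2]
    simpa only [mul_comm] using this

/-- The angular frequency `2πξ_i`. -/
def freq (i : Fin 3) (ξ : E3) : ℝ := 2 * Real.pi * ξ i

theorem continuous_freq (i : Fin 3) : Continuous (freq i) := by
  unfold freq; fun_prop

theorem integral_schwartz_hat (f : L2R3) (ψ : 𝓢(E3, ℂ)) :
    ∫ ξ, ψ ξ * hat f ξ = ∫ x, (𝓕 ψ) x * (f x : ℂ) := by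
  have h := integral_smul_fourier_eq (Complex.ofRealCLM.compLp f : L2C) ψ
  rw [← hat_eq] at h
  simp only [smul_eq_mul] at h
  rw [h]
  refine integral_congr_ae ?_
  filter_upwards [Complex.ofRealCLM.coeFn_compLp f] with x hx
  rw [hx]; rfl

/-- The weak derivative is moved onto 𝓕ψ, and ∂_i 𝓕ψ is the transform of -2πi ξ_i ψ. The sign from
the integration by parts cancels this one. -/
theorem IsWeakPartial.hat_eq {i : Fin 3} {f g : L2R3} (h : IsWeakPartial i f g) :
    ∀ᵐ ξ, hat g ξ = Complex.I * freq i ξ * hat f ξ := by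
  have hcont : Continuous fun ξ : E3 => Complex.I * (freq i ξ : ℂ) := by
    have := continuous_freq i; fun_prop
  refine ae_eq_of_integral_contDiff_smul_eq
    ((Lp.memLp _).locallyIntegrable (by norm_num)) ?_ ?_
  · have := ((Lp.memLp (hat f)).locallyIntegrable (by norm_num)).continuous_smul hcont
    simpa using this
  intro φ φ1 φ2
  set ψ := testC φ1 φ2
  have h1 := integral_schwartz_hat g ψ
  have h2 := h.integral_schwartz_eq (𝓕 ψ)
  rw [SchwartzMap.lineDerivOp_fourier_eq] at h2
  have h3 := integral_schwartz_hat f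
    (-(2 * ↑Real.pi * Complex.I) • (SchwartzMap.smulLeftCLM ℂ fun x => inner ℝ x (ev i)) ψ)
  rw [h2, ← h1] at h3
  have h4 : ∀ ξ, (-(2 * ↑Real.pi * Complex.I) •
      (SchwartzMap.smulLeftCLM ℂ fun x => inner ℝ x (ev i)) ψ) ξ
      = -(Complex.I * freq i ξ * φ ξ) := fun ξ => by
    rw [smul_apply, SchwartzMap.smulLeftCLM_apply_apply (by fun_prop)]
    rw [inner_ev, testC_apply]
    simp only [freq, Complex.real_smul, smul_eq_mul]
    push_cast
    ring
  simp only [h4] at h3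
  have h5 : ∫ ξ, -(Complex.I * freq i ξ * φ ξ) * hat f ξ
      = -∫ ξ, φ ξ • (Complex.I * freq i ξ * hat f ξ) := by
    rw [← integral_neg]
    refine integral_congr_ae (Eventually.of_forall fun ξ => ?_)
    simp only [Complex.real_smul]; ring
  rw [h5] at h3
  have h6 := neg_injective h3
  rw [h6]
  refine integral_congr_ae (Eventually.of_forall fun ξ => ?_)
  simp [ψ]

end


/-! ### Translations and difference quotients -/

noncomputable section

open scoped FourierTransform SchwartzMap
open Filter Topology

/-- Translation `f ↦ f(· + v)` on `L²`. -/
def tau (v : E3) : L2R3 →ₗᵢ[ℝ] L2R3 :=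
  Lp.compMeasurePreservingₗᵢ ℝ (fun x => x + v) (measurePreserving_add_right volume v)

theorem coeFn_tau (v : E3) (f : L2R3) : ∀ᵐ x, tau v f x = f (x + v) :=
  Lp.coeFn_compMeasurePreserving f (measurePreserving_add_right volume v)

/-- A relation that holds almost everywhere also holds almost everywhere after translation. -/
theorem ae_comp_add {P : E3 → Prop} (v : E3) (h : ∀ᵐ x, P x) : ∀ᵐ x, P (x + v) :=
  (measurePreserving_add_right volume v).quasiMeasurePreserving.ae h

theorem hat_tau (v : E3) (f : L2R3) :
    ∀ᵐ ξ, hat (tau v f) ξ = Complex.exp (Complex.I * (2 * Real.pi * inner ℝ ξ v : ℝ)) * hat f ξ := by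
  have hcont : ContDiff ℝ ∞ fun ξ : E3 =>
      Complex.exp (Complex.I * (2 * Real.pi * inner ℝ ξ v : ℝ)) := by
    have h1 : ContDiff ℝ ∞ fun ξ : E3 => 2 * Real.pi * inner ℝ ξ v :=
      contDiff_const.mul (contDiff_id.inner ℝ contDiff_const)
    exact (contDiff_const.mul (Complex.ofRealCLM.contDiff.comp h1)).cexp
  refine ae_eq_of_integral_contDiff_smul_eq
    ((Lp.memLp _).locallyIntegrable (by norm_num)) ?_ ?_
  · have := ((Lp.memLp (hat f)).locallyIntegrable (by norm_num)).continuous_smul hcont.continuous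
    simpa using this
  intro φ φ1 φ2
  let ψ := testC φ1 φ2
  have hs : HasCompactSupport fun ξ : E3 =>
      Complex.exp (Complex.I * (2 * Real.pi * inner ℝ ξ v : ℝ)) * (φ ξ : ℂ) :=
    HasCompactSupport.mul_left (φ2.comp_left (g := Complex.ofRealCLM) rfl)
  let ψ' : 𝓢(E3, ℂ) := hs.toSchwartzMap (hcont.mul (Complex.ofRealCLM.contDiff.comp φ1))
  have h1 := integral_schwartz_hat (tau v f) ψ
  have h2 := integral_schwartz_hat f ψ'
  -- Multiplying ψ by the character e^{2πi⟨ξ,v⟩} translates its transform by v, so the change of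
  -- variables x ↦ x+v transfers the translation from `f` to the test function.
  have h3 : ∀ x, (𝓕 ψ') (x + v) = (𝓕 ψ) x := fun x => by
    rw [SchwartzMap.fourier_coe, SchwartzMap.fourier_coe, Real.fourier_eq', Real.fourier_eq']
    refine integral_congr_ae (Eventually.of_forall fun y => ?_)
    have : ψ' y = Complex.exp (Complex.I * (2 * Real.pi * inner ℝ y v : ℝ)) * ψ y := rfl
    simp only [this, smul_eq_mul]
    rw [← mul_assoc, ← Complex.exp_add]
    congr 2
    rw [inner_add_right]
    push_cast
    ring
  have h4 : ∫ x, (𝓕 ψ) x * ((tau v f x : ℝ) : ℂ) = ∫ x, (𝓕 ψ') x * ((f x : ℝ) : ℂ) := by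
    refine Eq.trans ?_ (integral_add_right_eq_self (μ := volume)
      (fun x : E3 => (𝓕 ψ') x * ((f x : ℝ) : ℂ)) v)
    refine integral_congr_ae ?_
    filter_upwards [coeFn_tau v f] with x hx
    rw [hx, h3]
  rw [h4, ← h2] at h1
  calc ∫ ξ, φ ξ • hat (tau v f) ξ = ∫ ξ, ψ ξ * hat (tau v f) ξ := by simp [ψ]
    _ = ∫ ξ, ψ' ξ * hat f ξ := h1
    _ = _ := by
      refine integral_congr_ae (Eventually.of_forall fun ξ => ?_)
      have : ψ' ξ = Complex.exp (Complex.I * (2 * Real.pi * inner ℝ ξ v : ℝ)) * φ ξ := rfl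
      simp only [this, Complex.real_smul]
      ring

/-- The difference quotient `(f(· + h e_i) - f) / h` on `L²`. -/
def dq (i : Fin 3) (h : ℝ) : L2R3 →L[ℝ] L2R3 :=
  h⁻¹ • ((tau (h • ev i)).toContinuousLinearMap - ContinuousLinearMap.id ℝ L2R3)

theorem dq_apply (i : Fin 3) (h : ℝ) (f : L2R3) : dq i h f = h⁻¹ • (tau (h • ev i) f - f) := rfl

theorem tau_tau (v w : E3) (f : L2R3) : tau v (tau w f) = tau (v + w) f := by
  refine Lp.ext ?_
  have h1 := ae_comp_add v (coeFn_tau w f)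
  filter_upwards [coeFn_tau v (tau w f), h1, coeFn_tau (v + w) f] with x hx1 hx2 hx3
  rw [hx1, hx2, hx3, add_assoc]

theorem dq_comm (i j : Fin 3) (h k : ℝ) (f : L2R3) : dq i h (dq j k f) = dq j k (dq i h f) := by
  simp only [dq_apply, map_smul, map_sub, tau_tau]
  rw [add_comm (k • ev j)]
  module

/-- The Fourier symbol of the difference quotient. -/
def dqSymbol (i : Fin 3) (h : ℝ) (ξ : E3) : ℂ :=
  (h : ℂ)⁻¹ * (Complex.exp (Complex.I * (h * freq i ξ : ℝ)) - 1)

theorem hat_dq (i : Fin 3) (h : ℝ) (f : L2R3) :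
    ∀ᵐ ξ, hat (dq i h f) ξ = dqSymbol i h ξ * hat f ξ := by
  have e : hat (dq i h f) = h⁻¹ • (hat (tau (h • ev i) f) - hat f) := by
    rw [dq_apply, map_smul, map_sub]
  rw [e]
  filter_upwards [hat_tau (h • ev i) f, Lp.coeFn_smul h⁻¹ (hat (tau (h • ev i) f) - hat f),
    Lp.coeFn_sub (hat (tau (h • ev i) f)) (hat f)] with ξ h1 h2 h3
  rw [h2, Pi.smul_apply, h3, Pi.sub_apply, h1, inner_smul_right, inner_ev, dqSymbol, freq]
  rw [Complex.real_smul]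
  push_cast
  have : Complex.I * (2 * (Real.pi : ℂ) * (h * (ξ i : ℂ))) = Complex.I * (h * (2 * Real.pi * ξ i)) := by
    ring
  rw [this]
  ring

/-- From |e^{ix}-1| ≤ |x|. The bound does not depend on the step, so difference quotients are
dominated by derivatives uniformly in h, even pointwise on the Fourier side. -/
theorem norm_dqSymbol_le (i : Fin 3) {h : ℝ} (hh : h ≠ 0) (ξ : E3) :
    ‖dqSymbol i h ξ‖ ≤ |freq i ξ| := by
  rw [dqSymbol, norm_mul, norm_inv, Complex.norm_real, Real.norm_eq_abs]
  have := Real.norm_exp_I_mul_ofReal_sub_one_le (x := h * freq i ξ)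
  rw [Real.norm_eq_abs, abs_mul] at this
  rw [inv_mul_le_iff₀ (abs_pos.2 hh)]
  exact this

theorem tendsto_dqSymbol (i : Fin 3) (ξ : E3) :
    Tendsto (fun h => dqSymbol i h ξ) (𝓝[>] 0) (𝓝 (Complex.I * freq i ξ)) := by
  have h1 : HasDerivAt (fun h : ℝ => Complex.exp (Complex.I * (h * freq i ξ : ℝ)))
      (Complex.I * freq i ξ) 0 := by
    have h0 : HasDerivAt (fun h : ℝ => Complex.I * ((h * freq i ξ : ℝ) : ℂ))
        (Complex.I * ((1 * freq i ξ : ℝ) : ℂ)) 0 :=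
      (((hasDerivAt_id (0 : ℝ)).mul_const (freq i ξ)).ofReal_comp).const_mul _
    have := h0.cexp
    simpa using this
  have h2 := hasDerivAt_iff_tendsto_slope.1 h1
  refine (h2.mono_left (nhdsWithin_mono _ fun x hx => ne_of_gt hx)).congr fun h => ?_
  simp [slope_def_module, dqSymbol]

theorem hat_dq_pow (i : Fin 3) (h : ℝ) (f : L2R3) (n : ℕ) :
    ∀ᵐ ξ, hat ((dq i h ^ n) f) ξ = dqSymbol i h ξ ^ n * hat f ξ := by
  induction n with
  | zero => simp
  | succ n ih =>
    rw [pow_succ', mul_apply_eq_comp]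
    filter_upwards [ih, hat_dq i h ((dq i h ^ n) f)] with ξ h1 h2
    rw [h2, h1, pow_succ']; ring

/-- `g` is the `n`-th derivative of `f` in direction `i`, expressed by Fourier transforms. -/
def HatDeriv (i : Fin 3) (n : ℕ) (f g : L2R3) : Prop :=
  ∀ᵐ ξ, hat g ξ = (Complex.I * freq i ξ) ^ n * hat f ξ

theorem norm_le_of_norm_hat_le {f g : L2R3} (h : ∀ᵐ ξ, ‖hat f ξ‖ ≤ ‖hat g ξ‖) : ‖f‖ ≤ ‖g‖ := by
  rw [← norm_hat f, ← norm_hat g]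
  exact Lp.norm_le_norm_of_ae_le h

theorem HatDeriv.norm_hat_le {i : Fin 3} {n : ℕ} {f g : L2R3} (hfg : HatDeriv i n f g) {h : ℝ}
    (hh : h ≠ 0) : ∀ᵐ ξ, ‖hat ((dq i h ^ n) f) ξ‖ ≤ ‖hat g ξ‖ := by
  filter_upwards [hfg, hat_dq_pow i h f n] with ξ h1 h2
  rw [h1, h2, norm_mul, norm_mul, norm_pow, norm_pow, norm_mul, Complex.norm_I, one_mul,
    Complex.norm_real, Real.norm_eq_abs]
  gcongr
  exact norm_dqSymbol_le i hh ξ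

theorem HatDeriv.norm_le {i : Fin 3} {n : ℕ} {f g : L2R3} (hfg : HatDeriv i n f g) {h : ℝ}
    (hh : h ≠ 0) : ‖(dq i h ^ n) f‖ ≤ ‖g‖ := norm_le_of_norm_hat_le (hfg.norm_hat_le hh)

/-- Dominated convergence in frequency space: the symbols converge pointwise, and `norm_dqSymbol_le`
provides the majorant 4|ĝ|². -/
theorem HatDeriv.tendsto {i : Fin 3} {n : ℕ} {f g : L2R3} (hfg : HatDeriv i n f g) :
    Tendsto (fun h => (dq i h ^ n) f) (𝓝[>] 0) (𝓝 g) := by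
  rw [tendsto_iff_norm_sub_tendsto_zero]
  have hmeas : ∀ h, Continuous fun ξ => dqSymbol i h ξ ^ n - (Complex.I * freq i ξ) ^ n := fun h => by
    have := continuous_freq i
    unfold dqSymbol
    fun_prop
  have h0 : ∀ h, ‖(dq i h ^ n) f - g‖ ^ 2
      = ∫ ξ, ‖(dqSymbol i h ξ ^ n - (Complex.I * freq i ξ) ^ n) * hat f ξ‖ ^ 2 := fun h => by
    rw [norm_sq_hat, map_sub]
    refine integral_congr_ae ?_
    filter_upwards [hfg, hat_dq_pow i h f n, Lp.coeFn_sub (hat ((dq i h ^ n) f)) (hat g)]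
      with ξ h1 h2 h3
    rw [h3, Pi.sub_apply, h2, h1, sub_mul]
  have hlim : Tendsto (fun h => ‖(dq i h ^ n) f - g‖ ^ 2) (𝓝[>] 0) (𝓝 (∫ _ : E3, (0 : ℝ))) := by
    simp only [h0]
    refine tendsto_integral_filter_of_dominated_convergence (fun ξ => 4 * ‖hat g ξ‖ ^ 2) ?_ ?_
      ((integrable_norm_sq_L2C _).const_mul 4) ?_
    · exact Eventually.of_forall fun h =>
        (((hmeas h).aestronglyMeasurable.mul (Lp.memLp (hat f)).1).norm.pow 2)
    · filter_upwards [self_mem_nhdsWithin] with h hh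
      filter_upwards [hfg.norm_hat_le (ne_of_gt hh), hfg, hat_dq_pow i h f n]
        with ξ h1 h2 h3
      rw [sub_mul, ← h2, ← h3, norm_pow, norm_norm]
      have := norm_sub_le (hat ((dq i h ^ n) f) ξ) (hat g ξ)
      have h3 : ‖hat ((dq i h ^ n) f) ξ - hat g ξ‖ ≤ 2 * ‖hat g ξ‖ := by linarith
      calc _ ≤ (2 * ‖hat g ξ‖) ^ 2 := by gcongr
        _ = _ := by ring
    · refine Eventually.of_forall fun ξ => ?_
      have := (((((tendsto_dqSymbol i ξ).pow n).sub_const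
        ((Complex.I * freq i ξ) ^ n)).mul_const (hat f ξ)).norm).pow 2
      simpa using this
  simp only [integral_zero] at hlim
  have := hlim.sqrt
  simpa using this

end


/-! ### Sobolev norms in frequency space -/

noncomputable section

open Filter Topology

theorem IsWeakPartial.hatDeriv {i : Fin 3} {f g : L2R3} (h : IsWeakPartial i f g) :
    HatDeriv i 1 f g := by
  filter_upwards [h.hat_eq] with ξ hξ
  rw [hξ, pow_one]

theorem HatDeriv.succ {i : Fin 3} {n : ℕ} {f g k : L2R3} (h : HatDeriv i n f g)
    (h' : IsWeakPartial i g k) : HatDeriv i (n + 1) f k := by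
  filter_upwards [h, h'.hat_eq] with ξ h1 h2
  rw [h2, h1, pow_succ']; ring

namespace Hm

/-- The continuous linear projection `f ↦ ∂^α f`. -/
def projL {m : ℕ} (α : multiIndices m) : Hm m →L[ℝ] L2R3 :=
  (PiLp.proj 2 (fun _ : multiIndices m => L2R3) α).comp (sobolevSubmodule m).subtypeL

theorem norm_sq_eq {m : ℕ} (f : Hm m) : ‖f‖ ^ 2 = ∑ α, ‖f.1 α‖ ^ 2 := by
  rw [← Submodule.norm_coe, PiLp.norm_sq_eq_of_L2]

theorem norm_proj_le {m : ℕ} (f : Hm m) (α : multiIndices m) : ‖f.1 α‖ ≤ ‖f‖ := by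
  rw [← Submodule.norm_coe]; exact PiLp.norm_apply_le _ _

theorem norm_fn_le {m : ℕ} (f : Hm m) : ‖f.fn‖ ≤ ‖f‖ := norm_proj_le f _

theorem deriv_isWeakPartial {m : ℕ} (f : Hm (m + 1)) (i : Fin 3) :
    IsWeakPartial i f.fn (f.deriv i).fn := f.2 _ _ i rfl

theorem norm_deriv_le {m : ℕ} (f : Hm (m + 1)) (i : Fin 3) : ‖f.deriv i‖ ≤ ‖f‖ := by
  refine le_of_sq_le_sq ?_ (norm_nonneg _)
  rw [norm_sq_eq, norm_sq_eq]
  let e : multiIndices m → multiIndices (m + 1) := fun α =>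
    ⟨α.1 + Pi.single i 1, mem_multiIndices.2 (by
      have := mem_multiIndices.1 α.2
      simp only [Pi.add_apply, Finset.sum_add_distrib, Finset.sum_pi_single',
        Finset.mem_univ, if_true]
      omega)⟩
  have he : Function.Injective e := fun α β h => by
    have := congrArg Subtype.val h
    exact Subtype.ext (add_right_cancel this)
  calc ∑ α, ‖(f.deriv i).1 α‖ ^ 2 = ∑ α, ‖f.1 (e α)‖ ^ 2 := rfl
    _ = ∑ β ∈ Finset.univ.image e, ‖f.1 β‖ ^ 2 := by
      rw [Finset.sum_image fun a _ b _ h => he h]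
    _ ≤ ∑ β, ‖f.1 β‖ ^ 2 :=
      Finset.sum_le_sum_of_subset_of_nonneg (Finset.subset_univ _) fun _ _ _ => by positivity

/-- The partial derivative as a continuous linear map. -/
def derivL {m : ℕ} (i : Fin 3) : Hm (m + 1) →L[ℝ] Hm m :=
  LinearMap.mkContinuous ⟨⟨fun f => f.deriv i, fun _ _ => rfl⟩, fun _ _ => rfl⟩ 1
    fun f => by rw [one_mul]; exact norm_deriv_le f i

/-- The underlying function as a continuous linear map. -/
def fnL {m : ℕ} : Hm m →L[ℝ] L2R3 := projL ⟨0, mem_multiIndices.2 (by simp)⟩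

theorem hatDeriv_one {m : ℕ} (f : Hm (m + 1)) (i : Fin 3) :
    HatDeriv i 1 f.fn (f.deriv i).fn := (f.deriv_isWeakPartial i).hatDeriv

theorem hatDeriv_two {m : ℕ} (f : Hm (m + 2)) (i : Fin 3) :
    HatDeriv i 2 f.fn ((f.deriv i).deriv i).fn :=
  (f.hatDeriv_one i).succ ((f.deriv i).deriv_isWeakPartial i)

theorem hatDeriv_three {m : ℕ} (f : Hm (m + 3)) (i : Fin 3) :
    HatDeriv i 3 f.fn (((f.deriv i).deriv i).deriv i).fn :=
  (f.hatDeriv_two i).succ (((f.deriv i).deriv i).deriv_isWeakPartial i)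

/-- Induction on |α|, removing one unit vector from α at a time. All inequalities between Sobolev
quantities thereby become inequalities between polynomials in the frequencies. -/
theorem hat_proj {m : ℕ} (f : Hm m) : ∀ (n : ℕ) (α : multiIndices m), ∑ i, α.1 i = n →
    ∀ᵐ ξ, hat (f.1 α) ξ = (∏ j, (Complex.I * freq j ξ) ^ α.1 j) * hat f.fn ξ := by
  intro n
  induction n with
  | zero =>
    intro α hα
    have h0 : α.1 = 0 := by
      funext i
      exact (Finset.sum_eq_zero_iff.1 hα) i (Finset.mem_univ i)
    have : α = ⟨0, mem_multiIndices.2 (by simp)⟩ := Subtype.ext h0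
    subst this
    exact Eventually.of_forall fun ξ => by simp [Hm.fn]
  | succ n ih =>
    intro α hα
    obtain ⟨i, hi⟩ : ∃ i, α.1 i ≠ 0 := by
      by_contra hcon
      push Not at hcon
      simp [hcon] at hα
    have hsplit : α.1 = (α.1 - Pi.single i 1) + Pi.single i 1 := by
      funext j
      rcases eq_or_ne j i with rfl | hj
      · simp; omega
      · simp [hj]
    have hsum : ∑ j, ((α.1 - Pi.single i 1 : Fin 3 → ℕ)) j = n := by
      have h := hα
      rw [hsplit] at h
      simp only [Pi.add_apply, Finset.sum_add_distrib, Finset.sum_pi_single',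
        Finset.mem_univ, if_true] at h
      omega
    have hm : n + 1 ≤ m := hα ▸ mem_multiIndices.1 α.2
    let β : multiIndices m := ⟨α.1 - Pi.single i 1, mem_multiIndices.2 (by omega)⟩
    have hw := f.2 β α i hsplit
    filter_upwards [ih β hsum, hw.hat_eq] with ξ h1 h2
    rw [h2, h1]
    have : ∏ j, (Complex.I * (freq j ξ : ℂ)) ^ α.1 j
        = (∏ j, (Complex.I * (freq j ξ : ℂ)) ^ β.1 j) * (Complex.I * freq i ξ) := by
      conv_lhs => rw [hsplit]
      simp only [Pi.add_apply, pow_add, Finset.prod_mul_distrib]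
      congr 1
      rw [Finset.prod_eq_single i]
      · simp
      · intro j _ hj; simp [hj]
      · simp
    rw [this]; ring

theorem norm_sq_hat_proj {m : ℕ} (f : Hm m) (α : multiIndices m) :
    ∀ᵐ ξ, ‖hat (f.1 α) ξ‖ ^ 2 = (∏ j, (freq j ξ ^ 2) ^ α.1 j) * ‖hat f.fn ξ‖ ^ 2 := by
  filter_upwards [hat_proj f _ α rfl] with ξ h
  rw [h, norm_mul, mul_pow, norm_prod, ← Finset.prod_pow]
  congr 1
  refine Finset.prod_congr rfl fun j _ => ?_
  rw [norm_pow, norm_mul, Complex.norm_I, one_mul, Complex.norm_real, Real.norm_eq_abs, ← pow_mul,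
    mul_comm, pow_mul, sq_abs]

end Hm

theorem HatDeriv.norm_sq_hat {i : Fin 3} {n : ℕ} {f g : L2R3} (h : HatDeriv i n f g) :
    ∀ᵐ ξ, ‖hat g ξ‖ ^ 2 = (freq i ξ ^ 2) ^ n * ‖hat f ξ‖ ^ 2 := by
  filter_upwards [h] with ξ h
  rw [h, norm_mul, mul_pow, norm_pow, norm_mul, Complex.norm_I, one_mul, Complex.norm_real,
    Real.norm_eq_abs, ← pow_mul, mul_comm n, pow_mul, sq_abs]

/-- `|2πξ|²`. -/
def freqSq (ξ : E3) : ℝ := ∑ i, freq i ξ ^ 2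

theorem freqSq_nonneg (ξ : E3) : 0 ≤ freqSq ξ := Finset.sum_nonneg fun _ _ => sq_nonneg _

theorem continuous_freqSq : Continuous freqSq := by
  unfold freqSq
  exact continuous_finsetSum _ fun i _ => (continuous_freq i).pow 2

theorem freqSq_eq (ξ : E3) : freqSq ξ = (2 * Real.pi) ^ 2 * ‖ξ‖ ^ 2 := by
  rw [freqSq, EuclideanSpace.norm_sq_eq, Finset.mul_sum]
  simp only [freq, mul_pow, Real.norm_eq_abs, sq_abs]

theorem norm_sq_le_freqSq (ξ : E3) : ‖ξ‖ ^ 2 ≤ freqSq ξ := by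
  rw [freqSq_eq]
  have : (1 : ℝ) ≤ (2 * Real.pi) ^ 2 := by nlinarith [Real.pi_gt_three]
  nlinarith [sq_nonneg ‖ξ‖]

/-- Each factor is replaced by the largest coordinate or by 1. With y_j the squared frequencies,
this dominates every mixed derivative by the function and its pure top derivatives. -/
theorem prod_pow_le_of_sum_le {y : Fin 3 → ℝ} (hy : ∀ i, 0 ≤ y i) {α : Fin 3 → ℕ} {n : ℕ}
    (hα : ∑ i, α i ≤ n) : ∏ j, y j ^ α j ≤ 1 + ∑ j, y j ^ n := by
  obtain ⟨k, -, hk⟩ := Finset.exists_max_image Finset.univ y Finset.univ_nonempty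
  have h1 : ∏ j, y j ^ α j ≤ (max 1 (y k)) ^ n := by
    calc ∏ j, y j ^ α j ≤ ∏ j, (max 1 (y k)) ^ α j := by
          refine Finset.prod_le_prod (fun j _ => pow_nonneg (hy j) _) fun j _ => ?_
          exact pow_le_pow_left₀ (hy j) ((hk j (Finset.mem_univ j)).trans (le_max_right _ _)) _
      _ = (max 1 (y k)) ^ ∑ j, α j := Finset.prod_pow_eq_pow_sum _ _ _
      _ ≤ _ := pow_le_pow_right₀ (le_max_left _ _) hα
  have h2 : y k ^ n ≤ ∑ j, y j ^ n :=
    Finset.single_le_sum (f := fun j => y j ^ n) (fun j _ => pow_nonneg (hy j) _)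
      (Finset.mem_univ k)
  rcases le_total 1 (y k) with h | h
  · rw [max_eq_right h] at h1; linarith
  · rw [max_eq_left h, one_pow] at h1
    have : 0 ≤ ∑ j, y j ^ n := Finset.sum_nonneg fun j _ => pow_nonneg (hy j) _
    linarith

theorem integral_norm_sq_le {f : L2C} {w : E3 → ℝ} (hw : Integrable w)
    (h : ∀ᵐ ξ, ‖f ξ‖ ^ 2 ≤ w ξ) : ‖f‖ ^ 2 ≤ ∫ ξ, w ξ := by
  rw [norm_sq_L2C]
  exact integral_mono_ae (integrable_norm_sq_L2C _) hw h

theorem norm_sq_le_integral {f : L2R3} {w : E3 → ℝ} (hw : Integrable w)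
    (h : ∀ᵐ ξ, ‖hat f ξ‖ ^ 2 ≤ w ξ) : ‖f‖ ^ 2 ≤ ∫ ξ, w ξ := by
  rw [← norm_hat]; exact integral_norm_sq_le hw h

theorem integrable_norm_sq_hat (f : L2R3) : Integrable fun ξ => ‖hat f ξ‖ ^ 2 :=
  integrable_norm_sq_L2C _

/-- The pure third derivative `∂_i³ f`. -/
def Hm.d3 (f : Hm 3) (i : Fin 3) : L2R3 := (((f.deriv i).deriv i).deriv i).fn

/-- The pure second derivative `∂_i² f`. -/
def Hm.d2 {m : ℕ} (f : Hm (m + 2)) (i : Fin 3) : L2R3 := ((f.deriv i).deriv i).fn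

/-- Because of this bound the top order energy needs differences in one direction at a time only. -/
theorem Hm.norm_sq_le_fn_add_d3 (f : Hm 3) :
    ‖f‖ ^ 2 ≤ (multiIndices 3).card * (‖f.fn‖ ^ 2 + ∑ i, ‖f.d3 i‖ ^ 2) := by
  have hi : Integrable fun ξ => ‖hat f.fn ξ‖ ^ 2 + ∑ i, ‖hat (f.d3 i) ξ‖ ^ 2 :=
    (integrable_norm_sq_hat _).add (integrable_finsetSum _ fun i _ => integrable_norm_sq_hat _)
  have hint : ∫ ξ, (‖hat f.fn ξ‖ ^ 2 + ∑ i, ‖hat (f.d3 i) ξ‖ ^ 2)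
      = ‖f.fn‖ ^ 2 + ∑ i, ‖f.d3 i‖ ^ 2 := by
    rw [integral_add (integrable_norm_sq_hat _)
      (integrable_finsetSum _ fun i _ => integrable_norm_sq_hat _),
      integral_finsetSum _ fun i _ => integrable_norm_sq_hat _]
    simp only [norm_sq_hat]
  rw [Hm.norm_sq_eq, ← hint, ← Fintype.card_coe, ← nsmul_eq_mul, ← Finset.card_univ]
  refine Finset.sum_le_card_nsmul _ _ _ fun α _ => norm_sq_le_integral hi ?_
  have h3 := ae_all_iff.2 fun i => (f.hatDeriv_three i).norm_sq_hat
  filter_upwards [Hm.norm_sq_hat_proj f α, h3] with ξ h1 h2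
  rw [h1]
  have : ∑ i, ‖hat (f.d3 i) ξ‖ ^ 2 = (∑ i, (freq i ξ ^ 2) ^ 3) * ‖hat f.fn ξ‖ ^ 2 := by
    rw [Finset.sum_mul]; exact Finset.sum_congr rfl fun i _ => h2 i
  rw [this, ← one_add_mul]
  exact mul_le_mul_of_nonneg_right
    (prod_pow_le_of_sum_le (fun i => sq_nonneg _) (mem_multiIndices.1 α.2)) (sq_nonneg _)

/-- `∫_{|2πξ| ≤ 1} |2πξ|² |f̂|²`, the low-frequency part of `‖∇f‖²`. -/
def lowGrad (f : L2R3) : ℝ :=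
  ∫ ξ, {ξ | freqSq ξ ≤ 1}.indicator (fun ξ => freqSq ξ * ‖hat f ξ‖ ^ 2) ξ

theorem measurableSet_low : MeasurableSet {ξ : E3 | freqSq ξ ≤ 1} :=
  measurableSet_le continuous_freqSq.measurable measurable_const

theorem integrable_lowGrad (f : L2R3) :
    Integrable ({ξ | freqSq ξ ≤ 1}.indicator fun ξ => freqSq ξ * ‖hat f ξ‖ ^ 2) := by
  refine (integrable_norm_sq_hat f).mono' ?_ (Eventually.of_forall fun ξ => ?_)
  · exact ((continuous_freqSq.aestronglyMeasurable.mul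
      (integrable_norm_sq_hat f).1).indicator measurableSet_low)
  · by_cases h : freqSq ξ ≤ 1
    · rw [indicator_of_mem (show ξ ∈ {ξ | freqSq ξ ≤ 1} from h), norm_mul,
        Real.norm_of_nonneg (freqSq_nonneg _), Real.norm_of_nonneg (sq_nonneg _)]
      exact mul_le_of_le_one_left (sq_nonneg _) h
    · rw [indicator_of_notMem (show ξ ∉ {ξ | freqSq ξ ≤ 1} from h), norm_zero]
      positivity

/-- For s > 1 one has s ≤ s³, and s³ is at most 9 times the sum of cubes by the power mean
inequality. Used above the threshold |2πξ| = 1, where first derivatives are controlled by third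
ones. -/
theorem sum_le_sum_cube_of_one_lt {y : Fin 3 → ℝ} (hy : ∀ i, 0 ≤ y i) (h : 1 < ∑ i, y i) :
    ∑ i, y i ≤ 9 * ∑ i, y i ^ 3 := by
  simp only [Fin.sum_univ_three] at *
  have a := hy 0; have b := hy 1; have c := hy 2
  set s := y 0 + y 1 + y 2
  have h2 : s ≤ s ^ 3 := by nlinarith [mul_pos (show 0 < s by linarith) (show 0 < s - 1 by linarith)]
  have h3 : s ^ 3 ≤ 9 * (y 0 ^ 3 + y 1 ^ 3 + y 2 ^ 3) := by
    have : ∀ x z : ℝ, 0 ≤ x → 0 ≤ z → x ^ 2 * z + x * z ^ 2 ≤ x ^ 3 + z ^ 3 := fun x z hx hz => by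
      nlinarith [mul_nonneg (add_nonneg hx hz) (sq_nonneg (x - z))]
    have e1 := this _ _ a b
    have e2 := this _ _ a c
    have e3 := this _ _ b c
    have e4 : 3 * (y 0 * y 1 * y 2) ≤ y 0 ^ 3 + y 1 ^ 3 + y 2 ^ 3 := by
      nlinarith [mul_nonneg (add_nonneg (add_nonneg a b) c) (sq_nonneg (y 0 - y 1)),
        mul_nonneg (add_nonneg (add_nonneg a b) c) (sq_nonneg (y 0 - y 2)),
        mul_nonneg (add_nonneg (add_nonneg a b) c) (sq_nonneg (y 1 - y 2))]
    nlinarith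
  linarith

theorem Hm.norm_grad_sq_eq (f : Hm 3) : ‖f.grad‖ ^ 2 = ∑ k, ‖f.deriv k‖ ^ 2 := by
  rw [PiLp.norm_sq_eq_of_L2]; rfl

theorem Hm.norm_deriv_le_grad (f : Hm 3) (k : Fin 3) : ‖f.deriv k‖ ≤ ‖f.grad‖ :=
  PiLp.norm_apply_le f.grad k

theorem prod_pow_mul_le {y : Fin 3 → ℝ} (hy : ∀ i, 0 ≤ y i) {α : Fin 3 → ℕ}
    (hα : ∑ i, α i ≤ 2) (k : Fin 3) :
    (∏ j, y j ^ α j) * y k ≤ 4 * (∑ j, y j + ∑ j, y j ^ 3) := by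
  have h := prod_pow_le_of_sum_le hy hα
  have : (∏ j, y j ^ α j) * y k ≤ (1 + ∑ j, y j ^ 2) * y k := mul_le_mul_of_nonneg_right h (hy k)
  refine this.trans ?_
  have e : ∀ j, y j ^ 2 * y k ≤ y j ^ 3 + y k ^ 3 := fun j => by
    have hx := hy j; have hz := hy k
    nlinarith [mul_nonneg (add_nonneg hx hz) (sq_nonneg (y j - y k)), pow_nonneg hx 3,
      pow_nonneg hz 3, mul_nonneg hx (sq_nonneg (y k)), mul_nonneg hz (sq_nonneg (y j))]
  have hk1 : y k ≤ ∑ j, y j := Finset.single_le_sum (fun j _ => hy j) (Finset.mem_univ k)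
  have hk3 : y k ^ 3 ≤ ∑ j, y j ^ 3 :=
    Finset.single_le_sum (f := fun j => y j ^ 3) (fun j _ => pow_nonneg (hy j) _)
      (Finset.mem_univ k)
  have hs : (∑ j, y j ^ 2) * y k ≤ ∑ j, y j ^ 3 + 3 * y k ^ 3 := by
    rw [Finset.sum_mul]
    calc ∑ j, y j ^ 2 * y k ≤ ∑ j, (y j ^ 3 + y k ^ 3) := Finset.sum_le_sum fun j _ => e j
      _ = _ := by rw [Finset.sum_add_distrib]; simp
  nlinarith [Finset.sum_nonneg fun j (_ : j ∈ Finset.univ) => hy j]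

theorem Hm.norm_sq_hat_deriv_proj (f : Hm 3) (k : Fin 3) (α : multiIndices 2) :
    ∀ᵐ ξ, ‖hat ((f.deriv k).1 α) ξ‖ ^ 2
      ≤ 4 * (freqSq ξ + ∑ j, (freq j ξ ^ 2) ^ 3) * ‖hat f.fn ξ‖ ^ 2 := by
  filter_upwards [Hm.norm_sq_hat_proj (f.deriv k) α, (f.hatDeriv_one k).norm_sq_hat] with ξ h1 h2
  rw [h1, h2, pow_one, ← mul_assoc]
  exact mul_le_mul_of_nonneg_right
    (prod_pow_mul_le (fun i => sq_nonneg _) (mem_multiIndices.1 α.2) k) (sq_nonneg _)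

theorem Hm.norm_grad_sq_le_of_integral (f : Hm 3) {w : E3 → ℝ} (hw : Integrable w)
    (h : ∀ᵐ ξ, (freqSq ξ + ∑ j, (freq j ξ ^ 2) ^ 3) * ‖hat f.fn ξ‖ ^ 2 ≤ w ξ) :
    ‖f.grad‖ ^ 2 ≤ 12 * (multiIndices 2).card * ∫ ξ, w ξ := by
  have h1 : ∀ k, ‖f.deriv k‖ ^ 2 ≤ (multiIndices 2).card * (4 * ∫ ξ, w ξ) := fun k => by
    rw [Hm.norm_sq_eq, ← Fintype.card_coe, ← nsmul_eq_mul, ← Finset.card_univ]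
    refine Finset.sum_le_card_nsmul _ _ _ fun α _ => ?_
    rw [← integral_const_mul]
    refine norm_sq_le_integral (hw.const_mul 4) ?_
    filter_upwards [f.norm_sq_hat_deriv_proj k α, h] with ξ h2 h3
    nlinarith
  rw [Hm.norm_grad_sq_eq, Fin.sum_univ_three]
  have a := h1 0; have b := h1 1; have c := h1 2
  linarith

theorem Hm.norm_grad_sq_le (f : Hm 3) :
    ‖f.grad‖ ^ 2 ≤ 12 * (multiIndices 2).card *
      (∑ k, ‖(f.deriv k).fn‖ ^ 2 + ∑ i, ‖f.d3 i‖ ^ 2) := by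
  have i1 : Integrable fun ξ => ∑ k, ‖hat (f.deriv k).fn ξ‖ ^ 2 :=
    integrable_finsetSum _ fun i _ => integrable_norm_sq_hat _
  have i2 : Integrable fun ξ => ∑ k, ‖hat (f.d3 k) ξ‖ ^ 2 :=
    integrable_finsetSum _ fun i _ => integrable_norm_sq_hat _
  have hint : ∫ ξ, (∑ k, ‖hat (f.deriv k).fn ξ‖ ^ 2 + ∑ i, ‖hat (f.d3 i) ξ‖ ^ 2)
      = ∑ k, ‖(f.deriv k).fn‖ ^ 2 + ∑ i, ‖f.d3 i‖ ^ 2 := by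
    rw [integral_add i1 i2, integral_finsetSum _ fun i _ => integrable_norm_sq_hat _,
      integral_finsetSum _ fun i _ => integrable_norm_sq_hat _]
    simp only [norm_sq_hat]
  rw [← hint]
  refine f.norm_grad_sq_le_of_integral (i1.add i2) ?_
  filter_upwards [ae_all_iff.2 fun i => (f.hatDeriv_three i).norm_sq_hat,
    ae_all_iff.2 fun i => (f.hatDeriv_one i).norm_sq_hat] with ξ h3 h1
  rw [add_mul, freqSq, Finset.sum_mul, Finset.sum_mul]
  refine le_of_eq (congrArg₂ _ (Finset.sum_congr rfl fun i _ => ?_)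
    (Finset.sum_congr rfl fun i _ => ?_))
  · rw [h1 i, pow_one]
  · exact (h3 i).symm

/-- Frequencies above 1 are absorbed by the third derivatives, with 10 = 9 + 1; what is left of the
gradient is `lowGrad`, the only part that does not decay exponentially. -/
theorem Hm.norm_grad_sq_le_low (f : Hm 3) :
    ‖f.grad‖ ^ 2 ≤ 12 * (multiIndices 2).card *
      (lowGrad f.fn + 10 * ∑ i, ‖f.d3 i‖ ^ 2) := by
  have i2 : Integrable fun ξ => 10 * ∑ k, ‖hat (f.d3 k) ξ‖ ^ 2 :=
    (integrable_finsetSum _ fun i _ => integrable_norm_sq_hat _).const_mul 10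
  have hint : ∫ ξ, ({ξ | freqSq ξ ≤ 1}.indicator (fun ξ => freqSq ξ * ‖hat f.fn ξ‖ ^ 2) ξ
      + 10 * ∑ i, ‖hat (f.d3 i) ξ‖ ^ 2) = lowGrad f.fn + 10 * ∑ i, ‖f.d3 i‖ ^ 2 := by
    rw [integral_add (integrable_lowGrad _) i2, integral_const_mul,
      integral_finsetSum _ fun i _ => integrable_norm_sq_hat _]
    simp only [norm_sq_hat, lowGrad]
  rw [← hint]
  refine f.norm_grad_sq_le_of_integral ((integrable_lowGrad _).add i2) ?_
  filter_upwards [ae_all_iff.2 fun i => (f.hatDeriv_three i).norm_sq_hat] with ξ h3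
  have e : ∑ i, ‖hat (f.d3 i) ξ‖ ^ 2 = (∑ i, (freq i ξ ^ 2) ^ 3) * ‖hat f.fn ξ‖ ^ 2 := by
    rw [Finset.sum_mul]; exact Finset.sum_congr rfl fun i _ => h3 i
  have hpos : 0 ≤ (∑ i, (freq i ξ ^ 2) ^ 3) * ‖hat f.fn ξ‖ ^ 2 :=
    mul_nonneg (Finset.sum_nonneg fun i _ => by positivity) (sq_nonneg _)
  rw [e, add_mul]
  by_cases h : freqSq ξ ≤ 1
  · rw [indicator_of_mem (show ξ ∈ {ξ | freqSq ξ ≤ 1} from h)]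
    linarith
  · rw [indicator_of_notMem (show ξ ∉ {ξ | freqSq ξ ≤ 1} from h)]
    have := sum_le_sum_cube_of_one_lt (y := fun i => freq i ξ ^ 2) (fun i => sq_nonneg _)
      (not_le.1 h)
    have h5 := mul_le_mul_of_nonneg_right this (sq_nonneg ‖hat f.fn ξ‖)
    have h6 : freqSq ξ * ‖hat f.fn ξ‖ ^ 2
        ≤ 9 * (∑ i, (freq i ξ ^ 2) ^ 3) * ‖hat f.fn ξ‖ ^ 2 := h5
    linarith

/-- Split at squared frequency η: below it y² ≤ η², above it y² ≤ η⁻¹y³. The free η later allows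
second derivatives of the velocity to be charged mostly to its L² norm or mostly to its third
derivatives. -/
theorem Hm.norm_d2_sq_le (f : Hm 3) (i : Fin 3) {η : ℝ} (hη : 0 < η) :
    ‖f.d2 i‖ ^ 2 ≤ η ^ 2 * ‖f.fn‖ ^ 2 + η⁻¹ * ‖f.d3 i‖ ^ 2 := by
  have i1 : Integrable fun ξ => η ^ 2 * ‖hat f.fn ξ‖ ^ 2 + η⁻¹ * ‖hat (f.d3 i) ξ‖ ^ 2 :=
    ((integrable_norm_sq_hat _).const_mul _).add ((integrable_norm_sq_hat _).const_mul _)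
  have hint : ∫ ξ, (η ^ 2 * ‖hat f.fn ξ‖ ^ 2 + η⁻¹ * ‖hat (f.d3 i) ξ‖ ^ 2)
      = η ^ 2 * ‖f.fn‖ ^ 2 + η⁻¹ * ‖f.d3 i‖ ^ 2 := by
    rw [integral_add ((integrable_norm_sq_hat _).const_mul _)
      ((integrable_norm_sq_hat _).const_mul _), integral_const_mul, integral_const_mul]
    simp only [norm_sq_hat]
  rw [← hint]
  refine norm_sq_le_integral i1 ?_
  filter_upwards [(f.hatDeriv_three i).norm_sq_hat, (f.hatDeriv_two i).norm_sq_hat] with ξ h3 h2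
  rw [show hat (f.d3 i) ξ = hat ((((f.deriv i).deriv i).deriv i).fn) ξ from rfl, h3,
    show hat (f.d2 i) ξ = hat (((f.deriv i).deriv i).fn) ξ from rfl, h2, ← mul_assoc, ← add_mul]
  refine mul_le_mul_of_nonneg_right ?_ (sq_nonneg _)
  set y := freq i ξ ^ 2
  have hy : 0 ≤ y := sq_nonneg _
  rcases le_total y η with h | h
  · have : y ^ 2 ≤ η ^ 2 := pow_le_pow_left₀ hy h 2
    have : 0 ≤ η⁻¹ * y ^ 3 := by positivity
    linarith
  · have : y ^ 2 ≤ η⁻¹ * y ^ 3 := by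
      rw [le_inv_mul_iff₀ hη]
      nlinarith [sq_nonneg y]
    nlinarith [sq_nonneg η]

/-- `‖∂_i² ∂_k f‖² ≤ ∑_j ‖∂_j³ f‖²`. -/
theorem Hm.norm_d2_deriv_sq_le (f : Hm 3) (i k : Fin 3) :
    ‖(f.deriv k).d2 i‖ ^ 2 ≤ 2 * ∑ j, ‖f.d3 j‖ ^ 2 := by
  have i2 : Integrable fun ξ => 2 * ∑ k, ‖hat (f.d3 k) ξ‖ ^ 2 :=
    (integrable_finsetSum _ fun i _ => integrable_norm_sq_hat _).const_mul 2
  have hint : ∫ ξ, 2 * ∑ k, ‖hat (f.d3 k) ξ‖ ^ 2 = 2 * ∑ j, ‖f.d3 j‖ ^ 2 := by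
    rw [integral_const_mul, integral_finsetSum _ fun i _ => integrable_norm_sq_hat _]
    simp only [norm_sq_hat]
  rw [← hint]
  refine norm_sq_le_integral i2 ?_
  filter_upwards [ae_all_iff.2 fun i => (f.hatDeriv_three i).norm_sq_hat,
    (f.hatDeriv_one k).norm_sq_hat, ((f.deriv k).hatDeriv_two i).norm_sq_hat] with ξ h3 h1 h2
  have e : ∑ i, ‖hat (f.d3 i) ξ‖ ^ 2 = (∑ i, (freq i ξ ^ 2) ^ 3) * ‖hat f.fn ξ‖ ^ 2 := by
    rw [Finset.sum_mul]; exact Finset.sum_congr rfl fun i _ => h3 i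
  rw [e, show hat ((f.deriv k).d2 i) ξ = hat ((((f.deriv k).deriv i).deriv i).fn) ξ from rfl, h2, h1,
    ← mul_assoc, ← mul_assoc]
  refine mul_le_mul_of_nonneg_right ?_ (sq_nonneg _)
  have hi : (freq i ξ ^ 2) ^ 3 ≤ ∑ j, (freq j ξ ^ 2) ^ 3 :=
    Finset.single_le_sum (f := fun j => (freq j ξ ^ 2) ^ 3) (fun j _ => by positivity)
      (Finset.mem_univ i)
  have hk : (freq k ξ ^ 2) ^ 3 ≤ ∑ j, (freq j ξ ^ 2) ^ 3 :=
    Finset.single_le_sum (f := fun j => (freq j ξ ^ 2) ^ 3) (fun j _ => by positivity)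
      (Finset.mem_univ k)
  have hx : 0 ≤ freq i ξ ^ 2 := sq_nonneg _
  have hz : 0 ≤ freq k ξ ^ 2 := sq_nonneg _
  set x := freq i ξ ^ 2
  set z := freq k ξ ^ 2
  nlinarith [mul_nonneg (add_nonneg hx hz) (sq_nonneg (x - z)), pow_nonneg hx 3,
      pow_nonneg hz 3, mul_nonneg hx (sq_nonneg z), mul_nonneg hz (sq_nonneg x)]

end


/-! ### Sobolev embedding and bounds in Lebesgue spaces -/

noncomputable section

open Filter Topology
open scoped ENNReal

/-- The integrand decays like |ξ|^{-4}, which is integrable in dimension three; this is why two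
derivatives suffice for boundedness. -/
theorem integrable_one_add_freqSq_inv_sq : Integrable fun ξ : E3 => ((1 + freqSq ξ)⁻¹) ^ 2 := by
  have h0 : Integrable fun ξ : E3 => 4 * (1 + ‖ξ‖) ^ (-(4 : ℝ)) :=
    (integrable_one_add_norm (by simp; norm_num)).const_mul 4
  refine h0.mono' ?_ (Eventually.of_forall fun ξ => ?_)
  · have := continuous_freqSq
    have h2 : Continuous fun ξ : E3 => ((1 + freqSq ξ)⁻¹) ^ 2 :=
      ((continuous_const.add this).inv₀ fun ξ =>
        (by have := freqSq_nonneg ξ; positivity : (0 : ℝ) < 1 + freqSq ξ).ne').pow 2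
    exact h2.aestronglyMeasurable
  · have h1 := norm_sq_le_freqSq ξ
    have h2 : 0 ≤ ‖ξ‖ := norm_nonneg _
    have h3 : (1 + ‖ξ‖) ^ 2 ≤ 2 * (1 + freqSq ξ) := by nlinarith [sq_nonneg (1 - ‖ξ‖)]
    have h4 : 0 < 1 + freqSq ξ := by have := freqSq_nonneg ξ; positivity
    rw [Real.norm_of_nonneg (by positivity), Real.rpow_neg (by positivity)]
    rw [show (4 : ℝ) = ((4 : ℕ) : ℝ) by norm_num, Real.rpow_natCast, inv_pow,
      ← div_eq_mul_inv, ← one_div, div_le_div_iff₀ (by positivity) (by positivity), one_mul]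
    calc (1 + ‖ξ‖) ^ 4 = ((1 + ‖ξ‖) ^ 2) ^ 2 := by ring
      _ ≤ (2 * (1 + freqSq ξ)) ^ 2 := pow_le_pow_left₀ (by positivity) h3 2
      _ = _ := by push_cast; ring

theorem memLp_one_add_freqSq_inv : MemLp (fun ξ : E3 => (1 + freqSq ξ)⁻¹) 2 volume := by
  have h2 : Continuous fun ξ : E3 => (1 + freqSq ξ)⁻¹ :=
      ((continuous_const.add continuous_freqSq).inv₀ fun ξ =>
        (by have := freqSq_nonneg ξ; positivity : (0 : ℝ) < 1 + freqSq ξ).ne')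
  exact (memLp_two_iff_integrable_sq h2.aestronglyMeasurable).2 integrable_one_add_freqSq_inv_sq

theorem integral_mul_le_L2 {α : Type*} [MeasurableSpace α] {μ : Measure α} {f g : α → ℝ}
    (hf : MemLp f 2 μ) (hg : MemLp g 2 μ) :
    |∫ x, f x * g x ∂μ| ≤ Real.sqrt (∫ x, f x ^ 2 ∂μ) * Real.sqrt (∫ x, g x ^ 2 ∂μ) := by
  have h := abs_real_inner_le_norm (hf.toLp f) (hg.toLp g)
  have e : ∀ {k : α → ℝ} (hk : MemLp k 2 μ), ‖hk.toLp k‖ = Real.sqrt (∫ x, k x ^ 2 ∂μ) := by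
    intro k hk
    rw [← Real.sqrt_sq (norm_nonneg (hk.toLp k)), ← real_inner_self_eq_norm_sq, L2.inner_def]
    congr 1
    refine integral_congr_ae ?_
    filter_upwards [hk.coeFn_toLp] with x hx
    rw [hx]; simp [pow_two]
  rw [e hf, e hg, L2.inner_def] at h
  refine le_trans (le_of_eq (congrArg _ (integral_congr_ae ?_))) h
  filter_upwards [hf.coeFn_toLp, hg.coeFn_toLp] with x h1 h2
  rw [h1, h2]; simp [mul_comm]

/-- A square integrable function whose Fourier transform is dominated by that of an `H²` function
is bounded by a multiple of the `H²` norm. -/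
theorem exists_abs_le_of_norm_hat_le : ∃ S : ℝ, 1 ≤ S ∧ ∀ (f : Hm 2) (g : L2R3),
    (∀ᵐ ξ, ‖hat g ξ‖ ≤ ‖hat f.fn ξ‖) → ∀ᵐ x, |g x| ≤ S * ‖f‖ := by
  set I := Real.sqrt (∫ ξ : E3, ((1 + freqSq ξ)⁻¹) ^ 2)
  refine ⟨4 * I + 1, by have : 0 ≤ I := Real.sqrt_nonneg _; linarith, fun f g hg => ?_⟩
  -- G is (1-Δ)f, so f̂ = (1+|2πξ|²)⁻¹Ĝ, and Cauchy–Schwarz bounds the L¹ norm of f̂, hence that of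
  -- every ĝ below it.
  let G : L2R3 := f.fn - ∑ i, f.d2 i
  have hGn : ‖G‖ ≤ 4 * ‖f‖ := by
    have h1 : ‖∑ i, f.d2 i‖ ≤ 3 * ‖f‖ := by
      refine (norm_sum_le _ _).trans ?_
      calc ∑ i, ‖f.d2 i‖ ≤ ∑ _i : Fin 3, ‖f‖ := Finset.sum_le_sum fun i _ => Hm.norm_proj_le f _
        _ = _ := by simp
    have h2 := norm_sub_le f.fn (∑ i, f.d2 i)
    have h3 := f.norm_fn_le
    show ‖f.fn - ∑ i, f.d2 i‖ ≤ _
    linarith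
  have hG : ∀ᵐ ξ, ‖hat f.fn ξ‖ = (1 + freqSq ξ)⁻¹ * ‖hat G ξ‖ := by
    have e : hat G = hat f.fn - ∑ i, hat (f.d2 i) := by
      simp only [G, map_sub, map_sum]
    have hs := Lp.coeFn_sub (hat f.fn) (∑ i, hat (f.d2 i))
    have hs2 : ∀ᵐ ξ, (∑ i, hat (f.d2 i)) ξ = ∑ i, hat (f.d2 i) ξ := by
      simp only [Fin.sum_univ_three]
      filter_upwards [Lp.coeFn_add (hat (f.d2 0) + hat (f.d2 1)) (hat (f.d2 2)),
        Lp.coeFn_add (hat (f.d2 0)) (hat (f.d2 1))] with ξ h1 h2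
      rw [h1, Pi.add_apply, h2, Pi.add_apply]
    filter_upwards [hs, hs2, ae_all_iff.2 fun i => f.hatDeriv_two i] with ξ h1 h2 h3
    have h4 : ∑ i, hat (f.d2 i) ξ = -(freqSq ξ : ℂ) * hat f.fn ξ := by
      rw [freqSq]
      push_cast
      rw [← Finset.sum_neg_distrib, Finset.sum_mul]
      refine Finset.sum_congr rfl fun i _ => ?_
      have := h3 i
      rw [show hat (f.d2 i) ξ = hat (((f.deriv i).deriv i).fn) ξ from rfl, this, mul_pow,
        Complex.I_sq]
      ring
    rw [e, h1, Pi.sub_apply, h2, h4]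
    have h5 : hat f.fn ξ - -(freqSq ξ : ℂ) * hat f.fn ξ = ((1 + freqSq ξ : ℝ) : ℂ) * hat f.fn ξ := by
      push_cast; ring
    have h6 : 0 < 1 + freqSq ξ := by have := freqSq_nonneg ξ; positivity
    rw [h5, norm_mul, Complex.norm_real, Real.norm_of_nonneg h6.le, ← mul_assoc,
      inv_mul_cancel₀ h6.ne', one_mul]
  have hint : Integrable fun ξ => (1 + freqSq ξ)⁻¹ * ‖hat G ξ‖ :=
    memLp_one_add_freqSq_inv.integrable_mul (q := 2) (Lp.memLp (hat G)).norm
  have hle : ∀ᵐ ξ, ‖hat g ξ‖ ≤ (1 + freqSq ξ)⁻¹ * ‖hat G ξ‖ := by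
    filter_upwards [hg, hG] with ξ h1 h2
    rw [← h2]; exact h1
  have hgi : Integrable (hat g) := hint.mono' (Lp.memLp (hat g)).1 hle
  have h1 : ∫ ξ, ‖hat g ξ‖ ≤ I * ‖G‖ := by
    refine (integral_mono_ae hgi.norm hint hle).trans ((le_abs_self _).trans ?_)
    refine (integral_mul_le_L2 memLp_one_add_freqSq_inv (Lp.memLp (hat G)).norm).trans ?_
    rw [← norm_sq_L2C, Real.sqrt_sq (norm_nonneg _), norm_hat]
  filter_upwards [abs_le_of_integrable_hat g hgi] with x hx
  refine hx.trans (h1.trans ?_)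
  have : 0 ≤ I := Real.sqrt_nonneg _
  nlinarith [norm_nonneg f]

/-- A constant in the embedding of `H²(ℝ³)` into the bounded functions. -/
def supConst : ℝ := exists_abs_le_of_norm_hat_le.choose

theorem one_le_supConst : 1 ≤ supConst := exists_abs_le_of_norm_hat_le.choose_spec.1

theorem abs_le_of_norm_hat_le (f : Hm 2) (g : L2R3) (h : ∀ᵐ ξ, ‖hat g ξ‖ ≤ ‖hat f.fn ξ‖) :
    ∀ᵐ x, |g x| ≤ supConst * ‖f‖ := exists_abs_le_of_norm_hat_le.choose_spec.2 f g h

theorem Hm.abs_fn_le (f : Hm 2) : ∀ᵐ x, |f.fn x| ≤ supConst * ‖f‖ :=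
  abs_le_of_norm_hat_le f f.fn (Eventually.of_forall fun _ => le_rfl)

/-! ### Bounds in Lebesgue spaces -/

/-- `f` is measurable with `‖f‖_{L^p} ≤ K`. -/
structure LpLe (p : ℝ≥0∞) (f : E3 → ℝ) (K : ℝ) : Prop where
  meas : AEStronglyMeasurable f volume
  le : eLpNorm f p volume ≤ ENNReal.ofReal K
  nonneg : 0 ≤ K

namespace LpLe

variable {p q r : ℝ≥0∞} {f g : E3 → ℝ} {K K' : ℝ}

theorem memLp (h : LpLe p f K) : MemLp f p volume := ⟨h.meas, h.le.trans_lt ENNReal.ofReal_lt_top⟩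

theorem mono (h : LpLe p f K) (hK : K ≤ K') : LpLe p f K' :=
  ⟨h.meas, h.le.trans (ENNReal.ofReal_le_ofReal hK), h.nonneg.trans hK⟩

theorem congr (h : LpLe p f K) (hfg : f =ᵐ[volume] g) : LpLe p g K :=
  ⟨h.meas.congr hfg, (eLpNorm_congr_ae hfg) ▸ h.le, h.nonneg⟩

theorem add [Fact (1 ≤ p)] (h : LpLe p f K) (h' : LpLe p g K') :
    LpLe p (fun x => f x + g x) (K + K') :=
  ⟨h.meas.add h'.meas, (eLpNorm_add_le h.meas h'.meas Fact.out).trans (by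
    rw [ENNReal.ofReal_add h.nonneg h'.nonneg]; exact add_le_add h.le h'.le),
    add_nonneg h.nonneg h'.nonneg⟩

theorem of_ae_le {c : ℝ} (hf : AEStronglyMeasurable f volume) (h : LpLe p g K) (hc : 0 ≤ c)
    (hle : ∀ᵐ x, |f x| ≤ c * |g x|) : LpLe p f (c * K) :=
  ⟨hf, by
    rw [ENNReal.ofReal_mul hc]
    exact (eLpNorm_le_mul_eLpNorm_of_ae_le_mul (g := g) hle p).trans (by gcongr; exact h.le),
    mul_nonneg hc h.nonneg⟩

theorem mono_ae (hf : AEStronglyMeasurable f volume) (h : LpLe p g K)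
    (hle : ∀ᵐ x, |f x| ≤ |g x|) : LpLe p f K := by
  simpa using of_ae_le hf h zero_le_one (by simpa using hle)

theorem abs (h : LpLe p f K) : LpLe p (fun x => |f x|) K :=
  mono_ae h.meas.norm h (Eventually.of_forall fun x => by simp)

theorem neg (h : LpLe p f K) : LpLe p (fun x => -f x) K :=
  mono_ae h.meas.neg h (Eventually.of_forall fun x => by simp)

theorem sub [Fact (1 ≤ p)] (h : LpLe p f K) (h' : LpLe p g K') :
    LpLe p (fun x => f x - g x) (K + K') := by
  simpa [sub_eq_add_neg] using h.add h'.neg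

theorem const_mul (c : ℝ) (h : LpLe p f K) : LpLe p (fun x => c * f x) (|c| * K) :=
  of_ae_le (h.meas.const_mul c) h (abs_nonneg c) (Eventually.of_forall fun x => by rw [abs_mul])

theorem mul (h : LpLe p f K) (h' : LpLe q g K') [p.HolderTriple q r] :
    LpLe r (fun x => f x * g x) (K * K') :=
  ⟨h.meas.mul h'.meas, (eLpNorm_smul_le_mul_eLpNorm (r := r) h'.meas h.meas).trans (by
    rw [ENNReal.ofReal_mul h.nonneg]; exact mul_le_mul' h.le h'.le), mul_nonneg h.nonneg h'.nonneg⟩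

theorem comp_add (v : E3) (h : LpLe p f K) : LpLe p (fun x => f (x + v)) K :=
  have hv := measurePreserving_add_right (volume : Measure E3) v
  ⟨h.meas.comp_measurePreserving hv, by
    have := eLpNorm_comp_measurePreserving (p := p) h.meas hv
    exact this.le.trans h.le, h.nonneg⟩

theorem sum [Fact (1 ≤ p)] {f : Fin 3 → E3 → ℝ} (h : ∀ j, LpLe p (f j) K) :
    LpLe p (fun x => ∑ j, f j x) (3 * K) := by
  simp only [Fin.sum_univ_three]
  exact (((h 0).add (h 1)).add (h 2)).mono (by linarith)

theorem ae_abs_le (h : LpLe ∞ f K) : ∀ᵐ x, |f x| ≤ K := by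
  have h1 := h.le
  rw [eLpNorm_exponent_top] at h1
  filter_upwards [ae_le_eLpNormEssSup (f := f) (μ := volume)] with x hx
  have := (hx.trans h1)
  rw [← ofReal_norm] at this
  exact (ENNReal.ofReal_le_ofReal_iff h.nonneg).1 this

theorem of_ae_abs_le (hf : AEStronglyMeasurable f volume) (hK : 0 ≤ K) (h : ∀ᵐ x, |f x| ≤ K) :
    LpLe ∞ f K :=
  ⟨hf, by rw [eLpNorm_exponent_top]; exact eLpNormEssSup_le_of_ae_bound h, hK⟩

theorem of_norm_le (f : L2R3) (h : ‖f‖ ≤ K) : LpLe 2 f K :=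
  ⟨(Lp.memLp f).1, by
    rw [← ENNReal.ofReal_toReal (Lp.eLpNorm_ne_top f), ← Lp.norm_def]
    exact ENNReal.ofReal_le_ofReal h, (norm_nonneg f).trans h⟩

theorem norm_toLp_le (h : LpLe 2 f K) : ‖h.memLp.toLp f‖ ≤ K := by
  rw [Lp.norm_toLp]
  exact ENNReal.toReal_le_of_le_ofReal h.nonneg h.le

theorem norm_le (f : L2R3) (h : LpLe 2 f K) : ‖f‖ ≤ K := by
  rw [Lp.norm_def]
  exact ENNReal.toReal_le_of_le_ofReal h.nonneg h.le

theorem abs_integral_mul_le (h : LpLe 2 f K) (h' : LpLe 2 g K') :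
    |∫ x, f x * g x| ≤ K * K' := by
  have h1 := abs_real_inner_le_norm (h.memLp.toLp f) (h'.memLp.toLp g)
  rw [L2.inner_def] at h1
  have h2 : ∫ x, f x * g x = ∫ x, inner ℝ (h.memLp.toLp f x) (h'.memLp.toLp g x) := by
    refine integral_congr_ae ?_
    filter_upwards [h.memLp.coeFn_toLp, h'.memLp.coeFn_toLp] with x h1 h2
    rw [h1, h2]; simp [mul_comm]
  rw [h2]
  exact h1.trans (mul_le_mul h.norm_toLp_le h'.norm_toLp_le (norm_nonneg _) h.nonneg)

end LpLe

instance : Fact ((1 : ℝ≥0∞) ≤ 4) := ⟨by norm_num⟩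

/-- Needed for the products of a second and a first difference in the commutator, each of which is
only in L⁴. -/
instance : ENNReal.HolderTriple 4 4 2 := ⟨by
  have h : (4 : ℝ≥0∞)⁻¹ = 2⁻¹ * 2⁻¹ := by
    rw [← ENNReal.mul_inv (by norm_num) (by norm_num)]; norm_num
  rw [h, ← mul_add, ENNReal.inv_two_add_inv_two, mul_one]⟩

end


/-! ### Difference calculus: Leibniz rules, Gagliardo–Nirenberg, commutators -/

noncomputable section

open Filter Topology
open scoped ENNReal

/-- The difference quotient of a function. -/
def fd (i : Fin 3) (h : ℝ) (f : E3 → ℝ) (x : E3) : ℝ := h⁻¹ * (f (x + h • ev i) - f x)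

theorem coeFn_dq (i : Fin 3) (h : ℝ) (f : L2R3) : dq i h f =ᵐ[volume] fd i h f := by
  rw [dq_apply]
  filter_upwards [Lp.coeFn_smul h⁻¹ (tau (h • ev i) f - f), Lp.coeFn_sub (tau (h • ev i) f) f,
    coeFn_tau (h • ev i) f] with x h1 h2 h3
  rw [h1, Pi.smul_apply, h2, Pi.sub_apply, h3]; rfl

theorem fd_congr (i : Fin 3) (h : ℝ) {f g : E3 → ℝ} (hfg : f =ᵐ[volume] g) :
    fd i h f =ᵐ[volume] fd i h g := by
  filter_upwards [hfg, ae_comp_add (h • ev i) hfg] with x h1 h2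
  simp only [fd, h1, h2]

theorem coeFn_dq_two (i : Fin 3) (h : ℝ) (f : L2R3) :
    (dq i h ^ 2) f =ᵐ[volume] fd i h (fd i h f) := by
  rw [pow_two, mul_apply_eq_comp]
  exact (coeFn_dq i h (dq i h f)).trans (fd_congr i h (coeFn_dq i h f))

theorem coeFn_dq_three (i : Fin 3) (h : ℝ) (f : L2R3) :
    (dq i h ^ 3) f =ᵐ[volume] fd i h (fd i h (fd i h f)) := by
  rw [pow_succ', mul_apply_eq_comp]
  exact (coeFn_dq i h ((dq i h ^ 2) f)).trans (fd_congr i h (coeFn_dq_two i h f))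

theorem aestronglyMeasurable_comp_add {f : E3 → ℝ} (hf : AEStronglyMeasurable f volume) (v : E3) :
    AEStronglyMeasurable (fun x => f (x + v)) volume :=
  hf.comp_measurePreserving (measurePreserving_add_right volume v)

theorem aestronglyMeasurable_fd (i : Fin 3) (h : ℝ) {f : E3 → ℝ}
    (hf : AEStronglyMeasurable f volume) : AEStronglyMeasurable (fd i h f) volume :=
  ((aestronglyMeasurable_comp_add hf _).sub hf).const_mul _

theorem fd_mul (i : Fin 3) (h : ℝ) (f g : E3 → ℝ) :
    fd i h (fun x => f x * g x) = fun x => f x * fd i h g x + fd i h f x * g (x + h • ev i) := by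
  funext x; simp only [fd]; ring

theorem fd_fd_mul (i : Fin 3) (h : ℝ) (f g : E3 → ℝ) :
    fd i h (fd i h (fun x => f x * g x)) = fun x => f x * fd i h (fd i h g) x
      + 2 * (fd i h f x * fd i h g (x + h • ev i))
      + fd i h (fd i h f) x * g (x + h • ev i + h • ev i) := by
  funext x; simp only [fd]; ring

/-- The first term is the one kept in the equation; the remaining ones form the commutator. Shifts
of the second factor are harmless since all norms used are translation invariant. -/
theorem fd_fd_fd_mul (i : Fin 3) (h : ℝ) (f g : E3 → ℝ) :
    fd i h (fd i h (fd i h (fun x => f x * g x))) = fun x => f x * fd i h (fd i h (fd i h g)) x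
      + (3 * (fd i h f x * fd i h (fd i h g) (x + h • ev i))
      + 3 * (fd i h (fd i h f) x * fd i h g (x + h • ev i + h • ev i))
      + fd i h (fd i h (fd i h f)) x * g (x + h • ev i + h • ev i + h • ev i)) := by
  funext x; simp only [fd]; ring

theorem memLp_four_of_bounded {w : E3 → ℝ} (h2 : MemLp w 2 volume) {B : ℝ}
    (hB : ∀ᵐ x, |w x| ≤ B) : Integrable fun x => w x ^ 4 := by
  refine (h2.integrable_sq.const_mul (B ^ 2)).mono' (h2.1.pow 4) ?_
  filter_upwards [hB] with x hx
  rw [Real.norm_of_nonneg (by positivity)]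
  have : w x ^ 2 ≤ B ^ 2 := by rw [← sq_abs]; exact pow_le_pow_left₀ (abs_nonneg _) hx 2
  nlinarith [sq_nonneg (w x)]

/-- A discrete Gagliardo–Nirenberg inequality. -/
theorem integral_fd_pow_four_le {i : Fin 3} {h : ℝ} (hh : 0 < h) {a : E3 → ℝ} {K : ℝ}
    (ha : AEStronglyMeasurable a volume) (hK : ∀ᵐ x, |a x| ≤ K)
    (h1 : MemLp (fd i h a) 2 volume) (h2 : MemLp (fd i h (fd i h a)) 2 volume) :
    Integrable (fun x => fd i h a x ^ 4) ∧
    ∫ x, fd i h a x ^ 4 ≤ 9 * K ^ 2 * ∫ x, fd i h (fd i h a) x ^ 2 := by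
  set w := fd i h a with hw
  set v := h • ev i
  -- This bound degenerates as h → 0 and serves only for integrability.
  have hwb : ∀ᵐ x, |w x| ≤ h⁻¹ * (2 * K) := by
    filter_upwards [hK, ae_comp_add v hK] with x e1 e2
    rw [hw, fd, abs_mul, abs_of_pos (inv_pos.2 hh)]
    have := abs_sub (a (x + v)) (a x)
    gcongr
    linarith
  have i4 : Integrable fun x => w x ^ 4 := memLp_four_of_bounded h1 hwb
  refine ⟨i4, ?_⟩
  have i3 : Integrable fun x => w x ^ 3 := by
    refine (h1.integrable_sq.const_mul (h⁻¹ * (2 * K))).mono' (h1.1.pow 3) ?_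
    filter_upwards [hwb] with x hx
    rw [norm_pow, Real.norm_eq_abs, ← sq_abs (w x)]
    nlinarith [sq_nonneg (|w x|)]
  have i3a : Integrable fun x => w x ^ 3 * a x := by
    refine (i3.norm.mul_const K).mono' (i3.1.mul ha) ?_
    filter_upwards [hK] with x hx
    rw [norm_mul]
    exact mul_le_mul_of_nonneg_left hx (norm_nonneg _)
  have i3a' : Integrable fun x => w (x + -v) ^ 3 * a x := by
    refine ((i3.comp_add_right (-v)).norm.mul_const K).mono'
      ((i3.comp_add_right (-v)).1.mul ha) ?_
    filter_upwards [hK] with x hx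
    rw [norm_mul]
    exact mul_le_mul_of_nonneg_left hx (norm_nonneg _)
  have i3a'' : Integrable fun x => w x ^ 3 * a (x + v) := by
    have := i3a'.comp_add_right v
    simpa using this
  -- Summation by parts: one factor w is written as a difference of `a`, and the difference is moved
  -- onto w³. Factoring w³ - y³ below then produces the second difference of `a`.
  have e1 : ∫ x, w x ^ 4 = ∫ x, h⁻¹ * ((w (x + -v) ^ 3 - w x ^ 3) * a x) := by
    have e2 : ∫ x, w x ^ 3 * a (x + v) = ∫ x, w (x + -v) ^ 3 * a x := by
      have := integral_add_right_eq_self (μ := volume) (fun x => w (x + -v) ^ 3 * a x) v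
      rw [← this]
      simp
    calc ∫ x, w x ^ 4 = ∫ x, h⁻¹ * (w x ^ 3 * a (x + v) - w x ^ 3 * a x) := by
          refine integral_congr_ae (Eventually.of_forall fun x => ?_)
          show w x ^ 4 = _
          have : w x = h⁻¹ * (a (x + v) - a x) := rfl
          linear_combination w x ^ 3 * this
      _ = ∫ x, h⁻¹ * ((w (x + -v) ^ 3 - w x ^ 3) * a x) := by
          rw [integral_const_mul, integral_const_mul, integral_sub i3a'' i3a, e2,
            ← integral_sub i3a' i3a]
          simp only [sub_mul]
  have i4' : Integrable fun x => w (x + -v) ^ 4 := i4.comp_add_right (-v)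
  have hz : Integrable fun x => fd i h w (x + -v) ^ 2 := h2.integrable_sq.comp_add_right (-v)
  have e4 : ∫ x, w (x + -v) ^ 4 = ∫ x, w x ^ 4 :=
    integral_add_right_eq_self (μ := volume) (fun x => w x ^ 4) (-v)
  have ez : ∫ x, fd i h w (x + -v) ^ 2 = ∫ x, fd i h w x ^ 2 :=
    integral_add_right_eq_self (μ := volume) (fun x => fd i h w x ^ 2) (-v)
  have hle : ∫ x, w x ^ 4 ≤ ∫ x, (4⁻¹ * w x ^ 4 + 4⁻¹ * w (x + -v) ^ 4
      + 9 / 2 * K ^ 2 * fd i h w (x + -v) ^ 2) := by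
    rw [e1]
    refine integral_mono_ae ?_ (((i4.const_mul _).add (i4'.const_mul _)).add (hz.const_mul _)) ?_
    · refine Integrable.const_mul ?_ _
      simpa only [sub_mul] using! i3a'.sub i3a
    · filter_upwards [hK] with x hx
      set y := w (x + -v)
      have hzy : fd i h w (x + -v) = h⁻¹ * (w x - y) := by
        simp only [fd, y, v]; congr 3; abel_nf
      rw [hzy]
      set z := h⁻¹ * (w x - y) with hzdef
      have e5 : h⁻¹ * ((y ^ 3 - w x ^ 3) * a x)
          = -(z * a x) * (w x ^ 2 + w x * y + y ^ 2) := by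
        rw [hzdef]; ring
      rw [e5]
      have hza : (z * a x) ^ 2 ≤ K ^ 2 * z ^ 2 := by
        have : a x ^ 2 ≤ K ^ 2 := by rw [← sq_abs]; exact pow_le_pow_left₀ (abs_nonneg _) hx 2
        rw [mul_pow]
        nlinarith [sq_nonneg z]
      set c := z * a x
      have h6 : -c * (w x ^ 2 + w x * y + y ^ 2) ≤ |c| * (3 / 2 * (w x ^ 2 + y ^ 2)) := by
        have h7 : |w x ^ 2 + w x * y + y ^ 2| ≤ 3 / 2 * (w x ^ 2 + y ^ 2) := by
          rw [abs_of_nonneg (by nlinarith [sq_nonneg (w x + y), sq_nonneg (w x), sq_nonneg y])]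
          nlinarith [sq_nonneg (w x - y)]
        calc -c * (w x ^ 2 + w x * y + y ^ 2) ≤ |-c * (w x ^ 2 + w x * y + y ^ 2)| := le_abs_self _
          _ = |c| * |w x ^ 2 + w x * y + y ^ 2| := by rw [abs_mul, abs_neg]
          _ ≤ _ := mul_le_mul_of_nonneg_left h7 (abs_nonneg _)
      have h8 : |c| ^ 2 = c ^ 2 := sq_abs c
      -- Young's inequality 3/2·|c|w² ≤ w⁴/4 + 9/4·c², for w and for y. Half of the integral of w⁴
      -- is absorbed on the left, which turns 9/2 into 9.
      nlinarith [sq_nonneg (w x ^ 2 - 3 * |c|), sq_nonneg (y ^ 2 - 3 * |c|)]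
  have i5 : Integrable fun x => 4⁻¹ * w x ^ 4 + 4⁻¹ * w (x + -v) ^ 4 :=
    (i4.const_mul _).add (i4'.const_mul _)
  rw [integral_add i5 (hz.const_mul _),
    integral_add (i4.const_mul _) (i4'.const_mul _), integral_const_mul, integral_const_mul,
    integral_const_mul, e4, ez] at hle
  linarith

theorem LpLe.integral_sq_le {f : E3 → ℝ} {K : ℝ} (h : LpLe 2 f K) : ∫ x, f x ^ 2 ≤ K ^ 2 := by
  have := h.abs_integral_mul_le h
  simp only [← pow_two] at this
  exact (le_abs_self _).trans this

theorem LpLe.of_integral_pow_four {f : E3 → ℝ} {K : ℝ} (hf : AEStronglyMeasurable f volume)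
    (hi : Integrable fun x => f x ^ 4) (hK : 0 ≤ K) (h : ∫ x, f x ^ 4 ≤ K ^ 4) : LpLe 4 f K := by
  refine ⟨hf, ?_, hK⟩
  have hm : MemLp f 4 volume := by
    rw [← integrable_norm_rpow_iff hf (by norm_num) (by norm_num)]
    refine hi.congr (Eventually.of_forall fun x => ?_)
    simp only [ENNReal.toReal_ofNat]
    rw [show (4 : ℝ) = ((4 : ℕ) : ℝ) by norm_num, Real.rpow_natCast, Real.norm_eq_abs,
      Even.pow_abs (by decide)]
  rw [hm.eLpNorm_eq_integral_rpow_norm (by norm_num) (by norm_num)]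
  refine ENNReal.ofReal_le_ofReal ?_
  simp only [ENNReal.toReal_ofNat]
  have e : ∫ x, ‖f x‖ ^ (4 : ℝ) = ∫ x, f x ^ 4 := by
    refine integral_congr_ae (Eventually.of_forall fun x => ?_)
    simp only
    rw [show (4 : ℝ) = ((4 : ℕ) : ℝ) by norm_num, Real.rpow_natCast, Real.norm_eq_abs,
      Even.pow_abs (by decide)]
  rw [e]
  calc (∫ x, f x ^ 4) ^ (4 : ℝ)⁻¹ ≤ (K ^ 4) ^ (4 : ℝ)⁻¹ :=
        Real.rpow_le_rpow (integral_nonneg fun x => by positivity) h (by norm_num)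
    _ = K := by
        rw [← Real.rpow_natCast, ← Real.rpow_mul hK]; norm_num

theorem LpLe.fd_four {i : Fin 3} {h : ℝ} (hh : 0 < h) {a : E3 → ℝ} {K N M : ℝ}
    (ha : LpLe ∞ a K) (h1 : MemLp (fd i h a) 2 volume) (h2 : LpLe 2 (fd i h (fd i h a)) N)
    (hM : 0 ≤ M) (hKN : 3 * K * N ≤ M ^ 2) : LpLe 4 (fd i h a) M := by
  obtain ⟨h3, h4⟩ := integral_fd_pow_four_le hh ha.meas ha.ae_abs_le h1 h2.memLp
  refine LpLe.of_integral_pow_four h1.1 h3 hM (h4.trans ?_)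
  calc 9 * K ^ 2 * ∫ x, fd i h (fd i h a) x ^ 2 ≤ 9 * K ^ 2 * N ^ 2 :=
        mul_le_mul_of_nonneg_left h2.integral_sq_le (by positivity)
    _ = (3 * K * N) ^ 2 := by ring
    _ ≤ (M ^ 2) ^ 2 := pow_le_pow_left₀
        (mul_nonneg (mul_nonneg (by norm_num) ha.nonneg) h2.nonneg) hKN 2
    _ = _ := by ring

/-- Bounds on a function and its differences of the type satisfied by first derivatives of
`H³` functions. -/
structure DCoef (K : ℝ) (f : E3 → ℝ) : Prop where
  bound : LpLe ∞ f K
  l2 : LpLe 2 f K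
  d2 : ∀ i h, 0 < h → LpLe 2 (fd i h f) K
  d4 : ∀ i h, 0 < h → LpLe 4 (fd i h f) K
  dd2 : ∀ i h, 0 < h → LpLe 2 (fd i h (fd i h f)) K

/-- Bounds on a function and its differences of the type satisfied by `H³` functions. -/
structure Coef (K : ℝ) (f : E3 → ℝ) : Prop extends DCoef K f where
  dbound : ∀ i h, 0 < h → LpLe ∞ (fd i h f) K
  dd4 : ∀ i h, 0 < h → LpLe 4 (fd i h (fd i h f)) K
  ddd2 : ∀ i h, 0 < h → LpLe 2 (fd i h (fd i h (fd i h f))) K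

theorem DCoef.nonneg {K : ℝ} {f : E3 → ℝ} (h : DCoef K f) : 0 ≤ K := h.bound.nonneg

theorem DCoef.mono {K K' : ℝ} {f : E3 → ℝ} (h : DCoef K f) (hK : K ≤ K') : DCoef K' f :=
  ⟨h.bound.mono hK, h.l2.mono hK, fun i t ht => (h.d2 i t ht).mono hK,
    fun i t ht => (h.d4 i t ht).mono hK, fun i t ht => (h.dd2 i t ht).mono hK⟩

theorem Coef.mono {K K' : ℝ} {f : E3 → ℝ} (h : Coef K f) (hK : K ≤ K') : Coef K' f :=
  ⟨h.toDCoef.mono hK, fun i t ht => (h.dbound i t ht).mono hK,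
    fun i t ht => (h.dd4 i t ht).mono hK, fun i t ht => (h.ddd2 i t ht).mono hK⟩

theorem Coef.add {K K' : ℝ} {f g : E3 → ℝ} (hf : Coef K f) (hg : Coef K' g) :
    Coef (K + K') (fun x => f x + g x) := by
  have e1 : ∀ i t (f g : E3 → ℝ), fd i t (fun x => f x + g x) = fun x => fd i t f x + fd i t g x :=
    fun i t f g => by funext x; simp only [fd]; ring
  have e1' : ∀ i t, fd i t (fun x => f x + g x) = fun x => fd i t f x + fd i t g x :=
    fun i t => e1 i t f g
  refine ⟨⟨hf.bound.add hg.bound, hf.l2.add hg.l2, ?_, ?_, ?_⟩, ?_, ?_, ?_⟩ <;> intro i t ht <;>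
    simp only [e1]
  exacts [(hf.d2 i t ht).add (hg.d2 i t ht), (hf.d4 i t ht).add (hg.d4 i t ht),
    (hf.dd2 i t ht).add (hg.dd2 i t ht), (hf.dbound i t ht).add (hg.dbound i t ht),
    (hf.dd4 i t ht).add (hg.dd4 i t ht), (hf.ddd2 i t ht).add (hg.ddd2 i t ht)]

theorem Coef.const_mul {K : ℝ} {f : E3 → ℝ} (c : ℝ) (hf : Coef K f) :
    Coef (|c| * K) (fun x => c * f x) := by
  have e1 : ∀ i t (f : E3 → ℝ), fd i t (fun x => c * f x) = fun x => c * fd i t f x :=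
    fun i t f => by funext x; simp only [fd]; ring
  refine ⟨⟨hf.bound.const_mul c, hf.l2.const_mul c, ?_, ?_, ?_⟩, ?_, ?_, ?_⟩ <;> intro i t ht <;>
    simp only [e1]
  exacts [(hf.d2 i t ht).const_mul c, (hf.d4 i t ht).const_mul c,
    (hf.dd2 i t ht).const_mul c, (hf.dbound i t ht).const_mul c,
    (hf.dd4 i t ht).const_mul c, (hf.ddd2 i t ht).const_mul c]

/-- The commutator of a third difference with multiplication by a function. -/
theorem Coef.commutator {K K' : ℝ} {f g : E3 → ℝ} (hf : Coef K f) (hg : DCoef K' g) (i : Fin 3)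
    {h : ℝ} (hh : 0 < h) :
    LpLe 2 (fun x => fd i h (fd i h (fd i h (fun y => f y * g y))) x
      - f x * fd i h (fd i h (fd i h g)) x) (7 * K * K') := by
  -- The three terms are estimated as L^∞·L², L⁴·L⁴ and L²·L^∞. The binomial coefficients give 7 = 3
  -- + 3 + 1.
  have t1 := ((hf.dbound i h hh).mul (r := 2) ((hg.dd2 i h hh).comp_add (h • ev i))).const_mul 3
  have t2 := ((hf.dd4 i h hh).mul (r := 2)
    (((hg.d4 i h hh).comp_add (h • ev i)).comp_add (h • ev i))).const_mul 3
  have t3 := (hf.ddd2 i h hh).mul (r := 2)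
    (((hg.bound.comp_add (h • ev i)).comp_add (h • ev i)).comp_add (h • ev i))
  refine ((((t1.add t2).add t3).mono ?_).congr (Eventually.of_forall fun x => ?_))
  · rw [abs_of_pos (by norm_num : (0 : ℝ) < 3)]; linarith
  · simp only [fd_fd_fd_mul]; ring

theorem Coef.fd_fd_mul {K K' : ℝ} {f g : E3 → ℝ} (hf : Coef K f) (hg : DCoef K' g) (i : Fin 3)
    {h : ℝ} (hh : 0 < h) :
    LpLe 2 (fd i h (fd i h (fun y => f y * g y))) (4 * K * K') := by
  have t0 := hf.bound.mul (r := 2) (hg.dd2 i h hh)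
  have t1 := ((hf.dbound i h hh).mul (r := 2) ((hg.d2 i h hh).comp_add (h • ev i))).const_mul 2
  have t2 := (hf.dd2 i h hh).mul (r := 2)
    ((hg.bound.comp_add (h • ev i)).comp_add (h • ev i))
  rw [_root_.fd_fd_mul]
  refine ((t0.add t1).add t2).mono ?_
  rw [abs_of_pos (by norm_num : (0 : ℝ) < 2)]; linarith

theorem HatDeriv.lpLe_one {i : Fin 3} {f g : L2R3} (hfg : HatDeriv i 1 f g) {h K : ℝ}
    (hh : 0 < h) (hK : ‖g‖ ≤ K) : LpLe 2 (fd i h f) K := by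
  have := (hfg.norm_le hh.ne').trans hK
  rw [pow_one] at this
  exact (LpLe.of_norm_le _ this).congr (coeFn_dq i h f)

theorem HatDeriv.lpLe_two {i : Fin 3} {f g : L2R3} (hfg : HatDeriv i 2 f g) {h K : ℝ}
    (hh : 0 < h) (hK : ‖g‖ ≤ K) : LpLe 2 (fd i h (fd i h f)) K :=
  (LpLe.of_norm_le _ ((hfg.norm_le hh.ne').trans hK)).congr (coeFn_dq_two i h f)

theorem HatDeriv.lpLe_three {i : Fin 3} {f g : L2R3} (hfg : HatDeriv i 3 f g) {h K : ℝ}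
    (hh : 0 < h) (hK : ‖g‖ ≤ K) : LpLe 2 (fd i h (fd i h (fd i h f))) K :=
  (LpLe.of_norm_le _ ((hfg.norm_le hh.ne').trans hK)).congr (coeFn_dq_three i h f)

/-- The constant in the bounds of differences of Sobolev functions. -/
def coefConst : ℝ := 3 * supConst + 1

theorem one_le_coefConst : 1 ≤ coefConst := by
  have := one_le_supConst; unfold coefConst; linarith

theorem supConst_le_coefConst : supConst ≤ coefConst := by
  have := one_le_supConst; unfold coefConst; linarith

theorem Hm.dCoef (v : Hm 2) : DCoef (coefConst * ‖v‖) v.fn := by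
  have hS := one_le_supConst
  have hv := norm_nonneg v
  have h1 : ‖v‖ ≤ coefConst * ‖v‖ := le_mul_of_one_le_left hv one_le_coefConst
  have hb : LpLe ∞ v.fn (supConst * ‖v‖) :=
    LpLe.of_ae_abs_le (Lp.memLp v.fn).1 (by positivity) v.abs_fn_le
  refine ⟨hb.mono (mul_le_mul_of_nonneg_right supConst_le_coefConst hv),
    LpLe.of_norm_le _ (v.norm_fn_le.trans h1),
    fun i h hh => (v.hatDeriv_one i).lpLe_one hh ((v.norm_proj_le _).trans h1),
    fun i h hh => ?_, fun i h hh => (v.hatDeriv_two i).lpLe_two hh ((v.norm_proj_le _).trans h1)⟩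
  refine LpLe.fd_four hh hb ((v.hatDeriv_one i).lpLe_one hh (v.norm_proj_le _)).memLp
    ((v.hatDeriv_two i).lpLe_two hh (v.norm_proj_le _))
    (by have := one_le_coefConst; positivity) ?_
  rw [coefConst, mul_pow]
  nlinarith [sq_nonneg ‖v‖, sq_nonneg supConst, mul_nonneg (by linarith : 0 ≤ supConst) (sq_nonneg ‖v‖),
    mul_nonneg (sq_nonneg supConst) (sq_nonneg ‖v‖)]

theorem Hm.norm_incl_le {m : ℕ} (f : Hm (m + 1)) : ‖f.incl‖ ≤ ‖f‖ := by
  refine le_of_sq_le_sq ?_ (norm_nonneg _)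
  rw [norm_sq_eq, norm_sq_eq]
  let e : multiIndices m → multiIndices (m + 1) := fun α =>
    ⟨α.1, mem_multiIndices.2 ((mem_multiIndices.1 α.2).trans (Nat.le_succ m))⟩
  have he : Function.Injective e := fun α β h => Subtype.ext (congrArg Subtype.val h :)
  calc ∑ α, ‖f.incl.1 α‖ ^ 2 = ∑ α, ‖f.1 (e α)‖ ^ 2 := rfl
    _ = ∑ β ∈ Finset.univ.image e, ‖f.1 β‖ ^ 2 := by
      rw [Finset.sum_image fun a _ b _ h => he h]
    _ ≤ ∑ β, ‖f.1 β‖ ^ 2 :=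
      Finset.sum_le_sum_of_subset_of_nonneg (Finset.subset_univ _) fun _ _ _ => by positivity

/-- The transform of the difference quotient is dominated by that of the derivative, an H² function,
so the embedding gives a Lipschitz bound independent of the step without invoking a mean value
theorem for Sobolev functions. -/
theorem Hm.dbound (f : Hm 3) (i : Fin 3) {h : ℝ} (hh : 0 < h) :
    LpLe ∞ (fd i h f.fn) (supConst * ‖f.deriv i‖) := by
  have hS := one_le_supConst
  have := abs_le_of_norm_hat_le (f.deriv i) (dq i h f.fn) (by
    simpa using (f.hatDeriv_one i).norm_hat_le hh.ne')
  exact (LpLe.of_ae_abs_le (Lp.memLp _).1 (by positivity) this).congr (coeFn_dq i h f.fn)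

theorem Hm.coef (f : Hm 3) : Coef (coefConst * ‖f‖) f.fn := by
  have hS := one_le_supConst
  have hv := norm_nonneg f
  have hd : ∀ i h, 0 < h → LpLe ∞ (fd i h f.fn) (supConst * ‖f‖) := fun i h hh =>
    (f.dbound i hh).mono (mul_le_mul_of_nonneg_left (f.norm_deriv_le i) (by linarith))
  refine ⟨(f.incl.dCoef.mono (mul_le_mul_of_nonneg_left f.norm_incl_le
      (by have := one_le_coefConst; linarith))),
    fun i h hh => (hd i h hh).mono (mul_le_mul_of_nonneg_right supConst_le_coefConst hv),
    fun i h hh => ?_, fun i h hh => (f.hatDeriv_three i).lpLe_three hh ((f.norm_proj_le _).trans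
      (le_mul_of_one_le_left hv one_le_coefConst))⟩
  refine LpLe.fd_four hh (hd i h hh) ((f.hatDeriv_two i).lpLe_two hh (f.norm_proj_le _)).memLp
    ((f.hatDeriv_three i).lpLe_three hh (f.norm_proj_le _))
    (by have := one_le_coefConst; positivity) ?_
  rw [coefConst, mul_pow]
  nlinarith [sq_nonneg ‖f‖, sq_nonneg supConst, mul_nonneg (by linarith : 0 ≤ supConst) (sq_nonneg ‖f‖),
    mul_nonneg (sq_nonneg supConst) (sq_nonneg ‖f‖)]

end


/-! ### Composition with smooth functions -/

noncomputable section

open Filter Topology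
open scoped ENNReal

theorem abs_sub_le_of_hasDerivAt {Φ Φ' : ℝ → ℝ} {r C : ℝ}
    (h1 : ∀ x ∈ Icc (-r) r, HasDerivAt Φ (Φ' x) x) (b1 : ∀ x ∈ Icc (-r) r, |Φ' x| ≤ C)
    {a b : ℝ} (ha : a ∈ Icc (-r) r) (hb : b ∈ Icc (-r) r) : |Φ b - Φ a| ≤ C * |b - a| :=
  (convex_Icc (-r) r).norm_image_sub_le_of_norm_hasDerivWithin_le
    (fun x hx => (h1 x hx).hasDerivWithinAt) b1 ha hb

theorem hasDerivAt_comp_segment {Φ Φ' : ℝ → ℝ} {r : ℝ}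
    (h1 : ∀ x ∈ Icc (-r) r, HasDerivAt Φ (Φ' x) x) {a b t : ℝ} (ha : a ∈ Icc (-r) r)
    (hb : b ∈ Icc (-r) r) (ht : t ∈ Icc (0 : ℝ) 1) :
    HasDerivAt (fun t => Φ (a + t * (b - a))) (Φ' (a + t * (b - a)) * (b - a)) t := by
  have hm : a + t * (b - a) ∈ Icc (-r) r := by
    have := (convex_Icc (-r) r) ha hb (sub_nonneg.2 ht.2) ht.1 (by ring)
    simp only [smul_eq_mul] at this
    convert this using 1; ring
  have h2 : HasDerivAt (fun t => a + t * (b - a)) (b - a) t := by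
    simpa using ((hasDerivAt_id t).mul_const (b - a)).const_add a
  exact (h1 _ hm).comp t h2

theorem segment_mem {r a b t : ℝ} (ha : a ∈ Icc (-r) r) (hb : b ∈ Icc (-r) r)
    (ht : t ∈ Icc (0 : ℝ) 1) : a + t * (b - a) ∈ Icc (-r) r := by
  have := (convex_Icc (-r) r) ha hb (sub_nonneg.2 ht.2) ht.1 (by ring)
  simp only [smul_eq_mul] at this
  convert this using 1; ring

theorem abs_convex_comb_le {x y t : ℝ} (ht : t ∈ Icc (0 : ℝ) 1) :
    |(1 - t) * x + t * y| ≤ |x| + |y| := by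
  refine (abs_add_le _ _).trans ?_
  rw [abs_mul, abs_mul, abs_of_nonneg (sub_nonneg.2 ht.2), abs_of_nonneg ht.1]
  have := abs_nonneg x; have := abs_nonneg y
  nlinarith [ht.1, ht.2]

/-- The second difference is the increment over [0,1] of t ↦ Φ(a₁+t(a₂-a₁)) - Φ(a₀+t(a₁-a₀)), to
which the mean value inequality applies. -/
theorem abs_second_diff_le {Φ Φ1 Φ2 : ℝ → ℝ} {r C : ℝ}
    (h1 : ∀ x ∈ Icc (-r) r, HasDerivAt Φ (Φ1 x) x) (h2 : ∀ x ∈ Icc (-r) r, HasDerivAt Φ1 (Φ2 x) x)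
    (b1 : ∀ x ∈ Icc (-r) r, |Φ1 x| ≤ C) (b2 : ∀ x ∈ Icc (-r) r, |Φ2 x| ≤ C)
    {a0 a1 a2 : ℝ} (m0 : a0 ∈ Icc (-r) r) (m1 : a1 ∈ Icc (-r) r) (m2 : a2 ∈ Icc (-r) r) :
    |Φ a2 - 2 * Φ a1 + Φ a0|
      ≤ C * (|a2 - 2 * a1 + a0| + |a1 - a0| * (|a1 - a0| + |a2 - a1|)) := by
  have hC : 0 ≤ C := (abs_nonneg _).trans (b1 a0 m0)
  have key := norm_image_sub_le_of_norm_deriv_le_segment_01'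
    (f := fun t => Φ (a1 + t * (a2 - a1)) - Φ (a0 + t * (a1 - a0)))
    (f' := fun t => Φ1 (a1 + t * (a2 - a1)) * (a2 - a1) - Φ1 (a0 + t * (a1 - a0)) * (a1 - a0))
    (C := C * (|a2 - 2 * a1 + a0| + |a1 - a0| * (|a1 - a0| + |a2 - a1|)))
    (fun t ht => ((hasDerivAt_comp_segment h1 m1 m2 ht).sub
      (hasDerivAt_comp_segment h1 m0 m1 ht)).hasDerivWithinAt) (fun t ht => ?_)
  · simp only [Real.norm_eq_abs] at key
    convert key using 2
    ring_nf
  · have ht' : t ∈ Icc (0 : ℝ) 1 := Ico_subset_Icc_self ht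
    set A := a1 + t * (a2 - a1) with hA
    set B := a0 + t * (a1 - a0) with hB
    have mA : A ∈ Icc (-r) r := segment_mem m1 m2 ht'
    have mB : B ∈ Icc (-r) r := segment_mem m0 m1 ht'
    have e : Φ1 A * (a2 - a1) - Φ1 B * (a1 - a0)
        = Φ1 A * (a2 - 2 * a1 + a0) + (Φ1 A - Φ1 B) * (a1 - a0) := by ring
    have e2 : |A - B| ≤ |a1 - a0| + |a2 - a1| := by
      have : A - B = (1 - t) * (a1 - a0) + t * (a2 - a1) := by rw [hA, hB]; ring
      rw [this]; exact abs_convex_comb_le ht'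
    have e3 := abs_sub_le_of_hasDerivAt h2 b2 mB mA
    rw [Real.norm_eq_abs, e]
    refine (abs_add_le _ _).trans ?_
    rw [abs_mul, abs_mul, mul_add]
    refine add_le_add (mul_le_mul_of_nonneg_right (b1 A mA) (abs_nonneg _)) ?_
    calc |Φ1 A - Φ1 B| * |a1 - a0| ≤ C * (|a1 - a0| + |a2 - a1|) * |a1 - a0| := by
          refine mul_le_mul_of_nonneg_right (e3.trans ?_) (abs_nonneg _)
          exact mul_le_mul_of_nonneg_left e2 hC
      _ = _ := by ring

/-- The same interpolation one order higher: the derivative in t contains a second difference of Φ'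
along the interpolated points, controlled by `abs_second_diff_le`. The bound keeps the differences
of the arguments separate, so each can be measured in its own norm. -/
theorem abs_third_diff_le {Φ Φ1 Φ2 Φ3 : ℝ → ℝ} {r C : ℝ}
    (h1 : ∀ x ∈ Icc (-r) r, HasDerivAt Φ (Φ1 x) x) (h2 : ∀ x ∈ Icc (-r) r, HasDerivAt Φ1 (Φ2 x) x)
    (h3 : ∀ x ∈ Icc (-r) r, HasDerivAt Φ2 (Φ3 x) x)
    (b1 : ∀ x ∈ Icc (-r) r, |Φ1 x| ≤ C) (b2 : ∀ x ∈ Icc (-r) r, |Φ2 x| ≤ C)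
    (b3 : ∀ x ∈ Icc (-r) r, |Φ3 x| ≤ C)
    {a0 a1 a2 a3 L : ℝ} (m0 : a0 ∈ Icc (-r) r) (m1 : a1 ∈ Icc (-r) r) (m2 : a2 ∈ Icc (-r) r)
    (m3 : a3 ∈ Icc (-r) r) (l0 : |a1 - a0| ≤ L) (l1 : |a2 - a1| ≤ L) (l2 : |a3 - a2| ≤ L) :
    |Φ a3 - 3 * Φ a2 + 3 * Φ a1 - Φ a0|
      ≤ C * (|a3 - 3 * a2 + 3 * a1 - a0| + L * |a2 - 2 * a1 + a0|
        + 5 * L * |a3 - 2 * a2 + a1| + 8 * L ^ 2 * |a3 - a2|) := by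
  have hC : 0 ≤ C := (abs_nonneg _).trans (b1 a0 m0)
  have hL : 0 ≤ L := (abs_nonneg _).trans l0
  have key := norm_image_sub_le_of_norm_deriv_le_segment_01'
    (f := fun t => Φ (a2 + t * (a3 - a2)) - 2 * Φ (a1 + t * (a2 - a1)) + Φ (a0 + t * (a1 - a0)))
    (f' := fun t => Φ1 (a2 + t * (a3 - a2)) * (a3 - a2) - 2 * (Φ1 (a1 + t * (a2 - a1)) * (a2 - a1))
      + Φ1 (a0 + t * (a1 - a0)) * (a1 - a0))
    (C := C * (|a3 - 3 * a2 + 3 * a1 - a0| + L * |a2 - 2 * a1 + a0|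
        + 5 * L * |a3 - 2 * a2 + a1| + 8 * L ^ 2 * |a3 - a2|))
    (fun t ht => (((hasDerivAt_comp_segment h1 m2 m3 ht).sub
      ((hasDerivAt_comp_segment h1 m1 m2 ht).const_mul 2)).add
      (hasDerivAt_comp_segment h1 m0 m1 ht)).hasDerivWithinAt) (fun t ht => ?_)
  · simp only [Real.norm_eq_abs] at key
    convert key using 2
    ring_nf
  · have ht' : t ∈ Icc (0 : ℝ) 1 := Ico_subset_Icc_self ht
    set A2 := a2 + t * (a3 - a2) with hA2
    set A1 := a1 + t * (a2 - a1) with hA1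
    set A0 := a0 + t * (a1 - a0) with hA0
    have mA2 : A2 ∈ Icc (-r) r := segment_mem m2 m3 ht'
    have mA1 : A1 ∈ Icc (-r) r := segment_mem m1 m2 ht'
    have mA0 : A0 ∈ Icc (-r) r := segment_mem m0 m1 ht'
    have d0 : |A1 - A0| ≤ 2 * L := by
      have : A1 - A0 = (1 - t) * (a1 - a0) + t * (a2 - a1) := by rw [hA1, hA0]; ring
      rw [this]; exact (abs_convex_comb_le ht').trans (by linarith)
    have d1 : |A2 - A1| ≤ 2 * L := by
      have : A2 - A1 = (1 - t) * (a2 - a1) + t * (a3 - a2) := by rw [hA2, hA1]; ring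
      rw [this]; exact (abs_convex_comb_le ht').trans (by linarith)
    have dd : |A2 - 2 * A1 + A0| ≤ |a2 - 2 * a1 + a0| + |a3 - 2 * a2 + a1| := by
      have : A2 - 2 * A1 + A0 = (1 - t) * (a2 - 2 * a1 + a0) + t * (a3 - 2 * a2 + a1) := by
        rw [hA2, hA1, hA0]; ring
      rw [this]; exact abs_convex_comb_le ht'
    have e : Φ1 A2 * (a3 - a2) - 2 * (Φ1 A1 * (a2 - a1)) + Φ1 A0 * (a1 - a0)
        = Φ1 A0 * (a3 - 3 * a2 + 3 * a1 - a0) + 2 * ((Φ1 A1 - Φ1 A0) * (a3 - 2 * a2 + a1))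
          + (Φ1 A2 - 2 * Φ1 A1 + Φ1 A0) * (a3 - a2) := by ring
    have f1 := abs_sub_le_of_hasDerivAt h2 b2 mA0 mA1
    have f2 := abs_second_diff_le h2 h3 b2 b3 mA0 mA1 mA2
    rw [Real.norm_eq_abs, e]
    refine (abs_add_three _ _ _).trans ?_
    rw [abs_mul, abs_mul, abs_mul, abs_mul, abs_two]
    have g1 : |Φ1 A0| * |a3 - 3 * a2 + 3 * a1 - a0| ≤ C * |a3 - 3 * a2 + 3 * a1 - a0| :=
      mul_le_mul_of_nonneg_right (b1 A0 mA0) (abs_nonneg _)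
    have g2 : |Φ1 A1 - Φ1 A0| * |a3 - 2 * a2 + a1| ≤ C * (2 * L) * |a3 - 2 * a2 + a1| :=
      mul_le_mul_of_nonneg_right (f1.trans (mul_le_mul_of_nonneg_left d0 hC)) (abs_nonneg _)
    have g3 : |Φ1 A2 - 2 * Φ1 A1 + Φ1 A0| * |a3 - a2|
        ≤ C * (L * |a2 - 2 * a1 + a0| + L * |a3 - 2 * a2 + a1| + 8 * L ^ 2 * |a3 - a2|) := by
      have g4 : |A1 - A0| * (|A1 - A0| + |A2 - A1|) ≤ 8 * L ^ 2 := by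
        calc _ ≤ 2 * L * (2 * L + 2 * L) := by
              refine mul_le_mul d0 (add_le_add d0 d1) (by positivity) (by positivity)
          _ = _ := by ring
      calc _ ≤ C * ((|a2 - 2 * a1 + a0| + |a3 - 2 * a2 + a1|) + 8 * L ^ 2) * |a3 - a2| := by
            refine mul_le_mul_of_nonneg_right (f2.trans ?_) (abs_nonneg _)
            exact mul_le_mul_of_nonneg_left (add_le_add dd g4) hC
        _ = C * ((|a2 - 2 * a1 + a0| + |a3 - 2 * a2 + a1|) * |a3 - a2| + 8 * L ^ 2 * |a3 - a2|) := by
            ring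
        _ ≤ C * ((|a2 - 2 * a1 + a0| + |a3 - 2 * a2 + a1|) * L + 8 * L ^ 2 * |a3 - a2|) := by
            gcongr
        _ = _ := by ring
    linarith

/-- Composition of a `C³` function vanishing at `0` with a function that has bounded
differences. -/
theorem Coef.comp {Φ Φ1 Φ2 Φ3 : ℝ → ℝ} {r C : ℝ} (hm : Measurable Φ) (h0 : Φ 0 = 0)
    (h1 : ∀ x ∈ Icc (-r) r, HasDerivAt Φ (Φ1 x) x) (h2 : ∀ x ∈ Icc (-r) r, HasDerivAt Φ1 (Φ2 x) x)
    (h3 : ∀ x ∈ Icc (-r) r, HasDerivAt Φ2 (Φ3 x) x)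
    (b1 : ∀ x ∈ Icc (-r) r, |Φ1 x| ≤ C) (b2 : ∀ x ∈ Icc (-r) r, |Φ2 x| ≤ C)
    (b3 : ∀ x ∈ Icc (-r) r, |Φ3 x| ≤ C) {K : ℝ} {f : E3 → ℝ} (hf : Coef K f) (hr : K ≤ r)
    (hK1 : K ≤ 1) : Coef (15 * C * K) (fun x => Φ (f x)) := by
  have hK := hf.nonneg
  have z : (0 : ℝ) ∈ Icc (-r) r := ⟨by linarith, by linarith⟩
  have hC : 0 ≤ C := (abs_nonneg _).trans (b1 0 z)
  have hCK : C * K ≤ 15 * C * K := by nlinarith [mul_nonneg hC hK]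
  have meas : AEStronglyMeasurable (fun x => Φ (f x)) volume :=
    (hm.comp_aemeasurable hf.bound.meas.aemeasurable).aestronglyMeasurable
  have mem : ∀ᵐ x, f x ∈ Icc (-r) r := by
    filter_upwards [hf.bound.ae_abs_le] with x hx
    exact abs_le.1 (hx.trans hr)
  have p0 : ∀ᵐ x, |Φ (f x)| ≤ C * |f x| := by
    filter_upwards [mem] with x hx
    have := abs_sub_le_of_hasDerivAt h1 b1 z hx
    simpa [h0] using this
  have p1 : ∀ i h, 0 < h → ∀ᵐ x, |fd i h (fun x => Φ (f x)) x| ≤ C * |fd i h f x| := by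
    intro i h hh
    filter_upwards [mem, ae_comp_add (h • ev i) mem] with x m0 m1
    have := abs_sub_le_of_hasDerivAt h1 b1 m0 m1
    simp only [fd]
    rw [abs_mul, abs_mul, mul_left_comm]
    exact mul_le_mul_of_nonneg_left this (abs_nonneg _)
  -- Increments of `f` are at most hK. In the products of differences all factors but one are
  -- bounded in this way, and the powers of h cancel.
  have lip : ∀ i h, 0 < h → ∀ᵐ x, |f (x + h • ev i) - f x| ≤ h * K := by
    intro i h hh
    filter_upwards [(hf.dbound i h hh).ae_abs_le] with x hx
    rw [fd, abs_mul, abs_of_pos (inv_pos.2 hh), inv_mul_le_iff₀ hh] at hx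
    exact hx
  have m1 := fun i h => aestronglyMeasurable_fd i h meas
  have m2 := fun i h => aestronglyMeasurable_fd i h (m1 i h)
  have m3 := fun i h => aestronglyMeasurable_fd i h (m2 i h)
  have p2 : ∀ i h, 0 < h → ∀ᵐ x, |fd i h (fd i h (fun x => Φ (f x))) x|
      ≤ C * |(|fd i h (fd i h f) x| + 2 * K * |fd i h f x|)| := by
    intro i h hh
    have l1 := lip i h hh
    filter_upwards [mem, ae_comp_add (h • ev i) mem,
      ae_comp_add (h • ev i) (ae_comp_add (h • ev i) mem), l1, ae_comp_add (h • ev i) l1]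
      with x m0 m1 m2 k0 k1
    have := abs_second_diff_le h1 h2 b1 b2 m0 m1 m2
    set a0 := f x
    set a1 := f (x + h • ev i)
    set a2 := f (x + h • ev i + h • ev i)
    have e1 : fd i h (fd i h (fun x => Φ (f x))) x = h⁻¹ ^ 2 * (Φ a2 - 2 * Φ a1 + Φ a0) := by
      simp only [fd, a0, a1, a2]; ring
    have e2 : fd i h (fd i h f) x = h⁻¹ ^ 2 * (a2 - 2 * a1 + a0) := by
      simp only [fd, a0, a1, a2]; ring
    have e3 : fd i h f x = h⁻¹ * (a1 - a0) := rfl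
    have hi := inv_pos.2 hh
    refine le_trans ?_ (mul_le_mul_of_nonneg_left (le_abs_self _) hC)
    rw [e1, e2, e3, abs_mul, abs_mul, abs_mul, abs_of_pos (pow_pos hi 2), abs_of_pos hi]
    have e4 : |a1 - a0| * (|a1 - a0| + |a2 - a1|) ≤ |a1 - a0| * (2 * (h * K)) :=
      mul_le_mul_of_nonneg_left (by linarith) (abs_nonneg _)
    calc h⁻¹ ^ 2 * |Φ a2 - 2 * Φ a1 + Φ a0|
        ≤ h⁻¹ ^ 2 * (C * (|a2 - 2 * a1 + a0| + |a1 - a0| * (2 * (h * K)))) := by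
          refine mul_le_mul_of_nonneg_left (this.trans ?_) (by positivity)
          exact mul_le_mul_of_nonneg_left (by linarith) hC
      _ = C * (h⁻¹ ^ 2 * |a2 - 2 * a1 + a0| + 2 * K * (h⁻¹ * |a1 - a0|)) := by
          field_simp
  have p3 : ∀ i h, 0 < h → ∀ᵐ x, |fd i h (fd i h (fd i h (fun x => Φ (f x)))) x|
      ≤ C * |(|fd i h (fd i h (fd i h f)) x| + K * |fd i h (fd i h f) x|
        + 5 * K * |fd i h (fd i h f) (x + h • ev i)|
        + 8 * K ^ 2 * |fd i h f (x + h • ev i + h • ev i)|)| := by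
    intro i h hh
    have l1 := lip i h hh
    have l2 := ae_comp_add (h • ev i) l1
    have n1 := ae_comp_add (h • ev i) mem
    have n2 := ae_comp_add (h • ev i) n1
    filter_upwards [mem, n1, n2, ae_comp_add (h • ev i) n2, l1, l2, ae_comp_add (h • ev i) l2]
      with x m0 m1 m2 m3 k0 k1 k2
    have := abs_third_diff_le h1 h2 h3 b1 b2 b3 m0 m1 m2 m3 k0 k1 k2
    set a0 := f x
    set a1 := f (x + h • ev i)
    set a2 := f (x + h • ev i + h • ev i)
    set a3 := f (x + h • ev i + h • ev i + h • ev i)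
    have e1 : fd i h (fd i h (fd i h (fun x => Φ (f x)))) x
        = h⁻¹ ^ 3 * (Φ a3 - 3 * Φ a2 + 3 * Φ a1 - Φ a0) := by
      simp only [fd, a0, a1, a2, a3]; ring
    have e2 : fd i h (fd i h (fd i h f)) x = h⁻¹ ^ 3 * (a3 - 3 * a2 + 3 * a1 - a0) := by
      simp only [fd, a0, a1, a2, a3]; ring
    have e3 : fd i h (fd i h f) x = h⁻¹ ^ 2 * (a2 - 2 * a1 + a0) := by
      simp only [fd, a0, a1, a2]; ring
    have e4 : fd i h (fd i h f) (x + h • ev i) = h⁻¹ ^ 2 * (a3 - 2 * a2 + a1) := by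
      simp only [fd, a3, a1, a2]; ring
    have e5 : fd i h f (x + h • ev i + h • ev i) = h⁻¹ * (a3 - a2) := rfl
    have hi := inv_pos.2 hh
    refine le_trans ?_ (mul_le_mul_of_nonneg_left (le_abs_self _) hC)
    rw [e1, e2, e3, e4, e5, abs_mul, abs_mul, abs_mul, abs_mul, abs_mul, abs_of_pos (pow_pos hi 2),
      abs_of_pos (pow_pos hi 3), abs_of_pos hi]
    refine (mul_le_mul_of_nonneg_left this (by positivity)).trans (le_of_eq ?_)
    field_simp
  have q3 : ∀ i h, 0 < h → LpLe 2 (fd i h (fd i h (fd i h (fun x => Φ (f x))))) (15 * C * K) := by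
    intro i h hh
    have s1 := (hf.ddd2 i h hh).abs
    have s2 := (hf.dd2 i h hh).abs.const_mul K
    have s3 := ((hf.dd2 i h hh).comp_add (h • ev i)).abs.const_mul (5 * K)
    have s4 := (((hf.d2 i h hh).comp_add (h • ev i)).comp_add (h • ev i)).abs.const_mul (8 * K ^ 2)
    refine (LpLe.of_ae_le (m3 i h) (((s1.add s2).add s3).add s4) hC (p3 i h hh)).mono ?_
    rw [abs_of_nonneg hK, abs_of_nonneg (by positivity), abs_of_nonneg (by positivity)]
    have u1 : K * K ≤ K := by nlinarith
    have u2 : K ^ 2 * K ≤ K := by nlinarith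
    -- 15 = 1 + 1 + 5 + 8. The assumption K ≤ 1 makes the estimate linear in K, so that small
    -- functions have small compositions.
    have : K + K * K + 5 * K * K + 8 * K ^ 2 * K ≤ 15 * K := by nlinarith
    calc C * (K + K * K + 5 * K * K + 8 * K ^ 2 * K) ≤ C * (15 * K) :=
          mul_le_mul_of_nonneg_left this hC
      _ = _ := by ring
  have q2 : ∀ (p : ℝ≥0∞) [Fact (1 ≤ p)] i h, 0 < h → LpLe p (fd i h (fd i h f)) K →
      LpLe p (fd i h f) K → LpLe p (fd i h (fd i h (fun x => Φ (f x)))) (15 * C * K) := by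
    intro p _ i h hh s1 s2
    refine (LpLe.of_ae_le (m2 i h) (s1.abs.add (s2.abs.const_mul (2 * K))) hC (p2 i h hh)).mono ?_
    rw [abs_of_nonneg (by positivity)]
    have u1 : K * K ≤ K := by nlinarith
    have : K + 2 * K * K ≤ 15 * K := by nlinarith
    calc C * (K + 2 * K * K) ≤ C * (15 * K) := mul_le_mul_of_nonneg_left this hC
      _ = _ := by ring
  exact ⟨⟨(LpLe.of_ae_le meas hf.bound hC p0).mono hCK, (LpLe.of_ae_le meas hf.l2 hC p0).mono hCK,
    fun i h hh => (LpLe.of_ae_le (m1 i h) (hf.d2 i h hh) hC (p1 i h hh)).mono hCK,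
    fun i h hh => (LpLe.of_ae_le (m1 i h) (hf.d4 i h hh) hC (p1 i h hh)).mono hCK,
    fun i h hh => q2 2 i h hh (hf.dd2 i h hh) (hf.d2 i h hh)⟩,
    fun i h hh => (LpLe.of_ae_le (m1 i h) (hf.dbound i h hh) hC (p1 i h hh)).mono hCK,
    fun i h hh => q2 4 i h hh (hf.dd4 i h hh) (hf.d4 i h hh), q3⟩

end


/-! ### Multiplication operators and integration by parts -/

noncomputable section

open Filter Topology
open scoped ENNReal

theorem inner_L2_eq (f g : L2R3) : inner ℝ f g = ∫ x, f x * g x := by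
  rw [L2.inner_def]
  exact integral_congr_ae (Eventually.of_forall fun x => by simp [mul_comm])

theorem integrable_mul_L2 (f g : L2R3) : Integrable fun x => f x * g x :=
  (Lp.memLp f).integrable_mul (q := 2) (Lp.memLp g)

/-- Multiplication by a bounded function on `L²`. -/
def mulL {c : E3 → ℝ} {K : ℝ} (hc : LpLe ∞ c K) : L2R3 →L[ℝ] L2R3 :=
  LinearMap.mkContinuous
    { toFun := fun f => (hc.mul (r := 2) (LpLe.of_norm_le f le_rfl)).memLp.toLp _
      map_add' := fun f g => by
        rw [← MemLp.toLp_add]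
        refine MemLp.toLp_congr _ _ ?_
        filter_upwards [Lp.coeFn_add f g] with x hx
        rw [Pi.add_apply, hx, Pi.add_apply, mul_add]
      map_smul' := fun r f => by
        rw [RingHom.id_apply, ← MemLp.toLp_const_smul]
        refine MemLp.toLp_congr _ _ ?_
        filter_upwards [Lp.coeFn_smul r f] with x hx
        rw [Pi.smul_apply, hx, Pi.smul_apply, smul_eq_mul, smul_eq_mul, mul_left_comm] } K
    fun f => (hc.mul (r := 2) (LpLe.of_norm_le f le_rfl)).norm_toLp_le

theorem coeFn_mulL {c : E3 → ℝ} {K : ℝ} (hc : LpLe ∞ c K) (f : L2R3) :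
    mulL hc f =ᵐ[volume] fun x => c x * f x :=
  (hc.mul (r := 2) (LpLe.of_norm_le f le_rfl)).memLp.coeFn_toLp

theorem norm_mulL_le {c : E3 → ℝ} {K : ℝ} (hc : LpLe ∞ c K) (f : L2R3) :
    ‖mulL hc f‖ ≤ K * ‖f‖ :=
  (hc.mul (r := 2) (LpLe.of_norm_le f le_rfl)).norm_toLp_le

theorem inner_mulL {c : E3 → ℝ} {K : ℝ} (hc : LpLe ∞ c K) (f g : L2R3) :
    inner ℝ (mulL hc f) g = ∫ x, c x * (f x * g x) := by
  rw [inner_L2_eq]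
  refine integral_congr_ae ?_
  filter_upwards [coeFn_mulL hc f] with x hx
  rw [hx, mul_assoc]

theorem integrable_mul_mul {c : E3 → ℝ} {K : ℝ} (hc : LpLe ∞ c K) (f g : L2R3) :
    Integrable fun x => c x * (f x * g x) := by
  refine (integrable_mul_L2 (mulL hc f) g).congr ?_
  filter_upwards [coeFn_mulL hc f] with x hx
  rw [hx, mul_assoc]

/-- `w'` is the derivative of `w` in direction `j`, as a limit of difference quotients. -/
def HasDq (j : Fin 3) (w w' : L2R3) : Prop :=
  Tendsto (fun h => dq j h w) (𝓝[>] 0) (𝓝 w')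

theorem HatDeriv.hasDq {j : Fin 3} {f g : L2R3} (h : HatDeriv j 1 f g) : HasDq j f g := by
  simpa [HasDq] using h.tendsto

theorem Hm.hasDq {m : ℕ} (f : Hm (m + 1)) (j : Fin 3) : HasDq j f.fn (f.deriv j).fn :=
  (f.hatDeriv_one j).hasDq

theorem dq_pow_comm (i j : Fin 3) (h k : ℝ) (n : ℕ) (f : L2R3) :
    (dq i h ^ n) (dq j k f) = dq j k ((dq i h ^ n) f) := by
  induction n with
  | zero => rfl
  | succ n ih => rw [pow_succ', mul_apply_eq_comp, mul_apply_eq_comp, ih, dq_comm]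

/-- Differences commute with each other and are bounded for a fixed step. Hence third differences of
an H³ function still have L² derivatives, and integration by parts at top order needs no fourth
derivative. -/
theorem HasDq.dq_pow {j : Fin 3} {w w' : L2R3} (hw : HasDq j w w') (i : Fin 3) (h : ℝ) (n : ℕ) :
    HasDq j ((dq i h ^ n) w) ((dq i h ^ n) w') := by
  have := ((dq i h ^ n).continuous.tendsto w').comp hw
  exact this.congr fun k => dq_pow_comm i j h k n w

theorem HasDq.tendsto_tau {j : Fin 3} {w w' : L2R3} (hw : HasDq j w w') :
    Tendsto (fun h : ℝ => tau (h • ev j) w) (𝓝[>] 0) (𝓝 w) := by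
  have h0 : Tendsto (fun h : ℝ => h) (𝓝[>] 0) (𝓝 0) := tendsto_nhdsWithin_of_tendsto_nhds tendsto_id
  have h1 := (h0.smul hw).add_const w
  rw [zero_smul, zero_add] at h1
  refine h1.congr' ?_
  filter_upwards [self_mem_nhdsWithin] with h hh
  rw [dq_apply, smul_inv_smul₀ (ne_of_gt hh), sub_add_cancel]

/-- The limit of summation by parts, an exact identity because translations preserve the inner
product. -/
theorem HasDq.inner_eq {j : Fin 3} {w w' v v' : L2R3} (hw : HasDq j w w') (hv : HasDq j v v') :
    inner ℝ w v' = -inner ℝ w' v := by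
  have h1 : Tendsto (fun h => inner ℝ w (dq j h v) + inner ℝ (dq j h w) (tau (h • ev j) v))
      (𝓝[>] 0) (𝓝 (inner ℝ w v' + inner ℝ w' v)) :=
    (tendsto_const_nhds.inner hv).add (hw.inner hv.tendsto_tau)
  have h2 : ∀ h, inner ℝ w (dq j h v) + inner ℝ (dq j h w) (tau (h • ev j) v) = (0 : ℝ) := fun h => by
    simp only [dq_apply, real_inner_smul_left, real_inner_smul_right, inner_sub_left,
      inner_sub_right, LinearIsometry.inner_map_map]
    ring
  simp only [h2] at h1
  have := tendsto_nhds_unique h1 tendsto_const_nhds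
  linarith

/-- Integration by parts against a Lipschitz coefficient. -/
theorem HasDq.abs_integral_le {j : Fin 3} {w w' v v' : L2R3} (hw : HasDq j w w')
    (hv : HasDq j v v') {c : E3 → ℝ} {K M : ℝ} (hc : LpLe ∞ c K)
    (hM : ∀ h, 0 < h → LpLe ∞ (fd j h c) M) :
    |(∫ x, c x * (w x * v' x)) + ∫ x, c x * (w' x * v x)| ≤ M * (‖w‖ * ‖v‖) := by
  rw [← inner_mulL hc, ← inner_mulL hc]
  have h1 : Tendsto (fun h => inner ℝ (mulL hc w) (dq j h v)
      + inner ℝ (mulL hc (dq j h w)) (tau (h • ev j) v))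
      (𝓝[>] 0) (𝓝 (inner ℝ (mulL hc w) v' + inner ℝ (mulL hc w') v)) :=
    (tendsto_const_nhds.inner hv).add
      ((((mulL hc).continuous.tendsto _).comp hw).inner hv.tendsto_tau)
  refine le_of_tendsto h1.abs ?_
  filter_upwards [self_mem_nhdsWithin] with h hh
  have e1 : inner ℝ (mulL hc w) (dq j h v) + inner ℝ (mulL hc (dq j h w)) (tau (h • ev j) v)
      = h⁻¹ * (inner ℝ (mulL hc (tau (h • ev j) w)) (tau (h • ev j) v)
        - inner ℝ (mulL hc w) v) := by
    simp only [dq_apply, map_smul, map_sub, real_inner_smul_left, real_inner_smul_right,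
      inner_sub_left, inner_sub_right]
    ring
  have e2 : inner ℝ (mulL hc w) v
      = ∫ x, c (x + h • ev j) * (tau (h • ev j) w x * tau (h • ev j) v x) := by
    rw [inner_mulL, ← integral_add_right_eq_self (μ := volume) _ (h • ev j)]
    refine integral_congr_ae ?_
    filter_upwards [coeFn_tau (h • ev j) w, coeFn_tau (h • ev j) v] with x h1 h2
    rw [h1, h2]
  -- After the change of variables the differences of `w` and `v` cancel, and only the difference of
  -- the coefficient is left.
  have e3 : inner ℝ (mulL hc w) (dq j h v) + inner ℝ (mulL hc (dq j h w)) (tau (h • ev j) v)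
      = -∫ x, fd j h c x * (tau (h • ev j) w x * tau (h • ev j) v x) := by
    rw [e1, e2, inner_mulL, ← integral_sub (integrable_mul_mul hc _ _)
      (integrable_mul_mul (hc.comp_add (h • ev j)) _ _), ← integral_const_mul, ← integral_neg]
    refine integral_congr_ae (Eventually.of_forall fun x => ?_)
    simp only [fd]; ring
  rw [e3, abs_neg, ← inner_mulL (hM h hh)]
  refine (abs_real_inner_le_norm _ _).trans ?_
  refine (mul_le_mul_of_nonneg_right (norm_mulL_le _ _) (norm_nonneg _)).trans (le_of_eq ?_)
  rw [LinearIsometry.norm_map, LinearIsometry.norm_map, mul_assoc]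

/-- `∫ p² ∂_j u = -2 ∫ p ∂_j p u` for a Lipschitz function `p`. -/
theorem HasDq.integral_sq_mul {j : Fin 3} {p p' u u' : L2R3} (hp : HasDq j p p')
    (hu : HasDq j u u') {K : ℝ} (hb : LpLe ∞ p K) (hL : ∀ h, 0 < h → LpLe ∞ (fd j h p) K) :
    ∫ x, p x * (p x * u' x) = -(2 * ∫ x, p x * (p' x * u x)) := by
  have h0 : Tendsto (fun h : ℝ => h) (𝓝[>] 0) (𝓝 0) := tendsto_nhdsWithin_of_tendsto_nhds tendsto_id
  have hsq : HasDq j (mulL hb p) ((2 : ℝ) • mulL hb p') := by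
    have h1 : Tendsto (fun h => (2 : ℝ) • mulL hb (dq j h p)) (𝓝[>] 0)
        (𝓝 ((2 : ℝ) • mulL hb p')) :=
      (((mulL hb).continuous.tendsto _).comp hp).const_smul 2
    -- The error in the chain rule for p² is h times the square of the difference quotient, which is
    -- O(h) in L² because `p` is Lipschitz.
    have h2 : Tendsto (fun h => dq j h (mulL hb p) - (2 : ℝ) • mulL hb (dq j h p))
        (𝓝[>] 0) (𝓝 0) := by
      have h3 : Tendsto (fun h : ℝ => h * (K * ‖dq j h p‖)) (𝓝[>] 0) (𝓝 (0 * (K * ‖p'‖))) :=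
        h0.mul (hp.norm.const_mul K)
      rw [zero_mul] at h3
      refine squeeze_zero_norm' ?_ h3
      filter_upwards [self_mem_nhdsWithin] with h hh
      have e : dq j h (mulL hb p) - (2 : ℝ) • mulL hb (dq j h p)
          = h • mulL (hL h hh) (dq j h p) := by
        refine Lp.ext ?_
        filter_upwards [Lp.coeFn_sub (dq j h (mulL hb p)) ((2 : ℝ) • mulL hb (dq j h p)),
          Lp.coeFn_smul (2 : ℝ) (mulL hb (dq j h p)), Lp.coeFn_smul h (mulL (hL h hh) (dq j h p)),
          coeFn_mulL hb (dq j h p), coeFn_mulL (hL h hh) (dq j h p),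
          coeFn_dq j h (mulL hb p), fd_congr j h (coeFn_mulL hb p), coeFn_dq j h p]
          with x a1 a2 a3 a4 a5 a6 a7 a8
        rw [a1, Pi.sub_apply, a2, a3, Pi.smul_apply, Pi.smul_apply, a4, a5, a6, a7, a8, fd_mul]
        simp only [fd, smul_eq_mul]
        have : h ≠ 0 := ne_of_gt hh
        field_simp
        ring
      rw [e, norm_smul, Real.norm_eq_abs, abs_of_pos hh]
      exact mul_le_mul_of_nonneg_left (norm_mulL_le _ _) (le_of_lt hh)
    have := h2.add h1
    simpa [HasDq] using this
  have := hsq.inner_eq hu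
  rw [inner_mulL, real_inner_smul_left, inner_mulL] at this
  exact this

end


/-! ### The coefficients of the system and the symmetrizer -/

noncomputable section

open Filter Topology
open scoped ENNReal

/-- The coefficients of the system are exponentials of combinations of `s` and log(1+p/b), so only
the logarithm and the exponential have to pass through `Coef.comp`. The radius b/2 keeps b+y away
from zero, whence the factors 2/b. -/
theorem coef_log {b : ℝ} (hb : 0 < b) : ∃ C r : ℝ, 0 < C ∧ 0 < r ∧ r ≤ 1 ∧ r ≤ b / 2 ∧
    ∀ {K : ℝ} {f : E3 → ℝ}, Coef K f → K ≤ r → Coef (C * K) (fun x => Real.log (1 + f x / b)) := by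
  set C := 2 / b + (2 / b) ^ 2 + 2 * (2 / b) ^ 3 with hC
  have hpos : ∀ x ∈ Icc (-(b / 2)) (b / 2), b / 2 ≤ b + x := fun x hx => by linarith [hx.1]
  have hle : ∀ x ∈ Icc (-(b / 2)) (b / 2), 0 ≤ (b + x)⁻¹ ∧ (b + x)⁻¹ ≤ 2 / b := fun x hx => by
    have := hpos x hx
    refine ⟨inv_nonneg.2 (by linarith), ?_⟩
    rw [show 2 / b = (b / 2)⁻¹ by rw [inv_div]]
    exact inv_anti₀ (by positivity) this
  have hb2 : 0 < 2 / b := by positivity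
  refine ⟨15 * C, min (b / 2) 1, by positivity, by positivity, min_le_right _ _, min_le_left _ _,
    fun {K f} hf hK => ?_⟩
  refine Coef.comp (Φ := fun y => Real.log (1 + y / b)) (Φ1 := fun y => (b + y)⁻¹)
    (Φ2 := fun y => -((b + y)⁻¹ ^ 2)) (Φ3 := fun y => 2 * (b + y)⁻¹ ^ 3) (r := b / 2) ?_ (by simp)
    (fun x hx => ?_) (fun x hx => ?_) (fun x hx => ?_) (fun x hx => ?_) (fun x hx => ?_)
    (fun x hx => ?_) hf (hK.trans (min_le_left _ _)) (hK.trans (min_le_right _ _))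
  · exact Real.measurable_log.comp ((measurable_id.div_const b).const_add 1)
  · have h0 : b + x ≠ 0 := (by have := hpos x hx; linarith : (0 : ℝ) < b + x).ne'
    have h1 : (1 + x / b) ≠ 0 := by
      rw [show 1 + x / b = (b + x) / b by field_simp]; exact div_ne_zero h0 hb.ne'
    have := (((hasDerivAt_id' x).div_const b).const_add 1).log h1
    convert this using 1
    field_simp
  · have h0 : b + x ≠ 0 := (by have := hpos x hx; linarith : (0 : ℝ) < b + x).ne'
    refine (((hasDerivAt_id' x).const_add b).inv h0).congr_deriv ?_
    rw [inv_pow, neg_div, one_div]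
  · have h0 : b + x ≠ 0 := (by have := hpos x hx; linarith : (0 : ℝ) < b + x).ne'
    refine ((((hasDerivAt_id' x).const_add b).inv h0).pow 2).neg.congr_deriv ?_
    simp only [Nat.cast_ofNat, Nat.reduceSub, pow_one, Pi.inv_apply]
    field_simp
  · obtain ⟨h1, h2⟩ := hle x hx
    rw [abs_of_nonneg h1, hC]; nlinarith [pow_pos hb2 2, pow_pos hb2 3]
  · obtain ⟨h1, h2⟩ := hle x hx
    rw [abs_neg, abs_of_nonneg (by positivity), hC]
    nlinarith [pow_pos hb2 2, pow_pos hb2 3, pow_le_pow_left₀ h1 h2 2]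
  · obtain ⟨h1, h2⟩ := hle x hx
    rw [abs_of_nonneg (by positivity), hC]
    nlinarith [pow_pos hb2 2, pow_pos hb2 3, pow_le_pow_left₀ h1 h2 3]

theorem coef_exp_sub_one {K : ℝ} {f : E3 → ℝ} (hf : Coef K f) (hK : K ≤ 1) :
    Coef (45 * K) (fun x => Real.exp (f x) - 1) := by
  have hb : ∀ x ∈ Icc (-(1 : ℝ)) 1, |Real.exp x| ≤ 3 := fun x hx => by
    rw [abs_of_pos (Real.exp_pos x)]
    exact (Real.exp_le_exp.2 hx.2).trans (Real.exp_one_lt_d9.le.trans (by norm_num))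
  have := Coef.comp (Φ := fun y => Real.exp y - 1) (Φ1 := Real.exp) (Φ2 := Real.exp)
    (Φ3 := Real.exp) (r := 1) (Real.measurable_exp.sub_const 1) (by simp)
    (fun x _ => (Real.hasDerivAt_exp x).sub_const 1) (fun x _ => Real.hasDerivAt_exp x)
    (fun x _ => Real.hasDerivAt_exp x) hb hb hb hf hK hK
  exact this.mono (by linarith)

/-- Smallness of `exp(σ s - γ log(1 + p/b)) - 1`. -/
theorem exists_coef_exp {b : ℝ} (hb : 0 < b) (σ γ : ℝ) : ∃ C e₀ : ℝ, 0 < C ∧ 0 < e₀ ∧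
    ∀ (p s : Hm 3) (ε : ℝ), ε ≤ e₀ → ‖p‖ ≤ ε → ‖s‖ ≤ ε →
      Coef (C * ε) (fun x => Real.exp (σ * s.fn x - γ * Real.log (1 + p.fn x / b)) - 1) := by
  obtain ⟨C, r, hC, hr, -, -, hlog⟩ := coef_log hb
  have hc := one_le_coefConst
  set c := coefConst
  set D := |σ| * c + |γ| * (C * c) + 1 with hD
  have hD1 : 0 < D := by positivity
  refine ⟨45 * D, min (r / c) (1 / D), by positivity, by positivity, fun p s ε hε hp hs => ?_⟩
  have hε0 : 0 ≤ ε := (norm_nonneg p).trans hp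
  have h1 : c * ε ≤ r := by
    have := hε.trans (min_le_left _ _); rw [le_div_iff₀ (by linarith)] at this; linarith
  have h2 : D * ε ≤ 1 := by
    have := hε.trans (min_le_right _ _); rw [le_div_iff₀ hD1] at this; linarith
  have cp : Coef (c * ε) p.fn := p.coef.mono (mul_le_mul_of_nonneg_left hp (by linarith))
  have cs : Coef (c * ε) s.fn := s.coef.mono (mul_le_mul_of_nonneg_left hs (by linarith))
  have h3 := (cs.const_mul σ).add ((hlog cp h1).const_mul (-γ))
  have h4 : Coef (D * ε) (fun x => σ * s.fn x - γ * Real.log (1 + p.fn x / b)) := by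
    have : (fun x => σ * s.fn x - γ * Real.log (1 + p.fn x / b))
        = fun x => σ * s.fn x + -γ * Real.log (1 + p.fn x / b) := by funext x; ring
    rw [this]
    refine h3.mono ?_
    rw [abs_neg, hD]; nlinarith
  exact (coef_exp_sub_one h4 h2).mono (by linarith)

namespace FlowConstants

variable (P : FlowConstants)

theorem rhoInf_pos : 0 < P.rhoInf := by
  have := P.k_pos; have := P.pInf_pos
  unfold rhoInf rho; positivity

theorem kappa₁_pos : 0 < P.kappa₁ := by
  have := P.rhoInf_pos; have := P.pInf_pos; have := P.R_pos; have := P.cv_pos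
  unfold kappa₁; positivity

theorem kappa₂_pos : 0 < P.kappa₂ := by
  have := P.rhoInf_pos; have := P.pInf_pos; have := P.R_pos; have := P.cv_pos
  unfold kappa₂; positivity

theorem kappa_mul : P.kappa₁ * P.kappa₂ = 1 / P.rhoInf := by
  have := P.rhoInf_pos; have := P.pInf_pos; have := P.R_pos; have := P.cv_pos
  unfold kappa₁ kappa₂
  rw [← Real.sqrt_mul (by positivity), show P.cv / ((P.R + P.cv) * P.rhoInf * P.pInf) *
    ((P.R + P.cv) * P.pInf / (P.cv * P.rhoInf)) = (1 / P.rhoInf) ^ 2 by field_simp,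
    Real.sqrt_sq (by positivity)]

/-- The coefficient of `p ∇·u`. -/
def beta : ℝ := (P.R + P.cv) * P.kappa₁ / P.cv

theorem beta_pos : 0 < P.beta := by
  have := P.kappa₁_pos; have := P.R_pos; have := P.cv_pos
  unfold beta; positivity

/-- It says that κ₂ + βp is β times the full pressure, so the linear and the nonlinear multiple of
∇·u form a single term. -/
theorem beta_mul_pInf : P.beta * P.pInf = P.kappa₂ := by
  have h0 := P.rhoInf_pos; have h1 := P.pInf_pos; have h2 := P.R_pos; have h3 := P.cv_pos
  have h4 := P.kappa₁_pos
  have hsq : P.kappa₁ ^ 2 = P.cv / ((P.R + P.cv) * P.rhoInf * P.pInf) := by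
    unfold kappa₁; rw [Real.sq_sqrt (by positivity)]
  have h5 : P.kappa₁ * (P.beta * P.pInf) = P.kappa₁ * P.kappa₂ := by
    rw [kappa_mul, beta, show P.kappa₁ * ((P.R + P.cv) * P.kappa₁ / P.cv * P.pInf)
      = P.kappa₁ ^ 2 * ((P.R + P.cv) * P.pInf / P.cv) by ring, hsq]
    field_simp
  exact mul_left_cancel₀ h4.ne' h5

def sig : ℝ := 1 / (P.cv + P.R)

def theta : ℝ := P.cv / (P.cv + P.R)

/-- The nonlinear part of the coefficient of `∇p`, divided by `κ₂`. -/
def phi (y z : ℝ) : ℝ := Real.exp (P.sig * z - P.theta * Real.log (1 + y / P.pInf)) - 1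

/-- The symmetrizer of the system, minus one. -/
def psi (y z : ℝ) : ℝ := Real.exp (P.sig * z - (P.theta + 1) * Real.log (1 + y / P.pInf)) - 1

theorem one_add_pos {y : ℝ} (hy : |y| ≤ P.pInf / 2) : 0 < 1 + y / P.pInf := by
  have h1 := P.pInf_pos
  rw [show 1 + y / P.pInf = (P.pInf + y) / P.pInf by field_simp]
  have := abs_le.1 hy
  exact div_pos (by linarith) h1

/-- The exponents in `psi` and `phi` differ by one power of 1+y/p_∞, exactly the factor in κ₂+βy =
κ₂(1+y/p_∞). With the weight 1+ψ, the coefficient of ∇·u in the pressure equation becomes that of ∇p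
in the velocity equation, which is the symmetry used at top order. -/
theorem symmetrizer_mul {y : ℝ} (hy : |y| ≤ P.pInf / 2) (z : ℝ) :
    (1 + P.psi y z) * (P.kappa₂ + P.beta * y) = P.kappa₂ * (1 + P.phi y z) := by
  have h1 := P.pInf_pos
  have h2 := P.one_add_pos hy
  have h3 : P.kappa₂ + P.beta * y = P.kappa₂ * (1 + y / P.pInf) := by
    rw [← beta_mul_pInf]; field_simp
  rw [h3, psi, phi]
  have : P.sig * z - P.theta * Real.log (1 + y / P.pInf)
    = P.sig * z - (P.theta + 1) * Real.log (1 + y / P.pInf) + Real.log (1 + y / P.pInf) := by ring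
  rw [this, Real.exp_add, Real.exp_log h2]
  ring

/-- By the equation of state, 1/ρ is 1/ρ_∞ times the exponential in `phi`, and κ₁κ₂ = 1/ρ_∞ accounts
for the constant. The restriction on y keeps the full pressure positive. -/
theorem inv_rho_sub {y : ℝ} (hy : |y| ≤ P.pInf / 2) (z : ℝ) :
    1 / P.kappa₁ * (1 / P.rho (y + P.pInf) (z + P.sInf) - 1 / P.rhoInf)
      = P.kappa₂ * P.phi y z := by
  have h1 := P.pInf_pos
  have h2 := P.one_add_pos hy
  have h4 := P.kappa₁_pos
  have h0 := P.rhoInf_pos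
  have hR := P.R_pos; have hc := P.cv_pos
  have e1 : P.rho (y + P.pInf) (z + P.sInf)
      = P.rhoInf * Real.exp (-(P.sig * z - P.theta * Real.log (1 + y / P.pInf))) := by
    rw [rhoInf, rho, rho, show y + P.pInf = P.pInf * (1 + y / P.pInf) by field_simp; ring,
      Real.mul_rpow h1.le h2.le, show -(z + P.sInf) / (P.cv + P.R)
        = -P.sInf / (P.cv + P.R) + -(P.sig * z) by rw [sig]; ring, Real.exp_add,
      Real.rpow_def_of_pos h2, neg_sub, sub_eq_add_neg, Real.exp_add, theta,
      mul_comm (P.cv / (P.cv + P.R)) (Real.log _)]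
    ring
  rw [e1, Real.exp_neg, phi]
  have h5 : P.kappa₂ = 1 / P.kappa₁ * (1 / P.rhoInf) := by
    rw [← kappa_mul]; field_simp
  rw [h5]
  field_simp

/-- One constant dominates all coefficients, so that errors can be tracked as powers of it. M·e₀ ≤
1/2 keeps the weight 1+ψ between 1/2 and 3/2, and M·e₀ ≤ p_∞/2 keeps the full pressure away from
zero. -/
theorem exists_bound : ∃ M e₀ : ℝ, 1 ≤ M ∧ 0 < e₀ ∧ M * e₀ ≤ 1 / 2 ∧ M * e₀ ≤ P.pInf / 2 ∧
    P.kappa₁ ≤ M ∧ P.kappa₂ ≤ M ∧ P.beta ≤ M ∧ P.a ≤ M ∧ coefConst ≤ M ∧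
    ∀ (p s : Hm 3) (ε : ℝ), ε ≤ e₀ → ‖p‖ ≤ ε → ‖s‖ ≤ ε →
      Coef (M * ε) (fun x => P.phi (p.fn x) (s.fn x)) ∧
      Coef (M * ε) (fun x => P.psi (p.fn x) (s.fn x)) := by
  obtain ⟨C, e₁, hC, he₁, h1⟩ := exists_coef_exp P.pInf_pos P.sig P.theta
  obtain ⟨C', e₂, hC', he₂, h2⟩ := exists_coef_exp P.pInf_pos P.sig (P.theta + 1)
  have hc := one_le_coefConst
  have k1 := P.kappa₁_pos; have k2 := P.kappa₂_pos; have k3 := P.beta_pos; have k4 := P.a_pos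
  have k5 := P.pInf_pos
  set M := 1 + C + C' + P.kappa₁ + P.kappa₂ + P.beta + P.a + coefConst with hM
  have hM0 : 0 < M := by positivity
  refine ⟨M, min (min e₁ e₂) (min (1 / 2 / M) (P.pInf / 2 / M)), by linarith, by positivity, ?_, ?_,
    by linarith, by linarith, by linarith, by linarith, by linarith, fun p s ε hε hp hs => ?_⟩
  · rw [mul_comm, ← le_div_iff₀ hM0]; exact (min_le_right _ _).trans (min_le_left _ _)
  · rw [mul_comm, ← le_div_iff₀ hM0]; exact (min_le_right _ _).trans (min_le_right _ _)
  · have hε0 : 0 ≤ ε := (norm_nonneg p).trans hp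
    have h3 := hε.trans (min_le_left _ _)
    exact ⟨(h1 p s ε (h3.trans (min_le_left _ _)) hp hs).mono
        (mul_le_mul_of_nonneg_right (by linarith) hε0),
      (h2 p s ε (h3.trans (min_le_right _ _)) hp hs).mono
        (mul_le_mul_of_nonneg_right (by linarith) hε0)⟩

/-- A constant that bounds the coefficients of the system. -/
def M : ℝ := P.exists_bound.choose

/-- The smallness threshold for the coefficients of the system. -/
def eps₀ : ℝ := P.exists_bound.choose_spec.choose

theorem M_spec : 1 ≤ P.M ∧ 0 < P.eps₀ ∧ P.M * P.eps₀ ≤ 1 / 2 ∧ P.M * P.eps₀ ≤ P.pInf / 2 ∧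
    P.kappa₁ ≤ P.M ∧ P.kappa₂ ≤ P.M ∧ P.beta ≤ P.M ∧ P.a ≤ P.M ∧ coefConst ≤ P.M ∧
    ∀ (p s : Hm 3) (ε : ℝ), ε ≤ P.eps₀ → ‖p‖ ≤ ε → ‖s‖ ≤ ε →
      Coef (P.M * ε) (fun x => P.phi (p.fn x) (s.fn x)) ∧
      Coef (P.M * ε) (fun x => P.psi (p.fn x) (s.fn x)) :=
  P.exists_bound.choose_spec.choose_spec

end FlowConstants

end


/-! ### The equations at a fixed time, in operator form -/

noncomputable section

open Filter Topology
open scoped ENNReal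

theorem coeFn_sum_L2 (f : Fin 3 → L2R3) :
    ⇑(∑ j, f j) =ᵐ[volume] fun x => ∑ j, f j x := by
  simp only [Fin.sum_univ_three]
  filter_upwards [Lp.coeFn_add (f 0 + f 1) (f 2), Lp.coeFn_add (f 0) (f 1)] with x h1 h2
  rw [h1, Pi.add_apply, h2, Pi.add_apply]

theorem Coef.norm_commutator_le {K K' : ℝ} {f : E3 → ℝ} {g : L2R3} (hf : Coef K f)
    (hg : DCoef K' g) (i : Fin 3) {h : ℝ} (hh : 0 < h) :
    ‖(dq i h ^ 3) (mulL hf.bound g) - mulL hf.bound ((dq i h ^ 3) g)‖ ≤ 7 * K * K' := by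
  refine LpLe.norm_le _ ((hf.commutator hg i hh).congr ?_)
  filter_upwards [Lp.coeFn_sub ((dq i h ^ 3) (mulL hf.bound g)) (mulL hf.bound ((dq i h ^ 3) g)),
    coeFn_mulL hf.bound ((dq i h ^ 3) g), coeFn_dq_three i h g,
    coeFn_dq_three i h (mulL hf.bound g),
    fd_congr i h (fd_congr i h (fd_congr i h (coeFn_mulL hf.bound g)))] with x h1 h2 h3 h4 h5
  rw [h1, Pi.sub_apply, h2, h3, h4, h5]

theorem Coef.norm_dq_two_mul_le {K K' : ℝ} {f : E3 → ℝ} {g : L2R3} (hf : Coef K f)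
    (hg : DCoef K' g) (i : Fin 3) {h : ℝ} (hh : 0 < h) :
    ‖(dq i h ^ 2) (mulL hf.bound g)‖ ≤ 4 * K * K' := by
  refine LpLe.norm_le _ ((hf.fd_fd_mul hg i hh).congr ?_)
  filter_upwards [coeFn_dq_two i h (mulL hf.bound g),
    fd_congr i h (fd_congr i h (coeFn_mulL hf.bound g))] with x h4 h5
  rw [h4, h5]

theorem Coef.norm_mul_le {K K' : ℝ} {f : E3 → ℝ} {g : L2R3} (hf : Coef K f)
    (hg : DCoef K' g) : ‖mulL hf.bound g‖ ≤ K * K' :=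
  (norm_mulL_le _ _).trans (mul_le_mul_of_nonneg_left hg.l2.norm_le hf.nonneg)

theorem inner_mulL_comm {c : E3 → ℝ} {K : ℝ} (hc : LpLe ∞ c K) (f g : L2R3) :
    inner ℝ (mulL hc f) g = inner ℝ f (mulL hc g) := by
  rw [inner_mulL, real_inner_comm, inner_mulL]
  exact integral_congr_ae (Eventually.of_forall fun x => by simp only [mul_comm])

theorem HasDq.abs_inner_le {j : Fin 3} {w w' v v' : L2R3} (hw : HasDq j w w')
    (hv : HasDq j v v') {c : E3 → ℝ} {K M : ℝ} (hc : LpLe ∞ c K)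
    (hM : ∀ h, 0 < h → LpLe ∞ (fd j h c) M) :
    |inner ℝ w (mulL hc v') + inner ℝ v (mulL hc w')| ≤ M * (‖w‖ * ‖v‖) := by
  rw [real_inner_comm (mulL hc w') v, ← inner_mulL_comm, inner_mulL, inner_mulL]
  exact hw.abs_integral_le hv hc hM

theorem HasDq.abs_inner_self_le {j : Fin 3} {w w' : L2R3} (hw : HasDq j w w') {c : E3 → ℝ}
    {K M : ℝ} (hc : LpLe ∞ c K) (hM : ∀ h, 0 < h → LpLe ∞ (fd j h c) M) :
    |inner ℝ w (mulL hc w')| ≤ M * ‖w‖ ^ 2 := by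
  have h := hw.abs_inner_le hw hc hM
  have h1 : 0 ≤ M * ‖w‖ ^ 2 := mul_nonneg (hM 1 one_pos).nonneg (sq_nonneg _)
  rw [← two_mul, abs_mul, abs_two] at h
  nlinarith

/-- The quantity `‖∇p‖_2 + ‖u‖_3` controlled by the dissipation. -/
def dissip (p : Hm 3) (u : HmVec 3) : ℝ := ‖p.grad‖ + ‖u‖

theorem dissip_nonneg (p : Hm 3) (u : HmVec 3) : 0 ≤ dissip p u :=
  add_nonneg (norm_nonneg _) (norm_nonneg _)

theorem norm_grad_le_dissip (p : Hm 3) (u : HmVec 3) : ‖p.grad‖ ≤ dissip p u :=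
  le_add_of_nonneg_right (norm_nonneg _)

theorem norm_le_dissip (p : Hm 3) (u : HmVec 3) : ‖u‖ ≤ dissip p u :=
  le_add_of_nonneg_left (norm_nonneg _)

theorem norm_apply_le_dissip (p : Hm 3) (u : HmVec 3) (j : Fin 3) : ‖u j‖ ≤ dissip p u :=
  (PiLp.norm_apply_le u j).trans (norm_le_dissip p u)

theorem Hm.norm_d3_le_deriv (p : Hm 3) (i : Fin 3) : ‖p.d3 i‖ ≤ ‖p.deriv i‖ :=
  (((p.deriv i).deriv i).deriv i).norm_fn_le.trans
    (((p.deriv i).deriv i).norm_deriv_le i |>.trans ((p.deriv i).norm_deriv_le i))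

theorem Hm.norm_dq_three_le (p : Hm 3) (i : Fin 3) {h : ℝ} (hh : 0 < h) :
    ‖(dq i h ^ 3) p.fn‖ ≤ ‖p.d3 i‖ := (p.hatDeriv_three i).norm_le hh.ne'

namespace FlowConstants

variable (P : FlowConstants)

/-- The state `(p, u, s)` is small in `H³`, and its time derivative given by the equations is
`(pt, ut, st)`. -/
structure Slice (ε : ℝ) (p : Hm 3) (u : HmVec 3) (s : Hm 3) (pt : L2R3) (ut : Fin 3 → L2R3)
    (st : L2R3) : Prop where
  small : ε ≤ P.eps₀
  hp : ‖p‖ ≤ ε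
  hu : ‖u‖ ≤ ε
  hs : ‖s‖ ≤ ε
  pressure : ∀ᵐ x, pt x = -(P.kappa₂ * ∑ j, ((u j).deriv j).fn x)
    - P.beta * ∑ j, p.fn x * ((u j).deriv j).fn x - P.kappa₁ * ∑ j, (u j).fn x * (p.deriv j).fn x
  velocity : ∀ k, ∀ᵐ x, ut k x = -(P.kappa₂ * (p.deriv k).fn x)
    - P.kappa₂ * (P.phi (p.fn x) (s.fn x) * (p.deriv k).fn x)
    - P.kappa₁ * (∑ j, (u j).fn x * ((u k).deriv j).fn x) - P.a * (u k).fn x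
  entropy : ∀ᵐ x, st x = -(P.kappa₁ * ∑ j, (u j).fn x * (s.deriv j).fn x)

namespace Slice

variable {P} {ε : ℝ} {p : Hm 3} {u : HmVec 3} {s : Hm 3} {pt : L2R3} {ut : Fin 3 → L2R3}
  {st : L2R3}

theorem M_pos : 0 < P.M := lt_of_lt_of_le one_pos P.M_spec.1

theorem eps_nonneg (S : P.Slice ε p u s pt ut st) : 0 ≤ ε := (norm_nonneg p).trans S.hp

theorem M_mul_le (S : P.Slice ε p u s pt ut st) : P.M * ε ≤ 1 / 2 :=
  (mul_le_mul_of_nonneg_left S.small (M_pos).le).trans P.M_spec.2.2.1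

theorem M_mul_le_pInf (S : P.Slice ε p u s pt ut st) : P.M * ε ≤ P.pInf / 2 :=
  (mul_le_mul_of_nonneg_left S.small (M_pos).le).trans P.M_spec.2.2.2.1

theorem coef_of_norm_le (P : FlowConstants) (f : Hm 3) {K : ℝ} (hf : ‖f‖ ≤ K) :
    Coef (P.M * K) f.fn :=
  f.coef.mono (mul_le_mul P.M_spec.2.2.2.2.2.2.2.2.1 hf (norm_nonneg _) (M_pos).le)

theorem dCoef_of_norm_le (P : FlowConstants) (f : Hm 2) {K : ℝ} (hf : ‖f‖ ≤ K) :
    DCoef (P.M * K) f.fn :=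
  f.dCoef.mono (mul_le_mul P.M_spec.2.2.2.2.2.2.2.2.1 hf (norm_nonneg _) (M_pos).le)

theorem cp (S : P.Slice ε p u s pt ut st) : Coef (P.M * ε) p.fn := coef_of_norm_le P p S.hp

theorem cu (S : P.Slice ε p u s pt ut st) (j : Fin 3) : Coef (P.M * ε) (u j).fn :=
  coef_of_norm_le P _ ((PiLp.norm_apply_le u j).trans S.hu)

theorem cphi (S : P.Slice ε p u s pt ut st) :
    Coef (P.M * ε) fun x => P.phi (p.fn x) (s.fn x) :=
  (P.M_spec.2.2.2.2.2.2.2.2.2 p s ε S.small S.hp S.hs).1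

theorem cpsi (S : P.Slice ε p u s pt ut st) :
    Coef (P.M * ε) fun x => P.psi (p.fn x) (s.fn x) :=
  (P.M_spec.2.2.2.2.2.2.2.2.2 p s ε S.small S.hp S.hs).2

theorem dp (P : FlowConstants) (p : Hm 3) (u : HmVec 3) (j : Fin 3) :
    DCoef (P.M * dissip p u) (p.deriv j).fn :=
  dCoef_of_norm_le P _ ((p.norm_deriv_le_grad j).trans (norm_grad_le_dissip p u))

theorem du (P : FlowConstants) (p : Hm 3) (u : HmVec 3) (j k : Fin 3) :
    DCoef (P.M * dissip p u) ((u k).deriv j).fn :=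
  dCoef_of_norm_le P _ (((u k).norm_deriv_le j).trans (norm_apply_le_dissip p u k))

/-- An identity in L², rather than almost everywhere, so that powers of difference operators can be
applied to it directly. -/
theorem pressure_eq (S : P.Slice ε p u s pt ut st) :
    pt = -(P.kappa₂ • ∑ j, ((u j).deriv j).fn)
      - P.beta • ∑ j, mulL S.cp.bound ((u j).deriv j).fn
      - P.kappa₁ • ∑ j, mulL (S.cu j).bound (p.deriv j).fn := by
  refine Lp.ext ?_
  set a := ∑ j, ((u j).deriv j).fn with ha
  set b := ∑ j, mulL S.cp.bound ((u j).deriv j).fn with hb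
  set c := ∑ j, mulL (S.cu j).bound (p.deriv j).fn with hc
  have e1 : ∀ᵐ x, ∀ j, mulL S.cp.bound ((u j).deriv j).fn x = p.fn x * ((u j).deriv j).fn x :=
    ae_all_iff.2 fun j => coeFn_mulL _ _
  have e2 : ∀ᵐ x, ∀ j, mulL (S.cu j).bound (p.deriv j).fn x = (u j).fn x * (p.deriv j).fn x :=
    ae_all_iff.2 fun j => coeFn_mulL _ _
  filter_upwards [S.pressure, e1, e2, coeFn_sum_L2 fun j => ((u j).deriv j).fn,
    coeFn_sum_L2 fun j => mulL S.cp.bound ((u j).deriv j).fn,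
    coeFn_sum_L2 fun j => mulL (S.cu j).bound (p.deriv j).fn,
    Lp.coeFn_sub (-(P.kappa₂ • a) - P.beta • b) (P.kappa₁ • c),
    Lp.coeFn_sub (-(P.kappa₂ • a)) (P.beta • b), Lp.coeFn_neg (P.kappa₂ • a),
    Lp.coeFn_smul P.kappa₂ a, Lp.coeFn_smul P.beta b, Lp.coeFn_smul P.kappa₁ c]
    with x h0 h1 h2 h3 h4 h5 h6 h7 h8 h9 h10 h11
  rw [h0, h6, Pi.sub_apply, h7, Pi.sub_apply, h8, Pi.neg_apply, h9, h10, h11, Pi.smul_apply,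
    Pi.smul_apply, Pi.smul_apply, ha, hb, hc, h3, h4, h5]
  simp only [h1, h2, smul_eq_mul]

theorem velocity_eq (S : P.Slice ε p u s pt ut st) (k : Fin 3) :
    ut k = -(P.kappa₂ • (p.deriv k).fn) - P.kappa₂ • mulL S.cphi.bound (p.deriv k).fn
      - P.kappa₁ • ∑ j, mulL (S.cu j).bound ((u k).deriv j).fn - P.a • (u k).fn := by
  refine Lp.ext ?_
  set a := (p.deriv k).fn with ha
  set b := mulL S.cphi.bound (p.deriv k).fn with hb
  set c := ∑ j, mulL (S.cu j).bound ((u k).deriv j).fn with hc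
  set d := (u k).fn with hd
  have e2 : ∀ᵐ x, ∀ j, mulL (S.cu j).bound ((u k).deriv j).fn x
      = (u j).fn x * ((u k).deriv j).fn x := ae_all_iff.2 fun j => coeFn_mulL _ _
  filter_upwards [S.velocity k, coeFn_mulL S.cphi.bound (p.deriv k).fn, e2,
    coeFn_sum_L2 fun j => mulL (S.cu j).bound ((u k).deriv j).fn,
    Lp.coeFn_sub (-(P.kappa₂ • a) - P.kappa₂ • b - P.kappa₁ • c) (P.a • d),
    Lp.coeFn_sub (-(P.kappa₂ • a) - P.kappa₂ • b) (P.kappa₁ • c),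
    Lp.coeFn_sub (-(P.kappa₂ • a)) (P.kappa₂ • b), Lp.coeFn_neg (P.kappa₂ • a),
    Lp.coeFn_smul P.kappa₂ a, Lp.coeFn_smul P.kappa₂ b, Lp.coeFn_smul P.kappa₁ c,
    Lp.coeFn_smul P.a d]
    with x h0 h1 h2 h5 h5' h6 h7 h8 h9 h10 h11 h12
  rw [h0, h5', Pi.sub_apply, h6, Pi.sub_apply, h7, Pi.sub_apply, h8, Pi.neg_apply, h9, h10, h11,
    h12, Pi.smul_apply, Pi.smul_apply, Pi.smul_apply, Pi.smul_apply, hb, hc, h1, h5]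
  simp only [h2, smul_eq_mul, ← ha, ← hd]

theorem entropy_eq (S : P.Slice ε p u s pt ut st) :
    st = -(P.kappa₁ • ∑ j, mulL (S.cu j).bound (s.deriv j).fn) := by
  refine Lp.ext ?_
  set c := ∑ j, mulL (S.cu j).bound (s.deriv j).fn with hc
  have e2 : ∀ᵐ x, ∀ j, mulL (S.cu j).bound (s.deriv j).fn x
      = (u j).fn x * (s.deriv j).fn x := ae_all_iff.2 fun j => coeFn_mulL _ _
  filter_upwards [S.entropy, e2, coeFn_sum_L2 fun j => mulL (S.cu j).bound (s.deriv j).fn,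
    Lp.coeFn_neg (P.kappa₁ • c), Lp.coeFn_smul P.kappa₁ c] with x h0 h2 h5 h8 h9
  rw [h0, h8, Pi.neg_apply, h9, Pi.smul_apply, hc, h5]
  simp only [h2, smul_eq_mul]

end Slice
end FlowConstants
end


/-! ### The interaction functional and the energy of order zero -/

noncomputable section

open Filter Topology
open scoped ENNReal

theorem norm_sum_three_le {E : Type*} [SeminormedAddCommGroup E] {f : Fin 3 → E} {K : ℝ}
    (h : ∀ j, ‖f j‖ ≤ K) : ‖∑ j, f j‖ ≤ 3 * K := by
  refine (norm_sum_le_of_le _ fun j _ => h j).trans (le_of_eq ?_)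
  simp

theorem abs_sum_three_le {f : Fin 3 → ℝ} {K : ℝ} (h : ∀ j, |f j| ≤ K) : |∑ j, f j| ≤ 3 * K := by
  simp only [← Real.norm_eq_abs] at h ⊢
  exact norm_sum_three_le h

theorem norm_sq_sum_three_le {E : Type*} [SeminormedAddCommGroup E] (f : Fin 3 → E) :
    ‖∑ j, f j‖ ^ 2 ≤ 3 * ∑ j, ‖f j‖ ^ 2 := by
  have h : ‖∑ j, f j‖ ≤ ∑ j, ‖f j‖ := norm_sum_le _ _
  refine (pow_le_pow_left₀ (norm_nonneg _) h 2).trans ?_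
  simp only [Fin.sum_univ_three]
  nlinarith [sq_nonneg (‖f 0‖ - ‖f 1‖), sq_nonneg (‖f 0‖ - ‖f 2‖), sq_nonneg (‖f 1‖ - ‖f 2‖)]

/-- The interaction functional `∑ ⟨u_k, ∂_k p⟩` produces damping of `∇p`. -/
theorem interaction_le {E : Type*} [NormedAddCommGroup E] [InnerProductSpace ℝ E] {κ a R m : ℝ}
    (hκ : 0 < κ) {W : E} {U d v e : Fin 3 → E} (hm : 0 ≤ m)
    (hW : ‖W + κ • ∑ j, e j‖ ≤ R) (hU : ∀ k, ‖U k + κ • d k + a • v k‖ ≤ R)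
    (hd : ∀ k, ‖d k‖ ≤ m) (he : ∀ k, ‖e k‖ ≤ m) :
    ∑ k, (inner ℝ (U k) (d k) - inner ℝ (e k) W) ≤ -(κ / 2) * ∑ k, ‖d k‖ ^ 2
      + a ^ 2 / (2 * κ) * ∑ k, ‖v k‖ ^ 2 + 3 * κ * ∑ k, ‖e k‖ ^ 2 + 6 * R * m := by
  have hR : 0 ≤ R := (norm_nonneg _).trans hW
  -- The velocity equation supplies -κ‖d‖². Half of it pays for the friction term by Young's
  -- inequality, which leaves the gain -κ/2.
  have h1 : ∀ k, inner ℝ (U k) (d k) ≤ -(κ / 2) * ‖d k‖ ^ 2 + a ^ 2 / (2 * κ) * ‖v k‖ ^ 2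
      + R * m := fun k => by
    have e1 : inner ℝ (U k) (d k) = inner ℝ (U k + κ • d k + a • v k) (d k)
        - κ * ‖d k‖ ^ 2 - a * inner ℝ (v k) (d k) := by
      simp only [inner_add_left, real_inner_smul_left, real_inner_self_eq_norm_sq]; ring
    have e2 : inner ℝ (U k + κ • d k + a • v k) (d k) ≤ R * m :=
      (real_inner_le_norm _ _).trans (mul_le_mul (hU k) (hd k) (norm_nonneg _) hR)
    have e3 : -(a * inner ℝ (v k) (d k)) ≤ κ / 2 * ‖d k‖ ^ 2 + a ^ 2 / (2 * κ) * ‖v k‖ ^ 2 := by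
      have h0 : 0 ≤ ‖κ • d k + a • v k‖ ^ 2 := sq_nonneg _
      rw [norm_add_sq_real, norm_smul, norm_smul, real_inner_smul_left, real_inner_smul_right,
        real_inner_comm, mul_pow, mul_pow, Real.norm_eq_abs, Real.norm_eq_abs, sq_abs, sq_abs] at h0
      have : κ / 2 * ‖d k‖ ^ 2 + a ^ 2 / (2 * κ) * ‖v k‖ ^ 2 + a * inner ℝ (v k) (d k)
        = (κ ^ 2 * ‖d k‖ ^ 2 + 2 * (κ * (a * inner ℝ (v k) (d k))) + a ^ 2 * ‖v k‖ ^ 2)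
          / (2 * κ) := by field_simp; ring
      have h2 := div_nonneg h0 (by positivity : 0 ≤ 2 * κ)
      rw [← this] at h2
      linarith
    linarith
  -- The pressure equation replaces W by -κ times the divergence; the resulting positive term will
  -- be paid for by the damping of the velocity.
  have h2 : -inner ℝ (∑ k, e k) W ≤ κ * ‖∑ k, e k‖ ^ 2 + 3 * R * m := by
    have e1 : -inner ℝ (∑ k, e k) W = κ * ‖∑ k, e k‖ ^ 2
        - inner ℝ (∑ k, e k) (W + κ • ∑ j, e j) := by
      simp only [inner_add_right, real_inner_smul_right, real_inner_self_eq_norm_sq]; ring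
    have e2 : -inner ℝ (∑ k, e k) (W + κ • ∑ j, e j) ≤ 3 * m * R :=
      (neg_le_abs _).trans ((abs_real_inner_le_norm _ _).trans
        (mul_le_mul (norm_sum_three_le he) hW (norm_nonneg _) (by positivity)))
    linarith
  have h3 := mul_le_mul_of_nonneg_left (norm_sq_sum_three_le e) hκ.le
  rw [Finset.sum_sub_distrib, ← sum_inner]
  have h4 := Finset.sum_le_sum fun k (_ : k ∈ Finset.univ) => h1 k
  simp only [Finset.sum_add_distrib, ← Finset.mul_sum, Finset.sum_const, Finset.card_univ,
    Fintype.card_fin, nsmul_eq_mul, Nat.cast_ofNat] at h4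
  linarith

/-- An operator with the product estimate of an algebra of functions. -/
def ProductBound (T : L2R3 →L[ℝ] L2R3) : Prop :=
  ∀ ⦃K K' : ℝ⦄ ⦃f : E3 → ℝ⦄ ⦃g : L2R3⦄ (hf : Coef K f), DCoef K' g →
    ‖T (mulL hf.bound g)‖ ≤ 4 * K * K'

theorem productBound_one : ProductBound 1 := fun _ _ _ _ hf hg =>
  (hf.norm_mul_le hg).trans (by nlinarith [mul_nonneg hf.nonneg hg.nonneg])

theorem productBound_dq_two (i : Fin 3) {h : ℝ} (hh : 0 < h) : ProductBound (dq i h ^ 2) :=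
  fun _ _ _ _ hf hg => hf.norm_dq_two_mul_le hg i hh

theorem Hm.norm_dq_two_le (f : Hm 2) (i : Fin 3) {h : ℝ} (hh : 0 < h) :
    ‖(dq i h ^ 2) f.fn‖ ≤ ‖f‖ :=
  ((f.hatDeriv_two i).norm_le hh.ne').trans
    (((f.deriv i).deriv i).norm_fn_le.trans ((f.deriv i).norm_deriv_le i |>.trans
      (f.norm_deriv_le i)))

namespace FlowConstants.Slice

variable {P : FlowConstants} {ε : ℝ} {p : Hm 3} {u : HmVec 3} {s : Hm 3} {pt : L2R3}
  {ut : Fin 3 → L2R3} {st : L2R3}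

theorem kappa_bounds (P : FlowConstants) : |P.kappa₁| ≤ P.M ∧ |P.kappa₂| ≤ P.M ∧ |P.beta| ≤ P.M :=
  ⟨by rw [abs_of_pos P.kappa₁_pos]; exact P.M_spec.2.2.2.2.1,
    by rw [abs_of_pos P.kappa₂_pos]; exact P.M_spec.2.2.2.2.2.1,
    by rw [abs_of_pos P.beta_pos]; exact P.M_spec.2.2.2.2.2.2.1⟩

theorem norm_smul_le_M {E : Type*} [SeminormedAddCommGroup E] [NormedSpace ℝ E] {c K : ℝ} {f : E}
    (hc : |c| ≤ P.M) (hf : ‖f‖ ≤ K) : ‖c • f‖ ≤ P.M * K := by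
  rw [norm_smul]
  exact mul_le_mul hc hf (norm_nonneg _) M_pos.le

theorem norm_pressure_residual_le (S : P.Slice ε p u s pt ut st) {T : L2R3 →L[ℝ] L2R3}
    (hT : ProductBound T) :
    ‖T pt + P.kappa₂ • ∑ j, T ((u j).deriv j).fn‖ ≤ 24 * P.M ^ 3 * ε * dissip p u := by
  obtain ⟨k1, k2, k3⟩ := kappa_bounds P
  have e := congrArg T S.pressure_eq
  simp only [map_sub, map_neg, map_smul, map_sum] at e
  have e1 : T pt + P.kappa₂ • ∑ j, T ((u j).deriv j).fn
      = -(P.beta • ∑ j, T (mulL S.cp.bound ((u j).deriv j).fn)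
        + P.kappa₁ • ∑ j, T (mulL (S.cu j).bound (p.deriv j).fn)) := by
    rw [e]; abel
  rw [e1, norm_neg]
  have h1 := norm_smul_le_M k3 (norm_sum_three_le fun j => hT S.cp (du P p u j j))
  have h2 := norm_smul_le_M k1 (norm_sum_three_le fun j => hT (S.cu j) (dp P p u j))
  refine (norm_add_le_of_le h1 h2).trans (le_of_eq ?_)
  ring

theorem norm_velocity_residual_le (S : P.Slice ε p u s pt ut st) {T : L2R3 →L[ℝ] L2R3}
    (hT : ProductBound T) (k : Fin 3) :
    ‖T (ut k) + P.kappa₂ • T (p.deriv k).fn + P.a • T (u k).fn‖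
      ≤ 24 * P.M ^ 3 * ε * dissip p u := by
  obtain ⟨k1, k2, k3⟩ := kappa_bounds P
  have e := congrArg T (S.velocity_eq k)
  simp only [map_sub, map_neg, map_smul, map_sum] at e
  have e1 : T (ut k) + P.kappa₂ • T (p.deriv k).fn + P.a • T (u k).fn
      = -(P.kappa₂ • T (mulL S.cphi.bound (p.deriv k).fn)
        + P.kappa₁ • ∑ j, T (mulL (S.cu j).bound ((u k).deriv j).fn)) := by
    rw [e]; abel
  rw [e1, norm_neg]
  have h1 := norm_smul_le_M k2 (hT S.cphi (dp P p u k))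
  have h2 := norm_smul_le_M k1 (norm_sum_three_le fun j => hT (S.cu j) (du P p u j k))
  refine (norm_add_le_of_le h1 h2).trans ?_
  have := mul_nonneg (mul_nonneg (pow_pos (M_pos (P := P)) 3).le S.eps_nonneg) (dissip_nonneg p u)
  nlinarith

/-- The interaction estimate for an operator `T` of order at most two. -/
theorem interaction_le (S : P.Slice ε p u s pt ut st) {T : L2R3 →L[ℝ] L2R3}
    (hT : ProductBound T) (hb : ∀ f : Hm 2, ‖T f.fn‖ ≤ ‖f‖) :
    ∑ k, (inner ℝ (T (ut k)) (T (p.deriv k).fn) - inner ℝ (T ((u k).deriv k).fn) (T pt))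
      ≤ -(P.kappa₂ / 2) * ∑ k, ‖T (p.deriv k).fn‖ ^ 2
        + P.a ^ 2 / (2 * P.kappa₂) * ∑ k, ‖T (u k).fn‖ ^ 2
        + 3 * P.kappa₂ * ∑ k, ‖T ((u k).deriv k).fn‖ ^ 2
        + 144 * P.M ^ 3 * ε * dissip p u ^ 2 := by
  have := _root_.interaction_le (W := T pt) (U := fun k => T (ut k))
    (d := fun k => T (p.deriv k).fn) (v := fun k => T (u k).fn)
    (e := fun k => T ((u k).deriv k).fn) P.kappa₂_pos (dissip_nonneg p u)
    (S.norm_pressure_residual_le hT) (S.norm_velocity_residual_le hT)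
    (fun k => (hb _).trans ((p.norm_deriv_le_grad k).trans (norm_grad_le_dissip p u)))
    (fun k => (hb _).trans (((u k).norm_deriv_le k).trans (norm_apply_le_dissip p u k)))
  refine this.trans (le_of_eq ?_)
  ring

theorem abs_inner_mulL_le {c : E3 → ℝ} {K m n : ℝ} (hc : LpLe ∞ c K) {f g : L2R3} (hf : ‖f‖ ≤ m)
    (hg : ‖g‖ ≤ n) : |inner ℝ f (mulL hc g)| ≤ K * (m * n) := by
  have hm := (norm_nonneg _).trans hf
  refine (abs_real_inner_le_norm _ _).trans ?_
  calc ‖f‖ * ‖mulL hc g‖ ≤ m * (K * n) :=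
        mul_le_mul hf ((norm_mulL_le _ _).trans (mul_le_mul_of_nonneg_left hg hc.nonneg))
          (norm_nonneg _) hm
    _ = K * (m * n) := by ring

/-- The basic energy estimate. -/
theorem energy_zero_le (S : P.Slice ε p u s pt ut st) :
    inner ℝ p.fn pt + ∑ k, inner ℝ (u k).fn (ut k)
      ≤ -P.a * ∑ k, ‖(u k).fn‖ ^ 2 + 21 * P.M ^ 2 * ε * dissip p u ^ 2 := by
  have k1 := P.kappa₁_pos; have k2 := P.kappa₂_pos; have k3 := P.beta_pos
  obtain ⟨l1, l2, l3⟩ := kappa_bounds P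
  rw [abs_of_pos k1] at l1; rw [abs_of_pos k2] at l2; rw [abs_of_pos k3] at l3
  set m := dissip p u with hm
  have hm0 : 0 ≤ m := dissip_nonneg p u
  have hQ : 0 ≤ P.M * ε * (m * m) :=
    mul_nonneg (mul_nonneg M_pos.le S.eps_nonneg) (mul_nonneg hm0 hm0)
  have bu : ∀ k, ‖(u k).fn‖ ≤ m := fun k => (u k).norm_fn_le.trans (norm_apply_le_dissip p u k)
  have bp : ∀ k, ‖(p.deriv k).fn‖ ≤ m := fun k => (p.deriv k).norm_fn_le.trans
    ((p.norm_deriv_le_grad k).trans (norm_grad_le_dissip p u))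
  have bdu : ∀ j k, ‖((u k).deriv j).fn‖ ≤ m := fun j k => ((u k).deriv j).norm_fn_le.trans
    (((u k).norm_deriv_le j).trans (norm_apply_le_dissip p u k))
  -- Undifferentiated `p` is not controlled by `dissip`. It is therefore treated as the small
  -- coefficient, and `u` and ∇p as the two dissipative factors.
  have c1 : ∀ j, |inner ℝ p.fn (mulL (S.cu j).bound (p.deriv j).fn)| ≤ P.M * ε * (m * m) :=
    fun j => by
      have : inner ℝ p.fn (mulL (S.cu j).bound (p.deriv j).fn)
          = inner ℝ (u j).fn (mulL S.cp.bound (p.deriv j).fn) := by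
        rw [real_inner_comm, inner_mulL, real_inner_comm, inner_mulL]
        exact integral_congr_ae (Eventually.of_forall fun x => by simp only; ring)
      rw [this]
      exact abs_inner_mulL_le _ (bu j) (bp j)
  -- In p²∂u both copies of `p` are undifferentiated. Integrating by parts trades one of them for
  -- ∇p.
  have c2 : ∀ j, |inner ℝ p.fn (mulL S.cp.bound ((u j).deriv j).fn)|
      ≤ 2 * (P.M * ε * (m * m)) := fun j => by
    have := (p.hasDq j).integral_sq_mul ((u j).hasDq j) S.cp.bound (fun h hh => S.cp.dbound j h hh)
    rw [← inner_mulL_comm, inner_mulL, this, abs_neg, abs_mul, abs_two, ← inner_mulL S.cp.bound,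
      inner_mulL_comm]
    exact mul_le_mul_of_nonneg_left (abs_inner_mulL_le _ (bp j) (bu j)) two_pos.le
  have c3 : ∀ k, |inner ℝ (u k).fn (mulL S.cphi.bound (p.deriv k).fn)| ≤ P.M * ε * (m * m) :=
    fun k => abs_inner_mulL_le _ (bu k) (bp k)
  have c4 : ∀ j k, |inner ℝ (u k).fn (mulL (S.cu j).bound ((u k).deriv j).fn)|
      ≤ P.M * ε * (m * m) := fun j k => abs_inner_mulL_le _ (bu k) (bdu j k)
  have e1 : inner ℝ p.fn pt = -(P.kappa₂ * ∑ j, inner ℝ p.fn ((u j).deriv j).fn)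
      - P.beta * ∑ j, inner ℝ p.fn (mulL S.cp.bound ((u j).deriv j).fn)
      - P.kappa₁ * ∑ j, inner ℝ p.fn (mulL (S.cu j).bound (p.deriv j).fn) := by
    conv_lhs => rw [S.pressure_eq]
    simp only [inner_sub_right, inner_neg_right, real_inner_smul_right, inner_sum]
  have e2 : ∀ k, inner ℝ (u k).fn (ut k) = -(P.kappa₂ * inner ℝ (u k).fn (p.deriv k).fn)
      - P.kappa₂ * inner ℝ (u k).fn (mulL S.cphi.bound (p.deriv k).fn)
      - P.kappa₁ * (∑ j, inner ℝ (u k).fn (mulL (S.cu j).bound ((u k).deriv j).fn))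
      - P.a * ‖(u k).fn‖ ^ 2 := fun k => by
    conv_lhs => rw [S.velocity_eq k]
    simp only [inner_sub_right, inner_neg_right, real_inner_smul_right, inner_sum,
      real_inner_self_eq_norm_sq]
  -- The linear coupling is skew and cancels between the two equations.
  have e3 : ∑ j, inner ℝ p.fn ((u j).deriv j).fn = -∑ k, inner ℝ (u k).fn (p.deriv k).fn := by
    rw [← Finset.sum_neg_distrib]
    refine Finset.sum_congr rfl fun j _ => ?_
    rw [(p.hasDq j).inner_eq ((u j).hasDq j), real_inner_comm]
  have d1 := abs_sum_three_le c1
  have d2 := abs_sum_three_le c2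
  have d3 := abs_sum_three_le c3
  have d4 := abs_sum_three_le fun k => abs_sum_three_le fun j => c4 j k
  rw [e1, Finset.sum_congr rfl fun k _ => e2 k, e3]
  simp only [Finset.sum_sub_distrib, Finset.sum_neg_distrib, ← Finset.mul_sum]
  generalize (∑ j, inner ℝ p.fn (mulL (S.cu j).bound (p.deriv j).fn)) = x1 at *
  generalize (∑ j, inner ℝ p.fn (mulL S.cp.bound ((u j).deriv j).fn)) = x2 at *
  generalize (∑ k, inner ℝ (u k).fn (mulL S.cphi.bound (p.deriv k).fn)) = x3 at *
  generalize (∑ k, ∑ j, inner ℝ (u k).fn (mulL (S.cu j).bound ((u k).deriv j).fn)) = x4 at *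
  have f : ∀ {c x K : ℝ}, 0 < c → c ≤ P.M → |x| ≤ K → -(c * x) ≤ P.M * K :=
    fun {c x K} h0 h1 h2 => by
      calc -(c * x) ≤ c * |x| := by nlinarith [neg_le_abs x]
        _ ≤ P.M * K := mul_le_mul h1 h2 (abs_nonneg _) M_pos.le
  have g1 := f k1 l1 d1; have g2 := f k3 l3 d2; have g3 := f k2 l2 d3; have g4 := f k1 l1 d4
  nlinarith

end FlowConstants.Slice

end


/-! ### The top order energy with the symmetrizer -/

noncomputable section

open Filter Topology
open scoped ENNReal

namespace FlowConstants.Slice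

variable {P : FlowConstants} {ε : ℝ} {p : Hm 3} {u : HmVec 3} {s : Hm 3} {pt : L2R3}
  {ut : Fin 3 → L2R3} {st : L2R3}

/-- The symmetrizer `1 + ψ` is bounded. -/
theorem weight_bound (S : P.Slice ε p u s pt ut st) :
    LpLe ∞ (fun x => 1 + P.psi (p.fn x) (s.fn x)) 2 := by
  refine LpLe.of_ae_abs_le (S.cpsi.bound.meas.const_add 1) two_pos.le ?_
  filter_upwards [S.cpsi.bound.ae_abs_le] with x hx
  have := S.M_mul_le
  have := abs_le.1 (hx.trans this)
  exact abs_le.2 ⟨by linarith, by linarith⟩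

theorem ae_weight (S : P.Slice ε p u s pt ut st) :
    ∀ᵐ x, 1 / 2 ≤ 1 + P.psi (p.fn x) (s.fn x) ∧ 1 + P.psi (p.fn x) (s.fn x) ≤ 3 / 2 := by
  filter_upwards [S.cpsi.bound.ae_abs_le] with x hx
  have := abs_le.1 (hx.trans S.M_mul_le)
  exact ⟨by linarith, by linarith⟩

theorem weight_mul_eq (S : P.Slice ε p u s pt ut st) (f : L2R3) :
    mulL S.weight_bound (P.kappa₂ • f + P.beta • mulL S.cp.bound f)
      = P.kappa₂ • f + P.kappa₂ • mulL S.cphi.bound f := by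
  refine Lp.ext ?_
  filter_upwards [coeFn_mulL S.weight_bound (P.kappa₂ • f + P.beta • mulL S.cp.bound f),
    Lp.coeFn_add (P.kappa₂ • f) (P.beta • mulL S.cp.bound f),
    Lp.coeFn_add (P.kappa₂ • f) (P.kappa₂ • mulL S.cphi.bound f), Lp.coeFn_smul P.kappa₂ f,
    Lp.coeFn_smul P.beta (mulL S.cp.bound f), Lp.coeFn_smul P.kappa₂ (mulL S.cphi.bound f),
    coeFn_mulL S.cp.bound f, coeFn_mulL S.cphi.bound f, S.cp.bound.ae_abs_le]
    with x h1 h2 h3 h4 h5 h6 h7 h8 h9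
  rw [h1, h2, h3, Pi.add_apply, Pi.add_apply, h4, h5, h6, Pi.smul_apply, Pi.smul_apply,
    Pi.smul_apply, h7, h8, smul_eq_mul, smul_eq_mul, smul_eq_mul]
  linear_combination f x * P.symmetrizer_mul (h9.trans S.M_mul_le_pInf) (s.fn x)

theorem weight_mul_bound (S : P.Slice ε p u s pt ut st) (j : Fin 3) :
    LpLe ∞ (fun x => (1 + P.psi (p.fn x) (s.fn x)) * (u j).fn x) (2 * (P.M * ε)) :=
  S.weight_bound.mul (S.cu j).bound

theorem weight_mul_lipschitz (S : P.Slice ε p u s pt ut st) (j i : Fin 3) {h : ℝ} (hh : 0 < h) :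
    LpLe ∞ (fd i h fun x => (1 + P.psi (p.fn x) (s.fn x)) * (u j).fn x) (3 * (P.M * ε)) := by
  have h1 : LpLe ∞ (fun x => (1 + P.psi (p.fn x) (s.fn x)) * fd i h (u j).fn x)
      (2 * (P.M * ε)) := S.weight_bound.mul ((S.cu j).dbound i h hh)
  have h2 : LpLe ∞ (fun x => fd i h (fun y => P.psi (p.fn y) (s.fn y)) x
      * (u j).fn (x + h • ev i)) (P.M * ε * (P.M * ε)) :=
    (S.cpsi.dbound i h hh).mul ((S.cu j).bound.comp_add (h • ev i))
  have h3 : (fd i h fun x => (1 + P.psi (p.fn x) (s.fn x)) * (u j).fn x)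
      = fun x => (1 + P.psi (p.fn x) (s.fn x)) * fd i h (u j).fn x
        + fd i h (fun y => P.psi (p.fn y) (s.fn y)) x * (u j).fn (x + h • ev i) := by
    rw [fd_mul]
    funext x
    simp only [fd]
    ring
  rw [h3]
  refine (h1.add h2).mono ?_
  have := S.M_mul_le
  have := S.cp.nonneg
  nlinarith

theorem mulL_weight_mul (S : P.Slice ε p u s pt ut st) (j : Fin 3) (f : L2R3) :
    mulL S.weight_bound (mulL (S.cu j).bound f) = mulL (S.weight_mul_bound j) f := by
  refine Lp.ext ?_
  filter_upwards [coeFn_mulL S.weight_bound (mulL (S.cu j).bound f), coeFn_mulL (S.cu j).bound f,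
    coeFn_mulL (S.weight_mul_bound j) f] with x h1 h2 h3
  rw [h1, h2, h3, mul_assoc]

/-- The top order energy estimate, for third differences. -/
theorem energy_three_le (S : P.Slice ε p u s pt ut st) (i : Fin 3) {h : ℝ} (hh : 0 < h) :
    inner ℝ (mulL S.weight_bound ((dq i h ^ 3) p.fn)) ((dq i h ^ 3) pt)
      + ∑ k, inner ℝ ((dq i h ^ 3) (u k).fn) ((dq i h ^ 3) (ut k))
      ≤ -P.a * ∑ k, ‖(dq i h ^ 3) (u k).fn‖ ^ 2 + 300 * P.M ^ 3 * ε * dissip p u ^ 2 := by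
  have k1 := P.kappa₁_pos; have k2 := P.kappa₂_pos; have k3 := P.beta_pos
  obtain ⟨l1, l2, l3⟩ := kappa_bounds P
  set m := dissip p u with hm
  have hm0 : 0 ≤ m := dissip_nonneg p u
  have hM0 : 0 < P.M := M_pos
  have hM1 : 1 ≤ P.M := P.M_spec.1
  have hε := S.eps_nonneg
  set T := dq i h ^ 3 with hT
  have bp : ‖T p.fn‖ ≤ m := (p.norm_dq_three_le i hh).trans ((p.norm_d3_le_deriv i).trans
    ((p.norm_deriv_le_grad i).trans (norm_grad_le_dissip p u)))
  have bu : ∀ k, ‖T (u k).fn‖ ≤ m := fun k => ((u k).norm_dq_three_le i hh).trans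
    (((u k).norm_d3_le_deriv i).trans (((u k).norm_deriv_le i).trans (norm_apply_le_dissip p u k)))
  have wp : ∀ j, HasDq j (T p.fn) (T (p.deriv j).fn) := fun j => (p.hasDq j).dq_pow i h 3
  have wu : ∀ j k, HasDq j (T (u k).fn) (T ((u k).deriv j).fn) :=
    fun j k => ((u k).hasDq j).dq_pow i h 3
  -- residuals
  obtain ⟨r, hr, hr'⟩ : ∃ r : L2R3, ‖r‖ ≤ 42 * P.M ^ 3 * ε * m ∧ T pt = r
      - ∑ j, (P.kappa₂ • T ((u j).deriv j).fn + P.beta • mulL S.cp.bound (T ((u j).deriv j).fn))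
      - P.kappa₁ • ∑ j, mulL (S.cu j).bound (T (p.deriv j).fn) := by
    refine ⟨-(P.beta • ∑ j, (T (mulL S.cp.bound ((u j).deriv j).fn)
        - mulL S.cp.bound (T ((u j).deriv j).fn))
      + P.kappa₁ • ∑ j, (T (mulL (S.cu j).bound (p.deriv j).fn)
        - mulL (S.cu j).bound (T (p.deriv j).fn))), ?_, ?_⟩
    · have h1 := norm_smul_le_M l3
        (norm_sum_three_le fun j => S.cp.norm_commutator_le (du P p u j j) i hh)
      have h2 := norm_smul_le_M l1
        (norm_sum_three_le fun j => (S.cu j).norm_commutator_le (dp P p u j) i hh)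
      rw [norm_neg]
      refine (norm_add_le_of_le h1 h2).trans (le_of_eq ?_)
      ring
    · have e := congrArg T S.pressure_eq
      simp only [map_sub, map_neg, map_smul, map_sum] at e
      rw [e]
      simp only [Finset.sum_add_distrib, Finset.sum_sub_distrib, ← Finset.smul_sum, smul_sub]
      abel
  have hres : ∀ k, ∃ r : L2R3, ‖r‖ ≤ 28 * P.M ^ 3 * ε * m ∧ T (ut k) = r
      - P.kappa₂ • T (p.deriv k).fn - P.kappa₂ • mulL S.cphi.bound (T (p.deriv k).fn)
      - P.kappa₁ • (∑ j, mulL (S.cu j).bound (T ((u k).deriv j).fn)) - P.a • T (u k).fn := by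
    intro k
    refine ⟨-(P.kappa₂ • (T (mulL S.cphi.bound (p.deriv k).fn)
        - mulL S.cphi.bound (T (p.deriv k).fn))
      + P.kappa₁ • ∑ j, (T (mulL (S.cu j).bound ((u k).deriv j).fn)
        - mulL (S.cu j).bound (T ((u k).deriv j).fn))), ?_, ?_⟩
    · have h1 := norm_smul_le_M l2 (S.cphi.norm_commutator_le (dp P p u k) i hh)
      have h2 := norm_smul_le_M l1
        (norm_sum_three_le fun j => (S.cu j).norm_commutator_le (du P p u j k) i hh)
      rw [norm_neg]
      refine (norm_add_le_of_le h1 h2).trans (le_of_eq ?_)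
      ring
    · have e := congrArg T (S.velocity_eq k)
      simp only [map_sub, map_neg, map_smul, map_sum] at e
      rw [e]
      simp only [Finset.sum_sub_distrib, smul_sub]
      abel
  choose rk hrk hrk' using hres
  set w := T p.fn with hw
  set v := fun k => T (u k).fn with hv
  set w' := fun j => T (p.deriv j).fn with hw'
  set v' := fun j k => T ((u k).deriv j).fn with hv'
  have e1 : inner ℝ (mulL S.weight_bound w) (T pt) = inner ℝ (mulL S.weight_bound w) r
      - ∑ j, (P.kappa₂ * inner ℝ w (v' j j) + P.kappa₂ * inner ℝ w (mulL S.cphi.bound (v' j j)))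
      - P.kappa₁ * ∑ j, inner ℝ w (mulL (S.weight_mul_bound j) (w' j)) := by
    rw [hr', inner_sub_right, inner_sub_right, real_inner_smul_right, inner_sum, inner_sum]
    -- The weight turns κ₂+βp into κ₂(1+φ), so the divergence now carries the coefficient of ∇p in
    -- the velocity equation.
    have s1 : ∀ j, inner ℝ (mulL S.weight_bound w) (P.kappa₂ • T ((u j).deriv j).fn
        + P.beta • mulL S.cp.bound (T ((u j).deriv j).fn))
        = P.kappa₂ * inner ℝ w (v' j j) + P.kappa₂ * inner ℝ w (mulL S.cphi.bound (v' j j)) :=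
      fun j => by
        rw [inner_mulL_comm, S.weight_mul_eq, inner_add_right, real_inner_smul_right,
          real_inner_smul_right]
    have s2 : ∀ j, inner ℝ (mulL S.weight_bound w) (mulL (S.cu j).bound (T (p.deriv j).fn))
        = inner ℝ w (mulL (S.weight_mul_bound j) (w' j)) := fun j => by
      rw [inner_mulL_comm, S.mulL_weight_mul]
    simp only [s1, s2]
  have e2 : ∀ k, inner ℝ (v k) (T (ut k)) = inner ℝ (v k) (rk k)
      - P.kappa₂ * inner ℝ (v k) (w' k) - P.kappa₂ * inner ℝ (v k) (mulL S.cphi.bound (w' k))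
      - P.kappa₁ * (∑ j, inner ℝ (v k) (mulL (S.cu j).bound (v' j k))) - P.a * ‖v k‖ ^ 2 :=
    fun k => by
      rw [hrk' k]
      simp only [inner_sub_right, real_inner_smul_right, inner_sum]
      rw [← real_inner_self_eq_norm_sq]
  have e3 : ∀ k, inner ℝ w (v' k k) = -inner ℝ (v k) (w' k) := fun k => by
    rw [(wp k).inner_eq (wu k k), real_inner_comm]
  have hQ : 0 ≤ P.M * ε * (m * m) := mul_nonneg (mul_nonneg hM0.le hε) (mul_nonneg hm0 hm0)
  have sq : ∀ {x : L2R3}, ‖x‖ ≤ m → ‖x‖ ^ 2 ≤ m * m := fun {x} hx => by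
    rw [pow_two]; exact mul_le_mul hx hx (norm_nonneg _) hm0
  have c1 : |inner ℝ (mulL S.weight_bound w) r| ≤ 84 * P.M ^ 3 * ε * (m * m) := by
    refine (abs_real_inner_le_norm _ _).trans ?_
    calc _ ≤ 2 * m * (42 * P.M ^ 3 * ε * m) :=
          mul_le_mul ((norm_mulL_le _ _).trans (mul_le_mul_of_nonneg_left bp two_pos.le)) hr
            (norm_nonneg _) (by positivity)
      _ = _ := by ring
  have c2 : ∀ k, |inner ℝ (v k) (rk k)| ≤ 28 * P.M ^ 3 * ε * (m * m) := fun k => by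
    refine (abs_real_inner_le_norm _ _).trans ?_
    calc _ ≤ m * (28 * P.M ^ 3 * ε * m) := mul_le_mul (bu k) (hrk k) (norm_nonneg _) hm0
      _ = _ := by ring
  -- Each of these two terms alone contains a fourth order quantity. Their sum is φ times a
  -- derivative of a product, and integration by parts leaves only the difference quotient of φ.
  have c3 : ∀ k, |inner ℝ w (mulL S.cphi.bound (v' k k))
      + inner ℝ (v k) (mulL S.cphi.bound (w' k))| ≤ P.M * ε * (m * m) := fun k =>
    ((wp k).abs_inner_le (wu k k) S.cphi.bound (fun t ht => S.cphi.dbound k t ht)).trans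
      (mul_le_mul_of_nonneg_left (mul_le_mul bp (bu k) (norm_nonneg _) hm0) S.cp.nonneg)
  -- Transport terms: c·w·∂w is half of c·∂(w²), so the derivative falls on the Lipschitz
  -- coefficient.
  have c4 : ∀ j, |inner ℝ w (mulL (S.weight_mul_bound j) (w' j))| ≤ 3 * (P.M * ε) * (m * m) :=
    fun j => ((wp j).abs_inner_self_le (S.weight_mul_bound j)
      (fun t ht => S.weight_mul_lipschitz j j ht)).trans
        (mul_le_mul_of_nonneg_left (sq bp) (by positivity))
  have c5 : ∀ j k, |inner ℝ (v k) (mulL (S.cu j).bound (v' j k))| ≤ P.M * ε * (m * m) :=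
    fun j k => ((wu j k).abs_inner_self_le (S.cu j).bound
      (fun t ht => (S.cu j).dbound j t ht)).trans
        (mul_le_mul_of_nonneg_left (sq (bu k)) S.cp.nonneg)
  have d2 := abs_sum_three_le c2
  have d3 := abs_sum_three_le c3
  have d4 := abs_sum_three_le c4
  have d5 := abs_sum_three_le fun k => abs_sum_three_le fun j => c5 j k
  rw [e1, Finset.sum_congr rfl fun k _ => e2 k]
  simp only [e3]
  simp only [Finset.sum_sub_distrib, Finset.sum_add_distrib, ← Finset.mul_sum,
    Finset.sum_neg_distrib] at d3 ⊢
  generalize inner ℝ (mulL S.weight_bound w) r = x1 at *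
  generalize (∑ k, inner ℝ (v k) (rk k)) = x2 at *
  generalize (∑ k, inner ℝ w (mulL S.cphi.bound (v' k k))) = x3 at *
  generalize (∑ k, inner ℝ (v k) (mulL S.cphi.bound (w' k))) = x3' at *
  generalize (∑ j, inner ℝ w (mulL (S.weight_mul_bound j) (w' j))) = x4 at *
  generalize (∑ k, ∑ j, inner ℝ (v k) (mulL (S.cu j).bound (v' j k))) = x5 at *
  have f : ∀ {c x K : ℝ}, |c| ≤ P.M → |x| ≤ K → -(c * x) ≤ P.M * K :=
    fun {c x K} h1 h2 => by
      refine (neg_le_abs _).trans ?_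
      rw [abs_mul]
      exact mul_le_mul h1 h2 (abs_nonneg _) M_pos.le
  have g3 := f l2 d3; have g4 := f l1 d4; have g5 := f l1 d5
  have g1 := (le_abs_self _).trans c1
  have g2 := (le_abs_self _).trans d2
  have hM : P.M * (P.M * ε * (m * m)) ≤ P.M ^ 3 * ε * (m * m) := by
    have : P.M ^ 2 * (ε * (m * m)) ≤ P.M ^ 3 * (ε * (m * m)) :=
      mul_le_mul_of_nonneg_right (pow_le_pow_right₀ hM1 (by norm_num)) (by positivity)
    linarith
  have hM3 : 0 ≤ P.M ^ 3 * ε * (m * m) := by positivity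
  nlinarith

end FlowConstants.Slice

end


/-! ### L¹ bounds of the nonlinearity, sizes of time derivatives, entropy estimates -/

noncomputable section

open Filter Topology
open scoped ENNReal

theorem LpLe.integral_abs_le {f : E3 → ℝ} {K : ℝ} (h : LpLe 1 f K) :
    Integrable f ∧ ∫ x, |f x| ≤ K := by
  have hi : Integrable f := memLp_one_iff_integrable.1 h.memLp
  refine ⟨hi, ?_⟩
  have := integral_norm_eq_lintegral_enorm h.meas
  simp only [Real.norm_eq_abs] at this
  rw [this, ← eLpNorm_one_eq_lintegral_enorm]
  exact ENNReal.toReal_le_of_le_ofReal h.nonneg h.le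

theorem LpLe.ae_norm_hat_le {f : L2R3} {K : ℝ} (h : LpLe 1 f K) : ∀ᵐ ξ, ‖hat f ξ‖ ≤ K := by
  obtain ⟨h1, h2⟩ := h.integral_abs_le
  filter_upwards [norm_hat_le_of_integrable f h1] with ξ hξ
  exact hξ.trans h2

namespace FlowConstants.Slice

variable {P : FlowConstants} {ε : ℝ} {p : Hm 3} {u : HmVec 3} {s : Hm 3} {pt : L2R3}
  {ut : Fin 3 → L2R3} {st : L2R3}

/-- Every nonlinear term is a product of a factor of L² size ε and one of L² size `dissip`. Being in
L¹, it has bounded Fourier transform; the factor ε is what later closes the decay argument. -/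
theorem pressure_residual_l1 (S : P.Slice ε p u s pt ut st) :
    LpLe 1 (pt + P.kappa₂ • ∑ j, ((u j).deriv j).fn : L2R3) (6 * P.M ^ 3 * ε * dissip p u) := by
  obtain ⟨l1, l2, l3⟩ := kappa_bounds P
  have h1 : LpLe 1 (fun x => ∑ j, p.fn x * ((u j).deriv j).fn x)
      (3 * (P.M * ε * (P.M * dissip p u))) := LpLe.sum fun j => S.cp.l2.mul (du P p u j j).l2
  have h2 : LpLe 1 (fun x => ∑ j, (u j).fn x * (p.deriv j).fn x)
      (3 * (P.M * ε * (P.M * dissip p u))) := LpLe.sum fun j => (S.cu j).l2.mul (dp P p u j).l2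
  have h3 := ((h1.const_mul P.beta).add (h2.const_mul P.kappa₁)).neg
  have h4 := (mul_le_mul_of_nonneg_right l3 h1.nonneg)
  have h5 := (mul_le_mul_of_nonneg_right l1 h1.nonneg)
  refine (h3.mono (K' := 6 * P.M ^ 3 * ε * dissip p u) (by linarith)).congr ?_
  filter_upwards [S.pressure, Lp.coeFn_add pt (P.kappa₂ • ∑ j, ((u j).deriv j).fn),
    Lp.coeFn_smul P.kappa₂ (∑ j, ((u j).deriv j).fn), coeFn_sum_L2 fun j => ((u j).deriv j).fn]
    with x a1 a2 a3 a4
  rw [a2, Pi.add_apply, a3, Pi.smul_apply, a4, a1, smul_eq_mul]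
  ring

theorem velocity_residual_l1 (S : P.Slice ε p u s pt ut st) (k : Fin 3) :
    LpLe 1 (ut k + P.kappa₂ • (p.deriv k).fn + P.a • (u k).fn : L2R3)
      (6 * P.M ^ 3 * ε * dissip p u) := by
  obtain ⟨l1, l2, l3⟩ := kappa_bounds P
  have h1 : LpLe 1 (fun x => P.phi (p.fn x) (s.fn x) * (p.deriv k).fn x)
      (P.M * ε * (P.M * dissip p u)) := S.cphi.l2.mul (dp P p u k).l2
  have h2 : LpLe 1 (fun x => ∑ j, (u j).fn x * ((u k).deriv j).fn x)
      (3 * (P.M * ε * (P.M * dissip p u))) := LpLe.sum fun j => (S.cu j).l2.mul (du P p u j k).l2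
  have h3 := ((h1.const_mul P.kappa₂).add (h2.const_mul P.kappa₁)).neg
  have h4 := (mul_le_mul_of_nonneg_right l2 h1.nonneg)
  have h5 := (mul_le_mul_of_nonneg_right l1 h2.nonneg)
  have h6 := mul_nonneg (M_pos (P := P)).le h1.nonneg
  refine (h3.mono (K' := 6 * P.M ^ 3 * ε * dissip p u) (by linarith)).congr ?_
  filter_upwards [S.velocity k, Lp.coeFn_add (ut k + P.kappa₂ • (p.deriv k).fn) (P.a • (u k).fn),
    Lp.coeFn_add (ut k) (P.kappa₂ • (p.deriv k).fn), Lp.coeFn_smul P.kappa₂ (p.deriv k).fn,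
    Lp.coeFn_smul P.a (u k).fn] with x a1 a2 a3 a4 a5
  rw [a2, Pi.add_apply, a3, Pi.add_apply, a4, a5, Pi.smul_apply, Pi.smul_apply, a1, smul_eq_mul,
    smul_eq_mul]
  ring

/-- The sup norm is needed because the weight 1+ψ moves in time at a rate proportional to the
pointwise time derivatives of `p` and `s`. -/
theorem ae_abs_pressure_le (S : P.Slice ε p u s pt ut st) : LpLe ∞ pt (6 * P.M ^ 2 * ε) := by
  obtain ⟨l1, l2, l3⟩ := kappa_bounds P
  have hε := S.eps_nonneg
  have hM0 : 0 < P.M := M_pos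
  have b1 : ∀ j, LpLe ∞ ((u j).deriv j).fn (P.M * ε) := fun j =>
    (dCoef_of_norm_le P _ (((u j).norm_deriv_le j).trans
      ((PiLp.norm_apply_le u j).trans S.hu))).bound
  have b2 : ∀ j, LpLe ∞ (p.deriv j).fn (P.M * ε) := fun j =>
    (dCoef_of_norm_le P _ ((p.norm_deriv_le j).trans S.hp)).bound
  have h0 : LpLe ∞ (fun x => ∑ j, ((u j).deriv j).fn x) (3 * (P.M * ε)) := LpLe.sum b1
  have h1 : LpLe ∞ (fun x => ∑ j, p.fn x * ((u j).deriv j).fn x) (3 * (P.M * ε * (P.M * ε))) :=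
    LpLe.sum fun j => S.cp.bound.mul (b1 j)
  have h2 : LpLe ∞ (fun x => ∑ j, (u j).fn x * (p.deriv j).fn x) (3 * (P.M * ε * (P.M * ε))) :=
    LpLe.sum fun j => (S.cu j).bound.mul (b2 j)
  have h3 := (((h0.const_mul P.kappa₂).neg).sub (h1.const_mul P.beta)).sub
    (h2.const_mul P.kappa₁)
  have h4 := mul_le_mul_of_nonneg_right l3 h1.nonneg
  have h5 := mul_le_mul_of_nonneg_right l1 h1.nonneg
  have h6 := mul_le_mul_of_nonneg_right l2 h0.nonneg
  have h7 : P.M * ε * (P.M * ε) ≤ 1 / 2 * (P.M * ε) :=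
    mul_le_mul_of_nonneg_right S.M_mul_le (by positivity)
  have h8 := mul_le_mul_of_nonneg_left h7 hM0.le
  refine (h3.mono (K' := 6 * P.M ^ 2 * ε) (by linarith)).congr ?_
  filter_upwards [S.pressure] with x hx
  rw [hx]

theorem ae_abs_entropy_le (S : P.Slice ε p u s pt ut st) : LpLe ∞ st (6 * P.M ^ 2 * ε) := by
  obtain ⟨l1, l2, l3⟩ := kappa_bounds P
  have hε := S.eps_nonneg
  have hM0 : 0 < P.M := M_pos
  have b2 : ∀ j, LpLe ∞ (s.deriv j).fn (P.M * ε) := fun j =>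
    (dCoef_of_norm_le P _ ((s.norm_deriv_le j).trans S.hs)).bound
  have h2 : LpLe ∞ (fun x => ∑ j, (u j).fn x * (s.deriv j).fn x) (3 * (P.M * ε * (P.M * ε))) :=
    LpLe.sum fun j => (S.cu j).bound.mul (b2 j)
  have h3 := (h2.const_mul P.kappa₁).neg
  have h5 := mul_le_mul_of_nonneg_right l1 h2.nonneg
  have h7 : P.M * ε * (P.M * ε) ≤ 1 / 2 * (P.M * ε) :=
    mul_le_mul_of_nonneg_right S.M_mul_le (by positivity)
  have h8 := mul_le_mul_of_nonneg_left h7 hM0.le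
  have h9 : 0 ≤ P.M ^ 2 * ε := by positivity
  refine (h3.mono (K' := 6 * P.M ^ 2 * ε) (by linarith)).congr ?_
  filter_upwards [S.entropy] with x hx
  rw [hx]

/-- Every term of the equation contains ∇p or `u`, so the time derivative inherits the decay of
`dissip`. The same holds for the velocity and the entropy. -/
theorem norm_pressure_le (S : P.Slice ε p u s pt ut st) :
    ‖pt‖ ≤ (3 * P.M + 24 * P.M ^ 3 * ε) * dissip p u := by
  obtain ⟨l1, l2, l3⟩ := kappa_bounds P
  have h1 := S.norm_pressure_residual_le productBound_one
  simp only [one_apply_eq_self] at h1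
  have h2 := norm_smul_le_M l2 (norm_sum_three_le (f := fun j => ((u j).deriv j).fn) fun j =>
    ((u j).deriv j).norm_fn_le.trans (((u j).norm_deriv_le j).trans (norm_apply_le_dissip p u j)))
  have := norm_sub_le_of_le h1 h2
  rw [add_sub_cancel_right] at this
  linarith

theorem norm_velocity_le (S : P.Slice ε p u s pt ut st) (k : Fin 3) :
    ‖ut k‖ ≤ (2 * P.M + 24 * P.M ^ 3 * ε) * dissip p u := by
  obtain ⟨l1, l2, l3⟩ := kappa_bounds P
  have l4 : |P.a| ≤ P.M := by rw [abs_of_pos P.a_pos]; exact P.M_spec.2.2.2.2.2.2.2.1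
  have h1 := S.norm_velocity_residual_le productBound_one k
  simp only [one_apply_eq_self] at h1
  have h2 := norm_smul_le_M l2 ((p.deriv k).norm_fn_le.trans ((p.norm_deriv_le_grad k).trans
    (norm_grad_le_dissip p u)))
  have h3 := norm_smul_le_M l4 ((u k).norm_fn_le.trans (norm_apply_le_dissip p u k))
  have := norm_sub_le_of_le (norm_sub_le_of_le h1 h3) h2
  rw [add_sub_cancel_right, add_sub_cancel_right] at this
  linarith

/-- Here the constant is ‖u‖ instead of ε: the growth rate of the entropy has to be integrable in
time. -/
theorem coef_velocity (P : FlowConstants) (u : HmVec 3) (j : Fin 3) :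
    Coef (P.M * ‖u‖) (u j).fn := coef_of_norm_le P _ (PiLp.norm_apply_le u j)

theorem norm_entropy_le (S : P.Slice ε p u s pt ut st) :
    ‖st‖ ≤ 3 * P.M ^ 3 * ε * dissip p u := by
  obtain ⟨l1, l2, l3⟩ := kappa_bounds P
  have h := norm_smul_le_M l1 (norm_sum_three_le (f := fun j =>
    mulL (coef_velocity P u j).bound (s.deriv j).fn) fun j => (coef_velocity P u j).norm_mul_le
      (dCoef_of_norm_le P _ ((s.norm_deriv_le j).trans S.hs)))
  rw [S.entropy_eq, norm_neg]
  refine h.trans ?_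
  have hM0 : 0 < P.M := M_pos
  have hε := S.eps_nonneg
  have := mul_le_mul_of_nonneg_left (norm_le_dissip p u) (by positivity : 0 ≤ 3 * P.M ^ 3 * ε)
  linarith

/-- The entropy energy estimate, order zero. -/
theorem entropy_zero_le (S : P.Slice ε p u s pt ut st) :
    inner ℝ s.fn st ≤ 3 * P.M ^ 2 * ‖u‖ * ‖s‖ ^ 2 := by
  obtain ⟨l1, l2, l3⟩ := kappa_bounds P
  have h1 : ∀ j, |inner ℝ s.fn (mulL (S.cu j).bound (s.deriv j).fn)| ≤ P.M * ‖u‖ * ‖s‖ ^ 2 :=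
    fun j => ((s.hasDq j).abs_inner_self_le (S.cu j).bound
      (fun t ht => (coef_velocity P u j).dbound j t ht)).trans
      (mul_le_mul_of_nonneg_left (pow_le_pow_left₀ (norm_nonneg _) s.norm_fn_le 2)
        (coef_velocity P u j).nonneg)
  have h2 := abs_sum_three_le h1
  have e : inner ℝ s.fn st
      = -(P.kappa₁ * ∑ j, inner ℝ s.fn (mulL (S.cu j).bound (s.deriv j).fn)) := by
    conv_lhs => rw [S.entropy_eq]
    simp only [inner_neg_right, real_inner_smul_right, inner_sum]
  rw [e]
  refine (neg_le_abs _).trans ?_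
  rw [abs_mul]
  refine (mul_le_mul l1 h2 (abs_nonneg _) M_pos.le).trans (le_of_eq (by ring))

/-- The entropy energy estimate for third differences. -/
theorem entropy_three_le (S : P.Slice ε p u s pt ut st) (i : Fin 3) {h : ℝ} (hh : 0 < h) :
    inner ℝ ((dq i h ^ 3) s.fn) ((dq i h ^ 3) st) ≤ 24 * P.M ^ 3 * ‖u‖ * ‖s‖ ^ 2 := by
  obtain ⟨l1, l2, l3⟩ := kappa_bounds P
  have hM0 : 0 < P.M := M_pos
  have hM1 : 1 ≤ P.M := P.M_spec.1
  set T := dq i h ^ 3 with hT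
  have bs : ‖T s.fn‖ ≤ ‖s‖ := (s.norm_dq_three_le i hh).trans ((s.norm_d3_le_deriv i).trans
    (s.norm_deriv_le i))
  have h1 : ∀ j, |inner ℝ (T s.fn) (T (mulL (S.cu j).bound (s.deriv j).fn))|
      ≤ P.M * ‖u‖ * ‖s‖ ^ 2 + 7 * P.M ^ 2 * ‖u‖ * ‖s‖ ^ 2 := fun j => by
    have a1 : |inner ℝ (T s.fn) (mulL (S.cu j).bound (T (s.deriv j).fn))|
        ≤ P.M * ‖u‖ * ‖s‖ ^ 2 :=
      (((s.hasDq j).dq_pow i h 3).abs_inner_self_le (S.cu j).bound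
      (fun t ht => (coef_velocity P u j).dbound j t ht)).trans
      (mul_le_mul_of_nonneg_left (pow_le_pow_left₀ (norm_nonneg _) bs 2)
        (coef_velocity P u j).nonneg)
    have a2 : ‖T (mulL (S.cu j).bound (s.deriv j).fn) - mulL (S.cu j).bound (T (s.deriv j).fn)‖
        ≤ 7 * (P.M * ‖u‖) * (P.M * ‖s‖) :=
      (coef_velocity P u j).norm_commutator_le (dCoef_of_norm_le P _ (s.norm_deriv_le j)) i hh
    have a3 : |inner ℝ (T s.fn) (T (mulL (S.cu j).bound (s.deriv j).fn)
        - mulL (S.cu j).bound (T (s.deriv j).fn))| ≤ 7 * P.M ^ 2 * ‖u‖ * ‖s‖ ^ 2 := by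
      refine (abs_real_inner_le_norm _ _).trans ?_
      refine (mul_le_mul bs a2 (norm_nonneg _) (norm_nonneg _)).trans (le_of_eq (by ring))
    rw [inner_sub_right] at a3
    have := abs_add_le (inner ℝ (T s.fn) (mulL (S.cu j).bound (T (s.deriv j).fn)))
      (inner ℝ (T s.fn) (T (mulL (S.cu j).bound (s.deriv j).fn))
        - inner ℝ (T s.fn) (mulL (S.cu j).bound (T (s.deriv j).fn)))
    rw [add_sub_cancel] at this
    linarith
  have h2 := abs_sum_three_le h1
  have e : inner ℝ (T s.fn) (T st)
      = -(P.kappa₁ * ∑ j, inner ℝ (T s.fn) (T (mulL (S.cu j).bound (s.deriv j).fn))) := by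
    conv_lhs => rw [S.entropy_eq]
    simp only [map_neg, map_smul, map_sum, inner_neg_right, real_inner_smul_right, inner_sum]
  rw [e]
  refine (neg_le_abs _).trans ?_
  rw [abs_mul]
  refine (mul_le_mul l1 h2 (abs_nonneg _) M_pos.le).trans ?_
  have : P.M ^ 2 * (‖u‖ * ‖s‖ ^ 2) ≤ P.M ^ 3 * (‖u‖ * ‖s‖ ^ 2) :=
    mul_le_mul_of_nonneg_right (pow_le_pow_right₀ hM1 (by norm_num)) (by positivity)
  linarith

end FlowConstants.Slice

end


/-! ### One-sided derivatives, and the symmetrizer as a Lipschitz function -/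

noncomputable section

open Filter Topology
open scoped ENNReal

/-- The upper right derivative of `f` at `x` is at most `d`. -/
def UpperSlope (f : ℝ → ℝ) (x d : ℝ) : Prop := ∀ r, d < r → ∀ᶠ z in 𝓝[>] x, slope f x z < r

theorem UpperSlope.mono {f : ℝ → ℝ} {x d d' : ℝ} (h : UpperSlope f x d) (hd : d ≤ d') :
    UpperSlope f x d' := fun r hr => h r (hd.trans_lt hr)

theorem UpperSlope.add {f g : ℝ → ℝ} {x d d' : ℝ} (h : UpperSlope f x d) (h' : UpperSlope g x d') :
    UpperSlope (fun z => f z + g z) x (d + d') := fun r hr => by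
  filter_upwards [h (d + (r - d - d') / 2) (by linarith), h' (d' + (r - d - d') / 2) (by linarith)]
    with z h1 h2
  have : slope (fun z => f z + g z) x z = slope f x z + slope g x z := by
    simp only [slope_def_field]; ring
  rw [this]; linarith

theorem UpperSlope.of_hasDerivWithinAt {f : ℝ → ℝ} {x d : ℝ}
    (h : HasDerivWithinAt f d (Ioi x) x) : UpperSlope f x d := fun _ hr =>
  ((hasDerivWithinAt_iff_tendsto_slope' (by simp)).1 h).eventually (gt_mem_nhds hr)

theorem HasDerivWithinAt.Ioi_of_Icc {E : Type*} [NormedAddCommGroup E] [NormedSpace ℝ E]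
    {f : ℝ → E} {f' : E} {a b x : ℝ} (h : HasDerivWithinAt f f' (Icc a b) x) (hx : x ∈ Ico a b) :
    HasDerivWithinAt f f' (Ioi x) x :=
  h.mono_of_mem_nhdsWithin (Icc_mem_nhdsGT_of_mem hx)

/-- Comparison with a primitive of the bound. Upper Dini derivatives suffice for energy
inequalities, so the time derivative of the weight has to be bounded only, never computed. -/
theorem UpperSlope.sub_le_integral {f Φ : ℝ → ℝ} {a b : ℝ} (hab : a ≤ b)
    (hf : ContinuousOn f (Icc a b)) (hΦ : ContinuousOn Φ (Icc a b))
    (h : ∀ x ∈ Ico a b, UpperSlope f x (Φ x)) : f b - f a ≤ ∫ x in a..b, Φ x := by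
  have hi : IntervalIntegrable Φ volume a b := hΦ.intervalIntegrable_of_Icc hab
  have key := image_le_of_liminf_slope_right_le_deriv_boundary (f := f) (a := a) (b := b) hf
    (B := fun x => f a + ∫ t in a..x, Φ t) (B' := Φ) (by simp) ?_ ?_ ?_ (right_mem_Icc.2 hab)
  · linarith
  · refine continuousOn_const.add ?_
    have := intervalIntegral.continuousOn_primitive_interval (μ := volume) (a := a) (b := b)
      (f := Φ) (by rw [uIcc_of_le hab]; exact hΦ.integrableOn_Icc)
    rwa [uIcc_of_le hab] at this
  · intro x hx
    have hx' : x ∈ Icc a b := ⟨hx.1, hx.2.le⟩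
    refine HasDerivWithinAt.const_add _ ?_
    have hc : ContinuousWithinAt Φ (Ioi x) x :=
      (hΦ x hx').mono_of_mem_nhdsWithin (Icc_mem_nhdsGT_of_mem hx)
    have hm : StronglyMeasurableAtFilter Φ (𝓝[Ioi x] x) volume :=
      ⟨Icc a b, Icc_mem_nhdsGT_of_mem hx, hΦ.aestronglyMeasurable measurableSet_Icc⟩
    exact intervalIntegral.integral_hasDerivWithinAt_right
      (hi.mono_set (by rw [uIcc_of_le hx.1, uIcc_of_le hab]; exact Icc_subset_Icc le_rfl hx.2.le))
      hm hc
  · exact fun x hx r hr => (h x hx r hr).frequently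

/-- Energy inequalities pass to the limit. -/
theorem sub_le_integral_of_tendsto {F : ℝ → ℝ → ℝ} {f Φ : ℝ → ℝ} {G : ℝ → ℝ → ℝ} {a b C : ℝ}
    (hab : a ≤ b) (h : ∀ η, 0 < η → F η b - F η a ≤ ∫ t in a..b, G η t)
    (hc : ∀ η, 0 < η → ContinuousOn (G η) (Icc a b))
    (hC : ∀ η, 0 < η → ∀ t ∈ Icc a b, |G η t| ≤ C)
    (ha : Tendsto (fun η => F η a) (𝓝[>] 0) (𝓝 (f a)))
    (hb : Tendsto (fun η => F η b) (𝓝[>] 0) (𝓝 (f b)))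
    (hG : ∀ t ∈ Icc a b, Tendsto (fun η => G η t) (𝓝[>] 0) (𝓝 (Φ t))) :
    f b - f a ≤ ∫ t in a..b, Φ t := by
  have hsub : ∀ t, t ∈ uIoc a b → t ∈ Icc a b := fun t ht => by
    rw [uIoc_of_le hab] at ht; exact Ioc_subset_Icc_self ht
  have h1 := intervalIntegral.tendsto_integral_filter_of_dominated_convergence
    (μ := volume) (a := a) (b := b) (l := 𝓝[>] (0 : ℝ)) (F := G) (f := Φ) (fun _ => C) ?_ ?_
    (by simp) ?_
  · refine le_of_tendsto_of_tendsto (hb.sub ha) h1 ?_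
    filter_upwards [self_mem_nhdsWithin] with η hη using h η hη
  · filter_upwards [self_mem_nhdsWithin] with η hη
    rw [uIoc_of_le hab]
    exact ((hc η hη).mono Ioc_subset_Icc_self).aestronglyMeasurable measurableSet_Ioc
  · filter_upwards [self_mem_nhdsWithin] with η hη
    exact Eventually.of_forall fun t ht => hC η hη t (hsub t ht)
  · exact Eventually.of_forall fun t ht => hG t (hsub t ht)

/-- A weighted square `⟨w, w⟩_q` with a weight `q` that is Lipschitz in time. -/
theorem upperSlope_weighted {E : Type*} [NormedAddCommGroup E] [InnerProductSpace ℝ E]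
    {Q : ℝ → E → ℝ} {L : E →L[ℝ] E} {w : ℝ → E} {w' : E} {x c : ℝ}
    (hL : ∀ v v', inner ℝ (L v) v' = inner ℝ v (L v'))
    (hx : ∀ v, Q x v = inner ℝ (L v) v)
    (hQ : ∀ c', c < c' → ∀ᶠ z in 𝓝[>] x, ∀ v, Q z v - Q x v ≤ (z - x) * (c' * ‖v‖ ^ 2))
    (hw : HasDerivWithinAt w w' (Ioi x) x) :
    UpperSlope (fun z => Q z (w z)) x (2 * inner ℝ (L (w x)) w' + c * ‖w x‖ ^ 2) := by
  -- With the weight frozen at time x the quadratic form is differentiable, by symmetry of L.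
  have h1 : HasDerivWithinAt (fun z => Q x (w z)) (2 * inner ℝ (L (w x)) w') (Ioi x) x := by
    simp only [hx]
    have := (L.hasFDerivAt.comp_hasDerivWithinAt x hw).inner ℝ hw
    refine this.congr_deriv ?_
    simp only [Function.comp]
    rw [hL w' (w x), real_inner_comm (L (w x)) w']
    ring
  -- The change of the weight contributes at most its Lipschitz rate times ‖w‖²; continuity of `w`
  -- at x lets the rate be evaluated there.
  have h2 : UpperSlope (fun z => Q z (w z) - Q x (w z)) x (c * ‖w x‖ ^ 2) := fun r hr => by
    set c' := c + (r - c * ‖w x‖ ^ 2) / (2 * (‖w x‖ ^ 2 + 1)) with hc'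
    have hpos : 0 < r - c * ‖w x‖ ^ 2 := by linarith
    have hc1 : c < c' := by rw [hc']; exact lt_add_of_pos_right _ (by positivity)
    have hc2 : c' * ‖w x‖ ^ 2 < r := by
      have : (r - c * ‖w x‖ ^ 2) / (2 * (‖w x‖ ^ 2 + 1)) * ‖w x‖ ^ 2
          ≤ (r - c * ‖w x‖ ^ 2) / 2 := by
        rw [div_mul_eq_mul_div, div_le_div_iff₀ (by positivity) two_pos]
        nlinarith
      rw [hc', add_mul]; linarith
    have hcont : Tendsto (fun z => c' * ‖w z‖ ^ 2) (𝓝[>] x) (𝓝 (c' * ‖w x‖ ^ 2)) :=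
      (hw.continuousWithinAt.norm.pow 2).const_mul c'
    filter_upwards [hQ c' hc1, hcont.eventually (gt_mem_nhds hc2), self_mem_nhdsWithin]
      with z a1 a2 a3
    have hz : 0 < z - x := sub_pos.2 a3
    rw [slope_def_field, sub_self, sub_zero, div_lt_iff₀ hz]
    calc Q z (w z) - Q x (w z) ≤ (z - x) * (c' * ‖w z‖ ^ 2) := a1 _
      _ < r * (z - x) := by rw [mul_comm]; exact mul_lt_mul_of_pos_right a2 hz
  have := (UpperSlope.of_hasDerivWithinAt h1).add h2
  simpa using this

namespace FlowConstants

variable {P : FlowConstants}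

theorem abs_exp_sub_exp_le {x y B : ℝ} (hx : Real.exp x ≤ B) (hy : Real.exp y ≤ B) :
    |Real.exp x - Real.exp y| ≤ B * |x - y| := by
  have key : ∀ {a b : ℝ}, Real.exp a ≤ B → b ≤ a → Real.exp a - Real.exp b ≤ B * (a - b) := by
    intro a b ha hab
    have h1 := Real.add_one_le_exp (b - a)
    have h2 : Real.exp b = Real.exp a * Real.exp (b - a) := by rw [← Real.exp_add]; ring_nf
    have h3 := Real.exp_pos a
    nlinarith
  rcases le_total x y with h | h
  · rw [abs_sub_comm, abs_sub_comm x, abs_of_nonneg (sub_nonneg.2 (Real.exp_le_exp.2 h)),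
      abs_of_nonneg (sub_nonneg.2 h)]
    exact key hy h
  · rw [abs_of_nonneg (sub_nonneg.2 (Real.exp_le_exp.2 h)), abs_of_nonneg (sub_nonneg.2 h)]
    exact key hx h

theorem abs_log_sub_log_le {x y : ℝ} (hx : 1 / 2 ≤ x) (hy : 1 / 2 ≤ y) :
    |Real.log x - Real.log y| ≤ 2 * |x - y| := by
  have key : ∀ {a b : ℝ}, 1 / 2 ≤ b → b ≤ a → Real.log a - Real.log b ≤ 2 * (a - b) := by
    intro a b hb hab
    have hb0 : 0 < b := by linarith
    rw [← Real.log_div (by linarith) hb0.ne']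
    have h1 := Real.log_le_sub_one_of_pos (div_pos (by linarith : 0 < a) hb0)
    have h2 : a / b - 1 = (a - b) / b := by field_simp
    have h3 : (a - b) / b ≤ 2 * (a - b) := by
      rw [div_le_iff₀ hb0]; nlinarith
    linarith
  rcases le_total x y with h | h
  · rw [abs_sub_comm, abs_sub_comm x, abs_of_nonneg (sub_nonneg.2 (Real.log_le_log (by linarith) h)),
      abs_of_nonneg (sub_nonneg.2 h)]
    exact key hx h
  · rw [abs_of_nonneg (sub_nonneg.2 (Real.log_le_log (by linarith) h)),
      abs_of_nonneg (sub_nonneg.2 h)]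
    exact key hy h

/-- A Lipschitz constant of the symmetrizer. -/
def lipPsi (P : FlowConstants) : ℝ := 3 / 2 * (P.sig + (P.theta + 1) * (2 / P.pInf))

theorem sig_pos (P : FlowConstants) : 0 < P.sig := by
  have := P.R_pos; have := P.cv_pos; unfold sig; positivity

theorem theta_pos (P : FlowConstants) : 0 < P.theta := by
  have := P.R_pos; have := P.cv_pos; unfold theta; positivity

theorem lipPsi_pos (P : FlowConstants) : 0 < P.lipPsi := by
  have := P.sig_pos; have := P.theta_pos; have := P.pInf_pos
  unfold lipPsi; positivity

/-- The exponential has Lipschitz constant 3/2 where its values stay below 3/2, and the logarithm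
has constant 2 where 1+y/p_∞ ≥ 1/2. Their product appears in `lipPsi`. -/
theorem abs_psi_sub_le {y z y' z' : ℝ} (hy : |y| ≤ P.pInf / 2) (hy' : |y'| ≤ P.pInf / 2)
    (h : 1 + P.psi y z ≤ 3 / 2) (h' : 1 + P.psi y' z' ≤ 3 / 2) :
    |P.psi y z - P.psi y' z'| ≤ P.lipPsi * (|y - y'| + |z - z'|) := by
  have hs := P.sig_pos; have ht := P.theta_pos; have hb := P.pInf_pos
  have half : ∀ {y : ℝ}, |y| ≤ P.pInf / 2 → 1 / 2 ≤ 1 + y / P.pInf := fun {y} hy => by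
    have h1 := (abs_le.1 hy).1
    have : -(1 / 2) ≤ y / P.pInf := by rw [le_div_iff₀ hb]; linarith
    linarith
  simp only [psi, add_sub_cancel] at h h'
  rw [psi, psi, sub_sub_sub_cancel_right]
  have h1 := abs_log_sub_log_le (half hy) (half hy')
  rw [show 1 + y / P.pInf - (1 + y' / P.pInf) = (y - y') / P.pInf by ring, abs_div,
    abs_of_pos hb] at h1
  refine (abs_exp_sub_exp_le h h').trans ?_
  have h2 : |P.sig * z - (P.theta + 1) * Real.log (1 + y / P.pInf)
      - (P.sig * z' - (P.theta + 1) * Real.log (1 + y' / P.pInf))|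
      ≤ P.sig * |z - z'| + (P.theta + 1) * (2 * (|y - y'| / P.pInf)) := by
    rw [show P.sig * z - (P.theta + 1) * Real.log (1 + y / P.pInf)
      - (P.sig * z' - (P.theta + 1) * Real.log (1 + y' / P.pInf)) = P.sig * (z - z')
        - (P.theta + 1) * (Real.log (1 + y / P.pInf) - Real.log (1 + y' / P.pInf)) by ring]
    refine (abs_sub _ _).trans ?_
    rw [abs_mul, abs_mul, abs_of_pos hs, abs_of_pos (by linarith : 0 < P.theta + 1)]
    gcongr
  refine (mul_le_mul_of_nonneg_left h2 (by norm_num)).trans ?_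
  have h3 : 0 ≤ P.sig * |y - y'| := by positivity
  have h4 : 0 ≤ (P.theta + 1) * (2 / P.pInf) * |z - z'| := by positivity
  have h5 : (P.theta + 1) * (2 * (|y - y'| / P.pInf))
    = (P.theta + 1) * (2 / P.pInf) * |y - y'| := by ring
  rw [lipPsi, h5]
  nlinarith

end FlowConstants

end


/-! ### Small solutions as curves in time, and the weighted norm -/

noncomputable section

open Filter Topology
open scoped ENNReal

instance Hm.instNormedSpace (m : ℕ) : NormedSpace ℝ (Hm m) := inferInstance

instance HmVec.instNormedSpace (m : ℕ) : NormedSpace ℝ (HmVec m) :=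
  PiLp.normedSpace 2 ℝ fun _ : Fin 3 => Hm m

/-- The coordinates of a vector field as continuous linear maps. -/
def HmVec.coordL {m : ℕ} (k : Fin 3) : HmVec m →L[ℝ] Hm m :=
  PiLp.proj 2 (fun _ : Fin 3 => Hm m) k

namespace FlowConstants

/-- A small solution of the system on `[0,T]`. -/
structure Sol (P : FlowConstants) (ε T : ℝ) (p : ℝ → Hm 3) (u : ℝ → HmVec 3) (s : ℝ → Hm 3) :
    Prop where
  inX : InX T p u s
  slice : ∀ t ∈ Icc 0 T, P.Slice ε (p t) (u t) (s t) (dt T p t).fn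
    (fun k => (dtVec T u t k).fn) (dt T s t).fn

theorem Sol.of_solvesIVP {P : FlowConstants} {ε T : ℝ} {p₀ : Hm 3} {u₀ : HmVec 3} {s₀ : Hm 3}
    {p : ℝ → Hm 3} {u : ℝ → HmVec 3} {s : ℝ → Hm 3} (hX : InX T p u s)
    (h : SolvesIVP P T p₀ u₀ s₀ p u s) (hε : ε ≤ P.eps₀)
    (hn : ∀ t ∈ Icc 0 T, normPUS (p t) (u t) (s t) ≤ ε) : P.Sol ε T p u s := by
  refine ⟨hX, fun t ht => ?_⟩
  have hn' := hn t ht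
  have hp : ‖p t‖ ≤ ε := (Real.le_sqrt_of_sq_le (by nlinarith [sq_nonneg ‖u t‖, sq_nonneg ‖s t‖])
    |>.trans hn')
  have hu : ‖u t‖ ≤ ε := (Real.le_sqrt_of_sq_le (by nlinarith [sq_nonneg ‖p t‖, sq_nonneg ‖s t‖])
    |>.trans hn')
  have hs : ‖s t‖ ≤ ε := (Real.le_sqrt_of_sq_le (by nlinarith [sq_nonneg ‖u t‖, sq_nonneg ‖p t‖])
    |>.trans hn')
  refine ⟨hε, hp, hu, hs, ?_, fun k => ?_, ?_⟩
  · filter_upwards [h.pressure t ht] with x hx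
    rw [eq_sub_of_add_eq hx, F, beta, ← Finset.mul_sum]
    ring
  -- The formula for 1/ρ holds only where |p| ≤ p_∞/2, which follows from smallness in H³ and the
  -- Sobolev embedding.
  · have hb : ∀ᵐ x, |(p t).fn x| ≤ P.pInf / 2 := by
      filter_upwards [(Slice.coef_of_norm_le P (p t) hp).bound.ae_abs_le] with x hx
      exact hx.trans ((mul_le_mul_of_nonneg_left hε Slice.M_pos.le).trans P.M_spec.2.2.2.1)
    filter_upwards [h.velocity t ht k, hb] with x hx hb
    have e := P.inv_rho_sub hb ((s t).fn x)
    rw [G, e] at hx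
    linear_combination hx
  · filter_upwards [h.entropy t ht] with x hx
    linear_combination hx

namespace Sol

variable {P : FlowConstants} {ε T : ℝ} {p : ℝ → Hm 3} {u : ℝ → HmVec 3} {s : ℝ → Hm 3}

theorem hasDeriv_p (S : P.Sol ε T p u s) {t : ℝ} (ht : t ∈ Icc 0 T) :
    HasDerivWithinAt (fun τ => (p τ).incl) (dt T p t) (Icc 0 T) t :=
  (S.inX.p_C1.differentiableOn one_ne_zero t ht).hasDerivWithinAt

theorem hasDeriv_s (S : P.Sol ε T p u s) {t : ℝ} (ht : t ∈ Icc 0 T) :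
    HasDerivWithinAt (fun τ => (s τ).incl) (dt T s t) (Icc 0 T) t :=
  (S.inX.s_C1.differentiableOn one_ne_zero t ht).hasDerivWithinAt

theorem hasDeriv_u (S : P.Sol ε T p u s) {t : ℝ} (ht : t ∈ Icc 0 T) (k : Fin 3) :
    HasDerivWithinAt (fun τ => (u τ k).incl) (dtVec T u t k) (Icc 0 T) t := by
  have h1 : HasDerivWithinAt (fun τ => HmVec.incl (u τ)) (dtVec T u t) (Icc 0 T) t :=
    (S.inX.u_C1.differentiableOn one_ne_zero t ht).hasDerivWithinAt
  have h2 := (HmVec.coordL (m := 2) k).hasFDerivAt (x := HmVec.incl (u t))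
  exact h2.comp_hasDerivWithinAt t h1

theorem hasDeriv_fn {f : ℝ → Hm 3} {f' : Hm 2} {I : Set ℝ} {t : ℝ}
    (h : HasDerivWithinAt (fun τ => (f τ).incl) f' I t) (A : L2R3 →L[ℝ] L2R3) :
    HasDerivWithinAt (fun τ => A (f τ).fn) (A f'.fn) I t :=
  (A.comp Hm.fnL).hasFDerivAt.comp_hasDerivWithinAt t h

theorem hasDeriv_deriv_fn {f : ℝ → Hm 3} {f' : Hm 2} {I : Set ℝ} {t : ℝ}
    (h : HasDerivWithinAt (fun τ => (f τ).incl) f' I t) (k : Fin 3) (A : L2R3 →L[ℝ] L2R3) :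
    HasDerivWithinAt (fun τ => A ((f τ).deriv k).fn) (A (f'.deriv k).fn) I t :=
  (A.comp (Hm.fnL.comp (Hm.derivL k))).hasFDerivAt.comp_hasDerivWithinAt t h

theorem cont_u (S : P.Sol ε T p u s) (k : Fin 3) : ContinuousOn (fun t => u t k) (Icc 0 T) :=
  (HmVec.coordL k).continuous.comp_continuousOn S.inX.u_cont

theorem cont_fn {f : ℝ → Hm 3} {I : Set ℝ} (h : ContinuousOn f I) (A : L2R3 →L[ℝ] L2R3) :
    ContinuousOn (fun t => A (f t).fn) I :=
  (A.comp Hm.fnL).continuous.comp_continuousOn h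

theorem cont_deriv_fn {f : ℝ → Hm 3} {I : Set ℝ} (h : ContinuousOn f I) (k : Fin 3)
    (A : L2R3 →L[ℝ] L2R3) : ContinuousOn (fun t => A ((f t).deriv k).fn) I :=
  (A.comp (Hm.fnL.comp (Hm.derivL k))).continuous.comp_continuousOn h

theorem cont_grad {f : ℝ → Hm 3} {I : Set ℝ} (h : ContinuousOn f I) :
    ContinuousOn (fun t => ‖(f t).grad‖) I := by
  have : ∀ t, ‖(f t).grad‖ = Real.sqrt (∑ k, ‖(f t).deriv k‖ ^ 2) := fun t => by
    rw [← Hm.norm_grad_sq_eq, Real.sqrt_sq (norm_nonneg _)]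
  simp only [this]
  exact (continuousOn_finsetSum _ fun k _ =>
    (((Hm.derivL k).continuous.comp_continuousOn h).norm.pow 2)).sqrt

theorem cont_dissip (S : P.Sol ε T p u s) :
    ContinuousOn (fun t => dissip (p t) (u t)) (Icc 0 T) :=
  (cont_grad S.inX.p_cont).add S.inX.u_cont.norm

/-- Time derivative of the interaction functional. -/
theorem hasDeriv_interaction (S : P.Sol ε T p u s) {t : ℝ} (ht : t ∈ Icc 0 T)
    {A : L2R3 →L[ℝ] L2R3} (hA : ∀ k w w', HasDq k w w' → HasDq k (A w) (A w')) :
    HasDerivWithinAt (fun τ => ∑ k, inner ℝ (A (u τ k).fn) (A ((p τ).deriv k).fn))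
      (∑ k, (inner ℝ (A (dtVec T u t k).fn) (A ((p t).deriv k).fn)
        - inner ℝ (A ((u t k).deriv k).fn) (A (dt T p t).fn))) (Icc 0 T) t := by
  refine HasDerivWithinAt.fun_sum fun k _ => ?_
  refine ((hasDeriv_fn (S.hasDeriv_u ht k) A).inner ℝ
    (hasDeriv_deriv_fn (S.hasDeriv_p ht) k A)).congr_deriv ?_
  have h1 := hA k _ _ ((u t k).hasDq k)
  have h2 := hA k _ _ ((dt T p t).hasDq k)
  -- The derivative on ∂_t p is moved to the velocity, giving the form required by the interaction
  -- estimate.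
  rw [h1.inner_eq h2]
  ring

theorem ae_weight_sub_le (S : P.Sol ε T p u s) {t τ : ℝ} (ht : t ∈ Icc 0 T) (hτ : τ ∈ Icc 0 T)
    {a b : ℝ} (ha : ∀ᵐ x, |(p τ).fn x - (p t).fn x| ≤ a)
    (hb : ∀ᵐ x, |(s τ).fn x - (s t).fn x| ≤ b) :
    ∀ᵐ x, |P.psi ((p τ).fn x) ((s τ).fn x) - P.psi ((p t).fn x) ((s t).fn x)|
      ≤ P.lipPsi * (a + b) := by
  have h1 := S.slice t ht
  have h2 := S.slice τ hτ
  filter_upwards [ha, hb, h1.ae_weight, h2.ae_weight, h1.cp.bound.ae_abs_le,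
    h2.cp.bound.ae_abs_le] with x a1 a2 a3 a4 a5 a6
  refine (abs_psi_sub_le (a6.trans h2.M_mul_le_pInf) (a5.trans h1.M_mul_le_pInf) a4.2 a3.2).trans ?_
  exact mul_le_mul_of_nonneg_left (add_le_add a1 a2) P.lipPsi_pos.le

/-- The square of the `L²` norm with the symmetrizer as a weight. -/
def wsq (P : FlowConstants) (p s : Hm 3) (f : L2R3) : ℝ :=
  ∫ x, (1 + P.psi (p.fn x) (s.fn x)) * (f x * f x)

theorem wsq_eq (S : P.Sol ε T p u s) {t : ℝ} (ht : t ∈ Icc 0 T) (f : L2R3) :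
    wsq P (p t) (s t) f = inner ℝ (mulL (S.slice t ht).weight_bound f) f := by
  rw [inner_mulL]; rfl

theorem abs_wsq_sub_le (S : P.Sol ε T p u s) {t τ : ℝ} (ht : t ∈ Icc 0 T) (hτ : τ ∈ Icc 0 T)
    {N : ℝ} (hN : ∀ᵐ x, |P.psi ((p τ).fn x) ((s τ).fn x) - P.psi ((p t).fn x) ((s t).fn x)| ≤ N)
    (f : L2R3) : |wsq P (p τ) (s τ) f - wsq P (p t) (s t) f| ≤ N * ‖f‖ ^ 2 := by
  rw [wsq, wsq, ← integral_sub (integrable_mul_mul (S.slice τ hτ).weight_bound f f)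
    (integrable_mul_mul (S.slice t ht).weight_bound f f), norm_sq_L2, ← integral_const_mul,
    ← Real.norm_eq_abs]
  have hi : Integrable fun x => N * f x ^ 2 := by
    have := (integrable_mul_L2 f f).const_mul N
    simpa only [← pow_two] using this
  refine norm_integral_le_of_norm_le hi ?_
  filter_upwards [hN] with x hx
  rw [← sub_mul, add_sub_add_left_eq_sub, Real.norm_eq_abs, abs_mul, ← pow_two,
    abs_of_nonneg (sq_nonneg (f x))]
  exact mul_le_mul_of_nonneg_right hx (sq_nonneg _)

theorem wsq_le (S : P.Sol ε T p u s) {t : ℝ} (ht : t ∈ Icc 0 T) (f : L2R3) :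
    wsq P (p t) (s t) f ≤ 2 * ‖f‖ ^ 2 := by
  rw [S.wsq_eq ht]
  refine (real_inner_le_norm _ _).trans ?_
  refine (mul_le_mul_of_nonneg_right (norm_mulL_le _ _) (norm_nonneg _)).trans (le_of_eq (by ring))

theorem le_wsq (S : P.Sol ε T p u s) {t : ℝ} (ht : t ∈ Icc 0 T) (f : L2R3) :
    1 / 2 * ‖f‖ ^ 2 ≤ wsq P (p t) (s t) f := by
  rw [norm_sq_L2, wsq, ← integral_const_mul]
  have hi : Integrable fun x => 1 / 2 * f x ^ 2 := by
    have := (integrable_mul_L2 f f).const_mul (1 / 2)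
    simpa only [← pow_two] using this
  refine integral_mono_ae hi (integrable_mul_mul (S.slice t ht).weight_bound f f) ?_
  filter_upwards [(S.slice t ht).ae_weight] with x hx
  simp only [← pow_two]
  exact mul_le_mul_of_nonneg_right hx.1 (sq_nonneg _)

theorem ae_abs_sub_le (f g : Hm 3) : ∀ᵐ x, |f.fn x - g.fn x| ≤ supConst * ‖f - g‖ := by
  have hS := one_le_supConst
  filter_upwards [(f - g).incl.abs_fn_le, Lp.coeFn_sub f.fn g.fn] with x h1 h2
  have e : (f - g).incl.fn = f.fn - g.fn := rfl
  rw [e, h2, Pi.sub_apply] at h1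
  exact h1.trans (mul_le_mul_of_nonneg_left (Hm.norm_incl_le _) (by linarith))

theorem cont_wsq (S : P.Sol ε T p u s) {w : ℝ → L2R3} (hw : ContinuousOn w (Icc 0 T)) :
    ContinuousOn (fun t => wsq P (p t) (s t) (w t)) (Icc 0 T) := by
  intro t ht
  have h1 : Tendsto (fun τ => P.lipPsi * (supConst * ‖p τ - p t‖ + supConst * ‖s τ - s t‖)
      * ‖w τ‖ ^ 2) (𝓝[Icc 0 T] t) (𝓝 (P.lipPsi * (supConst * 0 + supConst * 0) * ‖w t‖ ^ 2)) := by
    have hp := tendsto_iff_norm_sub_tendsto_zero.1 (S.inX.p_cont t ht)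
    have hs := tendsto_iff_norm_sub_tendsto_zero.1 (S.inX.s_cont t ht)
    exact (((hp.const_mul _).add (hs.const_mul _)).const_mul _).mul ((hw t ht).norm.pow 2)
  have h2 : Tendsto (fun τ => wsq P (p τ) (s τ) (w τ) - wsq P (p t) (s t) (w τ))
      (𝓝[Icc 0 T] t) (𝓝 0) := by
    simp only [mul_zero, add_zero, zero_mul] at h1
    refine squeeze_zero_norm' ?_ h1
    filter_upwards [self_mem_nhdsWithin] with τ hτ
    exact S.abs_wsq_sub_le ht hτ (S.ae_weight_sub_le ht hτ (ae_abs_sub_le _ _)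
      (ae_abs_sub_le _ _)) (w τ)
  have h3 : Tendsto (fun τ => wsq P (p t) (s t) (w τ)) (𝓝[Icc 0 T] t)
      (𝓝 (wsq P (p t) (s t) (w t))) := by
    simp only [S.wsq_eq ht]
    exact (((mulL (S.slice t ht).weight_bound).continuous.tendsto _).comp (hw t ht)).inner (hw t ht)
  have := h2.add h3
  simpa [ContinuousWithinAt] using this

/-- The solution is Lipschitz in time, uniformly in space. -/
theorem eventually_ae_sub_le {f : ℝ → Hm 3} {f' : Hm 2} {t c : ℝ}
    (h : HasDerivWithinAt (fun τ => (f τ).incl) f' (Ioi t) t) (hc : LpLe ∞ f'.fn c) {c' : ℝ}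
    (hc' : c < c') :
    ∀ᶠ τ in 𝓝[>] t, ∀ᵐ x, |(f τ).fn x - (f t).fn x| ≤ (τ - t) * c' := by
  have hS := one_le_supConst
  have h1 := (hasDerivWithinAt_iff_tendsto_slope' (by simp)).1 h
  have h2 := (tendsto_iff_norm_sub_tendsto_zero.1 h1).const_mul supConst
  rw [mul_zero] at h2
  filter_upwards [h2.eventually (gt_mem_nhds (sub_pos.2 hc')), self_mem_nhdsWithin] with τ a1 a2
  have hpos : 0 < τ - t := sub_pos.2 a2
  -- D is the error of the difference quotient in time. It tends to zero in H², hence uniformly in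
  -- space.
  set D : Hm 2 := slope (fun τ => (f τ).incl) t τ - f' with hD
  have e : (f τ).fn - (f t).fn = (τ - t) • (D.fn + f'.fn) := by
    have : (f τ).incl - (f t).incl = (τ - t) • (D + f') := by
      rw [hD, sub_add_cancel, sub_smul_slope, vsub_eq_sub]
    exact congrArg Hm.fnL this
  filter_upwards [D.abs_fn_le, hc.ae_abs_le, Lp.coeFn_sub (f τ).fn (f t).fn,
    Lp.coeFn_smul (τ - t) (D.fn + f'.fn), Lp.coeFn_add D.fn f'.fn] with x b1 b2 b3 b4 b5
  rw [← Pi.sub_apply, ← b3, e, b4, Pi.smul_apply, b5, Pi.add_apply, smul_eq_mul, abs_mul,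
    abs_of_pos hpos]
  refine mul_le_mul_of_nonneg_left ?_ hpos.le
  refine (abs_add_le _ _).trans ?_
  linarith

/-- The last term is the motion of the weight: 12M²ε is the sum of the sup bounds 6M²ε for the time
derivatives of `p` and `s`, multiplied by the Lipschitz constant of the symmetrizer. -/
theorem upperSlope_wsq (S : P.Sol ε T p u s) {t : ℝ} (ht : t ∈ Ico 0 T) {w : ℝ → L2R3} {w' : L2R3}
    (hw : HasDerivWithinAt w w' (Icc 0 T) t) :
    UpperSlope (fun τ => wsq P (p τ) (s τ) (w τ)) t
      (2 * inner ℝ (mulL (S.slice t ⟨ht.1, ht.2.le⟩).weight_bound (w t)) w'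
        + P.lipPsi * (12 * P.M ^ 2 * ε) * ‖w t‖ ^ 2) := by
  have ht' : t ∈ Icc 0 T := ⟨ht.1, ht.2.le⟩
  refine upperSlope_weighted (Q := fun τ f => wsq P (p τ) (s τ) f)
    (fun v v' => inner_mulL_comm _ _ _) (fun v => S.wsq_eq ht' v) (fun c' hc' => ?_)
    (hw.Ioi_of_Icc ht)
  have hl := P.lipPsi_pos
  -- The slack in c' is shared equally between the pressure and the entropy.
  set d := c' / (2 * P.lipPsi) with hd
  have hd1 : 6 * P.M ^ 2 * ε < d := by rw [hd, lt_div_iff₀ (by positivity)]; linarith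
  have h1 := eventually_ae_sub_le ((S.hasDeriv_p ht').Ioi_of_Icc ht)
    (S.slice t ht').ae_abs_pressure_le hd1
  have h2 := eventually_ae_sub_le ((S.hasDeriv_s ht').Ioi_of_Icc ht)
    (S.slice t ht').ae_abs_entropy_le hd1
  filter_upwards [h1, h2, Icc_mem_nhdsGT_of_mem ht] with τ a1 a2 a3 v
  refine (le_abs_self _).trans ((S.abs_wsq_sub_le ht' a3
    (S.ae_weight_sub_le ht' a3 a1 a2) v).trans (le_of_eq ?_))
  rw [hd]; field_simp; ring

end Sol

end FlowConstants

end


/-! ### The top order energy inequality, with the limit of vanishing step -/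

noncomputable section

open Filter Topology
open scoped ENNReal

theorem Hm.norm_grad_le_two (p : Hm 3) : ‖p.grad‖ ≤ 2 * ‖p‖ := by
  refine le_of_sq_le_sq ?_ (by positivity)
  rw [p.norm_grad_sq_eq]
  have := Finset.sum_le_sum fun k (_ : k ∈ Finset.univ) =>
    pow_le_pow_left₀ (norm_nonneg _) (p.norm_deriv_le k) 2
  simp only [Finset.sum_const, Finset.card_univ, Fintype.card_fin, nsmul_eq_mul,
    Nat.cast_ofNat] at this
  nlinarith [sq_nonneg ‖p‖]

theorem sum_norm_sq_mem {E : Type*} [SeminormedAddCommGroup E] {f : Fin 3 → E} {K : ℝ}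
    (h : ∀ k, ‖f k‖ ≤ K) : 0 ≤ ∑ k, ‖f k‖ ^ 2 ∧ ∑ k, ‖f k‖ ^ 2 ≤ 3 * K ^ 2 := by
  refine ⟨Finset.sum_nonneg fun _ _ => sq_nonneg _, ?_⟩
  have := Finset.sum_le_sum fun k (_ : k ∈ Finset.univ) =>
    pow_le_pow_left₀ (norm_nonneg _) (h k) 2
  simpa using this

namespace FlowConstants

/-- The constant in front of the nonlinear error terms. -/
def errC (P : FlowConstants) : ℝ := 444 * P.M ^ 3 + 6 * P.lipPsi * P.M ^ 2

theorem errC_pos (P : FlowConstants) : 0 < P.errC := by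
  have := Slice.M_pos (P := P); have := P.lipPsi_pos; unfold errC; positivity

/-- The dissipation rate in the top order energy estimate, in terms of third differences or
derivatives `D³ u_k`, and second ones `D² ∂_k p`, `D² u_k`, `D² ∂_k u_k`. -/
def rate (P : FlowConstants) (δ ε m : ℝ) (u3 p2 u2 d2 : Fin 3 → L2R3) : ℝ :=
  2 * (-P.a * ∑ k, ‖u3 k‖ ^ 2 + δ * (-(P.kappa₂ / 2) * ∑ k, ‖p2 k‖ ^ 2
    + P.a ^ 2 / (2 * P.kappa₂) * ∑ k, ‖u2 k‖ ^ 2 + 3 * P.kappa₂ * ∑ k, ‖d2 k‖ ^ 2)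
    + P.errC * ε * m ^ 2)

/-- Only a bound uniform in the step matters here, as the majorant for dominated convergence in
time. -/
theorem abs_rate_le (P : FlowConstants) {δ ε m : ℝ} (hδ : 0 ≤ δ) {u3 p2 u2 d2 : Fin 3 → L2R3}
    (hε : 0 ≤ ε) (hm0 : 0 ≤ m) (hm : m ≤ 3 * ε) (h1 : ∀ k, ‖u3 k‖ ≤ ε) (h2 : ∀ k, ‖p2 k‖ ≤ ε)
    (h3 : ∀ k, ‖u2 k‖ ≤ ε) (h4 : ∀ k, ‖d2 k‖ ≤ ε) :
    |P.rate δ ε m u3 p2 u2 d2| ≤ 2 * (P.a * (3 * ε ^ 2) + δ * (P.kappa₂ / 2 * (3 * ε ^ 2)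
      + P.a ^ 2 / (2 * P.kappa₂) * (3 * ε ^ 2) + 3 * P.kappa₂ * (3 * ε ^ 2))
      + P.errC * ε * (9 * ε ^ 2)) := by
  have ha := P.a_pos; have hk := P.kappa₂_pos; have hE := P.errC_pos
  obtain ⟨a1, b1⟩ := sum_norm_sq_mem h1
  obtain ⟨a2, b2⟩ := sum_norm_sq_mem h2
  obtain ⟨a3, b3⟩ := sum_norm_sq_mem h3
  obtain ⟨a4, b4⟩ := sum_norm_sq_mem h4
  have b5 : m ^ 2 ≤ 9 * ε ^ 2 := by nlinarith
  have a5 := sq_nonneg m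
  rw [rate]
  generalize (∑ k, ‖u3 k‖ ^ 2) = x1 at *
  generalize (∑ k, ‖p2 k‖ ^ 2) = x2 at *
  generalize (∑ k, ‖u2 k‖ ^ 2) = x3 at *
  generalize (∑ k, ‖d2 k‖ ^ 2) = x4 at *
  rw [abs_mul, abs_two]
  refine mul_le_mul_of_nonneg_left ?_ two_pos.le
  refine (abs_add_le _ _).trans (add_le_add ((abs_add_le _ _).trans (add_le_add ?_ ?_)) ?_)
  · rw [abs_mul, abs_neg, abs_of_pos ha, abs_of_nonneg a1]; gcongr
  · rw [abs_mul, abs_of_nonneg hδ]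
    refine mul_le_mul_of_nonneg_left ?_ hδ
    refine (abs_add_le _ _).trans (add_le_add ((abs_add_le _ _).trans (add_le_add ?_ ?_)) ?_)
    · rw [abs_mul, abs_neg, abs_of_pos (by positivity), abs_of_nonneg a2]; gcongr
    · rw [abs_of_nonneg (by positivity)]; gcongr
    · rw [abs_of_nonneg (by positivity)]; gcongr
  · rw [abs_of_nonneg (by positivity)]; gcongr

namespace Sol

variable {P : FlowConstants} {ε T : ℝ} {p : ℝ → Hm 3} {u : ℝ → HmVec 3} {s : ℝ → Hm 3}

theorem dissip_le (S : P.Sol ε T p u s) {t : ℝ} (ht : t ∈ Icc 0 T) :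
    dissip (p t) (u t) ≤ 3 * ε := by
  have h1 := (p t).norm_grad_le_two
  have h2 := (S.slice t ht).hp
  have h3 := (S.slice t ht).hu
  unfold dissip; linarith

theorem hasDeriv_norm_sq_u (S : P.Sol ε T p u s) {t : ℝ} (ht : t ∈ Icc 0 T)
    (A : L2R3 →L[ℝ] L2R3) :
    HasDerivWithinAt (fun τ => ∑ k, ‖A (u τ k).fn‖ ^ 2)
      (∑ k, 2 * inner ℝ (A (u t k).fn) (A (dtVec T u t k).fn)) (Icc 0 T) t :=
  HasDerivWithinAt.fun_sum fun k _ => (hasDeriv_fn (S.hasDeriv_u ht k) A).norm_sq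

theorem cont_norm_sq_u (S : P.Sol ε T p u s) (A : L2R3 →L[ℝ] L2R3) :
    ContinuousOn (fun τ => ∑ k, ‖A (u τ k).fn‖ ^ 2) (Icc 0 T) :=
  continuousOn_finsetSum _ fun k _ => (cont_fn (S.cont_u k) A).norm.pow 2

/-- The top order energy inequality for third differences. -/
theorem energy_three_dq (S : P.Sol ε T p u s) {δ : ℝ} (hδ : 0 ≤ δ) (hδ1 : δ ≤ 1) (i : Fin 3) {h : ℝ}
    (hh : 0 < h) {t : ℝ} (ht : t ∈ Ico 0 T) :
    UpperSlope (fun τ => wsq P (p τ) (s τ) ((dq i h ^ 3) (p τ).fn)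
      + ∑ k, ‖(dq i h ^ 3) (u τ k).fn‖ ^ 2
      + 2 * δ * ∑ k, inner ℝ ((dq i h ^ 2) (u τ k).fn) ((dq i h ^ 2) ((p τ).deriv k).fn)) t
      (P.rate δ ε (dissip (p t) (u t)) (fun k => (dq i h ^ 3) (u t k).fn)
        (fun k => (dq i h ^ 2) ((p t).deriv k).fn) (fun k => (dq i h ^ 2) (u t k).fn)
        (fun k => (dq i h ^ 2) ((u t k).deriv k).fn)) := by
  have ht' : t ∈ Icc 0 T := ⟨ht.1, ht.2.le⟩
  have h1 := S.upperSlope_wsq ht (hasDeriv_fn (S.hasDeriv_p ht') (dq i h ^ 3))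
  have h2 := UpperSlope.of_hasDerivWithinAt ((S.hasDeriv_norm_sq_u ht' (dq i h ^ 3)).Ioi_of_Icc ht)
  have h3 := UpperSlope.of_hasDerivWithinAt (((S.hasDeriv_interaction ht' (A := dq i h ^ 2)
    fun k w w' hw => hw.dq_pow i h 2).const_mul (2 * δ)).Ioi_of_Icc ht)
  refine ((h1.add h2).add h3).mono ?_
  have e1 := (S.slice t ht').energy_three_le i hh
  have e2 := (S.slice t ht').interaction_le (productBound_dq_two i hh)
    (fun f => f.norm_dq_two_le i hh)
  have e3 := mul_le_mul_of_nonneg_left e2 hδ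
  have hM := Slice.M_pos (P := P)
  have hε := (S.slice t ht').eps_nonneg
  have hl := P.lipPsi_pos
  have bp : ‖(dq i h ^ 3) (p t).fn‖ ≤ dissip (p t) (u t) :=
    ((p t).norm_dq_three_le i hh).trans (((p t).norm_d3_le_deriv i).trans
    (((p t).norm_deriv_le_grad i).trans (norm_grad_le_dissip _ _)))
  have e4 := mul_le_mul_of_nonneg_left (pow_le_pow_left₀ (norm_nonneg _) bp 2)
    (by positivity : 0 ≤ P.lipPsi * (12 * P.M ^ 2 * ε))
  have e5 : δ * (144 * P.M ^ 3 * ε * dissip (p t) (u t) ^ 2)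
      ≤ 1 * (144 * P.M ^ 3 * ε * dissip (p t) (u t) ^ 2) :=
    mul_le_mul_of_nonneg_right hδ1 (by positivity)
  -- `errC` collects 300 from the energy estimate, 144 from the interaction, and 6·`lipPsi`, half of
  -- the 12 from the motion of the weight because of the prefactor 2 in `rate`.
  rw [rate, errC, ← Finset.mul_sum]
  nlinarith

/-- The top order energy, with the interaction functional. -/
def energyThree (P : FlowConstants) (δ : ℝ) (p : Hm 3) (u : HmVec 3) (s : Hm 3) (i : Fin 3) : ℝ :=
  wsq P p s (p.d3 i) + ∑ k, ‖(u k).d3 i‖ ^ 2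
    + 2 * δ * ∑ k, inner ℝ ((u k).d2 i) ((p.deriv k).d2 i)

theorem Hm_tendsto_dq_three (f : Hm 3) (i : Fin 3) :
    Tendsto (fun h => (dq i h ^ 3) f.fn) (𝓝[>] 0) (𝓝 (f.d3 i)) := (f.hatDeriv_three i).tendsto

theorem Hm_tendsto_dq_two {m : ℕ} (f : Hm (m + 2)) (i : Fin 3) :
    Tendsto (fun h => (dq i h ^ 2) f.fn) (𝓝[>] 0) (𝓝 (f.d2 i)) := (f.hatDeriv_two i).tendsto

/-- The top order energy inequality. -/
theorem energy_three (S : P.Sol ε T p u s) {δ : ℝ} (hδ : 0 ≤ δ) (hδ1 : δ ≤ 1) (i : Fin 3)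
    {t₁ t₂ : ℝ} (h0 : 0 ≤ t₁) (h12 : t₁ ≤ t₂) (h2 : t₂ ≤ T) :
    energyThree P δ (p t₂) (u t₂) (s t₂) i - energyThree P δ (p t₁) (u t₁) (s t₁) i
      ≤ ∫ t in t₁..t₂, P.rate δ ε (dissip (p t) (u t)) (fun k => (u t k).d3 i)
        (fun k => ((p t).deriv k).d2 i) (fun k => (u t k).d2 i)
        (fun k => ((u t k).deriv k).d2 i) := by
  have hsub : Icc t₁ t₂ ⊆ Icc 0 T := Icc_subset_Icc h0 h2
  have hT1 : t₁ ∈ Icc 0 T := hsub (left_mem_Icc.2 h12)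
  have hT2 : t₂ ∈ Icc 0 T := hsub (right_mem_Icc.2 h12)
  have hE : ∀ t ∈ Icc 0 T, Tendsto (fun h => wsq P (p t) (s t) ((dq i h ^ 3) (p t).fn)
      + ∑ k, ‖(dq i h ^ 3) (u t k).fn‖ ^ 2
      + 2 * δ * ∑ k, inner ℝ ((dq i h ^ 2) (u t k).fn) ((dq i h ^ 2) ((p t).deriv k).fn)) (𝓝[>] 0)
      (𝓝 (energyThree P δ (p t) (u t) (s t) i)) := fun t ht => by
    refine ((?_ : Tendsto _ _ _).add (tendsto_finsetSum _ fun k _ =>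
      ((Hm_tendsto_dq_three (u t k) i).norm.pow 2))).add ((tendsto_finsetSum _ fun k _ =>
        (Hm_tendsto_dq_two (u t k) i).inner (Hm_tendsto_dq_two ((p t).deriv k) i)).const_mul _)
    simp only [S.wsq_eq ht]
    exact (((mulL (S.slice t ht).weight_bound).continuous.tendsto _).comp
      (Hm_tendsto_dq_three (p t) i)).inner (Hm_tendsto_dq_three (p t) i)
  have hcont : ∀ h, ContinuousOn (fun t => P.rate δ ε (dissip (p t) (u t))
      (fun k => (dq i h ^ 3) (u t k).fn)
        (fun k => (dq i h ^ 2) ((p t).deriv k).fn) (fun k => (dq i h ^ 2) (u t k).fn)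
        (fun k => (dq i h ^ 2) ((u t k).deriv k).fn)) (Icc 0 T) := fun h => by
    have c1 := S.cont_norm_sq_u (dq i h ^ 3)
    have c2 := S.cont_norm_sq_u (dq i h ^ 2)
    have c3 : ContinuousOn (fun τ => ∑ k, ‖(dq i h ^ 2) ((p τ).deriv k).fn‖ ^ 2) (Icc 0 T) :=
      continuousOn_finsetSum _ fun k _ => (cont_deriv_fn S.inX.p_cont k _).norm.pow 2
    have c4 : ContinuousOn (fun τ => ∑ k, ‖(dq i h ^ 2) ((u τ k).deriv k).fn‖ ^ 2) (Icc 0 T) :=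
      continuousOn_finsetSum _ fun k _ => (cont_deriv_fn (S.cont_u k) k _).norm.pow 2
    have c5 := (S.cont_dissip.pow 2)
    unfold rate
    exact continuousOn_const.mul (((continuousOn_const.mul c1).add (continuousOn_const.mul
      (((continuousOn_const.mul c3).add (continuousOn_const.mul c2)).add
        (continuousOn_const.mul c4)))).add (continuousOn_const.mul c5))
  -- The inequality is integrated for a fixed step and the limit is taken afterwards. The limit
  -- functional cannot be differentiated directly, since ∂_t p and ∂_t u are only in H².
  refine sub_le_integral_of_tendsto (f := fun t => energyThree P δ (p t) (u t) (s t) i) h12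
    (F := fun h t => wsq P (p t) (s t) ((dq i h ^ 3) (p t).fn)
      + ∑ k, ‖(dq i h ^ 3) (u t k).fn‖ ^ 2
      + 2 * δ * ∑ k, inner ℝ ((dq i h ^ 2) (u t k).fn) ((dq i h ^ 2) ((p t).deriv k).fn))
    (G := fun h t => P.rate δ ε (dissip (p t) (u t)) (fun k => (dq i h ^ 3) (u t k).fn)
        (fun k => (dq i h ^ 2) ((p t).deriv k).fn) (fun k => (dq i h ^ 2) (u t k).fn)
        (fun k => (dq i h ^ 2) ((u t k).deriv k).fn))
    (C := 2 * (P.a * (3 * ε ^ 2) + δ * (P.kappa₂ / 2 * (3 * ε ^ 2)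
      + P.a ^ 2 / (2 * P.kappa₂) * (3 * ε ^ 2) + 3 * P.kappa₂ * (3 * ε ^ 2))
      + P.errC * ε * (9 * ε ^ 2)))
    (fun h hh => ?_) (fun h hh => (hcont h).mono hsub) (fun h hh t ht => ?_) (hE _ hT1) (hE _ hT2)
    (fun t ht => ?_)
  · refine UpperSlope.sub_le_integral h12 (ContinuousOn.mono ?_ hsub) ((hcont h).mono hsub)
      fun t ht => S.energy_three_dq hδ hδ1 i hh ⟨h0.trans ht.1, ht.2.trans_le h2⟩
    refine ((S.cont_wsq (cont_fn S.inX.p_cont _)).add (S.cont_norm_sq_u _)).add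
      (continuousOn_const.mul (continuousOn_finsetSum _ fun k _ => ?_))
    exact (cont_fn (S.cont_u k) _).inner (cont_deriv_fn S.inX.p_cont k _)
  · have hS := S.slice t (hsub ht)
    have bu : ∀ k, ‖u t k‖ ≤ ε := fun k => (PiLp.norm_apply_le (u t) k).trans hS.hu
    refine abs_rate_le P hδ hS.eps_nonneg (dissip_nonneg _ _) (S.dissip_le (hsub ht))
      (fun k => ?_) (fun k => ?_) (fun k => ?_) (fun k => ?_)
    · exact ((u t k).norm_dq_three_le i hh).trans (((u t k).norm_d3_le_deriv i).trans
        (((u t k).norm_deriv_le i).trans (bu k)))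
    · exact (((p t).deriv k).norm_dq_two_le i hh).trans (((p t).norm_deriv_le k).trans hS.hp)
    · exact ((u t k).incl.norm_dq_two_le i hh).trans ((u t k).norm_incl_le.trans (bu k))
    · exact (((u t k).deriv k).norm_dq_two_le i hh).trans (((u t k).norm_deriv_le k).trans (bu k))
  · unfold rate
    exact ((((tendsto_finsetSum _ fun k _ => ((Hm_tendsto_dq_three (u t k) i).norm.pow 2)).const_mul
      _).add ((((((tendsto_finsetSum _ fun k _ =>
        ((Hm_tendsto_dq_two ((p t).deriv k) i).norm.pow 2)).const_mul _).add
      ((tendsto_finsetSum _ fun k _ => ((Hm_tendsto_dq_two (u t k) i).norm.pow 2)).const_mul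
      _)).add ((tendsto_finsetSum _ fun k _ =>
        ((Hm_tendsto_dq_two ((u t k).deriv k) i).norm.pow 2)).const_mul _))).const_mul _)).add
      tendsto_const_nhds).const_mul _

end Sol

end FlowConstants

end


/-! ### Scalar energy quantities and their differential inequalities -/

noncomputable section

open Filter Topology
open scoped ENNReal

theorem UpperSlope.const_mul {f : ℝ → ℝ} {x d c : ℝ} (hc : 0 < c) (h : UpperSlope f x d) :
    UpperSlope (fun z => c * f z) x (c * d) := fun r hr => by
  filter_upwards [h (r / c) (by rw [lt_div_iff₀ hc]; linarith)] with z hz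
  have : slope (fun z => c * f z) x z = c * slope f x z := by simp only [slope_def_field]; ring
  rw [this]
  rw [lt_div_iff₀ hc] at hz; linarith

theorem UpperSlope.sum {f : Fin 3 → ℝ → ℝ} {x : ℝ} {d : Fin 3 → ℝ}
    (h : ∀ i, UpperSlope (f i) x (d i)) : UpperSlope (fun z => ∑ i, f i z) x (∑ i, d i) := by
  simp only [Fin.sum_univ_three]
  exact ((h 0).add (h 1)).add (h 2)

/-- Converts an integrated inequality, the form in which limits of energies arrive, back into a
pointwise one, which can be combined with the other inequalities. -/
theorem UpperSlope.of_sub_le_integral {f Φ : ℝ → ℝ} {x b : ℝ} (hx : x < b)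
    (hΦ : ContinuousOn Φ (Icc x b)) (h : ∀ z ∈ Icc x b, f z - f x ≤ ∫ t in x..z, Φ t) :
    UpperSlope f x (Φ x) := by
  have hmem : Icc x b ∈ 𝓝[>] x := Icc_mem_nhdsGT_of_mem ⟨le_rfl, hx⟩
  have hd : HasDerivWithinAt (fun z => ∫ t in x..z, Φ t) (Φ x) (Ioi x) x := by
    have := intervalIntegral.integral_hasDerivWithinAt_right (f := Φ) (a := x) (b := x)
      (s := Ici x) (t := Ioi x) (by simp)
      ⟨Icc x b, hmem, hΦ.aestronglyMeasurable measurableSet_Icc⟩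
      ((hΦ x (left_mem_Icc.2 hx.le)).mono_of_mem_nhdsWithin hmem)
    exact this.mono Ioi_subset_Ici_self
  intro r hr
  filter_upwards [UpperSlope.of_hasDerivWithinAt hd r hr, hmem, self_mem_nhdsWithin] with z h1 h2 h3
  refine lt_of_le_of_lt ?_ h1
  rw [slope_def_field, slope_def_field, intervalIntegral.integral_same, sub_zero]
  exact div_le_div_of_nonneg_right (h z h2) (sub_pos.2 h3).le

/-- `∑ ‖u_k‖²`. -/
def velSq (u : HmVec 3) : ℝ := ∑ k, ‖(u k).fn‖ ^ 2

/-- `∑ ‖∂_i³ u_k‖²`. -/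
def velTop (u : HmVec 3) : ℝ := ∑ i, ∑ k, ‖(u k).d3 i‖ ^ 2

/-- `∑ ‖∂_k p‖²`. -/
def gradSq (p : Hm 3) : ℝ := ∑ k, ‖(p.deriv k).fn‖ ^ 2

/-- `∑ ‖∂_i³ p‖²`. -/
def presTop (p : Hm 3) : ℝ := ∑ i, ‖p.d3 i‖ ^ 2

/-- `∑ ‖∂_i² ∂_k p‖²`. -/
def presMix (p : Hm 3) : ℝ := ∑ i, ∑ k, ‖(p.deriv k).d2 i‖ ^ 2

theorem velSq_nonneg (u : HmVec 3) : 0 ≤ velSq u := Finset.sum_nonneg fun _ _ => sq_nonneg _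

theorem velTop_nonneg (u : HmVec 3) : 0 ≤ velTop u :=
  Finset.sum_nonneg fun _ _ => Finset.sum_nonneg fun _ _ => sq_nonneg _

theorem gradSq_nonneg (p : Hm 3) : 0 ≤ gradSq p := Finset.sum_nonneg fun _ _ => sq_nonneg _

theorem presTop_nonneg (p : Hm 3) : 0 ≤ presTop p := Finset.sum_nonneg fun _ _ => sq_nonneg _

theorem presMix_nonneg (p : Hm 3) : 0 ≤ presMix p :=
  Finset.sum_nonneg fun _ _ => Finset.sum_nonneg fun _ _ => sq_nonneg _

theorem HmVec.norm_sq_eq {m : ℕ} (u : HmVec m) : ‖u‖ ^ 2 = ∑ k, ‖u k‖ ^ 2 :=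
  PiLp.norm_sq_eq_of_L2 _ _

theorem velSq_le (u : HmVec 3) : velSq u ≤ ‖u‖ ^ 2 := by
  rw [HmVec.norm_sq_eq]
  exact Finset.sum_le_sum fun k _ => pow_le_pow_left₀ (norm_nonneg _) (u k).norm_fn_le 2

theorem Hm.norm_d3_le (f : Hm 3) (i : Fin 3) : ‖f.d3 i‖ ≤ ‖f‖ :=
  (f.norm_d3_le_deriv i).trans (f.norm_deriv_le i)

theorem velTop_le (u : HmVec 3) : velTop u ≤ 3 * ‖u‖ ^ 2 := by
  rw [HmVec.norm_sq_eq]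
  refine (Finset.sum_le_sum fun i (_ : i ∈ Finset.univ) => Finset.sum_le_sum
    fun k (_ : k ∈ Finset.univ) =>
      pow_le_pow_left₀ (norm_nonneg _) ((u k).norm_d3_le i) 2).trans (le_of_eq ?_)
  simp

theorem presTop_le_grad (p : Hm 3) : presTop p ≤ ‖p.grad‖ ^ 2 := by
  rw [Hm.norm_grad_sq_eq]
  exact Finset.sum_le_sum fun i _ => pow_le_pow_left₀ (norm_nonneg _) (p.norm_d3_le_deriv i) 2

theorem gradSq_le_grad (p : Hm 3) : gradSq p ≤ ‖p.grad‖ ^ 2 := by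
  rw [Hm.norm_grad_sq_eq]
  exact Finset.sum_le_sum fun i _ => pow_le_pow_left₀ (norm_nonneg _) (p.deriv i).norm_fn_le 2

theorem presTop_le_presMix (p : Hm 3) : presTop p ≤ presMix p :=
  Finset.sum_le_sum fun i _ => Finset.single_le_sum (f := fun k => ‖(p.deriv k).d2 i‖ ^ 2)
    (fun _ _ => sq_nonneg _) (Finset.mem_univ i)

theorem presMix_le (p : Hm 3) : presMix p ≤ 18 * presTop p := by
  refine (Finset.sum_le_sum fun i (_ : i ∈ Finset.univ) => Finset.sum_le_sum
    fun k (_ : k ∈ Finset.univ) => p.norm_d2_deriv_sq_le i k).trans (le_of_eq ?_)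
  simp [presTop]; ring

/-- The number of derivatives up to order three, as a constant in norm equivalences. -/
def eqvC : ℝ := 120 * (multiIndices 3).card + 120 * (multiIndices 2).card

theorem one_le_eqvC : 1 ≤ eqvC := by
  have : (1 : ℝ) ≤ (multiIndices 3).card := by
    exact_mod_cast Finset.card_pos.2 ⟨0, mem_multiIndices.2 (by simp)⟩
  have h2 : (0 : ℝ) ≤ (multiIndices 2).card := Nat.cast_nonneg _
  unfold eqvC; linarith

theorem norm_sq_vec_le (u : HmVec 3) : ‖u‖ ^ 2 ≤ eqvC * (velSq u + velTop u) := by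
  have h2 : (0 : ℝ) ≤ (multiIndices 2).card := Nat.cast_nonneg _
  have h3 : (0 : ℝ) ≤ (multiIndices 3).card := Nat.cast_nonneg _
  rw [HmVec.norm_sq_eq]
  refine (Finset.sum_le_sum fun k (_ : k ∈ Finset.univ) => (u k).norm_sq_le_fn_add_d3).trans ?_
  rw [← Finset.mul_sum, Finset.sum_add_distrib, Finset.sum_comm]
  refine mul_le_mul_of_nonneg_right ?_ (add_nonneg (velSq_nonneg u) (velTop_nonneg u))
  unfold eqvC; linarith

theorem norm_sq_le_presTop (p : Hm 3) : ‖p‖ ^ 2 ≤ eqvC * (‖p.fn‖ ^ 2 + presTop p) := by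
  have h2 : (0 : ℝ) ≤ (multiIndices 2).card := Nat.cast_nonneg _
  have h3 : (0 : ℝ) ≤ (multiIndices 3).card := Nat.cast_nonneg _
  refine p.norm_sq_le_fn_add_d3.trans (mul_le_mul_of_nonneg_right ?_
    (add_nonneg (sq_nonneg _) (presTop_nonneg p)))
  unfold eqvC; linarith

theorem norm_grad_sq_le_eqvC (p : Hm 3) : ‖p.grad‖ ^ 2 ≤ eqvC * (gradSq p + presTop p) := by
  have h2 : (0 : ℝ) ≤ (multiIndices 2).card := Nat.cast_nonneg _
  have h3 : (0 : ℝ) ≤ (multiIndices 3).card := Nat.cast_nonneg _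
  refine p.norm_grad_sq_le.trans (mul_le_mul_of_nonneg_right ?_
    (add_nonneg (gradSq_nonneg p) (presTop_nonneg p)))
  unfold eqvC; linarith

theorem lowGrad_nonneg (f : L2R3) : 0 ≤ lowGrad f :=
  integral_nonneg fun ξ => indicator_nonneg
    (fun ξ _ => mul_nonneg (freqSq_nonneg ξ) (sq_nonneg _)) ξ

theorem norm_grad_sq_le_lowGrad (p : Hm 3) :
    ‖p.grad‖ ^ 2 ≤ eqvC * (lowGrad p.fn + presTop p) := by
  have h2 : (0 : ℝ) ≤ (multiIndices 2).card := Nat.cast_nonneg _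
  have h3 : (0 : ℝ) ≤ (multiIndices 3).card := Nat.cast_nonneg _
  have h4 := lowGrad_nonneg p.fn
  have h5 := presTop_nonneg p
  refine p.norm_grad_sq_le_low.trans ?_
  unfold eqvC
  change _ * (_ + 10 * presTop p) ≤ _
  nlinarith [mul_nonneg h2 h4, mul_nonneg h2 h5, mul_nonneg h3 h4, mul_nonneg h3 h5]

theorem dissip_sq_le (p : Hm 3) (u : HmVec 3) :
    dissip p u ^ 2 ≤ 2 * (‖p.grad‖ ^ 2 + ‖u‖ ^ 2) := by
  unfold dissip; nlinarith [sq_nonneg (‖p.grad‖ - ‖u‖)]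

theorem sum_d2_sq_le (u : HmVec 3) {η : ℝ} (hη : 0 < η) :
    ∑ i, ∑ k, ‖(u k).d2 i‖ ^ 2 ≤ 3 * η ^ 2 * velSq u + η⁻¹ * velTop u := by
  refine (Finset.sum_le_sum fun i (_ : i ∈ Finset.univ) => Finset.sum_le_sum
    fun k (_ : k ∈ Finset.univ) => (u k).norm_d2_sq_le i hη).trans (le_of_eq ?_)
  simp only [Finset.sum_add_distrib, ← Finset.mul_sum, velSq, velTop]
  simp; ring

theorem sum_d2_deriv_sq_le (u : HmVec 3) :
    ∑ i, ∑ k, ‖((u k).deriv k).d2 i‖ ^ 2 ≤ 6 * velTop u := by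
  refine (Finset.sum_le_sum fun i (_ : i ∈ Finset.univ) => Finset.sum_le_sum
    fun k (_ : k ∈ Finset.univ) => (u k).norm_d2_deriv_sq_le i k).trans (le_of_eq ?_)
  simp only [← Finset.mul_sum, velTop]
  rw [Finset.sum_comm (s := Finset.univ) (t := Finset.univ) (f := fun k j => ‖(u k).d3 j‖ ^ 2)]
  simp; ring

namespace FlowConstants

namespace Sol

variable {P : FlowConstants} {ε T : ℝ} {p : ℝ → Hm 3} {u : ℝ → HmVec 3} {s : ℝ → Hm 3}

/-- The top order energy summed over the directions. -/
def energyTop (P : FlowConstants) (δ : ℝ) (p : Hm 3) (u : HmVec 3) (s : Hm 3) : ℝ :=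
  ∑ i, energyThree P δ p u s i

theorem cont_d3 {f : ℝ → Hm 3} {I : Set ℝ} (h : ContinuousOn f I) (i : Fin 3) :
    ContinuousOn (fun t => (f t).d3 i) I :=
  (Hm.fnL.comp ((Hm.derivL i).comp ((Hm.derivL i).comp (Hm.derivL i)))).continuous.comp_continuousOn h

theorem cont_d2 {m : ℕ} {f : ℝ → Hm (m + 2)} {I : Set ℝ} (h : ContinuousOn f I) (i : Fin 3) :
    ContinuousOn (fun t => (f t).d2 i) I :=
  (Hm.fnL.comp ((Hm.derivL i).comp (Hm.derivL i))).continuous.comp_continuousOn h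

theorem cont_deriv {m : ℕ} {f : ℝ → Hm (m + 1)} {I : Set ℝ} (h : ContinuousOn f I) (i : Fin 3) :
    ContinuousOn (fun t => (f t).deriv i) I :=
  (Hm.derivL i).continuous.comp_continuousOn h

theorem cont_energyTop (S : P.Sol ε T p u s) (δ : ℝ) :
    ContinuousOn (fun t => energyTop P δ (p t) (u t) (s t)) (Icc 0 T) := by
  refine continuousOn_finsetSum _ fun i _ => ?_
  refine ((S.cont_wsq (cont_d3 S.inX.p_cont i)).add (continuousOn_finsetSum _ fun k _ =>
    (cont_d3 (S.cont_u k) i).norm.pow 2)).add (continuousOn_const.mul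
      (continuousOn_finsetSum _ fun k _ => ?_))
  exact (cont_d2 (S.cont_u k) i).inner (cont_d2 (cont_deriv S.inX.p_cont k) i)

theorem upperSlope_E3 (S : P.Sol ε T p u s) {δ : ℝ} (hδ : 0 ≤ δ) (hδ1 : δ ≤ 1) (i : Fin 3) {t : ℝ}
    (ht : t ∈ Ico 0 T) :
    UpperSlope (fun t => energyThree P δ (p t) (u t) (s t) i) t
      (P.rate δ ε (dissip (p t) (u t)) (fun k => (u t k).d3 i)
        (fun k => ((p t).deriv k).d2 i) (fun k => (u t k).d2 i)
        (fun k => ((u t k).deriv k).d2 i)) := by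
  have hsub : Icc t T ⊆ Icc 0 T := Icc_subset_Icc ht.1 le_rfl
  refine UpperSlope.of_sub_le_integral (Φ := fun t => P.rate δ ε (dissip (p t) (u t))
    (fun k => (u t k).d3 i) (fun k => ((p t).deriv k).d2 i) (fun k => (u t k).d2 i)
        (fun k => ((u t k).deriv k).d2 i)) ht.2 (ContinuousOn.mono ?_ hsub)
    fun z hz => S.energy_three hδ hδ1 i ht.1 hz.1 hz.2
  have c1 : ContinuousOn (fun τ => ∑ k, ‖(u τ k).d3 i‖ ^ 2) (Icc 0 T) :=
      continuousOn_finsetSum _ fun k _ => (cont_d3 (S.cont_u k) i).norm.pow 2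
  have c2 : ContinuousOn (fun τ => ∑ k, ‖(u τ k).d2 i‖ ^ 2) (Icc 0 T) :=
      continuousOn_finsetSum _ fun k _ => (cont_d2 (S.cont_u k) i).norm.pow 2
  have c3 : ContinuousOn (fun τ => ∑ k, ‖((p τ).deriv k).d2 i‖ ^ 2) (Icc 0 T) :=
      continuousOn_finsetSum _ fun k _ => (cont_d2 (cont_deriv S.inX.p_cont k) i).norm.pow 2
  have c4 : ContinuousOn (fun τ => ∑ k, ‖((u τ k).deriv k).d2 i‖ ^ 2) (Icc 0 T) :=
      continuousOn_finsetSum _ fun k _ => (cont_d2 (cont_deriv (S.cont_u k) k) i).norm.pow 2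
  have c5 := (S.cont_dissip.pow 2)
  unfold rate
  exact continuousOn_const.mul (((continuousOn_const.mul c1).add (continuousOn_const.mul
      (((continuousOn_const.mul c3).add (continuousOn_const.mul c2)).add
        (continuousOn_const.mul c4)))).add (continuousOn_const.mul c5))

/-- The parameter η stays free: η = 1 is enough for the energy estimate, whereas the damped
functional needs the coefficient of `velSq` to be small. -/
theorem upperSlope_energyTop (S : P.Sol ε T p u s) {δ η : ℝ} (hδ : 0 ≤ δ) (hδ1 : δ ≤ 1) (hη : 0 < η)
    {t : ℝ} (ht : t ∈ Ico 0 T) :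
    UpperSlope (fun t => energyTop P δ (p t) (u t) (s t)) t
      (2 * (-P.a * velTop (u t) + δ * (-(P.kappa₂ / 2) * presMix (p t)
        + P.a ^ 2 / (2 * P.kappa₂) * (3 * η ^ 2 * velSq (u t) + η⁻¹ * velTop (u t))
        + 18 * P.kappa₂ * velTop (u t)) + 3 * P.errC * ε * dissip (p t) (u t) ^ 2)) := by
  refine (UpperSlope.sum fun i => S.upperSlope_E3 hδ hδ1 i ht).mono ?_
  have hk := P.kappa₂_pos
  have h1 := mul_le_mul_of_nonneg_left (sum_d2_sq_le (u t) hη)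
    (by positivity : 0 ≤ P.a ^ 2 / (2 * P.kappa₂))
  have h2 := mul_le_mul_of_nonneg_left (sum_d2_deriv_sq_le (u t))
    (by positivity : 0 ≤ 3 * P.kappa₂)
  have h3 := mul_le_mul_of_nonneg_left (add_le_add h1 h2) hδ
  simp only [rate, ← Finset.mul_sum, Finset.sum_add_distrib, Finset.sum_const, Finset.card_univ,
    Fintype.card_fin, nsmul_eq_mul, Nat.cast_ofNat]
  change 2 * (-P.a * velTop (u t) + δ * (-(P.kappa₂ / 2) * presMix (p t) + _ + _) + _) ≤ _
  nlinarith

/-- The low order energy with the interaction functional. -/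
def energyLow (δ : ℝ) (p : Hm 3) (u : HmVec 3) : ℝ :=
  ‖p.fn‖ ^ 2 + velSq u + 2 * δ * ∑ k, inner ℝ (u k).fn (p.deriv k).fn

theorem cont_velSq (S : P.Sol ε T p u s) : ContinuousOn (fun t => velSq (u t)) (Icc 0 T) :=
  S.cont_norm_sq_u 1

theorem cont_energyLow (S : P.Sol ε T p u s) (δ : ℝ) :
    ContinuousOn (fun t => energyLow δ (p t) (u t)) (Icc 0 T) := by
  refine (((cont_fn S.inX.p_cont 1).norm.pow 2).add S.cont_velSq).add (continuousOn_const.mul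
      (continuousOn_finsetSum _ fun k _ => ?_))
  exact (cont_fn (S.cont_u k) 1).inner (cont_deriv_fn S.inX.p_cont k 1)

/-- The term in ‖u‖² comes from the divergence and exceeds what `velSq` controls; it is absorbed
only after the top order energy is added. -/
theorem upperSlope_energyLow (S : P.Sol ε T p u s) {δ : ℝ} (hδ : 0 ≤ δ) (hδ1 : δ ≤ 1)
    {t : ℝ} (ht : t ∈ Ico 0 T) :
    UpperSlope (fun t => energyLow δ (p t) (u t)) t
      (2 * (-P.a * velSq (u t) + δ * (-(P.kappa₂ / 2) * gradSq (p t)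
        + P.a ^ 2 / (2 * P.kappa₂) * velSq (u t) + 3 * P.kappa₂ * ‖u t‖ ^ 2)
        + P.errC * ε * dissip (p t) (u t) ^ 2)) := by
  have ht' : t ∈ Icc 0 T := ⟨ht.1, ht.2.le⟩
  have h1 := (hasDeriv_fn (S.hasDeriv_p ht') 1).norm_sq
  have h2 := S.hasDeriv_norm_sq_u ht' 1
  have h3 := (S.hasDeriv_interaction ht' (A := 1) fun k w w' hw => hw).const_mul (2 * δ)
  have h4 := UpperSlope.of_hasDerivWithinAt (((h1.add h2).add h3).Ioi_of_Icc ht)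
  refine UpperSlope.mono (f := fun t => energyLow δ (p t) (u t)) h4 ?_
  have e1 := (S.slice t ht').energy_zero_le
  have e2 := (S.slice t ht').interaction_le productBound_one (fun f => f.norm_fn_le)
  simp only [one_apply_eq_self] at e2 ⊢
  have hM := Slice.M_pos (P := P)
  have hM1 : 1 ≤ P.M := P.M_spec.1
  have hε := (S.slice t ht').eps_nonneg
  have hl := P.lipPsi_pos
  have hk := P.kappa₂_pos
  have e6 : ∑ k, ‖((u t k).deriv k).fn‖ ^ 2 ≤ ‖u t‖ ^ 2 := by
    rw [HmVec.norm_sq_eq]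
    exact Finset.sum_le_sum fun k _ => pow_le_pow_left₀ (norm_nonneg _)
      (((u t k).deriv k).norm_fn_le.trans ((u t k).norm_deriv_le k)) 2
  have e7 := mul_le_mul_of_nonneg_left e6 (by positivity : 0 ≤ 3 * P.kappa₂)
  have e3 := mul_le_mul_of_nonneg_left (e2.trans (add_le_add_left (add_le_add_right e7 _) _)) hδ
  have e5 : δ * (144 * P.M ^ 3 * ε * dissip (p t) (u t) ^ 2)
      ≤ 1 * (144 * P.M ^ 3 * ε * dissip (p t) (u t) ^ 2) :=
    mul_le_mul_of_nonneg_right hδ1 (by positivity)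
  have e8 : P.M ^ 2 * (ε * dissip (p t) (u t) ^ 2) ≤ P.M ^ 3 * (ε * dissip (p t) (u t) ^ 2) :=
      mul_le_mul_of_nonneg_right (pow_le_pow_right₀ hM1 (by norm_num)) (by positivity)
  have e9 : 0 ≤ P.M ^ 3 * (ε * dissip (p t) (u t) ^ 2) := by positivity
  have e10 : 0 ≤ P.lipPsi * P.M ^ 2 * (ε * dissip (p t) (u t) ^ 2) := by positivity
  rw [errC, ← Finset.mul_sum]
  change _ ≤ 2 * (-P.a * velSq (u t) + _ + _)
  unfold velSq gradSq
  nlinarith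

/-- Half of the friction pays for the coupling with ∇p. Unlike `energyLow`, this quantity does not
contain ‖p‖, which decays too slowly to enter a functional equivalent to the dissipation. -/
theorem upperSlope_velSq (S : P.Sol ε T p u s) {t : ℝ} (ht : t ∈ Ico 0 T) :
    UpperSlope (fun t => velSq (u t)) t (-P.a * velSq (u t) + P.kappa₂ ^ 2 / P.a * gradSq (p t)
        + P.errC * ε * dissip (p t) (u t) ^ 2) := by
  have ht' : t ∈ Icc 0 T := ⟨ht.1, ht.2.le⟩
  have h2 := UpperSlope.of_hasDerivWithinAt ((S.hasDeriv_norm_sq_u ht' 1).Ioi_of_Icc ht)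
  refine UpperSlope.mono (f := fun t => velSq (u t)) h2 ?_
  have hM := Slice.M_pos (P := P)
  have hε := (S.slice t ht').eps_nonneg
  have hl := P.lipPsi_pos
  have ha := P.a_pos
  have hm := dissip_nonneg (p t) (u t)
  simp only [one_apply_eq_self]
  have e : ∀ k, 2 * inner ℝ (u t k).fn (dtVec T u t k).fn ≤ -P.a * ‖(u t k).fn‖ ^ 2
      + P.kappa₂ ^ 2 / P.a * ‖((p t).deriv k).fn‖ ^ 2
      + 48 * P.M ^ 3 * ε * dissip (p t) (u t) ^ 2 := fun k => by
    have r := (S.slice t ht').norm_velocity_residual_le productBound_one k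
    simp only [one_apply_eq_self] at r
    have e1 : inner ℝ (u t k).fn (dtVec T u t k).fn = inner ℝ (u t k).fn ((dtVec T u t k).fn
        + P.kappa₂ • ((p t).deriv k).fn + P.a • (u t k).fn)
        - P.kappa₂ * inner ℝ (u t k).fn ((p t).deriv k).fn - P.a * ‖(u t k).fn‖ ^ 2 := by
      simp only [inner_add_right, real_inner_smul_right, real_inner_self_eq_norm_sq]; ring
    have e2 : inner ℝ (u t k).fn ((dtVec T u t k).fn
        + P.kappa₂ • ((p t).deriv k).fn + P.a • (u t k).fn)
        ≤ dissip (p t) (u t) * (24 * P.M ^ 3 * ε * dissip (p t) (u t)) :=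
      (real_inner_le_norm _ _).trans (mul_le_mul ((u t k).norm_fn_le.trans
        (norm_apply_le_dissip _ _ k)) r (norm_nonneg _) hm)
    have e3 : -(2 * P.kappa₂ * inner ℝ (u t k).fn ((p t).deriv k).fn)
        ≤ P.a * ‖(u t k).fn‖ ^ 2 + P.kappa₂ ^ 2 / P.a * ‖((p t).deriv k).fn‖ ^ 2 := by
      have h0 : 0 ≤ ‖P.a • (u t k).fn + P.kappa₂ • ((p t).deriv k).fn‖ ^ 2 := sq_nonneg _
      rw [norm_add_sq_real, norm_smul, norm_smul, real_inner_smul_left, real_inner_smul_right,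
        mul_pow, mul_pow, Real.norm_eq_abs, Real.norm_eq_abs, sq_abs, sq_abs] at h0
      have h5 := div_nonneg h0 ha.le
      have : P.a * ‖(u t k).fn‖ ^ 2 + P.kappa₂ ^ 2 / P.a * ‖((p t).deriv k).fn‖ ^ 2
          + 2 * P.kappa₂ * inner ℝ (u t k).fn ((p t).deriv k).fn
          = (P.a ^ 2 * ‖(u t k).fn‖ ^ 2
            + 2 * (P.a * (P.kappa₂ * inner ℝ (u t k).fn ((p t).deriv k).fn))
            + P.kappa₂ ^ 2 * ‖((p t).deriv k).fn‖ ^ 2) / P.a := by field_simp; ring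
      linarith
    nlinarith
  refine (Finset.sum_le_sum fun k _ => e k).trans ?_
  simp only [Finset.sum_add_distrib, ← Finset.mul_sum, Finset.sum_const, Finset.card_univ,
    Fintype.card_fin, nsmul_eq_mul, Nat.cast_ofNat]
  have e9 : 0 ≤ P.M ^ 3 * (ε * dissip (p t) (u t) ^ 2) := by positivity
  have e10 : 0 ≤ P.lipPsi * P.M ^ 2 * (ε * dissip (p t) (u t) ^ 2) := by positivity
  unfold velSq gradSq errC
  nlinarith

/-- Bounds for the interaction part of the top order energy. -/
theorem abs_energyTop_sub_le (S : P.Sol ε T p u s) {δ η : ℝ} (hδ : 0 ≤ δ) (hη : 0 < η)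
    {t : ℝ} (ht : t ∈ Icc 0 T) :
    1 / 2 * presTop (p t) + velTop (u t)
      - δ * (3 * η ^ 2 * velSq (u t) + η⁻¹ * velTop (u t) + 18 * presTop (p t))
      ≤ energyTop P δ (p t) (u t) (s t) ∧
    energyTop P δ (p t) (u t) (s t) ≤ 2 * presTop (p t) + velTop (u t)
      + δ * (3 * η ^ 2 * velSq (u t) + η⁻¹ * velTop (u t) + 18 * presTop (p t)) := by
  have h1 : |2 * ∑ i, ∑ k, inner ℝ ((u t k).d2 i) (((p t).deriv k).d2 i)|
      ≤ 3 * η ^ 2 * velSq (u t) + η⁻¹ * velTop (u t) + 18 * presTop (p t) := by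
    have a1 : ∀ x y : L2R3, |2 * inner ℝ x y| ≤ ‖x‖ ^ 2 + ‖y‖ ^ 2 := fun x y => by
      rw [abs_mul, abs_two]
      have := abs_real_inner_le_norm x y
      nlinarith [sq_nonneg (‖x‖ - ‖y‖)]
    have a2 : |2 * ∑ i, ∑ k, inner ℝ ((u t k).d2 i) (((p t).deriv k).d2 i)|
        ≤ ∑ i, ∑ k, (‖(u t k).d2 i‖ ^ 2 + ‖((p t).deriv k).d2 i‖ ^ 2) := by
      rw [Finset.mul_sum]
      refine (Finset.abs_sum_le_sum_abs _ _).trans (Finset.sum_le_sum fun i _ => ?_)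
      rw [Finset.mul_sum]
      exact (Finset.abs_sum_le_sum_abs _ _).trans (Finset.sum_le_sum fun k _ => a1 _ _)
    simp only [Finset.sum_add_distrib] at a2
    exact a2.trans (add_le_add (sum_d2_sq_le (u t) hη) (presMix_le (p t)))
  have h2 := Finset.sum_le_sum fun i (_ : i ∈ Finset.univ) => S.wsq_le ht ((p t).d3 i)
  have h3 := Finset.sum_le_sum fun i (_ : i ∈ Finset.univ) => S.le_wsq ht ((p t).d3 i)
  rw [← Finset.mul_sum] at h2 h3
  have e : energyTop P δ (p t) (u t) (s t) = ∑ i, wsq P (p t) (s t) ((p t).d3 i) + velTop (u t)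
      + δ * (2 * ∑ i, ∑ k, inner ℝ ((u t k).d2 i) (((p t).deriv k).d2 i)) := by
    simp only [energyTop, energyThree, Finset.sum_add_distrib, ← Finset.mul_sum, velTop]
    ring
  have h4 := abs_le.1 h1
  have h5 := mul_le_mul_of_nonneg_left h4.1 hδ
  have h6 := mul_le_mul_of_nonneg_left h4.2 hδ
  rw [e]
  unfold presTop at *
  constructor <;> linarith

end Sol

end FlowConstants

end


/-! ### Choice of parameters and the uniform energy estimate -/

noncomputable section

open Filter Topology
open scoped ENNReal

theorem le_min_div_mul {x G a : ℝ} (hG : 0 < G) (hx : x ≤ a / G) : x * G ≤ a := by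
  rwa [le_div_iff₀ hG] at hx

namespace FlowConstants

/-- Algebra of the dissipation rates: the combined low and top order energies. -/
theorem exists_rate_le (P : FlowConstants) : ∃ δ c e₁ : ℝ, 0 < δ ∧ δ ≤ 1 ∧
    δ * (22 + eqvC) ≤ 1 / 4 ∧ 0 < c ∧ 0 < e₁ ∧
    ∀ (p : Hm 3) (u : HmVec 3) (ε : ℝ), ε ≤ e₁ →
      2 * (-P.a * velTop u + δ * (-(P.kappa₂ / 2) * presMix p
        + P.a ^ 2 / (2 * P.kappa₂) * (3 * 1 ^ 2 * velSq u + 1⁻¹ * velTop u)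
        + 18 * P.kappa₂ * velTop u) + 3 * P.errC * ε * dissip p u ^ 2)
      + 2 * (-P.a * velSq u + δ * (-(P.kappa₂ / 2) * gradSq p
        + P.a ^ 2 / (2 * P.kappa₂) * velSq u + 3 * P.kappa₂ * ‖u‖ ^ 2)
        + P.errC * ε * dissip p u ^ 2) ≤ -(c * (‖p.grad‖ ^ 2 + ‖u‖ ^ 2)) := by
  have ha := P.a_pos; have hk := P.kappa₂_pos; have hE := P.errC_pos; have hN := one_le_eqvC
  set N := eqvC
  set a := P.a
  set κ := P.kappa₂
  set A := a ^ 2 / (2 * κ) with hA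
  have hA0 : 0 < A := by positivity
  -- G sums up the positive contributions of both interaction terms. δG ≤ a/2 lets half of the
  -- friction absorb them; the bound with 22 + N in δ is reserved for the coercivity of the energy.
  set G := 4 * A + 3 * κ * N + 18 * κ with hG
  have hG0 : 0 < G := by positivity
  set δ := min 1 (min (a / 2 / G) (1 / 4 / (22 + N))) with hδ
  have hδ0 : 0 < δ := by positivity
  have hδG : δ * G ≤ a / 2 :=
    le_min_div_mul hG0 ((min_le_right _ _).trans (min_le_left _ _))
  set c := min (a / N) (δ * κ / N) with hc
  have hc0 : 0 < c := by positivity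
  refine ⟨δ, c / 2, c / 2 / (16 * P.errC), hδ0, min_le_left _ _, le_min_div_mul (by positivity)
    ((min_le_right _ _).trans (min_le_right _ _)), by positivity, by positivity,
    fun p u ε hε => ?_⟩
  have h1 : ‖u‖ ^ 2 ≤ N * (velSq u + velTop u) := norm_sq_vec_le u
  have h2 : ‖p.grad‖ ^ 2 ≤ N * (gradSq p + presMix p) := (norm_grad_sq_le_eqvC p).trans
    (mul_le_mul_of_nonneg_left (add_le_add_right (presTop_le_presMix p) _) (by linarith))
  have h3 := dissip_sq_le p u
  have hε' := le_min_div_mul (by positivity) hε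
  have v0 := velSq_nonneg u; have v1 := velTop_nonneg u
  have g0 := gradSq_nonneg p; have g1 := presMix_nonneg p
  have n0 := sq_nonneg ‖u‖; have n1 := sq_nonneg ‖p.grad‖; have n2 := sq_nonneg (dissip p u)
  generalize velSq u = U at *
  generalize velTop u = Z at *
  generalize gradSq p = Y at *
  generalize presMix p = Q at *
  generalize ‖u‖ ^ 2 = x at *
  generalize ‖p.grad‖ ^ 2 = y at *
  generalize dissip p u ^ 2 = m at *
  have s1 : δ * (A * (3 * U + Z) + 18 * κ * Z + A * U + 3 * κ * x) ≤ a / 2 * (U + Z) := by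
    refine le_trans ?_ (mul_le_mul_of_nonneg_right hδG (by positivity : 0 ≤ U + Z))
    rw [mul_assoc δ G]
    refine mul_le_mul_of_nonneg_left ?_ hδ0.le
    have : κ * x ≤ κ * (N * (U + Z)) := mul_le_mul_of_nonneg_left h1 hk.le
    rw [hG]
    nlinarith [mul_nonneg hA0.le v1, mul_nonneg hk.le v0]
  have s2 : c * x ≤ a * (U + Z) := by
    calc c * x ≤ a / N * x := mul_le_mul_of_nonneg_right (min_le_left _ _) n0
      _ ≤ a / N * (N * (U + Z)) := mul_le_mul_of_nonneg_left h1 (by positivity)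
      _ = a * (U + Z) := by field_simp
  have s3 : c * y ≤ δ * κ * (Y + Q) := by
    calc c * y ≤ δ * κ / N * y := mul_le_mul_of_nonneg_right (min_le_right _ _) n1
      _ ≤ δ * κ / N * (N * (Y + Q)) := mul_le_mul_of_nonneg_left h2 (by positivity)
      _ = δ * κ * (Y + Q) := by field_simp
  have s4 : 8 * P.errC * ε * m ≤ c / 2 * (y + x) := by
    rcases le_or_gt 0 ε with h | h
    · calc 8 * P.errC * ε * m ≤ 8 * P.errC * ε * (2 * (y + x)) :=
            mul_le_mul_of_nonneg_left h3 (by positivity)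
        _ = ε * (16 * P.errC) * (y + x) := by ring
        _ ≤ c / 2 * (y + x) := mul_le_mul_of_nonneg_right hε' (by positivity)
    · have : 8 * P.errC * ε * m ≤ 0 :=
        mul_nonpos_of_nonpos_of_nonneg (mul_nonpos_of_nonneg_of_nonpos (by positivity) h.le) n2
      have : 0 ≤ c / 2 * (y + x) := by positivity
      linarith
  rw [one_pow, inv_one]
  linarith

namespace Sol

theorem gradSq_le_norm (p : Hm 3) : gradSq p ≤ ‖p‖ ^ 2 := by
  let e : Fin 3 → multiIndices 3 := fun k => ⟨Pi.single k 1, mem_multiIndices.2 (by simp)⟩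
  have he : Function.Injective e := fun k l h => by
    have h' : (Pi.single k 1 : Fin 3 → ℕ) = Pi.single l 1 := congrArg Subtype.val h
    by_contra hkl
    have := congrFun h' k
    simp [Pi.single_eq_of_ne hkl] at this
  rw [Hm.norm_sq_eq]
  calc gradSq p = ∑ k, ‖p.1 (e k)‖ ^ 2 := by
        refine Finset.sum_congr rfl fun k _ => ?_
        have : (p.deriv k).fn = p.1 (e k) := by
          change p.1 ⟨0 + Pi.single k 1, _⟩ = p.1 ⟨Pi.single k 1, _⟩
          simp only [zero_add]
        rw [this]
    _ = ∑ α ∈ Finset.univ.image e, ‖p.1 α‖ ^ 2 := by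
        rw [Finset.sum_image fun a _ b _ h => he h]
    _ ≤ ∑ α, ‖p.1 α‖ ^ 2 :=
        Finset.sum_le_sum_of_subset_of_nonneg (Finset.subset_univ _) fun _ _ _ => sq_nonneg _

theorem presTop_le_norm (p : Hm 3) : presTop p ≤ 4 * ‖p‖ ^ 2 := by
  refine (presTop_le_grad p).trans ?_
  have := pow_le_pow_left₀ (norm_nonneg _) p.norm_grad_le_two 2
  linarith [mul_pow 2 ‖p‖ 2]

theorem abs_interaction_low_le (p : Hm 3) (u : HmVec 3) :
    |2 * ∑ k, inner ℝ (u k).fn (p.deriv k).fn| ≤ velSq u + gradSq p := by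
  have a1 : ∀ x y : L2R3, |2 * inner ℝ x y| ≤ ‖x‖ ^ 2 + ‖y‖ ^ 2 := fun x y => by
    rw [abs_mul, abs_two]
    have := abs_real_inner_le_norm x y
    nlinarith [sq_nonneg (‖x‖ - ‖y‖)]
  rw [Finset.mul_sum, velSq, gradSq, ← Finset.sum_add_distrib]
  exact (Finset.abs_sum_le_sum_abs _ _).trans (Finset.sum_le_sum fun k _ => a1 _ _)

/-- The energy estimate, uniform in time. -/
theorem exists_energy_estimate (P : FlowConstants) : ∃ e₁ C : ℝ, 0 < e₁ ∧ 0 < C ∧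
    ∀ {ε T : ℝ} {p : ℝ → Hm 3} {u : ℝ → HmVec 3} {s : ℝ → Hm 3}, ε ≤ e₁ → P.Sol ε T p u s →
      ∀ t ∈ Icc 0 T, ‖p t‖ ^ 2 + ‖u t‖ ^ 2 + ∫ τ in (0 : ℝ)..t, (‖(p τ).grad‖ ^ 2 + ‖u τ‖ ^ 2)
        ≤ C * (‖p 0‖ ^ 2 + ‖u 0‖ ^ 2) := by
  obtain ⟨δ, c, e₁, hδ0, hδ1, hδN, hc, he₁, hrate⟩ := P.exists_rate_le
  have hN := one_le_eqvC
  refine ⟨e₁, (4 * eqvC + c⁻¹) * 100, he₁, by positivity, fun {ε T p u s} hε S t ht => ?_⟩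
  have ht0 : (0 : ℝ) ∈ Icc 0 T := ⟨le_rfl, ht.1.trans ht.2⟩
  have hsub : Icc 0 t ⊆ Icc 0 T := Icc_subset_Icc le_rfl ht.2
  set N := eqvC
  have hcD : ContinuousOn (fun τ => ‖(p τ).grad‖ ^ 2 + ‖u τ‖ ^ 2) (Icc 0 T) :=
    ((cont_grad S.inX.p_cont).pow 2).add (S.inX.u_cont.norm.pow 2)
  have h1 := UpperSlope.sub_le_integral ht.1
    (f := fun t => energyTop P δ (p t) (u t) (s t) + energyLow δ (p t) (u t))
    (Φ := fun τ => -(c * (‖(p τ).grad‖ ^ 2 + ‖u τ‖ ^ 2)))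
    (((S.cont_energyTop δ).add (S.cont_energyLow δ)).mono hsub)
    ((continuousOn_const.mul hcD).neg.mono hsub) (fun τ hτ => by
      have hτ' : τ ∈ Ico 0 T := ⟨hτ.1, hτ.2.trans_le ht.2⟩
      exact ((S.upperSlope_energyTop hδ0.le hδ1 one_pos hτ').add
        (S.upperSlope_energyLow hδ0.le hδ1 hτ')).mono (hrate (p τ) (u τ) ε hε))
  rw [intervalIntegral.integral_neg, intervalIntegral.integral_const_mul] at h1
  have hI : 0 ≤ ∫ τ in (0 : ℝ)..t, (‖(p τ).grad‖ ^ 2 + ‖u τ‖ ^ 2) :=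
    intervalIntegral.integral_nonneg ht.1 fun _ _ => by positivity
  -- Coercivity: the interaction terms are at most a quarter of the squared norms, against the lower
  -- bound 1/2 of the weighted part. The gradient in the low order interaction is bounded through
  -- the full H³ norm.
  have hlow : 1 / (4 * N) * (‖p t‖ ^ 2 + ‖u t‖ ^ 2)
      ≤ energyTop P δ (p t) (u t) (s t) + energyLow δ (p t) (u t) := by
    have b1 := (S.abs_energyTop_sub_le hδ0.le one_pos ht).1
    have b2 := (abs_le.1 (abs_interaction_low_le (p t) (u t))).1
    have b3 := mul_le_mul_of_nonneg_left b2 hδ0.le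
    have b4 : ‖p t‖ ^ 2 ≤ N * (‖(p t).fn‖ ^ 2 + presTop (p t)) := norm_sq_le_presTop (p t)
    have b5 : ‖u t‖ ^ 2 ≤ N * (velSq (u t) + velTop (u t)) := norm_sq_vec_le (u t)
    have v0 := velSq_nonneg (u t); have v1 := velTop_nonneg (u t)
    have v2 := presTop_nonneg (p t); have v3 := sq_nonneg ‖(p t).fn‖
    have w0 : δ * (22 + N) * (‖(p t).fn‖ ^ 2 + presTop (p t) + velSq (u t) + velTop (u t))
        ≤ 1 / 4 * (‖(p t).fn‖ ^ 2 + presTop (p t) + velSq (u t) + velTop (u t)) :=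
      mul_le_mul_of_nonneg_right hδN (by positivity)
    have b7 := (gradSq_le_norm (p t)).trans b4
    have b8 := mul_le_mul_of_nonneg_left b7 hδ0.le
    have b9 : 1 / (4 * N) * (‖p t‖ ^ 2 + ‖u t‖ ^ 2) ≤ 1 / (4 * N) * (N * (‖(p t).fn‖ ^ 2
        + presTop (p t)) + N * (velSq (u t) + velTop (u t))) :=
      mul_le_mul_of_nonneg_left (add_le_add b4 b5) (by positivity)
    have b10 : 1 / (4 * N) * (N * (‖(p t).fn‖ ^ 2 + presTop (p t))
        + N * (velSq (u t) + velTop (u t))) = 1 / 4 * (‖(p t).fn‖ ^ 2 + presTop (p t)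
        + (velSq (u t) + velTop (u t))) := by field_simp
    rw [b10] at b9
    refine b9.trans ?_
    rw [energyLow]
    rw [one_pow, inv_one] at b1
    nlinarith [mul_nonneg hδ0.le v0, mul_nonneg hδ0.le v1, mul_nonneg hδ0.le v2,
      mul_nonneg hδ0.le v3, mul_nonneg (mul_nonneg hδ0.le (by linarith : (0 : ℝ) ≤ N)) v0,
      mul_nonneg (mul_nonneg hδ0.le (by linarith : (0 : ℝ) ≤ N)) v1]
  have hup : energyTop P δ (p 0) (u 0) (s 0) + energyLow δ (p 0) (u 0)
      ≤ 100 * (‖p 0‖ ^ 2 + ‖u 0‖ ^ 2) := by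
    have b1 := (S.abs_energyTop_sub_le hδ0.le one_pos ht0).2
    have b2 := (abs_le.1 (abs_interaction_low_le (p 0) (u 0))).2
    have b3 := mul_le_mul_of_nonneg_left b2 hδ0.le
    have c1 := velSq_le (u 0); have c2 := velTop_le (u 0)
    have c3 := presTop_le_norm (p 0); have c4 := gradSq_le_norm (p 0)
    have c5 := pow_le_pow_left₀ (norm_nonneg _) (p 0).norm_fn_le 2
    have v0 := velSq_nonneg (u 0); have v1 := velTop_nonneg (u 0)
    have v2 := presTop_nonneg (p 0); have v4 := gradSq_nonneg (p 0)
    have d1 : δ * (velSq (u 0) + gradSq (p 0)) ≤ 1 * (velSq (u 0) + gradSq (p 0)) :=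
      mul_le_mul_of_nonneg_right hδ1 (by positivity)
    have d2 : δ * (3 * velSq (u 0) + velTop (u 0) + 18 * presTop (p 0))
      ≤ 1 * (3 * velSq (u 0) + velTop (u 0) + 18 * presTop (p 0)) :=
      mul_le_mul_of_nonneg_right hδ1 (by positivity)
    rw [one_pow, inv_one] at b1
    rw [energyLow]
    linarith [sq_nonneg ‖u 0‖, sq_nonneg ‖p 0‖]
  set I := ∫ τ in (0 : ℝ)..t, (‖(p τ).grad‖ ^ 2 + ‖u τ‖ ^ 2)
  set X := ‖p t‖ ^ 2 + ‖u t‖ ^ 2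
  set X0 := ‖p 0‖ ^ 2 + ‖u 0‖ ^ 2
  have hX : 0 ≤ X := by positivity
  have k1 : 1 / (4 * N) * X ≤ 100 * X0 := by nlinarith
  have k2 : c * I ≤ 100 * X0 := by
    have : 0 ≤ 1 / (4 * N) * X := by positivity
    linarith
  have k3 : X ≤ 4 * N * (100 * X0) := by
    have := mul_le_mul_of_nonneg_left k1 (by positivity : 0 ≤ 4 * N)
    have e : 4 * N * (1 / (4 * N) * X) = X := by field_simp
    linarith
  have k4 : I ≤ c⁻¹ * (100 * X0) := by
    have := mul_le_mul_of_nonneg_left k2 (by positivity : 0 ≤ c⁻¹)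
    rwa [inv_mul_cancel_left₀ hc.ne'] at this
  linarith

end Sol

end FlowConstants

end


/-! ### The damped functional and algebraic decay -/

noncomputable section

open Filter Topology
open scoped ENNReal

namespace FlowConstants

set_option maxHeartbeats 1000000 in
/-- A functional that controls the solution up to low frequencies of `∇p`, with exponential damping
up to these low frequencies. -/
theorem Sol.exists_damped_functional (P : FlowConstants) : ∃ e₁ c C : ℝ, 0 < e₁ ∧ 0 < c ∧ 0 < C ∧
    ∃ H : Hm 3 → HmVec 3 → Hm 3 → ℝ,
    ∀ {ε T : ℝ} {p : ℝ → Hm 3} {u : ℝ → HmVec 3} {s : ℝ → Hm 3}, ε ≤ e₁ → P.Sol ε T p u s →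
      ContinuousOn (fun t => H (p t) (u t) (s t)) (Icc 0 T) ∧
      (∀ t ∈ Ico 0 T, UpperSlope (fun t => H (p t) (u t) (s t)) t
        (-c * H (p t) (u t) (s t) + C * lowGrad (p t).fn)) ∧
      ∀ t ∈ Icc 0 T, ‖(p t).grad‖ ^ 2 + ‖u t‖ ^ 2 ≤ C * (H (p t) (u t) (s t) + lowGrad (p t).fn) ∧
        H (p t) (u t) (s t) ≤ C * (‖p t‖ ^ 2 + ‖u t‖ ^ 2) := by
  have ha := P.a_pos; have hk := P.kappa₂_pos; have hE := P.errC_pos; have hN := one_le_eqvC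
  set N := eqvC
  set a := P.a
  set κ := P.kappa₂
  set A := a ^ 2 / (2 * κ) with hA
  have hA0 : 0 < A := by positivity
  set B := κ ^ 2 / a * N with hB
  have hB0 : 0 < B := by positivity
  -- The functional is l·`energyTop` + `velSq`, with μ = lδ fixed first. Then its dissipation μκ =
  -- 2B of the high derivatives of `p` is twice what the ∇p forcing of `velSq` costs. Afterwards η
  -- is chosen small in terms of μ, δ small in terms of η, and l = μ/δ comes out large.
  set μ := 2 * κ * N / a with hμ
  have hμ0 : 0 < μ := by positivity
  have hμκ : μ * κ = 2 * B := by rw [hμ, hB]; ring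
  set η := min 1 (min (1 / 2 / (3 * μ)) (a / 4 / (6 * μ * A))) with hη
  have hη0 : 0 < η := by positivity
  have hη1 : η ≤ 1 := min_le_left _ _
  have hη2 : η * (3 * μ) ≤ 1 / 2 :=
    le_min_div_mul (by positivity) ((min_le_right _ _).trans (min_le_left _ _))
  have hη3 : η * (6 * μ * A) ≤ a / 4 :=
    le_min_div_mul (by positivity) ((min_le_right _ _).trans (min_le_right _ _))
  have hηsq : η ^ 2 ≤ η := by nlinarith
  set G := A * η⁻¹ + 18 * κ with hG
  have hG0 : 0 < G := by positivity
  set δ := min 1 (min (a / 2 / G) (min (η / 4) (1 / 144))) with hδ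
  have hδ0 : 0 < δ := by positivity
  have hδ1 : δ ≤ 1 := min_le_left _ _
  have hδG : δ * G ≤ a / 2 :=
    le_min_div_mul hG0 ((min_le_right _ _).trans (min_le_left _ _))
  have hδη : δ * η⁻¹ ≤ 1 / 4 := by
    have : δ ≤ η / 4 := (min_le_right _ _).trans ((min_le_right _ _).trans (min_le_left _ _))
    rw [← div_eq_mul_inv, div_le_iff₀ hη0]; linarith
  have hδ144 : δ ≤ 1 / 144 :=
    (min_le_right _ _).trans ((min_le_right _ _).trans (min_le_right _ _))
  set l := μ / δ with hl
  have hl0 : 0 < l := by positivity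
  have hlδ : l * δ = μ := by rw [hl]; field_simp
  set c := min (l * a) (min (a / 2) B) with hc
  have hc0 : 0 < c := by positivity
  have c1 : c ≤ l * a := min_le_left _ _
  have c2 : c ≤ a / 2 := (min_le_right _ _).trans (min_le_left _ _)
  have c3 : c ≤ B := (min_le_right _ _).trans (min_le_right _ _)
  set b := min (l / 4) (1 / 2) with hb
  have hb0 : 0 < b := by positivity
  have b1 : b ≤ l / 4 := min_le_left _ _
  have b2 : b ≤ 1 / 2 := min_le_right _ _
  set CH := 3 * l + 2 with hCH
  have hCH0 : 0 < CH := by positivity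
  -- bounds of the functional
  have bounds : ∀ {ε T : ℝ} {p : ℝ → Hm 3} {u : ℝ → HmVec 3} {s : ℝ → Hm 3}, P.Sol ε T p u s →
      ∀ t ∈ Icc 0 T, b * (presTop (p t) + velTop (u t) + velSq (u t))
          ≤ l * energyTop P δ (p t) (u t) (s t) + velSq (u t) ∧
        l * energyTop P δ (p t) (u t) (s t) + velSq (u t)
          ≤ CH * (presTop (p t) + velTop (u t) + velSq (u t)) := by
    intro ε T p u s S t ht
    obtain ⟨h1, h2⟩ := S.abs_energyTop_sub_le hδ0.le hη0 ht
    have v0 := velSq_nonneg (u t); have v1 := velTop_nonneg (u t)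
    have v2 := presTop_nonneg (p t)
    have h3 := mul_le_mul_of_nonneg_left h1 hl0.le
    have h4 := mul_le_mul_of_nonneg_left h2 hl0.le
    have e : l * (δ * (3 * η ^ 2 * velSq (u t) + η⁻¹ * velTop (u t) + 18 * presTop (p t)))
        ≤ 1 / 2 * velSq (u t) + l * (1 / 4) * velTop (u t) + l * (1 / 8) * presTop (p t) := by
      have e1 : l * (δ * (3 * η ^ 2 * velSq (u t) + η⁻¹ * velTop (u t) + 18 * presTop (p t)))
          = μ * (3 * η ^ 2) * velSq (u t) + l * (δ * η⁻¹) * velTop (u t)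
            + l * (18 * δ) * presTop (p t) := by rw [← hlδ]; ring
      rw [e1]
      refine add_le_add (add_le_add (mul_le_mul_of_nonneg_right ?_ v0)
        (mul_le_mul_of_nonneg_right (mul_le_mul_of_nonneg_left hδη hl0.le) v1))
        (mul_le_mul_of_nonneg_right (mul_le_mul_of_nonneg_left (by linarith) hl0.le) v2)
      linarith [mul_le_mul_of_nonneg_left hηsq hμ0.le]
    have f1 := mul_le_mul_of_nonneg_right b1 v2
    have f2 := mul_le_mul_of_nonneg_right b1 v1
    have f3 := mul_le_mul_of_nonneg_right b2 v0
    have g1 := mul_nonneg hl0.le v0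
    have g2 := mul_nonneg hl0.le v1
    have g3 := mul_nonneg hl0.le v2
    rw [hCH]
    constructor <;> linarith
  -- The nonlinear errors add up to (6l+1)·`errC`·ε·`dissip`². This threshold makes them at most
  -- half of the damping, up to `lowGrad`.
  set e₁ := c / 2 / ((6 * l + 1) * P.errC * (2 * N)) with he₁
  set C := max (B + c / 2) (max (N * (1 + 1 / b)) (8 * CH)) with hC
  refine ⟨e₁, c / 2 / CH, C, by positivity, by positivity,
    lt_of_lt_of_le (by positivity) (le_max_left _ _),
    fun p u s => l * energyTop P δ p u s + velSq u, fun {ε T p u s} hε S => ⟨?_, ?_, ?_⟩⟩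
  · exact (continuousOn_const.mul (S.cont_energyTop δ)).add S.cont_velSq
  · intro t ht
    have ht' : t ∈ Icc 0 T := ⟨ht.1, ht.2.le⟩
    have hε0 := (S.slice t ht').eps_nonneg
    refine (((S.upperSlope_energyTop hδ0.le hδ1 hη0 ht).const_mul hl0).add
      (S.upperSlope_velSq ht)).mono ?_
    change l * (2 * (-a * velTop (u t) + δ * (-(κ / 2) * presMix (p t)
        + A * (3 * η ^ 2 * velSq (u t) + η⁻¹ * velTop (u t)) + 18 * κ * velTop (u t))
        + 3 * P.errC * ε * dissip (p t) (u t) ^ 2))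
      + (-a * velSq (u t) + κ ^ 2 / a * gradSq (p t) + P.errC * ε * dissip (p t) (u t) ^ 2)
      ≤ -(c / 2 / CH) * (l * energyTop P δ (p t) (u t) (s t) + velSq (u t))
        + C * lowGrad (p t).fn
    have h1 : ‖u t‖ ^ 2 ≤ N * (velSq (u t) + velTop (u t)) := norm_sq_vec_le (u t)
    -- The high frequencies of ∇p are covered by the top order dissipation, so `lowGrad` is the only
    -- source term.
    have h2 : ‖(p t).grad‖ ^ 2 ≤ N * (lowGrad (p t).fn + presMix (p t)) :=
      (norm_grad_sq_le_lowGrad (p t)).trans (mul_le_mul_of_nonneg_left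
        (add_le_add_right (presTop_le_presMix (p t)) _) (by linarith))
    have h3 := dissip_sq_le (p t) (u t)
    have h4 := (gradSq_le_grad (p t)).trans h2
    have h5 := (bounds S t ht').2
    have h6 := presTop_le_presMix (p t)
    have hε' := le_min_div_mul (by positivity) hε
    have v0 := velSq_nonneg (u t); have v1 := velTop_nonneg (u t)
    have v2 := presTop_nonneg (p t); have v3 := presMix_nonneg (p t)
    have v4 := lowGrad_nonneg (p t).fn
    have hCB : B + c / 2 ≤ C := le_max_left _ _
    generalize l * energyTop P δ (p t) (u t) (s t) + velSq (u t) = Ht at *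
    generalize velSq (u t) = U at *
    generalize velTop (u t) = Z at *
    generalize gradSq (p t) = Y at *
    generalize presMix (p t) = Q at *
    generalize presTop (p t) = Q' at *
    generalize lowGrad (p t).fn = L at *
    have n2 := sq_nonneg (dissip (p t) (u t))
    generalize dissip (p t) (u t) ^ 2 = m at *
    have s1 : (6 * l + 1) * P.errC * ε * m ≤ c / 2 * (L + Q + U + Z) := by
      have : m ≤ 2 * N * (L + Q + U + Z) := by linarith
      calc (6 * l + 1) * P.errC * ε * m ≤ (6 * l + 1) * P.errC * ε * (2 * N * (L + Q + U + Z)) :=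
            mul_le_mul_of_nonneg_left this (by positivity)
        _ = ε * ((6 * l + 1) * P.errC * (2 * N)) * (L + Q + U + Z) := by ring
        _ ≤ c / 2 * (L + Q + U + Z) := mul_le_mul_of_nonneg_right hε' (by positivity)
    have s2 : l * (2 * (δ * (A * (3 * η ^ 2 * U + η⁻¹ * Z) + 18 * κ * Z)))
        ≤ a / 4 * U + l * a * Z := by
      have e1 : l * (2 * (δ * (A * (3 * η ^ 2 * U + η⁻¹ * Z) + 18 * κ * Z)))
          = 6 * μ * A * η ^ 2 * U + 2 * l * (δ * G) * Z := by rw [← hlδ, hG]; ring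
      rw [e1]
      refine add_le_add (mul_le_mul_of_nonneg_right ?_ v0) (mul_le_mul_of_nonneg_right ?_ v1)
      · have := mul_le_mul_of_nonneg_left hηsq (by positivity : 0 ≤ 6 * μ * A)
        linarith
      · have := mul_le_mul_of_nonneg_left hδG (by positivity : 0 ≤ 2 * l)
        linarith
    have s3 : κ ^ 2 / a * Y ≤ B * (L + Q) := by
      have := mul_le_mul_of_nonneg_left h4 (by positivity : 0 ≤ κ ^ 2 / a)
      rw [hB]; linarith
    have s4 : l * (2 * (δ * (-(κ / 2) * Q))) = -(2 * B * Q) := by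
      rw [← hμκ, ← hlδ]; ring
    have s5 : c / 2 / CH * Ht ≤ c / 2 * (Q + Z + U) := by
      have : c / 2 / CH * Ht ≤ c / 2 / CH * (CH * (Q' + Z + U)) :=
        mul_le_mul_of_nonneg_left h5 (by positivity)
      have e2 : c / 2 / CH * (CH * (Q' + Z + U)) = c / 2 * (Q' + Z + U) := by field_simp
      have := mul_le_mul_of_nonneg_left h6 (by positivity : 0 ≤ c / 2)
      linarith
    have t1 := mul_le_mul_of_nonneg_right c1 v1
    have t2 := mul_le_mul_of_nonneg_right c2 v0
    have t3 := mul_le_mul_of_nonneg_right c3 v3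
    have t4 := mul_le_mul_of_nonneg_right hCB v4
    have t5 := mul_nonneg ha.le v0
    linarith
  · intro t ht
    obtain ⟨h5, h6⟩ := bounds S t ht
    have h1 : ‖u t‖ ^ 2 ≤ N * (velSq (u t) + velTop (u t)) := norm_sq_vec_le (u t)
    have h2 : ‖(p t).grad‖ ^ 2 ≤ N * (lowGrad (p t).fn + presTop (p t)) :=
      norm_grad_sq_le_lowGrad (p t)
    have v0 := velSq_nonneg (u t); have v1 := velTop_nonneg (u t)
    have v2 := presTop_nonneg (p t); have v4 := lowGrad_nonneg (p t).fn
    have hC1 : N * (1 + 1 / b) ≤ C := (le_max_left _ _).trans (le_max_right _ _)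
    have hC2 : 8 * CH ≤ C := (le_max_right _ _).trans (le_max_right _ _)
    have d1 := velSq_le (u t); have d2 := velTop_le (u t); have d3 := presTop_le_norm (p t)
    have n0 := sq_nonneg ‖u t‖; have n1 := sq_nonneg ‖p t‖
    constructor
    · have k1 : presTop (p t) + velTop (u t) + velSq (u t)
          ≤ 1 / b * (l * energyTop P δ (p t) (u t) (s t) + velSq (u t)) := by
        rw [one_div, ← div_eq_inv_mul, le_div_iff₀ hb0]; linarith
      have hH0 : 0 ≤ l * energyTop P δ (p t) (u t) (s t) + velSq (u t) :=
        (by positivity : 0 ≤ b * (presTop (p t) + velTop (u t) + velSq (u t))).trans h5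
      refine le_trans ?_ (mul_le_mul_of_nonneg_right hC1 (add_nonneg hH0 v4))
      have k2 := mul_le_mul_of_nonneg_left k1 (by linarith : 0 ≤ N)
      have k3 : 0 ≤ N * (1 / b) * lowGrad (p t).fn := by positivity
      have k4 : 0 ≤ N * (l * energyTop P δ (p t) (u t) (s t) + velSq (u t)) := by positivity
      linarith
    · refine h6.trans (le_trans ?_ (mul_le_mul_of_nonneg_right hC2 (by positivity)))
      have : presTop (p t) + velTop (u t) + velSq (u t) ≤ 8 * (‖p t‖ ^ 2 + ‖u t‖ ^ 2) := by linarith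
      have := mul_le_mul_of_nonneg_left this hCH0.le
      linarith

end FlowConstants

/-- Algebraic decay for damped functionals with an algebraically decaying source. -/
theorem decay_of_upperSlope {c : ℝ} (hc : 0 < c) : ∃ C : ℝ, 0 < C ∧
    ∀ {f g : ℝ → ℝ} {T A B : ℝ}, ContinuousOn f (Icc 0 T) → 0 ≤ A → 0 ≤ B → f 0 ≤ A →
      (∀ t ∈ Ico 0 T, UpperSlope f t (-c * f t + g t)) →
      (∀ t ∈ Ico 0 T, g t ≤ B * (1 + t) ^ (-(5 / 2 : ℝ))) →
      ∀ t ∈ Icc 0 T, f t ≤ C * (A + B) * (1 + t) ^ (-(5 / 2 : ℝ)) := by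
  -- The barrier is a multiple of (1+γt)^{-5/2}. Its logarithmic derivative is at most 5γ/2 ≤ c/2 in
  -- size, so half of the damping beats its decrease and the other half beats the source.
  set γ := min 1 (c / 5) with hγ
  have hγ0 : 0 < γ := by positivity
  have hγ1 : γ ≤ 1 := min_le_left _ _
  have hγc : 5 / 2 * γ ≤ c / 2 := by have : γ ≤ c / 5 := min_le_right _ _; linarith
  -- The extra θ makes the comparison strict where `f` touches the barrier; it is removed at the
  -- end.
  have main : ∀ {f g : ℝ → ℝ} {T A B : ℝ}, ContinuousOn f (Icc 0 T) → 0 ≤ A → 0 ≤ B → f 0 ≤ A →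
      (∀ t ∈ Ico 0 T, UpperSlope f t (-c * f t + g t)) →
      (∀ t ∈ Ico 0 T, g t ≤ B * (1 + t) ^ (-(5 / 2 : ℝ))) → ∀ θ > 0,
      ∀ t ∈ Icc 0 T, f t ≤ (A + 2 / c * B + θ) * (1 + γ * t) ^ (-(5 / 2 : ℝ)) := by
    intro f g T A B hf hA hB h0 hs hg θ hθ
    set D := A + 2 / c * B + θ with hD
    have hD0 : 0 < D := by positivity
    have hpos : ∀ t ∈ Icc 0 T, 0 < 1 + γ * t := fun t ht => by
      have := mul_nonneg hγ0.le ht.1; linarith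
    have hder : ∀ t ∈ Icc 0 T, HasDerivAt (fun t => D * (1 + γ * t) ^ (-(5 / 2 : ℝ)))
        (D * (γ * (-(5 / 2)) * (1 + γ * t) ^ (-(5 / 2 : ℝ) - 1))) t := fun t ht => by
      have h1 : HasDerivAt (fun t => 1 + γ * t) γ t := by
        simpa using ((hasDerivAt_id t).const_mul γ).const_add 1
      exact (h1.rpow_const (Or.inl (hpos t ht).ne')).const_mul D
    intro t ht
    refine image_le_of_liminf_slope_right_lt_deriv_boundary' (f := f)
      (f' := fun t => -c * f t + g t) hf (fun x hx r hr => (hs x hx r hr).frequently)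
      (B := fun t => D * (1 + γ * t) ^ (-(5 / 2 : ℝ))) ?_
      (fun x hx => (hder x hx).continuousAt.continuousWithinAt)
      (fun x hx => (hder x ⟨hx.1, hx.2.le⟩).hasDerivWithinAt) ?_ ht
    · simp only [mul_zero, add_zero, Real.one_rpow, mul_one]
      have : 0 ≤ 2 / c * B := by positivity
      linarith
    · intro x hx hfx
      have hx' : x ∈ Icc 0 T := ⟨hx.1, hx.2.le⟩
      have hp := hpos x hx'
      set z := (1 + γ * x) ^ (-(5 / 2 : ℝ)) with hz
      have hz0 : 0 < z := Real.rpow_pos_of_pos hp _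
      have e1 : (1 + γ * x) ^ (-(5 / 2 : ℝ) - 1) ≤ z :=
        Real.rpow_le_rpow_of_exponent_le (by linarith [mul_nonneg hγ0.le hx.1]) (by norm_num)
      have e2 : (1 + x) ^ (-(5 / 2 : ℝ)) ≤ z :=
        Real.rpow_le_rpow_of_nonpos hp (by nlinarith [hx.1]) (by norm_num)
      have e3 := (hg x hx).trans (mul_le_mul_of_nonneg_left e2 hB)
      rw [hfx]
      have e4 : D * (γ * (5 / 2) * (1 + γ * x) ^ (-(5 / 2 : ℝ) - 1)) ≤ D * (c / 2 * z) := by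
        refine mul_le_mul_of_nonneg_left ?_ hD0.le
        exact mul_le_mul (by linarith) e1 (Real.rpow_nonneg hp.le _) (by positivity)
      have e5 : B < c / 2 * D := by
        have e6 : c / 2 * D = c / 2 * A + B + c / 2 * θ := by rw [hD]; field_simp
        have : 0 < c / 2 * θ := by positivity
        have : 0 ≤ c / 2 * A := by positivity
        linarith
      have e7 := mul_lt_mul_of_pos_right e5 hz0
      nlinarith
  refine ⟨(1 + 2 / c) * γ ^ (-(5 / 2 : ℝ)), by positivity,
    fun {f g T A B} hf hA hB h0 hs hg t ht => ?_⟩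
  have h1 : f t ≤ (A + 2 / c * B) * (1 + γ * t) ^ (-(5 / 2 : ℝ)) := by
    refine le_of_forall_pos_le_add fun θ hθ => ?_
    refine (main hf hA hB h0 hs hg θ hθ t ht).trans ?_
    rw [add_mul _ θ]
    refine add_le_add_right ?_ _
    refine mul_le_of_le_one_right hθ.le (Real.rpow_le_one_of_one_le_of_nonpos ?_ (by norm_num))
    linarith [mul_nonneg hγ0.le ht.1]
  refine h1.trans ?_
  have h2 : (1 + γ * t) ^ (-(5 / 2 : ℝ)) ≤ γ ^ (-(5 / 2 : ℝ)) * (1 + t) ^ (-(5 / 2 : ℝ)) := by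
    rw [← Real.mul_rpow hγ0.le (by linarith [ht.1])]
    exact Real.rpow_le_rpow_of_nonpos (mul_pos hγ0 (by linarith [ht.1]))
      (by nlinarith) (by norm_num)
  have h3 : A + 2 / c * B ≤ (1 + 2 / c) * (A + B) := by
    have : 0 ≤ 2 / c * A := by positivity
    nlinarith
  calc (A + 2 / c * B) * (1 + γ * t) ^ (-(5 / 2 : ℝ))
      ≤ ((1 + 2 / c) * (A + B)) * (γ ^ (-(5 / 2 : ℝ)) * (1 + t) ^ (-(5 / 2 : ℝ))) :=
        mul_le_mul h3 h2 (Real.rpow_nonneg (by linarith [mul_nonneg hγ0.le ht.1]) _)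
          (by positivity)
    _ = _ := by ring

end


/-! ### A Lyapunov functional for damped hyperbolic systems in Hilbert space -/

noncomputable section

open Filter Topology
open scoped ENNReal

/-- A differential inequality `f' ≤ 2 ν √f` integrates to `√f(t) ≤ √f(0) + ∫ ν`. -/
theorem sqrt_le_of_deriv_le {f f' ν : ℝ → ℝ} {t : ℝ} (ht : 0 ≤ t) (hf0 : ∀ τ ∈ Icc 0 t, 0 ≤ f τ)
    (hf : ∀ τ ∈ Icc 0 t, HasDerivWithinAt f (f' τ) (Icc 0 t) τ) (hν : ContinuousOn ν (Icc 0 t))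
    (hν0 : ∀ τ ∈ Icc 0 t, 0 ≤ ν τ) (h : ∀ τ ∈ Icc 0 t, f' τ ≤ 2 * ν τ * Real.sqrt (f τ)) :
    Real.sqrt (f t) ≤ Real.sqrt (f 0) + ∫ τ in (0 : ℝ)..t, ν τ := by
  -- Adding θ keeps the square root differentiable where `f` vanishes.
  have key : ∀ θ : ℝ, 0 < θ → Real.sqrt (f t + θ) - Real.sqrt (f 0 + θ) ≤ ∫ τ in (0 : ℝ)..t, ν τ := by
    intro θ hθ
    have hd : ∀ τ ∈ Icc 0 t, HasDerivWithinAt (fun τ => Real.sqrt (f τ + θ))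
        (f' τ / (2 * Real.sqrt (f τ + θ))) (Icc 0 t) τ := fun τ hτ =>
      ((hf τ hτ).add_const θ).sqrt (by have := hf0 τ hτ; positivity)
    refine UpperSlope.sub_le_integral (f := fun τ => Real.sqrt (f τ + θ)) ht
      (fun τ hτ => (hd τ hτ).continuousWithinAt) hν fun τ hτ => ?_
    have hτ' : τ ∈ Icc 0 t := ⟨hτ.1, hτ.2.le⟩
    refine (UpperSlope.of_hasDerivWithinAt ((hd τ hτ').Ioi_of_Icc hτ)).mono ?_
    have hpos : 0 < Real.sqrt (f τ + θ) := Real.sqrt_pos.2 (by have := hf0 τ hτ'; positivity)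
    rw [div_le_iff₀ (by positivity)]
    refine (h τ hτ').trans ?_
    have : Real.sqrt (f τ) ≤ Real.sqrt (f τ + θ) := Real.sqrt_le_sqrt (by linarith)
    have := mul_le_mul_of_nonneg_left this (by have := hν0 τ hτ'; positivity : 0 ≤ 2 * ν τ)
    linarith
  have h0 : Tendsto (fun θ : ℝ => θ) (𝓝[>] 0) (𝓝 0) := tendsto_nhdsWithin_of_tendsto_nhds tendsto_id
  have lim : ∀ y : ℝ, Tendsto (fun θ => Real.sqrt (y + θ)) (𝓝[>] 0) (𝓝 (Real.sqrt y)) := fun y => by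
    have := (Real.continuous_sqrt.tendsto (y + 0)).comp (h0.const_add y)
    simpa [Function.comp_def] using this
  have := le_of_tendsto ((lim (f t)).sub (lim (f 0))) (by
    filter_upwards [self_mem_nhdsWithin] with θ hθ using key θ hθ)
  linarith

/-- The Lyapunov functional of a damped hyperbolic system in a Hilbert space: `X_k` are skew
operators and `B = c₀ R²`. -/
theorem lyapunov_deriv_le {V : Type*} [NormedAddCommGroup V] [InnerProductSpace ℝ V]
    {X : Fin 3 → V →L[ℝ] V} {R B : V →L[ℝ] V} {κ a δ : ℝ} (hκ : 0 < κ) (ha : 0 < a) (hδ : 0 < δ)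
    (hδ1 : δ ≤ 1) (hδa : δ * (7 * κ + 2 * a ^ 2 / κ) ≤ a)
    (hX : ∀ k f g, inner ℝ (X k f) g = -inner ℝ f (X k g))
    (hR : ∀ f, ∑ k, ‖X k f‖ ^ 2 = ‖R f‖ ^ 2) (hR1 : ∀ f, ‖R f‖ ≤ ‖f‖)
    (hB : ∀ f g, inner ℝ f (B g) = δ * κ / 16 * inner ℝ (R f) (R g))
    {p p' n : V} {u u' m : Fin 3 → V} {ν : ℝ} (hn : ‖n‖ ≤ ν) (hm : ∀ k, ‖m k‖ ≤ ν)
    (hp : p' = n - κ • ∑ j, X j (u j) + B p)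
    (hu : ∀ k, u' k = m k - κ • X k p - a • u k + B (u k)) :
    2 * inner ℝ p p' + ∑ k, 2 * inner ℝ (u k) (u' k)
      + 2 * δ * ∑ k, (inner ℝ (X k p') (u k) + inner ℝ (X k p) (u' k))
      ≤ 20 * ν * Real.sqrt (‖p‖ ^ 2 + ∑ k, ‖u k‖ ^ 2) := by
  have hν : 0 ≤ ν := (norm_nonneg _).trans hn
  -- The operator B will be the growth of the heat weight in time. With the factor 1/16 its
  -- contributions are absorbed: that of `p` by the interaction dissipation δκ‖Rp‖², those of the
  -- velocity by the friction.
  set c := δ * κ / 16 with hc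
  have hc0 : 0 < c := by positivity
  set x := ‖R p‖ with hx
  have hx0 : 0 ≤ x := norm_nonneg _
  have hXR : ∀ k f, ‖X k f‖ ≤ ‖R f‖ := fun k f => by
    refine le_of_sq_le_sq ?_ (norm_nonneg _)
    rw [← hR f]
    exact Finset.single_le_sum (f := fun k => ‖X k f‖ ^ 2) (fun _ _ => sq_nonneg _)
      (Finset.mem_univ k)
  have hX1 : ∀ k f, ‖X k f‖ ≤ ‖f‖ := fun k f => (hXR k f).trans (hR1 f)
  set E := ‖p‖ ^ 2 + ∑ k, ‖u k‖ ^ 2 with hE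
  have hE0 : 0 ≤ ∑ k, ‖u k‖ ^ 2 := Finset.sum_nonneg fun _ _ => sq_nonneg _
  have hpE : ‖p‖ ≤ Real.sqrt E := Real.le_sqrt_of_sq_le (by rw [hE]; linarith)
  have huE : ∀ k, ‖u k‖ ≤ Real.sqrt E := fun k => Real.le_sqrt_of_sq_le (by
    have := Finset.single_le_sum (f := fun k => ‖u k‖ ^ 2) (fun _ _ => sq_nonneg _)
      (Finset.mem_univ k)
    rw [hE]; nlinarith [sq_nonneg ‖p‖])
  -- expansions
  have e1 : inner ℝ p p' = inner ℝ p n - κ * ∑ j, inner ℝ p (X j (u j)) + c * x ^ 2 := by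
    rw [hp, inner_add_right, inner_sub_right, real_inner_smul_right, inner_sum, hB,
      real_inner_self_eq_norm_sq]
  have e2 : ∀ k, inner ℝ (u k) (u' k) = inner ℝ (u k) (m k) - κ * inner ℝ (u k) (X k p)
      - a * ‖u k‖ ^ 2 + c * ‖R (u k)‖ ^ 2 := fun k => by
    rw [hu k, inner_add_right, inner_sub_right, inner_sub_right, real_inner_smul_right,
      real_inner_smul_right, hB, real_inner_self_eq_norm_sq, real_inner_self_eq_norm_sq]
  have e3 : ∀ k, inner ℝ (X k p') (u k) = inner ℝ (X k n) (u k)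
      + κ * inner ℝ (∑ j, X j (u j)) (X k (u k)) - c * inner ℝ (R (X k (u k))) (R p) := fun k => by
    rw [hX k p', hp, inner_add_left, inner_sub_left, real_inner_smul_left, hX k n,
      real_inner_comm (X k (u k)) (B p), hB]
    ring
  have e4 : ∀ k, inner ℝ (X k p) (u' k) = inner ℝ (X k p) (m k) - κ * ‖X k p‖ ^ 2
      - a * inner ℝ (X k p) (u k) + c * inner ℝ (R (X k p)) (R (u k)) := fun k => by
    rw [hu k, inner_add_right, inner_sub_right, inner_sub_right, real_inner_smul_right,
      real_inner_smul_right, hB, real_inner_self_eq_norm_sq]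
  -- Skewness cancels the coupling between the pressure and velocity equations.
  have cross : ∀ j, inner ℝ (u j) (X j p) = -inner ℝ p (X j (u j)) := fun j => by
    rw [real_inner_comm, hX]
  -- bounds
  have b1 : inner ℝ p n ≤ ν * Real.sqrt E := (real_inner_le_norm _ _).trans (by
    rw [mul_comm]; exact mul_le_mul hn hpE (norm_nonneg _) hν)
  have b2 : ∀ k, inner ℝ (u k) (m k) ≤ ν * Real.sqrt E := fun k =>
    (real_inner_le_norm _ _).trans (by
      rw [mul_comm]; exact mul_le_mul (hm k) (huE k) (norm_nonneg _) hν)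
  have b3 : ∀ k, inner ℝ (X k n) (u k) ≤ ν * Real.sqrt E := fun k =>
    (real_inner_le_norm _ _).trans
      (mul_le_mul ((hX1 k n).trans hn) (huE k) (norm_nonneg _) hν)
  have b4 : ∀ k, inner ℝ (X k p) (m k) ≤ ν * Real.sqrt E := fun k =>
    (real_inner_le_norm _ _).trans (by
      rw [mul_comm]; exact mul_le_mul (hm k) ((hX1 k p).trans hpE) (norm_nonneg _) hν)
  have b5 : ∀ k, ‖R (u k)‖ ^ 2 ≤ ‖u k‖ ^ 2 := fun k =>
    pow_le_pow_left₀ (norm_nonneg _) (hR1 _) 2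
  -- The operators R and X_k have norm at most 1, as for low frequencies, so one factor R on `p` is
  -- enough to use the dissipation of ‖Rp‖.
  have b6 : ∀ k, -inner ℝ (R (X k (u k))) (R p) ≤ 1 / 2 * x ^ 2 + 1 / 2 * ‖u k‖ ^ 2 := fun k => by
    refine (neg_le_abs _).trans ((abs_real_inner_le_norm _ _).trans ?_)
    have : ‖R (X k (u k))‖ ≤ ‖u k‖ := (hR1 _).trans (hX1 k _)
    have := mul_le_mul_of_nonneg_right this hx0
    nlinarith [sq_nonneg (x - ‖u k‖)]
  have b7 : ∀ k, inner ℝ (R (X k p)) (R (u k)) ≤ 1 / 2 * x ^ 2 + 1 / 2 * ‖u k‖ ^ 2 := fun k => by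
    refine (real_inner_le_norm _ _).trans ?_
    have h1 : ‖R (X k p)‖ ≤ x := (hR1 _).trans (hXR k p)
    have := mul_le_mul h1 (hR1 (u k)) (norm_nonneg _) hx0
    nlinarith [sq_nonneg (x - ‖u k‖)]
  have b8 : ∀ k, -(a * inner ℝ (X k p) (u k)) ≤ κ / 4 * ‖X k p‖ ^ 2 + a ^ 2 / κ * ‖u k‖ ^ 2 :=
    fun k => by
      have h1 : -(a * inner ℝ (X k p) (u k)) ≤ a * (‖X k p‖ * ‖u k‖) := by
        have := neg_le_abs (inner ℝ (X k p) (u k))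
        have := abs_real_inner_le_norm (X k p) (u k)
        nlinarith
      refine h1.trans ?_
      have h2 : κ / 4 * ‖X k p‖ ^ 2 + a ^ 2 / κ * ‖u k‖ ^ 2 - a * (‖X k p‖ * ‖u k‖)
          = (κ * ‖X k p‖ / 2 - a * ‖u k‖) ^ 2 / κ := by field_simp; ring
      have h3 : 0 ≤ (κ * ‖X k p‖ / 2 - a * ‖u k‖) ^ 2 / κ := by positivity
      linarith
  have b9 : ‖∑ j, X j (u j)‖ ^ 2 ≤ 3 * ∑ k, ‖u k‖ ^ 2 :=
    (norm_sq_sum_three_le _).trans (mul_le_mul_of_nonneg_left (Finset.sum_le_sum fun k _ =>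
      pow_le_pow_left₀ (norm_nonneg _) (hX1 k _) 2) (by norm_num))
  -- summation
  have s2 : ∑ k, inner ℝ (u k) (u' k) ≤ 3 * (ν * Real.sqrt E) + κ * ∑ j, inner ℝ p (X j (u j))
      - a * (∑ k, ‖u k‖ ^ 2) + c * ∑ k, ‖u k‖ ^ 2 := by
    have : ∀ k, inner ℝ (u k) (u' k) ≤ ν * Real.sqrt E + κ * inner ℝ p (X k (u k))
        - a * ‖u k‖ ^ 2 + c * ‖u k‖ ^ 2 := fun k => by
      rw [e2 k, cross k]
      have := b2 k
      have := mul_le_mul_of_nonneg_left (b5 k) hc0.le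
      linarith
    refine (Finset.sum_le_sum fun k _ => this k).trans (le_of_eq ?_)
    simp only [Finset.sum_add_distrib, Finset.sum_sub_distrib, ← Finset.mul_sum]
    simp only [Finset.sum_const, Finset.card_univ, Fintype.card_fin, nsmul_eq_mul,
      Nat.cast_ofNat]
    ring
  have s3 : ∑ k, (inner ℝ (X k p') (u k) + inner ℝ (X k p) (u' k)) ≤ 6 * (ν * Real.sqrt E)
      + κ * (3 * ∑ k, ‖u k‖ ^ 2) - 3 * κ / 4 * x ^ 2 + a ^ 2 / κ * (∑ k, ‖u k‖ ^ 2)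
      + c * (3 * x ^ 2 + ∑ k, ‖u k‖ ^ 2) := by
    have : ∀ k, inner ℝ (X k p') (u k) + inner ℝ (X k p) (u' k) ≤ 2 * (ν * Real.sqrt E)
        + κ * inner ℝ (∑ j, X j (u j)) (X k (u k)) - 3 * κ / 4 * ‖X k p‖ ^ 2
        + a ^ 2 / κ * ‖u k‖ ^ 2 + c * (x ^ 2 + ‖u k‖ ^ 2) := fun k => by
      rw [e3 k, e4 k]
      have := b3 k; have := b4 k; have := b8 k
      have := mul_le_mul_of_nonneg_left (b6 k) hc0.le
      have := mul_le_mul_of_nonneg_left (b7 k) hc0.le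
      linarith
    refine (Finset.sum_le_sum fun k _ => this k).trans ?_
    simp only [Finset.sum_add_distrib, Finset.sum_sub_distrib, ← Finset.mul_sum]
    rw [hR p, ← inner_sum, real_inner_self_eq_norm_sq]
    have := mul_le_mul_of_nonneg_left b9 hκ.le
    simp only [Finset.sum_const, Finset.card_univ, Fintype.card_fin, nsmul_eq_mul,
      Nat.cast_ofNat]
    linarith
  have s3' := mul_le_mul_of_nonneg_left s3 (by positivity : 0 ≤ 2 * δ)
  rw [e1, ← Finset.mul_sum]
  have q : 0 ≤ ν * Real.sqrt E := mul_nonneg hν (Real.sqrt_nonneg _)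
  have q1 := mul_le_mul_of_nonneg_right hδ1 q
  set W := ∑ k, ‖u k‖ ^ 2
  have w1 := mul_le_mul_of_nonneg_right hδa hE0
  have hcδ : δ * c ≤ c := mul_le_of_le_one_left hc0.le hδ1
  have w2 := mul_le_mul_of_nonneg_right hcδ (sq_nonneg x)
  have w3 := mul_le_mul_of_nonneg_right hcδ hE0
  have w4 : 16 * c * x ^ 2 = δ * κ * x ^ 2 := by rw [hc]; ring
  have w5 : 16 * c * W = δ * κ * W := by rw [hc]; ring
  have w6 : 0 ≤ δ * κ * x ^ 2 := by positivity
  have w7 : 0 ≤ δ * κ * W := by positivity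
  have w8 : δ * (7 * κ + 2 * a ^ 2 / κ) * W = 7 * (δ * κ * W) + 2 * (δ * (a ^ 2 / κ * W)) := by
    ring
  have w9 : 0 ≤ a * W := by positivity
  nlinarith

end


/-! ### Low frequency multipliers and heat decay -/

noncomputable section

open Filter Topology
open scoped ENNReal

/-- Bounded measurable Fourier symbols. -/
structure IsSymbol (c : E3 → ℂ) (K : ℝ) : Prop where
  meas : AEStronglyMeasurable c volume
  bound : ∀ ξ, ‖c ξ‖ ≤ K

theorem IsSymbol.memLp_mul {c : E3 → ℂ} {K : ℝ} (h : IsSymbol c K) (f : L2C) :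
    MemLp (fun ξ => c ξ * f ξ) 2 volume :=
  (Lp.memLp f).of_le_mul (c := K) (h.meas.mul (Lp.memLp f).1) (Eventually.of_forall fun ξ => by
    rw [norm_mul]; exact mul_le_mul_of_nonneg_right (h.bound ξ) (norm_nonneg _))

/-- Multiplication by a bounded symbol. -/
def mulC {c : E3 → ℂ} {K : ℝ} (h : IsSymbol c K) : L2C →L[ℝ] L2C :=
  LinearMap.mkContinuous
    { toFun := fun f => (h.memLp_mul f).toLp _
      map_add' := fun f g => by
        rw [← MemLp.toLp_add]
        refine MemLp.toLp_congr _ _ ?_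
        filter_upwards [Lp.coeFn_add f g] with x hx
        rw [Pi.add_apply, hx, Pi.add_apply, mul_add]
      map_smul' := fun r f => by
        rw [RingHom.id_apply, ← MemLp.toLp_const_smul]
        refine MemLp.toLp_congr _ _ ?_
        filter_upwards [Lp.coeFn_smul r f] with x hx
        rw [Pi.smul_apply, hx, Pi.smul_apply, mul_smul_comm] } K
    fun f => by
      refine Lp.norm_le_mul_norm_of_ae_le_mul ?_
      filter_upwards [(h.memLp_mul f).coeFn_toLp] with ξ hξ
      simp only [LinearMap.coe_mk, AddHom.coe_mk, hξ, norm_mul]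
      exact mul_le_mul_of_nonneg_right (h.bound ξ) (norm_nonneg _)

theorem coeFn_mulC {c : E3 → ℂ} {K : ℝ} (h : IsSymbol c K) (f : L2C) :
    mulC h f =ᵐ[volume] fun ξ => c ξ * f ξ :=
  (h.memLp_mul f).coeFn_toLp

theorem norm_sq_mulC {c : E3 → ℂ} {K : ℝ} (h : IsSymbol c K) (f : L2C) :
    ‖mulC h f‖ ^ 2 = ∫ ξ, ‖c ξ‖ ^ 2 * ‖f ξ‖ ^ 2 := by
  rw [norm_sq_L2C]
  refine integral_congr_ae ?_
  filter_upwards [coeFn_mulC h f] with ξ hξ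
  rw [hξ, norm_mul, mul_pow]

theorem inner_mulC_left {c c' : E3 → ℂ} {K K' : ℝ} (h : IsSymbol c K) (h' : IsSymbol c' K')
    (hc : ∀ ξ, c' ξ = (starRingEnd ℂ) (c ξ)) (f g : L2C) :
    inner ℝ (mulC h f) g = inner ℝ f (mulC h' g) := by
  rw [L2.inner_def, L2.inner_def]
  refine integral_congr_ae ?_
  filter_upwards [coeFn_mulC h f, coeFn_mulC h' g] with ξ h1 h2
  rw [h1, h2, hc, Complex.inner, Complex.inner, map_mul]
  congr 1
  ring

/-- The symbol `|ξ|^j e^{r |ξ|²}` cut off to the low frequencies `|ξ| ≤ 1`. -/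
def lowSym (j : ℕ) (r : ℝ) (ξ : E3) : ℝ :=
  if freqSq ξ ≤ 1 then Real.exp (r * freqSq ξ) * Real.sqrt (freqSq ξ) ^ j else 0

theorem lowSym_nonneg (j : ℕ) (r : ℝ) (ξ : E3) : 0 ≤ lowSym j r ξ := by
  unfold lowSym; split_ifs <;> positivity

theorem measurable_lowSym (j : ℕ) (r : ℝ) : Measurable (lowSym j r) := by
  have h := continuous_freqSq
  refine Measurable.ite measurableSet_low ?_ measurable_const
  exact Continuous.measurable (by fun_prop)

theorem lowSym_le (j : ℕ) {r b : ℝ} (hr : r ≤ b) (hb : 0 ≤ b) (ξ : E3) :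
    lowSym j r ξ ≤ Real.exp b := by
  unfold lowSym
  split_ifs with h
  · have h0 := freqSq_nonneg ξ
    have h1 : Real.sqrt (freqSq ξ) ^ j ≤ 1 :=
      pow_le_one₀ (Real.sqrt_nonneg _) (Real.sqrt_le_one.2 h)
    have h2 : Real.exp (r * freqSq ξ) ≤ Real.exp b := Real.exp_le_exp.2 (by nlinarith)
    exact (mul_le_of_le_one_right (Real.exp_nonneg _) h1).trans h2
  · positivity

theorem lowSym_mul (i j : ℕ) (r s : ℝ) (ξ : E3) :
    lowSym i r ξ * lowSym j s ξ = lowSym (i + j) (r + s) ξ := by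
  unfold lowSym
  split_ifs
  · rw [add_mul, Real.exp_add, pow_add]; ring
  · simp

theorem isSymbol_lowSym (j : ℕ) {r b : ℝ} (hr : r ≤ b) (hb : 0 ≤ b) :
    IsSymbol (fun ξ => (lowSym j r ξ : ℂ)) (Real.exp b) where
  meas := (Complex.measurable_ofReal.comp (measurable_lowSym j r)).aestronglyMeasurable
  bound ξ := by
    rw [Complex.norm_real, Real.norm_of_nonneg (lowSym_nonneg _ _ _)]
    exact lowSym_le j hr hb ξ

/-- The low frequency multiplier with symbol `lowSym j r`. -/
def lowOp (j : ℕ) (r : ℝ) : L2C →L[ℝ] L2C :=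
  mulC (isSymbol_lowSym j (le_abs_self r) (abs_nonneg r))

theorem coeFn_lowOp (j : ℕ) (r : ℝ) (f : L2C) :
    lowOp j r f =ᵐ[volume] fun ξ => (lowSym j r ξ : ℂ) * f ξ := coeFn_mulC _ f

theorem norm_lowOp_le (j : ℕ) {r : ℝ} (hr : r ≤ 0) (f : L2C) : ‖lowOp j r f‖ ≤ ‖f‖ := by
  refine Lp.norm_le_norm_of_ae_le ?_
  filter_upwards [coeFn_lowOp j r f] with ξ hξ
  rw [hξ, norm_mul, Complex.norm_real, Real.norm_of_nonneg (lowSym_nonneg _ _ _)]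
  have := lowSym_le j hr le_rfl ξ
  rw [Real.exp_zero] at this
  exact mul_le_of_le_one_left (norm_nonneg _) this

theorem lowOp_lowOp (i j : ℕ) (r s : ℝ) (f : L2C) :
    lowOp i r (lowOp j s f) = lowOp (i + j) (r + s) f := by
  refine Lp.ext ?_
  filter_upwards [coeFn_lowOp i r (lowOp j s f), coeFn_lowOp j s f,
    coeFn_lowOp (i + j) (r + s) f] with ξ h1 h2 h3
  rw [h1, h2, h3, ← lowSym_mul, Complex.ofReal_mul, mul_assoc]

theorem inner_lowOp (j : ℕ) (r : ℝ) (f g : L2C) :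
    inner ℝ (lowOp j r f) g = inner ℝ f (lowOp j r g) :=
  inner_mulC_left _ _ (fun _ => (Complex.conj_ofReal _).symm) f g

theorem norm_sq_lowOp (j : ℕ) (r : ℝ) (f : L2C) :
    ‖lowOp j r f‖ ^ 2 = ∫ ξ, lowSym j r ξ ^ 2 * ‖f ξ‖ ^ 2 := by
  rw [lowOp, norm_sq_mulC]
  simp only [Complex.norm_real, Real.norm_eq_abs, sq_abs]

/-- The truncation bounds |2πξ| by 1, so the Taylor remainder of the exponential is uniform in ξ.
The derivative therefore exists in operator norm, and the symbol gains the factor |2πξ|², recorded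
as j + 2. -/
theorem hasDerivAt_lowOp (j : ℕ) (r : ℝ) :
    HasDerivAt (fun r => lowOp j r) (lowOp (j + 2) r) r := by
  rw [hasDerivAt_iff_isLittleO]
  have key : ∀ x : ℝ, |x - r| ≤ 1 →
      ‖lowOp j x - lowOp j r - (x - r) • lowOp (j + 2) r‖ ≤ Real.exp |r| * (x - r) ^ 2 := by
    intro x hx
    refine ContinuousLinearMap.opNorm_le_bound _ (by positivity) fun f => ?_
    refine Lp.norm_le_mul_norm_of_ae_le_mul ?_
    simp only [sub_apply, smul_apply]
    filter_upwards [coeFn_lowOp j x f, coeFn_lowOp j r f, coeFn_lowOp (j + 2) r f,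
      Lp.coeFn_sub (lowOp j x f - lowOp j r f) ((x - r) • lowOp (j + 2) r f),
      Lp.coeFn_sub (lowOp j x f) (lowOp j r f), Lp.coeFn_smul (x - r) (lowOp (j + 2) r f)]
      with ξ h1 h2 h3 h4 h5 h6
    rw [h4, Pi.sub_apply, h5, Pi.sub_apply, h6, Pi.smul_apply, h1, h2, h3, Complex.real_smul,
      ← mul_assoc, ← sub_mul, ← sub_mul, norm_mul]
    refine mul_le_mul_of_nonneg_right ?_ (norm_nonneg _)
    rw [← Complex.ofReal_sub, ← Complex.ofReal_mul, ← Complex.ofReal_sub, Complex.norm_real,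
      Real.norm_eq_abs]
    by_cases h : freqSq ξ ≤ 1
    · have h' : freqSq ξ ≤ 1 := h
      set y := freqSq ξ with hy
      have h0 : 0 ≤ y := freqSq_nonneg ξ
      have e : lowSym j x ξ - lowSym j r ξ - (x - r) * lowSym (j + 2) r ξ
          = lowSym j r ξ * (Real.exp ((x - r) * y) - 1 - (x - r) * y) := by
        simp only [lowSym, if_pos h', ← hy]
        rw [show x * y = r * y + (x - r) * y by ring, Real.exp_add, pow_add,
          Real.sq_sqrt h0]
        ring
      have hxy : |(x - r) * y| ≤ |x - r| := by
        rw [abs_mul, abs_of_nonneg h0]; exact mul_le_of_le_one_right (abs_nonneg _) h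
      rw [e, abs_mul, abs_of_nonneg (lowSym_nonneg _ _ _)]
      refine mul_le_mul (lowSym_le j (le_abs_self r) (abs_nonneg r) ξ) ?_ (abs_nonneg _)
        (Real.exp_nonneg _)
      refine (Real.abs_exp_sub_one_sub_id_le (hxy.trans hx)).trans ?_
      rw [← sq_abs, ← sq_abs (x - r)]
      exact pow_le_pow_left₀ (abs_nonneg _) hxy 2
    · simp only [lowSym, if_neg h]
      simp only [sub_self, mul_zero, abs_zero]
      positivity
  have h1 : (fun x : ℝ => (x - r) ^ 2) =o[𝓝 r] fun x => x - r := by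
    simpa using Asymptotics.isLittleO_pow_sub_sub r one_lt_two
  refine Asymptotics.IsBigO.trans_isLittleO (Asymptotics.IsBigO.of_bound (Real.exp |r|) ?_) h1
  filter_upwards [Metric.closedBall_mem_nhds r one_pos] with x hx
  rw [Real.norm_of_nonneg (sq_nonneg _)]
  exact key x (by simpa [Real.dist_eq] using hx)

theorem isSymbol_lowDer (k : Fin 3) :
    IsSymbol (fun ξ => Complex.I * freq k ξ * lowSym 0 0 ξ) 1 where
  meas := by
    have h := continuous_freq k
    refine Measurable.aestronglyMeasurable (Measurable.mul ?_
      (Complex.measurable_ofReal.comp (measurable_lowSym 0 0)))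
    exact Continuous.measurable (by fun_prop)
  bound ξ := by
    rw [norm_mul, norm_mul, Complex.norm_I, one_mul, Complex.norm_real, Complex.norm_real]
    by_cases h : freqSq ξ ≤ 1
    · simp only [lowSym, if_pos h, zero_mul, Real.exp_zero, pow_zero, mul_one, norm_one,
        Real.norm_eq_abs]
      refine abs_le_one_iff_mul_self_le_one.2 ?_
      rw [← pow_two]
      exact (Finset.single_le_sum (f := fun k => freq k ξ ^ 2) (fun _ _ => sq_nonneg _)
        (Finset.mem_univ k)).trans h
    · simp [lowSym, if_neg h]

/-- The derivative `∂_k` restricted to the low frequencies. -/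
def lowDer (k : Fin 3) : L2C →L[ℝ] L2C := mulC (isSymbol_lowDer k)

/-- The symbol is imaginary. The truncated derivatives are the skew operators required by
`lyapunov_deriv_le`. -/
theorem inner_lowDer (k : Fin 3) (f g : L2C) :
    inner ℝ (lowDer k f) g = -inner ℝ f (lowDer k g) := by
  have h : IsSymbol (fun ξ => -(Complex.I * freq k ξ * lowSym 0 0 ξ)) 1 :=
    ⟨(isSymbol_lowDer k).meas.neg, fun ξ => by rw [norm_neg]; exact (isSymbol_lowDer k).bound ξ⟩
  rw [lowDer, inner_mulC_left (isSymbol_lowDer k) h (fun ξ => by simp) f g, ← inner_neg_right]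
  congr 1
  refine Lp.ext ?_
  filter_upwards [coeFn_mulC h g, coeFn_mulC (isSymbol_lowDer k) g,
    Lp.coeFn_neg (mulC (isSymbol_lowDer k) g)] with ξ h1 h2 h3
  rw [h1, h3, Pi.neg_apply, h2, neg_mul]

/-- `lowOp 1 0` is the truncated |∇| and takes the place of R in the Lyapunov argument. -/
theorem sum_norm_sq_lowDer (f : L2C) : ∑ k, ‖lowDer k f‖ ^ 2 = ‖lowOp 1 0 f‖ ^ 2 := by
  have hi : ∀ k, Integrable fun ξ => ‖Complex.I * freq k ξ * lowSym 0 0 ξ‖ ^ 2 * ‖f ξ‖ ^ 2 :=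
    fun k => by
      refine (integrable_norm_sq_L2C (lowDer k f)).congr ?_
      filter_upwards [coeFn_mulC (isSymbol_lowDer k) f] with ξ hξ
      rw [lowDer, hξ, norm_mul, mul_pow]
  rw [norm_sq_lowOp]
  simp only [lowDer, norm_sq_mulC]
  rw [← integral_finsetSum _ fun k _ => hi k]
  refine integral_congr_ae (Eventually.of_forall fun ξ => ?_)
  simp only
  rw [← Finset.sum_mul]
  congr 1
  simp only [norm_mul, Complex.norm_I, one_mul, Complex.norm_real, mul_pow, Real.norm_eq_abs,
    sq_abs]
  rw [← Finset.sum_mul]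
  by_cases h : freqSq ξ ≤ 1
  · simp only [lowSym, if_pos h, zero_mul, Real.exp_zero, pow_zero, mul_one, one_pow, one_mul,
      pow_one, Real.sq_sqrt (freqSq_nonneg ξ)]
    rfl
  · simp [lowSym, if_neg h]

theorem IsWeakPartial.lowOp_hat {k : Fin 3} {f g : L2R3} (h : IsWeakPartial k f g) (j : ℕ) (r : ℝ) :
    lowOp j r (hat g) = lowDer k (lowOp j r (hat f)) := by
  refine Lp.ext ?_
  filter_upwards [coeFn_lowOp j r (hat g), coeFn_lowOp j r (hat f),
    coeFn_mulC (isSymbol_lowDer k) (lowOp j r (hat f)), h.hat_eq] with ξ h1 h2 h3 h4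
  rw [lowDer, h1, h3, h2, h4]
  by_cases h : freqSq ξ ≤ 1
  · simp only [lowSym, if_pos h, zero_mul, Real.exp_zero, pow_zero, mul_one, Complex.ofReal_one]
    ring
  · simp [lowSym, if_neg h]

/-- Decay of the low frequency heat semigroup acting on functions with bounded Fourier transform. -/
theorem exists_norm_lowOp_le (j : ℕ) {c : ℝ} (hc : 0 < c) : ∃ C > (0 : ℝ), ∀ (f : L2C) (K σ : ℝ),
    0 ≤ σ → (∀ᵐ ξ, ‖f ξ‖ ≤ K) →
      ‖lowOp j (-(c * σ)) f‖ ≤ C * K * (1 + σ) ^ (-(3 / 4 + j / 2 : ℝ)) := by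
  set A : ℝ := Real.exp (2 * c) * (j.factorial / c ^ j) *
    (Real.pi / (c * (2 * Real.pi) ^ 2)) ^ (3 / 2 : ℝ) with hA
  have hA0 : 0 < A := by positivity
  refine ⟨Real.sqrt A, Real.sqrt_pos.2 hA0, fun f K σ hσ hf => ?_⟩
  have hK : 0 ≤ K := by
    obtain ⟨ξ, hξ⟩ := hf.exists
    exact (norm_nonneg _).trans hξ
  have h1σ : 0 < 1 + σ := by linarith
  set b := c * (1 + σ) * (2 * Real.pi) ^ 2 with hb
  have hb0 : 0 < b := by positivity
  -- The value of the Gaussian integral is positive, whereas a nonintegrable function would have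
  -- integral zero.
  have hint : Integrable fun ξ : E3 => Real.exp (-b * ‖ξ‖ ^ 2) := by
    by_contra h
    have := GaussianFourier.integral_rexp_neg_mul_sq_norm (V := E3) hb0
    rw [integral_undef h] at this
    exact (Real.rpow_pos_of_pos (div_pos Real.pi_pos hb0) _).ne this
  -- The truncation allows σ to be replaced by 1+σ at the price e^{2c}. Half of the exponent absorbs
  -- the polynomial through y^j/j! ≤ e^y and gives (1+σ)^{-j}; the other half is a Gaussian, whose
  -- integral gives (1+σ)^{-3/2}.
  have pt : ∀ ξ, lowSym j (-(c * σ)) ξ ^ 2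
      ≤ Real.exp (2 * c) * (j.factorial / (c * (1 + σ)) ^ j) * Real.exp (-b * ‖ξ‖ ^ 2) := by
    intro ξ
    by_cases h : freqSq ξ ≤ 1
    · have h0 := freqSq_nonneg ξ
      have e0 : -b * ‖ξ‖ ^ 2 = -(c * (1 + σ)) * freqSq ξ := by rw [freqSq_eq]; ring
      rw [e0]
      simp only [lowSym, if_pos h]
      set y := freqSq ξ
      rw [mul_pow, ← pow_mul, mul_comm j 2, pow_mul, Real.sq_sqrt h0, ← Real.exp_nat_mul]
      have h2 : (c * (1 + σ) * y) ^ j / j.factorial ≤ Real.exp (c * (1 + σ) * y) :=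
        Real.pow_div_factorial_le_exp _ (by positivity) j
      have h3 : y ^ j ≤ j.factorial / (c * (1 + σ)) ^ j * Real.exp (c * (1 + σ) * y) := by
        rw [div_le_iff₀ (by positivity), mul_pow] at h2
        rw [div_mul_eq_mul_div, le_div_iff₀ (by positivity)]
        linarith
      have h4 : Real.exp (((2 : ℕ) : ℝ) * (-(c * σ) * y))
          ≤ Real.exp (2 * c) * Real.exp (-2 * (c * (1 + σ) * y)) := by
        rw [← Real.exp_add]
        refine Real.exp_le_exp.2 ?_
        push_cast
        nlinarith
      refine (mul_le_mul h4 h3 (by positivity) (by positivity)).trans (le_of_eq ?_)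
      have e1 : Real.exp (-(c * (1 + σ)) * y)
          = Real.exp (-2 * (c * (1 + σ) * y)) * Real.exp (c * (1 + σ) * y) := by
        rw [← Real.exp_add]; congr 1; ring
      rw [e1]
      ring
    · simp only [lowSym, if_neg h, zero_pow two_ne_zero]
      positivity
  have h5 : ‖lowOp j (-(c * σ)) f‖ ^ 2 ≤ A * K ^ 2 * (1 + σ) ^ (-(3 / 2 + j : ℝ)) := by
    rw [norm_sq_lowOp]
    calc _ ≤ ∫ ξ : E3, Real.exp (2 * c) * (j.factorial / (c * (1 + σ)) ^ j) * K ^ 2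
          * Real.exp (-b * ‖ξ‖ ^ 2) := by
          refine integral_mono_of_nonneg (Eventually.of_forall fun ξ => by
            positivity) (hint.const_mul _) ?_
          filter_upwards [hf] with ξ hξ
          have := mul_le_mul (pt ξ) (pow_le_pow_left₀ (norm_nonneg _) hξ 2) (by positivity)
            (by positivity)
          linarith
      _ = A * K ^ 2 * (1 + σ) ^ (-(3 / 2 + j : ℝ)) := by
          rw [integral_const_mul, GaussianFourier.integral_rexp_neg_mul_sq_norm hb0]
          have e2 : (Real.pi / b) ^ ((Module.finrank ℝ E3 : ℝ) / 2)
              = (Real.pi / (c * (2 * Real.pi) ^ 2)) ^ (3 / 2 : ℝ) * (1 + σ) ^ (-(3 / 2) : ℝ) := by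
            rw [Real.rpow_neg h1σ.le, ← Real.inv_rpow h1σ.le,
              ← Real.mul_rpow (by positivity) (by positivity)]
            simp only [finrank_euclideanSpace, Fintype.card_fin, Nat.cast_ofNat]
            congr 1
            rw [hb]
            field_simp
          rw [e2, neg_add, Real.rpow_add h1σ, Real.rpow_neg h1σ.le (j : ℝ), Real.rpow_natCast, hA,
            mul_pow]
          field_simp
  refine le_of_sq_le_sq (h5.trans (le_of_eq ?_)) (by positivity)
  rw [mul_pow, mul_pow, Real.sq_sqrt hA0.le, ← Real.rpow_natCast ((1 + σ) ^ _) 2,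
    ← Real.rpow_mul h1σ.le]
  congr 2
  push_cast
  ring

end


/-! ### Low frequency decay of the pressure -/

noncomputable section

open Filter Topology
open scoped ENNReal

theorem continuousOn_one_add_rpow (α t : ℝ) :
    ContinuousOn (fun τ : ℝ => (1 + τ) ^ α) (Icc 0 t) := by
  refine ContinuousOn.rpow_const (by fun_prop) fun τ hτ => Or.inl ?_
  have := hτ.1
  positivity

theorem continuousOn_one_add_sub_rpow (α t : ℝ) :
    ContinuousOn (fun τ : ℝ => (1 + (t - τ)) ^ α) (Icc 0 t) := by
  refine ContinuousOn.rpow_const (by fun_prop) fun τ hτ => Or.inl ?_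
  have := hτ.2
  have : 0 ≤ t - τ := by linarith
  positivity

theorem integral_one_add_rpow_le {t : ℝ} (ht : 0 ≤ t) :
    ∫ τ in (0 : ℝ)..t, (1 + τ) ^ (-(5 / 4) : ℝ) ≤ 4 := by
  have hd : ∀ τ ∈ uIcc 0 t, HasDerivAt (fun τ : ℝ => -4 * (1 + τ) ^ (-(1 / 4) : ℝ))
      ((1 + τ) ^ (-(5 / 4) : ℝ)) τ := fun τ hτ => by
    rw [uIcc_of_le ht] at hτ
    have h0 : 0 < 1 + τ := by linarith [hτ.1]
    refine ((((hasDerivAt_id' τ).const_add 1).rpow_const (p := -(1 / 4)) (Or.inl h0.ne')).const_mul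
      (-4)).congr_deriv ?_
    norm_num
    ring
  rw [intervalIntegral.integral_eq_sub_of_hasDerivAt hd
    (ContinuousOn.intervalIntegrable_of_Icc ht (continuousOn_one_add_rpow _ t))]
  have := Real.rpow_nonneg (by positivity : 0 ≤ 1 + t) (-(1 / 4))
  rw [add_zero, Real.one_rpow]
  linarith

/-- On either half of the interval the larger of the two arguments is at least (1+t)/2, so one
factor is at most 4(1+t)^{-α}. Since α ≤ 5/4, the exponents can be exchanged when that is the wrong
factor. The remaining two integrals are at most 4 each, which gives 32. -/
theorem integral_convolution_le {t α : ℝ} (ht : 0 ≤ t) (hα : 0 ≤ α) (hα' : α ≤ 5 / 4) :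
    ∫ τ in (0 : ℝ)..t, (1 + (t - τ)) ^ (-α) * (1 + τ) ^ (-(5 / 4) : ℝ) ≤ 32 * (1 + t) ^ (-α) := by
  have hpt : ∀ τ ∈ Icc 0 t, (1 + (t - τ)) ^ (-α) * (1 + τ) ^ (-(5 / 4) : ℝ)
      ≤ 4 * (1 + t) ^ (-α) * ((1 + (t - τ)) ^ (-(5 / 4) : ℝ) + (1 + τ) ^ (-(5 / 4) : ℝ)) := by
    intro τ hτ
    have ha : 0 < 1 + (t - τ) := by linarith [hτ.2]
    have hb : 0 < 1 + τ := by linarith [hτ.1]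
    have half : ∀ x : ℝ, (1 + t) / 2 ≤ x → x ^ (-α) ≤ 4 * (1 + t) ^ (-α) := fun x hx => by
      refine (Real.rpow_le_rpow_of_nonpos (by linarith) hx (by linarith)).trans ?_
      rw [div_eq_mul_inv, Real.mul_rpow (by linarith) (by norm_num), Real.inv_rpow (by norm_num),
        Real.rpow_neg (x := 2) (by norm_num), inv_inv, mul_comm]
      refine mul_le_mul_of_nonneg_right ?_ (Real.rpow_nonneg (by linarith) _)
      calc (2 : ℝ) ^ α ≤ 2 ^ (2 : ℝ) := Real.rpow_le_rpow_of_exponent_le (by norm_num) (by linarith)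
        _ = 4 := by norm_num
    rcases le_total (1 + τ) (1 + (t - τ)) with h | h
    · have h1 := half (1 + (t - τ)) (by linarith)
      have h2 := Real.rpow_nonneg hb.le (-(5 / 4))
      have h3 := Real.rpow_nonneg ha.le (-(5 / 4))
      have h4 : 0 ≤ 4 * (1 + t) ^ (-α) := (Real.rpow_nonneg ha.le _).trans h1
      have := mul_le_mul_of_nonneg_right h1 h2
      have := mul_nonneg h4 h3
      linarith
    · have h1 := half (1 + τ) (by linarith)
      have h2 := Real.rpow_nonneg hb.le (-(5 / 4))
      have h3 := Real.rpow_nonneg ha.le (-(5 / 4))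
      have h4 : 0 ≤ 4 * (1 + t) ^ (-α) := (Real.rpow_nonneg hb.le _).trans h1
      have h5 : (1 + τ) ^ (-(5 / 4 - α)) ≤ (1 + (t - τ)) ^ (-(5 / 4 - α)) :=
        Real.rpow_le_rpow_of_nonpos ha h (by linarith)
      have e : (1 + (t - τ)) ^ (-α) * (1 + τ) ^ (-(5 / 4) : ℝ)
          ≤ (1 + τ) ^ (-α) * (1 + (t - τ)) ^ (-(5 / 4) : ℝ) := by
        rw [show (-(5 / 4) : ℝ) = -α + -(5 / 4 - α) by ring, Real.rpow_add ha, Real.rpow_add hb]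
        have := mul_le_mul_of_nonneg_left h5 (mul_nonneg (Real.rpow_nonneg ha.le (-α))
          (Real.rpow_nonneg hb.le (-α)))
        linarith
      have := mul_le_mul_of_nonneg_right h1 h3
      have := mul_nonneg h4 h2
      linarith
  have i1 := ContinuousOn.intervalIntegrable_of_Icc (μ := volume) ht
    (continuousOn_one_add_rpow (-(5 / 4)) t)
  have i2 := ContinuousOn.intervalIntegrable_of_Icc (μ := volume) ht
    (continuousOn_one_add_sub_rpow (-(5 / 4)) t)
  refine (intervalIntegral.integral_mono_on ht (ContinuousOn.intervalIntegrable_of_Icc ht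
    ((continuousOn_one_add_sub_rpow (-α) t).mul (continuousOn_one_add_rpow (-(5 / 4)) t)))
    ((i2.add i1).const_mul _) hpt).trans ?_
  rw [intervalIntegral.integral_const_mul, intervalIntegral.integral_add i2 i1]
  have e := intervalIntegral.integral_comp_sub_left (a := 0) (b := t)
    (fun x : ℝ => (1 + x) ^ (-(5 / 4) : ℝ)) t
  rw [sub_self, sub_zero] at e
  rw [e]
  have h0 := Real.rpow_nonneg (by linarith : 0 ≤ 1 + t) (-α)
  have := mul_le_mul_of_nonneg_left (integral_one_add_rpow_le ht) (mul_nonneg (by norm_num : (0:ℝ) ≤ 4) h0)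
  linarith

theorem abs_sum_inner_le {V : Type*} [NormedAddCommGroup V] [InnerProductSpace ℝ V]
    {X : Fin 3 → V →L[ℝ] V} {R : V →L[ℝ] V} (hR : ∀ f, ∑ k, ‖X k f‖ ^ 2 = ‖R f‖ ^ 2)
    (hR1 : ∀ f, ‖R f‖ ≤ ‖f‖) (p : V) (u : Fin 3 → V) :
    |∑ k, inner ℝ (X k p) (u k)| ≤ 1 / 2 * (‖p‖ ^ 2 + ∑ k, ‖u k‖ ^ 2) := by
  have h1 : |∑ k, inner ℝ (X k p) (u k)| ≤ ∑ k, 1 / 2 * (‖X k p‖ ^ 2 + ‖u k‖ ^ 2) :=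
    (Finset.abs_sum_le_sum_abs _ _).trans (Finset.sum_le_sum fun k _ => by
      have := abs_real_inner_le_norm (X k p) (u k)
      nlinarith [sq_nonneg (‖X k p‖ - ‖u k‖)])
  rw [← Finset.mul_sum, Finset.sum_add_distrib, hR] at h1
  have := pow_le_pow_left₀ (norm_nonneg _) (hR1 p) 2
  linarith

namespace FlowConstants.Sol

variable {P : FlowConstants}

set_option maxHeartbeats 1000000 in
/-- Decay of the low frequency part of the pressure, in terms of the `L¹` size of the data and of
the decay of the dissipation. -/
theorem exists_low_decay (P : FlowConstants) {j : ℕ} (hj : j ≤ 1) : ∃ C > (0 : ℝ),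
    ∀ {ε T : ℝ} {p : ℝ → Hm 3} {u : ℝ → HmVec 3} {s : ℝ → Hm 3}, P.Sol ε T p u s →
    ∀ {K N : ℝ}, (∀ᵐ ξ, ‖hat (p 0).fn ξ‖ ≤ K) → (∀ k, ∀ᵐ ξ, ‖hat (u 0 k).fn ξ‖ ≤ K) → 0 ≤ N →
    (∀ τ ∈ Icc 0 T, dissip (p τ) (u τ) ≤ N * (1 + τ) ^ (-(5 / 4) : ℝ)) →
    ∀ t ∈ Icc 0 T,
      ‖lowOp j 0 (hat (p t).fn)‖ ≤ C * (K + ε * N) * (1 + t) ^ (-(3 / 4 + j / 2 : ℝ)) := by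
  have hκ := P.kappa₂_pos
  have ha := P.a_pos
  have hM := Slice.M_pos (P := P)
  set κ := P.kappa₂
  set a := P.a
  set M := P.M
  set d := 7 * κ + 2 * a ^ 2 / κ with hd
  have hd0 : 0 < d := by positivity
  -- δ ≤ 1/2 makes the functional Λ equivalent to E, and δd ≤ a is the smallness condition of the
  -- Lyapunov lemma.
  set δ := min (1 / 2) (a / d) with hδ
  have hδ0 : 0 < δ := lt_min (by norm_num) (by positivity)
  have hδ2 : δ ≤ 1 / 2 := min_le_left _ _
  have hδa : δ * d ≤ a := by
    have := mul_le_mul_of_nonneg_right (min_le_right (1 / 2) (a / d)) hd0.le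
    rwa [div_mul_cancel₀ _ hd0.ne'] at this
  set c := δ * κ / 16 with hc
  have hc0 : 0 < c := by positivity
  obtain ⟨C, hC, hlow⟩ := exists_norm_lowOp_le j hc0
  refine ⟨8000 * C * (1 + M ^ 3), by positivity, ?_⟩
  intro ε T p u s S K N hp0 hu0 hN hdis t ht
  have hε := (S.slice t ht).eps_nonneg
  have hK : 0 ≤ K := by
    obtain ⟨ξ, hξ⟩ := hp0.exists
    exact (norm_nonneg _).trans hξ
  set α : ℝ := 3 / 4 + j / 2 with hα
  have hj' : (j : ℝ) ≤ 1 := by exact_mod_cast hj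
  have hα0 : 0 ≤ α := by positivity
  have hα1 : α ≤ 5 / 4 := by rw [hα]; linarith
  have sub : Icc 0 t ⊆ Icc 0 T := Icc_subset_Icc_right ht.2
  -- At τ = t this is the plain low frequency cutoff, and at τ = 0 the heat semigroup at time t
  -- applied to the data. Moving τ from 0 to t replaces a Duhamel formula for the full linear
  -- system.
  set q : ℝ → L2C →L[ℝ] L2C := fun τ => lowOp j (c * (τ - t)) with hq
  have hq' : ∀ τ, HasDerivAt q (c • lowOp (j + 2) (c * (τ - t))) τ := fun τ => by
    have h1 : HasDerivAt (fun τ : ℝ => c * (τ - t)) c τ :=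
      (((hasDerivAt_id' τ).sub_const t).const_mul c).congr_deriv (mul_one c)
    exact (hasDerivAt_lowOp j (c * (τ - t))).scomp τ h1
  set B : L2C →L[ℝ] L2C := c • lowOp 2 0 with hB
  have hBq : ∀ τ f, (c • lowOp (j + 2) (c * (τ - t))) f = B (q τ f) := fun τ f => by
    rw [hB, smul_apply, smul_apply, hq, lowOp_lowOp, zero_add, add_comm 2 j]
  have dfn : ∀ {f : ℝ → Hm 3} {f' : Hm 2} {τ : ℝ},
      HasDerivWithinAt (fun τ => (f τ).incl) f' (Icc 0 T) τ →
      HasDerivWithinAt (fun τ => q τ (hat (f τ).fn))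
        (B (q τ (hat (f τ).fn)) + q τ (hat f'.fn)) (Icc 0 t) τ := fun {f f' τ} h => by
    have h1 : HasDerivWithinAt (fun τ => hat (f τ).fn) (hat f'.fn) (Icc 0 t) τ :=
      ((hat.comp Hm.fnL).hasFDerivAt.comp_hasDerivWithinAt τ h).mono sub
    refine ((hq' τ).hasDerivWithinAt.clm_apply h1).congr_deriv ?_
    rw [hBq]
  set pp : ℝ → L2C := fun τ => q τ (hat (p τ).fn) with hpp
  set uu : Fin 3 → ℝ → L2C := fun k τ => q τ (hat (u τ k).fn) with huu
  set pp' : ℝ → L2C := fun τ => B (pp τ) + q τ (hat (dt T p τ).fn) with hpp'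
  set uu' : Fin 3 → ℝ → L2C := fun k τ => B (uu k τ) + q τ (hat (dtVec T u τ k).fn) with huu'
  have dp : ∀ τ ∈ Icc 0 t, HasDerivWithinAt pp (pp' τ) (Icc 0 t) τ := fun τ hτ =>
    dfn (S.hasDeriv_p (sub hτ))
  have du : ∀ τ ∈ Icc 0 t, ∀ k, HasDerivWithinAt (uu k) (uu' k τ) (Icc 0 t) τ := fun τ hτ k =>
    dfn (f := fun τ => u τ k) (S.hasDeriv_u (sub hτ) k)
  set E : ℝ → ℝ := fun τ => ‖pp τ‖ ^ 2 + ∑ k, ‖uu k τ‖ ^ 2 with hE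
  set Λ : ℝ → ℝ := fun τ => ‖pp τ‖ ^ 2 + ∑ k, ‖uu k τ‖ ^ 2
    + 2 * δ * ∑ k, inner ℝ (lowDer k (pp τ)) (uu k τ) with hΛ
  have hE0 : ∀ τ, 0 ≤ E τ := fun τ => by positivity
  have hR1 : ∀ f, ‖lowOp 1 0 f‖ ≤ ‖f‖ := norm_lowOp_le 1 le_rfl
  have hcross : ∀ τ, |2 * δ * ∑ k, inner ℝ (lowDer k (pp τ)) (uu k τ)| ≤ 1 / 2 * E τ := fun τ => by
    have := abs_sum_inner_le sum_norm_sq_lowDer hR1 (pp τ) (fun k => uu k τ)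
    rw [abs_mul, abs_of_pos (by positivity : 0 < 2 * δ)]
    refine (mul_le_mul_of_nonneg_left this (by positivity)).trans ?_
    have := mul_le_mul_of_nonneg_right hδ2 (hE0 τ)
    simp only [hE] at this ⊢
    linarith
  have hΛ1 : ∀ τ, E τ ≤ 2 * Λ τ := fun τ => by
    have := (abs_le.1 (hcross τ)).1
    simp only [hE, hΛ] at this ⊢
    linarith
  have hΛ2 : ∀ τ, Λ τ ≤ 2 * E τ := fun τ => by
    have := (abs_le.1 (hcross τ)).2
    have := hE0 τ
    simp only [hE, hΛ] at *
    linarith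
  have hΛ0 : ∀ τ, 0 ≤ Λ τ := fun τ => by linarith [hΛ1 τ, hE0 τ]
  set ν : ℝ → ℝ := fun τ => C * (6 * M ^ 3 * ε * dissip (p τ) (u τ)) * (1 + (t - τ)) ^ (-α) with hν
  -- An L¹ bound of the nonlinear residual is a bound of its transform, and the remaining heat time
  -- t-τ then gives the decay (1+t-τ)^{-α}.
  have hres : ∀ τ ∈ Icc 0 t, ∀ f : L2R3, LpLe 1 f (6 * M ^ 3 * ε * dissip (p τ) (u τ)) →
      ‖q τ (hat f)‖ ≤ ν τ := fun τ hτ f hf => by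
    have := hlow (hat f) _ (t - τ) (by linarith [hτ.2]) hf.ae_norm_hat_le
    rwa [show -(c * (t - τ)) = c * (τ - t) by ring] at this
  have hΛ' : ∀ τ ∈ Icc 0 t, HasDerivWithinAt Λ
      (2 * inner ℝ (pp τ) (pp' τ) + ∑ k, 2 * inner ℝ (uu k τ) (uu' k τ)
      + 2 * δ * ∑ k, (inner ℝ (lowDer k (pp' τ)) (uu k τ) + inner ℝ (lowDer k (pp τ)) (uu' k τ)))
      (Icc 0 t) τ := fun τ hτ => by
    refine (((dp τ hτ).norm_sq).add (HasDerivWithinAt.fun_sum fun k _ =>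
      (du τ hτ k).norm_sq)).add (HasDerivWithinAt.const_mul (2 * δ)
      (HasDerivWithinAt.fun_sum fun k _ => ?_))
    refine (((lowDer k).hasFDerivAt.comp_hasDerivWithinAt τ (dp τ hτ)).inner ℝ
      (du τ hτ k)).congr_deriv ?_
    exact add_comm _ _
  have hode : ∀ τ ∈ Icc 0 t,
      2 * inner ℝ (pp τ) (pp' τ) + ∑ k, 2 * inner ℝ (uu k τ) (uu' k τ)
      + 2 * δ * ∑ k, (inner ℝ (lowDer k (pp' τ)) (uu k τ) + inner ℝ (lowDer k (pp τ)) (uu' k τ))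
      ≤ 2 * (20 * ν τ) * Real.sqrt (Λ τ) := fun τ hτ => by
    have SS := S.slice τ (sub hτ)
    have n0 := hres τ hτ _ SS.pressure_residual_l1
    have nk := fun k => hres τ hτ _ (SS.velocity_residual_l1 k)
    have hν0 : 0 ≤ ν τ := (norm_nonneg _).trans n0
    refine (lyapunov_deriv_le (X := lowDer) (R := lowOp 1 0) (B := B) hκ ha hδ0 (by linarith) hδa
      inner_lowDer sum_norm_sq_lowDer hR1 ?_ n0 nk (p := pp τ) (p' := pp' τ)
      (u := fun k => uu k τ) (u' := fun k => uu' k τ) ?_ ?_).trans ?_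
    · intro f g
      rw [hB, smul_apply, real_inner_smul_right, inner_lowOp, lowOp_lowOp, add_zero]
    · simp only [hpp', map_add, map_smul, map_sum, huu]
      have : ∀ k, q τ (hat ((u τ k).deriv k).fn) = lowDer k (q τ (hat (u τ k).fn)) := fun k =>
        ((u τ k).deriv_isWeakPartial k).lowOp_hat j _
      simp only [this]
      abel
    · intro k
      have : q τ (hat ((p τ).deriv k).fn) = lowDer k (q τ (hat (p τ).fn)) :=
        ((p τ).deriv_isWeakPartial k).lowOp_hat j _
      simp only [huu', map_add, map_smul, hpp, this]
      abel
    · have h1 : Real.sqrt (E τ) ≤ 2 * Real.sqrt (Λ τ) := by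
        rw [show (2 : ℝ) * Real.sqrt (Λ τ) = Real.sqrt (2 ^ 2 * Λ τ) by
          rw [Real.sqrt_mul (by norm_num), Real.sqrt_sq (by norm_num)]]
        exact Real.sqrt_le_sqrt (by linarith [hΛ1 τ, hΛ0 τ])
      have := mul_le_mul_of_nonneg_left h1 (by positivity : 0 ≤ 20 * ν τ)
      simp only [hE] at this
      linarith
  have hνc : ContinuousOn ν (Icc 0 t) := by
    refine ContinuousOn.mul (ContinuousOn.mul continuousOn_const
      (ContinuousOn.mul continuousOn_const (S.cont_dissip.mono sub)))
      (continuousOn_one_add_sub_rpow _ t)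
  have hν0 : ∀ τ ∈ Icc 0 t, 0 ≤ 20 * ν τ := fun τ hτ => by
    have := (norm_nonneg _).trans (hres τ hτ _ (S.slice τ (sub hτ)).pressure_residual_l1)
    linarith
  have main := sqrt_le_of_deriv_le ht.1 (fun τ _ => hΛ0 τ) hΛ' (hνc.const_mul 20 :) hν0 hode
  -- data
  set w := (1 + t) ^ (-α) with hw
  have hw0 : 0 ≤ w := Real.rpow_nonneg (by linarith [ht.1]) _
  have hinit : Real.sqrt (Λ 0) ≤ 3 * (C * K * w) := by
    have e0 : ∀ f : L2R3, (∀ᵐ ξ, ‖hat f ξ‖ ≤ K) → ‖q 0 (hat f)‖ ^ 2 ≤ (C * K * w) ^ 2 :=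
      fun f hf => by
        have := hlow (hat f) K t ht.1 hf
        rw [show -(c * t) = c * (0 - t) by ring] at this
        exact pow_le_pow_left₀ (norm_nonneg _) this 2
    refine Real.sqrt_le_iff.2 ⟨by positivity, (hΛ2 0).trans ?_⟩
    have h1 := e0 _ hp0
    have h2 := Finset.sum_le_sum fun k (_ : k ∈ Finset.univ) => e0 _ (hu0 k)
    simp only [Finset.sum_const, Finset.card_univ, Fintype.card_fin, nsmul_eq_mul,
      Nat.cast_ofNat] at h2
    simp only [hE, hpp, huu]
    nlinarith [sq_nonneg (C * K * w)]
  -- 3840 = 120·32, the second factor coming from the convolution estimate.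
  have hint : ∫ τ in (0 : ℝ)..t, 20 * ν τ ≤ 3840 * C * M ^ 3 * (ε * N) * w := by
    have h1 : ∀ τ ∈ Icc 0 t, 20 * ν τ ≤ 120 * C * M ^ 3 * (ε * N)
        * ((1 + (t - τ)) ^ (-α) * (1 + τ) ^ (-(5 / 4) : ℝ)) := fun τ hτ => by
      have h2 := Real.rpow_nonneg (by linarith [hτ.2] : 0 ≤ 1 + (t - τ)) (-α)
      have h3 := mul_le_mul_of_nonneg_left (hdis τ (sub hτ))
        (by positivity : 0 ≤ 120 * C * M ^ 3 * ε * (1 + (t - τ)) ^ (-α))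
      simp only [hν]
      linarith
    refine (intervalIntegral.integral_mono_on ht.1
      (ContinuousOn.intervalIntegrable_of_Icc ht.1 (hνc.const_mul 20))
      (ContinuousOn.intervalIntegrable_of_Icc ht.1
        (((continuousOn_one_add_sub_rpow (-α) t).mul
          (continuousOn_one_add_rpow (-(5 / 4)) t)).const_mul _)) h1).trans ?_
    rw [intervalIntegral.integral_const_mul]
    have := mul_le_mul_of_nonneg_left (integral_convolution_le ht.1 hα0 hα1)
      (by positivity : 0 ≤ 120 * C * M ^ 3 * (ε * N))
    exact this.trans (le_of_eq (by ring))
  have hfin : ‖lowOp j 0 (hat (p t).fn)‖ ≤ 2 * Real.sqrt (Λ t) := by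
    have e1 : lowOp j 0 (hat (p t).fn) = pp t := by simp only [hpp, hq, sub_self, mul_zero]
    have e2 : Real.sqrt (Λ t) ^ 2 = Λ t := Real.sq_sqrt (hΛ0 t)
    rw [e1]
    refine le_of_sq_le_sq ?_ (by positivity)
    have h1 : ‖pp t‖ ^ 2 ≤ E t := by
      simp only [hE]
      have : 0 ≤ ∑ k, ‖uu k t‖ ^ 2 := by positivity
      linarith
    have := hΛ1 t; have := hΛ0 t
    nlinarith
  have z1 : 0 ≤ C * K * w := by positivity
  have z2 : 0 ≤ C * (ε * N) * w := by positivity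
  have z3 : 0 ≤ C * M ^ 3 * K * w := by positivity
  have z4 : 0 ≤ C * M ^ 3 * (ε * N) * w := by positivity
  linarith

end FlowConstants.Sol

end


/-! ### Closing the decay estimate; growth of the entropy -/

noncomputable section

open Filter Topology
open scoped ENNReal

theorem lowGrad_eq (f : L2R3) : lowGrad f = ‖lowOp 1 0 (hat f)‖ ^ 2 := by
  rw [norm_sq_lowOp, lowGrad]
  refine integral_congr_ae (Eventually.of_forall fun ξ => ?_)
  by_cases h : freqSq ξ ≤ 1
  · simp only [indicator_of_mem (show ξ ∈ {ξ | freqSq ξ ≤ 1} from h), lowSym, if_pos h, zero_mul,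
      Real.exp_zero, one_mul, pow_one, Real.sq_sqrt (freqSq_nonneg ξ)]
  · simp [indicator_of_notMem (show ξ ∉ {ξ | freqSq ξ ≤ 1} from h), lowSym, if_neg h]

/-- Above the cutoff 1 ≤ |2πξ|², so there `p` is controlled by ∇p, which decays faster. -/
theorem Hm.norm_sq_fn_le_low (p : Hm 3) : ‖p.fn‖ ^ 2 ≤ ‖lowOp 0 0 (hat p.fn)‖ ^ 2 + gradSq p := by
  have hi : Integrable fun ξ => ‖lowOp 0 0 (hat p.fn) ξ‖ ^ 2
      + ∑ k, ‖hat (p.deriv k).fn ξ‖ ^ 2 := (integrable_norm_sq_L2C _).add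
    (integrable_finsetSum _ fun i _ => integrable_norm_sq_hat _)
  have hint : ∫ ξ, (‖lowOp 0 0 (hat p.fn) ξ‖ ^ 2 + ∑ k, ‖hat (p.deriv k).fn ξ‖ ^ 2)
      = ‖lowOp 0 0 (hat p.fn)‖ ^ 2 + gradSq p := by
    rw [integral_add (integrable_norm_sq_L2C _)
      (integrable_finsetSum _ fun i _ => integrable_norm_sq_hat _),
      integral_finsetSum _ fun i _ => integrable_norm_sq_hat _, ← norm_sq_L2C]
    simp only [← norm_sq_hat]
    rfl
  rw [← hint]
  refine norm_sq_le_integral hi ?_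
  have hd : ∀ᵐ ξ, ∀ k, ‖hat (p.deriv k).fn ξ‖ ^ 2 = (freq k ξ ^ 2) ^ 1 * ‖hat p.fn ξ‖ ^ 2 :=
    ae_all_iff.2 fun k => (p.hatDeriv_one k).norm_sq_hat
  filter_upwards [hd, coeFn_lowOp 0 0 (hat p.fn)] with ξ h1 h2
  simp only [h1, h2, pow_one]
  rw [← Finset.sum_mul]
  change _ ≤ _ + freqSq ξ * _
  by_cases h : freqSq ξ ≤ 1
  · simp only [lowSym, if_pos h, zero_mul, Real.exp_zero, pow_zero, mul_one, Complex.ofReal_one,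
      one_mul]
    exact le_add_of_nonneg_right (mul_nonneg (freqSq_nonneg ξ) (sq_nonneg _))
  · simp only [lowSym, if_neg h, Complex.ofReal_zero, zero_mul, norm_zero]
    push Not at h
    nlinarith [sq_nonneg ‖hat p.fn ξ‖]

theorem sq_one_add_rpow {t : ℝ} (ht : 0 ≤ t) :
    ((1 + t) ^ (-(5 / 4) : ℝ)) ^ 2 = (1 + t) ^ (-(5 / 2 : ℝ)) := by
  rw [← Real.rpow_natCast, ← Real.rpow_mul (by positivity)]
  norm_num

/-- Grönwall's inequality with an integrable algebraically decaying rate. -/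
theorem gronwall_of_upperSlope {f : ℝ → ℝ} {T L : ℝ} (hf : ContinuousOn f (Icc 0 T))
    (hf0 : ∀ t ∈ Icc 0 T, 0 ≤ f t)
    (h : ∀ t ∈ Ico 0 T, UpperSlope f t (L * (1 + t) ^ (-(5 / 4) : ℝ) * f t)) (hL : 0 ≤ L) :
    ∀ t ∈ Icc 0 T, f t ≤ f 0 * Real.exp (4 * L) := by
  intro t ht
  have h0 : 0 ≤ f 0 := hf0 0 ⟨le_rfl, ht.1.trans ht.2⟩
  have key : ∀ θ > 0, f t ≤ (f 0 + θ) * Real.exp (4 * L + θ * t) := by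
    intro θ hθ
    -- 4(1-(1+t)^{-1/4}) is the primitive of the rate and stays below 4; θt makes the comparison
    -- strict.
    set g : ℝ → ℝ := fun t => L * (4 * (1 - (1 + t) ^ (-(1 / 4) : ℝ))) + θ * t with hg
    have hder : ∀ x ∈ Icc 0 T, HasDerivAt (fun t => (f 0 + θ) * Real.exp (g t))
        ((f 0 + θ) * (Real.exp (g x) * (L * (1 + x) ^ (-(5 / 4) : ℝ) + θ))) x := fun x hx => by
      have hp : 0 < 1 + x := by linarith [hx.1]
      have h1 := (((hasDerivAt_id' x).const_add 1).rpow_const (p := -(1 / 4)) (Or.inl hp.ne'))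
      have h2 := ((((h1.const_sub 1).const_mul 4).const_mul L).add ((hasDerivAt_id' x).const_mul θ))
      refine (h2.exp.const_mul (f 0 + θ)).congr_deriv ?_
      norm_num
      left
      ring
    have := image_le_of_liminf_slope_right_lt_deriv_boundary' (f := f)
      (f' := fun t => L * (1 + t) ^ (-(5 / 4) : ℝ) * f t) hf
      (fun x hx r hr => (h x hx r hr).frequently)
      (B := fun t => (f 0 + θ) * Real.exp (g t)) ?_
      (fun x hx => (hder x hx).continuousAt.continuousWithinAt)
      (fun x hx => (hder x ⟨hx.1, hx.2.le⟩).hasDerivWithinAt) ?_ ht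
    · refine this.trans (mul_le_mul_of_nonneg_left (Real.exp_le_exp.2 ?_) (by positivity))
      have h3 := Real.rpow_nonneg (by linarith [ht.1] : 0 ≤ 1 + t) (-(1 / 4))
      have h4 := mul_nonneg hL h3
      simp only [hg]
      linarith
    · simp [hg]; linarith
    · intro x hx hfx
      have h5 : 0 < (f 0 + θ) * Real.exp (g x) := by positivity
      rw [hfx]
      nlinarith [mul_pos h5 hθ]
  have lim : Tendsto (fun θ => (f 0 + θ) * Real.exp (4 * L + θ * t)) (𝓝[>] 0)
      (𝓝 ((f 0 + 0) * Real.exp (4 * L + 0 * t))) := by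
    refine tendsto_nhdsWithin_of_tendsto_nhds (Continuous.tendsto ?_ 0)
    fun_prop
  rw [add_zero, zero_mul, add_zero] at lim
  refine ge_of_tendsto lim ?_
  filter_upwards [self_mem_nhdsWithin] with θ hθ using key θ hθ

namespace FlowConstants.Sol

set_option maxHeartbeats 1000000 in
/-- Algebraic decay of the pressure and of the dissipation for small solutions. -/
theorem exists_decay (P : FlowConstants) : ∃ e₁ C : ℝ, 0 < e₁ ∧ 0 < C ∧
    ∀ {ε T : ℝ} {p : ℝ → Hm 3} {u : ℝ → HmVec 3} {s : ℝ → Hm 3}, ε ≤ e₁ → P.Sol ε T p u s →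
    ∀ {K : ℝ}, (∀ᵐ ξ, ‖hat (p 0).fn ξ‖ ≤ K) → (∀ k, ∀ᵐ ξ, ‖hat (u 0 k).fn ξ‖ ≤ K) →
    ‖p 0‖ ^ 2 + ‖u 0‖ ^ 2 ≤ K ^ 2 → ∀ t ∈ Icc 0 T,
      dissip (p t) (u t) ≤ C * K * (1 + t) ^ (-(5 / 4) : ℝ) ∧
      ‖(p t).fn‖ ≤ C * K * (1 + t) ^ (-(3 / 4) : ℝ) := by
  obtain ⟨e₀, c, C, he₀, hc, hC, H, hH⟩ := exists_damped_functional P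
  obtain ⟨C', hC', hdecay⟩ := decay_of_upperSlope hc
  obtain ⟨C₁, hC₁, hlow₁⟩ := exists_low_decay P (j := 1) le_rfl
  obtain ⟨C₀, hC₀, hlow₀⟩ := exists_low_decay P (j := 0) zero_le_one
  -- Q is the constant in `dissip` ≤ Q(K+εN)(1+t)^{-5/4}, from the damped functional fed with the
  -- low frequency decay of ∇p. It is fixed before ε, whose bound requires εQ ≤ 1/2.
  set Q := Real.sqrt (2 * C * (C' * (C + C * C₁ ^ 2) + C₁ ^ 2)) with hQ
  have hQ0 : 0 < Q := Real.sqrt_pos.2 (by positivity)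
  have hQ2 : Q ^ 2 = 2 * C * (C' * (C + C * C₁ ^ 2) + C₁ ^ 2) := Real.sq_sqrt (by positivity)
  refine ⟨min e₀ (1 / (2 * Q)), 2 * Q + 2 * C₀, by positivity, by positivity, ?_⟩
  intro ε T p u s hε S K hp0 hu0 h0 t ht
  have hε1 : ε ≤ e₀ := hε.trans (min_le_left _ _)
  have hε2 : ε * Q ≤ 1 / 2 := by
    have := mul_le_mul_of_nonneg_right (hε.trans (min_le_right _ _)) hQ0.le
    rwa [show 1 / (2 * Q) * Q = 1 / 2 by field_simp] at this
  have hε0 := (S.slice t ht).eps_nonneg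
  have hK : 0 ≤ K := by
    obtain ⟨ξ, hξ⟩ := hp0.exists
    exact (norm_nonneg _).trans hξ
  have hT : 0 ≤ T := ht.1.trans ht.2
  obtain ⟨Hc, Hs, Hb⟩ := hH hε1 S
  -- the largest weighted value of the dissipation
  obtain ⟨t₀, ht₀, hmax⟩ := isCompact_Icc.exists_isMaxOn (nonempty_Icc.2 hT)
    ((continuousOn_one_add_rpow (5 / 4) T).mul S.cont_dissip)
  set N := (1 + t₀) ^ (5 / 4 : ℝ) * dissip (p t₀) (u t₀) with hN
  have inv : ∀ τ : ℝ, 0 ≤ τ → (1 + τ) ^ (5 / 4 : ℝ) * (1 + τ) ^ (-(5 / 4) : ℝ) = 1 := fun τ hτ => by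
    rw [← Real.rpow_add (by linarith)]; norm_num
  have w0 : ∀ (α τ : ℝ), 0 ≤ τ → 0 ≤ (1 + τ) ^ α := fun α τ hτ => Real.rpow_nonneg (by linarith) _
  have hN0 : 0 ≤ N := mul_nonneg (w0 _ _ ht₀.1) (dissip_nonneg _ _)
  have hdis : ∀ τ ∈ Icc 0 T, dissip (p τ) (u τ) ≤ N * (1 + τ) ^ (-(5 / 4) : ℝ) := fun τ hτ => by
    have h1 : (1 + τ) ^ (5 / 4 : ℝ) * dissip (p τ) (u τ) ≤ N := hmax hτ
    have h2 := mul_le_mul_of_nonneg_right h1 (w0 (-(5 / 4)) τ hτ.1)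
    rwa [mul_right_comm, inv τ hτ.1, one_mul] at h2
  set L := K + ε * N with hL
  have hL0 : 0 ≤ L := by positivity
  have hKL : K ^ 2 ≤ L ^ 2 := pow_le_pow_left₀ hK (by rw [hL]; linarith [mul_nonneg hε0 hN0]) 2
  have hlow : ∀ τ ∈ Icc 0 T, lowGrad (p τ).fn ≤ C₁ ^ 2 * L ^ 2 * (1 + τ) ^ (-(5 / 2 : ℝ)) :=
    fun τ hτ => by
      have h1 := hlow₁ S hp0 hu0 hN0 hdis τ hτ
      rw [show (-(3 / 4 + ((1 : ℕ) : ℝ) / 2)) = -(5 / 4) by norm_num] at h1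
      rw [lowGrad_eq, ← sq_one_add_rpow hτ.1]
      exact (pow_le_pow_left₀ (norm_nonneg _) h1 2).trans (le_of_eq (by ring))
  have hHd := hdecay (A := C * L ^ 2) (B := C * (C₁ ^ 2 * L ^ 2)) Hc (by positivity) (by positivity)
    (((Hb 0 ⟨le_rfl, hT⟩).2).trans (mul_le_mul_of_nonneg_left (h0.trans hKL) hC.le)) Hs
    fun τ hτ => by
      have := mul_le_mul_of_nonneg_left (hlow τ ⟨hτ.1, hτ.2.le⟩) hC.le
      linarith
  have hdis2 : ∀ τ ∈ Icc 0 T, dissip (p τ) (u τ) ≤ Q * L * (1 + τ) ^ (-(5 / 4) : ℝ) :=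
    fun τ hτ => by
      refine le_of_sq_le_sq ?_ (mul_nonneg (by positivity) (w0 _ _ hτ.1))
      have h1 := (Hb τ hτ).1
      have h2 := mul_le_mul_of_nonneg_left (add_le_add (hHd τ hτ) (hlow τ hτ)) hC.le
      have h3 : dissip (p τ) (u τ) ^ 2 ≤ 2 * (‖(p τ).grad‖ ^ 2 + ‖u τ‖ ^ 2) := by
        unfold dissip; nlinarith [sq_nonneg (‖(p τ).grad‖ - ‖u τ‖)]
      rw [mul_pow, mul_pow, hQ2, sq_one_add_rpow hτ.1]
      linarith
  -- At the maximum point N ≤ Q(K+εN) ≤ QK + N/2. Since N is finite on the compact interval from the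
  -- outset, no continuation argument is needed and the bound does not depend on T.
  have hNQ : N ≤ 2 * Q * K := by
    have h1 := mul_le_mul_of_nonneg_left (hdis2 t₀ ht₀) (w0 (5 / 4) t₀ ht₀.1)
    have h2 : (1 + t₀) ^ (5 / 4 : ℝ) * (Q * L * (1 + t₀) ^ (-(5 / 4) : ℝ)) = Q * L := by
      rw [mul_left_comm, inv t₀ ht₀.1, mul_one]
    rw [h2, ← hN, hL] at h1
    have := mul_le_mul_of_nonneg_right hε2 hN0
    linarith
  have hεN : ε * N ≤ K := by
    have h1 := mul_le_mul_of_nonneg_left hNQ hε0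
    have h2 := mul_le_mul_of_nonneg_right hε2 hK
    linarith
  have d5 : dissip (p t) (u t) ≤ 2 * Q * K * (1 + t) ^ (-(5 / 4) : ℝ) :=
    (hdis t ht).trans (mul_le_mul_of_nonneg_right hNQ (w0 _ _ ht.1))
  constructor
  · refine d5.trans (mul_le_mul_of_nonneg_right ?_ (w0 _ _ ht.1))
    have := mul_nonneg hC₀.le hK
    linarith
  · have h1 := hlow₀ S hp0 hu0 hN0 hdis t ht
    rw [show (-(3 / 4 + ((0 : ℕ) : ℝ) / 2)) = -(3 / 4) by norm_num] at h1
    have h2 := (p t).norm_sq_fn_le_low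
    have h3 := gradSq_le_grad (p t)
    have h4 : ‖(p t).fn‖ ≤ ‖lowOp 0 0 (hat (p t).fn)‖ + ‖(p t).grad‖ := by
      refine le_of_sq_le_sq ?_ (by positivity)
      nlinarith [mul_nonneg (norm_nonneg (lowOp 0 0 (hat (p t).fn))) (norm_nonneg (p t).grad)]
    have h5 : (1 + t) ^ (-(5 / 4) : ℝ) ≤ (1 + t) ^ (-(3 / 4) : ℝ) :=
      Real.rpow_le_rpow_of_exponent_le (by linarith [ht.1]) (by norm_num)
    have h6 := mul_le_mul_of_nonneg_left h5 (by positivity : 0 ≤ 2 * Q * K)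
    have h7 := norm_grad_le_dissip (p t) (u t)
    have h8 : C₀ * (K + ε * N) * (1 + t) ^ (-(3 / 4) : ℝ) ≤ 2 * C₀ * K * (1 + t) ^ (-(3 / 4) : ℝ) := by
      refine mul_le_mul_of_nonneg_right ?_ (w0 _ _ ht.1)
      have := mul_le_mul_of_nonneg_left hεN hC₀.le
      linarith
    linarith

/-- Growth of the entropy, given integrable decay of the velocity. -/
theorem exists_entropy_bound (P : FlowConstants) : ∃ C : ℝ, 0 < C ∧
    ∀ {ε T : ℝ} {p : ℝ → Hm 3} {u : ℝ → HmVec 3} {s : ℝ → Hm 3}, P.Sol ε T p u s →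
    ∀ {U : ℝ}, 0 ≤ U → (∀ τ ∈ Icc 0 T, ‖u τ‖ ≤ U * (1 + τ) ^ (-(5 / 4) : ℝ)) →
    ∀ t ∈ Icc 0 T, ‖s t‖ ≤ C * ‖s 0‖ * Real.exp (C * U) := by
  have hM := Slice.M_pos (P := P)
  have hN := one_le_eqvC
  set M := P.M
  set A := 6 * M ^ 2 + 144 * M ^ 3 with hA
  have hA0 : 0 < A := by positivity
  refine ⟨max (2 * Real.sqrt eqvC) (2 * (A * eqvC)), by positivity, ?_⟩
  intro ε T p u s S U hU hu t ht
  have hT : 0 ≤ T := ht.1.trans ht.2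
  set Y : ℝ → ℝ := fun τ => ‖(s τ).fn‖ ^ 2 + ∑ i, ‖(s τ).d3 i‖ ^ 2 with hY
  set Φ : ℝ → ℝ := fun τ => A * ‖u τ‖ * ‖s τ‖ ^ 2 with hΦ
  have hΦc : ContinuousOn Φ (Icc 0 T) :=
    (continuousOn_const.mul S.inX.u_cont.norm).mul (S.inX.s_cont.norm.pow 2)
  have hYc : ContinuousOn Y (Icc 0 T) :=
    ((cont_fn S.inX.s_cont 1).norm.pow 2).add
      (continuousOn_finsetSum _ fun i _ => (cont_d3 S.inX.s_cont i).norm.pow 2)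
  have hYn : ∀ τ, ‖s τ‖ ^ 2 ≤ eqvC * Y τ := fun τ => norm_sq_le_presTop (s τ)
  -- The estimate is made for third differences, since ∂_t s is only in H². The majorant Φ does not
  -- depend on the step, so only the values at the end points pass to the limit.
  have inc : ∀ t₁ ∈ Icc 0 T, ∀ t₂ ∈ Icc t₁ T, Y t₂ - Y t₁ ≤ ∫ τ in t₁..t₂, Φ τ := by
    intro t₁ h₁ t₂ h₂
    have hsub : Icc t₁ t₂ ⊆ Icc 0 T := Icc_subset_Icc h₁.1 h₂.2
    have hlim : ∀ τ, Tendsto (fun h => ‖(s τ).fn‖ ^ 2 + ∑ i, ‖(dq i h ^ 3) (s τ).fn‖ ^ 2) (𝓝[>] 0)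
        (𝓝 (Y τ)) := fun τ => tendsto_const_nhds.add
      (tendsto_finsetSum _ fun i _ => (Hm_tendsto_dq_three (s τ) i).norm.pow 2)
    refine le_of_tendsto ((hlim t₂).sub (hlim t₁)) ?_
    filter_upwards [self_mem_nhdsWithin] with h hh
    have hd : ∀ τ ∈ Icc t₁ t₂, HasDerivWithinAt
        (fun τ => ‖(s τ).fn‖ ^ 2 + ∑ i, ‖(dq i h ^ 3) (s τ).fn‖ ^ 2)
        (2 * inner ℝ (s τ).fn (dt T s τ).fn
          + ∑ i, 2 * inner ℝ ((dq i h ^ 3) (s τ).fn) ((dq i h ^ 3) (dt T s τ).fn))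
        (Icc t₁ t₂) τ := fun τ hτ =>
      (((hasDeriv_fn (S.hasDeriv_s (hsub hτ)) 1).norm_sq).add (HasDerivWithinAt.fun_sum fun i _ =>
        (hasDeriv_fn (S.hasDeriv_s (hsub hτ)) (dq i h ^ 3)).norm_sq)).mono hsub
    refine UpperSlope.sub_le_integral (f := fun τ => ‖(s τ).fn‖ ^ 2
        + ∑ i, ‖(dq i h ^ 3) (s τ).fn‖ ^ 2) h₂.1
      (fun τ hτ => (hd τ hτ).continuousWithinAt) (hΦc.mono hsub) fun τ hτ => ?_
    have hτ' : τ ∈ Icc t₁ t₂ := ⟨hτ.1, hτ.2.le⟩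
    refine (UpperSlope.of_hasDerivWithinAt ((hd τ hτ').Ioi_of_Icc hτ)).mono ?_
    have SS := S.slice τ (hsub hτ')
    have h1 := SS.entropy_zero_le
    have h2 := Finset.sum_le_sum fun i (_ : i ∈ Finset.univ) =>
      mul_le_mul_of_nonneg_left (SS.entropy_three_le i hh) (by norm_num : (0 : ℝ) ≤ 2)
    simp only [Finset.sum_const, Finset.card_univ, Fintype.card_fin, nsmul_eq_mul,
      Nat.cast_ofNat] at h2
    refine (add_le_add (mul_le_mul_of_nonneg_left h1 (by norm_num : (0 : ℝ) ≤ 2)) h2).trans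
      (le_of_eq ?_)
    simp only [hΦ, hA]
    ring
  have hY0 : ∀ τ, 0 ≤ Y τ := fun τ => by positivity
  have hslope : ∀ τ ∈ Ico 0 T,
      UpperSlope Y τ (A * eqvC * U * (1 + τ) ^ (-(5 / 4) : ℝ) * Y τ) := fun τ hτ => by
    have hτ' : τ ∈ Icc 0 T := ⟨hτ.1, hτ.2.le⟩
    refine (UpperSlope.of_sub_le_integral hτ.2 (hΦc.mono (Icc_subset_Icc_left hτ.1))
      fun z hz => inc τ hτ' z hz).mono ?_
    have h1 := mul_le_mul (hu τ hτ') (hYn τ) (sq_nonneg _) ((norm_nonneg _).trans (hu τ hτ'))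
    have h2 := mul_le_mul_of_nonneg_left h1 hA0.le
    simp only [hΦ]
    linarith
  have hg := gronwall_of_upperSlope hYc (fun τ _ => hY0 τ) hslope (by positivity) t ht
  have hY00 : Y 0 ≤ 4 * ‖s 0‖ ^ 2 := by
    have h1 := pow_le_pow_left₀ (norm_nonneg _) (s 0).norm_fn_le 2
    have h2 := Finset.sum_le_sum fun i (_ : i ∈ Finset.univ) =>
      pow_le_pow_left₀ (norm_nonneg _) ((s 0).norm_d3_le i) 2
    simp only [Finset.sum_const, Finset.card_univ, Fintype.card_fin, nsmul_eq_mul,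
      Nat.cast_ofNat] at h2
    simp only [hY]
    linarith
  have hs : ‖s t‖ ≤ 2 * Real.sqrt eqvC * ‖s 0‖ * Real.exp (2 * (A * eqvC) * U) := by
    refine le_of_sq_le_sq ?_ (by positivity)
    rw [mul_pow, mul_pow, mul_pow, Real.sq_sqrt (by linarith), ← Real.exp_nat_mul]
    have e : ((2 : ℕ) : ℝ) * (2 * (A * eqvC) * U) = 4 * (A * eqvC * U) := by push_cast; ring
    rw [e]
    have h1 := mul_le_mul_of_nonneg_right hY00 (Real.exp_nonneg (4 * (A * eqvC * U)))
    have h2 := mul_le_mul_of_nonneg_left (hg.trans h1) (by linarith : 0 ≤ eqvC)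
    have := hYn t
    linarith
  refine hs.trans (mul_le_mul (mul_le_mul_of_nonneg_right (le_max_left _ _) (norm_nonneg _))
    (Real.exp_le_exp.2 (mul_le_mul_of_nonneg_right (le_max_right _ _) hU)) (Real.exp_nonneg _)
    (by positivity))

end FlowConstants.Sol

end


/-! ### Assembly of the a priori estimate -/

theorem normPU_sq {m : ℕ} (p : Hm m) (u : HmVec m) : normPU p u ^ 2 = ‖p‖ ^ 2 + ‖u‖ ^ 2 :=
  Real.sq_sqrt (by positivity)

theorem norm_le_normPUS {m : ℕ} (p : Hm m) (u : HmVec m) (s : Hm m) : ‖s‖ ≤ normPUS p u s :=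
  Real.le_sqrt_of_sq_le (by nlinarith [sq_nonneg ‖p‖, sq_nonneg ‖u‖])

theorem l2NormPUS_le {m : ℕ} (p : Hm m) (u : HmVec m) (s : Hm m) {A B C : ℝ} (hp : ‖p.fn‖ ≤ A)
    (hu : ∀ i, ‖(u i).fn‖ ≤ B) (hs : ‖s.fn‖ ≤ C) : l2NormPUS p u s ≤ A + 3 * B + C := by
  have hA := (norm_nonneg _).trans hp
  have hB := (norm_nonneg _).trans (hu 0)
  have hC := (norm_nonneg _).trans hs
  refine Real.sqrt_le_iff.2 ⟨by positivity, ?_⟩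
  have h1 := pow_le_pow_left₀ (norm_nonneg _) hp 2
  have h2 := Finset.sum_le_sum fun i (_ : i ∈ Finset.univ) =>
    pow_le_pow_left₀ (norm_nonneg _) (hu i) 2
  have h3 := pow_le_pow_left₀ (norm_nonneg _) hs 2
  simp only [Finset.sum_const, Finset.card_univ, Fintype.card_fin, nsmul_eq_mul,
    Nat.cast_ofNat] at h2
  nlinarith [mul_nonneg hA hB, mul_nonneg hA hC, mul_nonneg hB hC, sq_nonneg B]

theorem proposition2p2 (P : FlowConstants) :
    ∃ ε > (0 : ℝ), ∃ C₂ > (0 : ℝ), ∃ C₃ : ℝ → ℝ, Monotone C₃ ∧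
      ∀ (T : ℝ), 0 < T →
      ∀ (p₀ : Hm 3) (u₀ : HmVec 3) (s₀ : Hm 3),
      Integrable p₀.fn volume → (∀ i, Integrable (u₀ i).fn volume) →
      ∀ (p : ℝ → Hm 3) (u : ℝ → HmVec 3) (s : ℝ → Hm 3),
      InX T p u s → SolvesIVP P T p₀ u₀ s₀ p u s →
      (∀ t ∈ Icc 0 T, normPUS (p t) (u t) (s t) ≤ ε) →
      ∀ t ∈ Icc 0 T,
        normPU (p t) (u t) ^ 2 + (∫ τ in (0 : ℝ)..t, (‖(p τ).grad‖ ^ 2 + ‖u τ‖ ^ 2))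
            ≤ C₂ * normPU p₀ u₀ ^ 2 ∧
        ‖s t‖ ≤ C₂ * normPUS p₀ u₀ s₀ * Real.exp (C₂ * dataNorm p₀ u₀) ∧
        ‖(p t).fn‖ ≤ C₃ (dataNorm p₀ u₀) * (1 + t) ^ (-(3 / 4 : ℝ)) ∧
        ‖(p t).grad‖ + ‖u t‖ ≤ C₃ (dataNorm p₀ u₀) * (1 + t) ^ (-(5 / 4 : ℝ)) ∧
        l2NormPUS (dt T p t) (dtVec T u t) (dt T s t)
            ≤ C₃ (dataNorm p₀ u₀) * (1 + t) ^ (-(5 / 4 : ℝ)) := by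
  obtain ⟨e₁, A, he₁, hA, energy⟩ := FlowConstants.Sol.exists_energy_estimate P
  obtain ⟨e₂, B, he₂, hB, decay⟩ := FlowConstants.Sol.exists_decay P
  obtain ⟨D, hD, entropy⟩ := FlowConstants.Sol.exists_entropy_bound P
  have hM : 0 < P.M := FlowConstants.Slice.M_pos
  have he₀ : 0 < P.eps₀ := P.M_spec.2.1
  set ε := min P.eps₀ (min e₁ e₂) with hε
  have hε0 : 0 < ε := by positivity
  have hε_0 : ε ≤ P.eps₀ := min_le_left _ _
  have hε_1 : ε ≤ e₁ := (min_le_right _ _).trans (min_le_left _ _)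
  have hε_2 : ε ≤ e₂ := (min_le_right _ _).trans (min_le_right _ _)
  -- The bracket is the total constant for the time derivatives: (3M+24M³ε) + 3(2M+24M³ε) + 3M³ε.
  -- The summand 1 lets the same constant serve the other decay estimates.
  set Q := 1 + (9 * P.M + 99 * P.M ^ 3 * ε) with hQ
  have hQ1 : 1 ≤ Q := le_add_of_nonneg_right (by positivity)
  -- D·B is for the exponent, as the velocity decays with constant B·K. Truncating K at zero makes
  -- the last function monotone on all of ℝ; the data norm itself is nonnegative.
  refine ⟨ε, hε0, max A (max D (D * B)), by positivity, fun K => Q * B * max K 0, ?_, ?_⟩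
  · intro x y hxy
    exact mul_le_mul_of_nonneg_left (max_le_max_right 0 hxy) (by positivity)
  intro T hT p₀ u₀ s₀ hp₀ hu₀ p u s hX hI hn t ht
  have S : P.Sol ε T p u s := FlowConstants.Sol.of_solvesIVP hX hI hε_0 hn
  obtain rfl : p 0 = p₀ := hI.initial_p
  obtain rfl : u 0 = u₀ := hI.initial_u
  obtain rfl : s 0 = s₀ := hI.initial_s
  set K := dataNorm (p 0) (u 0) with hK
  have k1 : 0 ≤ ∫ x, |(p 0).fn x| := integral_nonneg fun _ => abs_nonneg _
  have k2 : ∀ i, 0 ≤ ∫ x, |(u 0 i).fn x| := fun i => integral_nonneg fun _ => abs_nonneg _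
  have k3 : 0 ≤ normPU (p 0) (u 0) := Real.sqrt_nonneg _
  have k4 := Finset.sum_nonneg fun i (_ : i ∈ Finset.univ) => k2 i
  have hK0 : 0 ≤ K := by rw [hK, dataNorm]; positivity
  have hp1 : ∀ᵐ ξ, ‖hat (p 0).fn ξ‖ ≤ K := by
    filter_upwards [norm_hat_le_of_integrable _ hp₀] with ξ hξ
    exact hξ.trans (by rw [hK, dataNorm]; linarith)
  have hu1 : ∀ k, ∀ᵐ ξ, ‖hat (u 0 k).fn ξ‖ ≤ K := fun k => by
    filter_upwards [norm_hat_le_of_integrable _ (hu₀ k)] with ξ hξ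
    have := Finset.single_le_sum (f := fun i => ∫ x, |(u 0 i).fn x|) (fun i _ => k2 i)
      (Finset.mem_univ k)
    simp only at this
    exact hξ.trans (by rw [hK, dataNorm]; linarith)
  have h0 : ‖p 0‖ ^ 2 + ‖u 0‖ ^ 2 ≤ K ^ 2 := by
    rw [← normPU_sq]
    exact pow_le_pow_left₀ k3 (by rw [hK, dataNorm]; linarith) 2
  have dec := decay hε_2 S hp1 hu1 h0
  obtain ⟨d1, d2⟩ := dec t ht
  have w0 : ∀ α τ : ℝ, 0 ≤ τ → 0 ≤ (1 + τ) ^ α := fun α τ hτ => Real.rpow_nonneg (by linarith) _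
  have hBQ : B * K ≤ Q * B * K :=
    mul_le_mul_of_nonneg_right (le_mul_of_one_le_left hB.le hQ1) hK0
  simp only [max_eq_left hK0]
  refine ⟨?_, ?_, ?_, ?_, ?_⟩
  · rw [normPU_sq, normPU_sq]
    exact (energy hε_1 S t ht).trans
      (mul_le_mul_of_nonneg_right (le_max_left _ _) (by positivity))
  · refine (entropy S (mul_nonneg hB.le hK0) (fun τ hτ =>
      (norm_le_dissip _ _).trans (dec τ hτ).1) t ht).trans ?_
    have hC1 : D ≤ max A (max D (D * B)) := (le_max_left _ _).trans (le_max_right _ _)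
    have hC2 : D * B ≤ max A (max D (D * B)) := (le_max_right _ _).trans (le_max_right _ _)
    refine mul_le_mul (mul_le_mul hC1 (norm_le_normPUS _ _ _) (norm_nonneg _)
      (hD.le.trans hC1)) (Real.exp_le_exp.2 ?_) (Real.exp_nonneg _)
      (mul_nonneg (hD.le.trans hC1) (Real.sqrt_nonneg _))
    rw [← mul_assoc]
    exact mul_le_mul_of_nonneg_right hC2 hK0
  · exact d2.trans (mul_le_mul_of_nonneg_right hBQ (w0 _ _ ht.1))
  · exact d1.trans (mul_le_mul_of_nonneg_right hBQ (w0 _ _ ht.1))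
  · have SS := S.slice t ht
    refine (l2NormPUS_le _ _ _ SS.norm_pressure_le SS.norm_velocity_le SS.norm_entropy_le).trans ?_
    have m0 := dissip_nonneg (p t) (u t)
    have h2 := mul_le_mul_of_nonneg_left d1 (by positivity : 0 ≤ Q)
    refine le_trans ?_ (h2.trans (le_of_eq (by ring)))
    rw [hQ]
    have : 0 ≤ P.M ^ 3 * ε * dissip (p t) (u t) := by positivity
    linarith
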